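/- **Setting.** Let $d\in\mathbb N=\{1,2,\dots\}$, $n\ge 2$, $\alpha>1/2$, $\tau\in(0,1)$, and let $\{\gamma_j\}_{j\ge1}$ be positive numbers (product weights). For $h\in\mathbb Z^s$ put $r_\alpha(h)=\prod_{j:\,h_j\ne0}\gamma_j^{-1}|h_j|^\alpha$, and for $\lambda\in[1/2,\alpha)$ put $\mu_{s,\alpha,\gamma,\lambda}=\sum_{h\in\mathbb Z^s\setminus\{0\}}r_\alpha(h)^{-1/\lambda}$. The weighted Korobov space consists of the (continuous) one-periodic functions $f$ on $[0,1]^s$ with $\|f\|=\big(\sum_{h\in\mathbb Z^s}r_\alpha(h)^2|\widehat f(h)|^2\big)^{1/2}<\infty$. Let $\mathcal P_n$ be the set of primes $p$ with $n/2<p\le n$ and $N=\prod_{p\in\mathcal P_n}p$. For $z\in\mathbb Z^s$ let $$Q_{s,p,z}(f)=\frac1p\sum_{k=0}^{p-1}f\Big(\frac{kz \bmod p}{p}\Big),\qquad e^{\rm ran}_s(z)=\sup_{\|f\|\le1}\frac1{|\mathcal P_n|}\sum_{p\in\mathcal P_n}\Big|Q_{s,p,z}(f)-\int_{[0,1]^s}f\Big|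 .$$ **The construction.** For $s\ge2$, given $z'=(z_1,\dots,z_{s-1})$ and a residue $c$ modulo $p\in\mathcal P_n$, and with $h=(h',h_s)\in\mathbb Z^{s-1}\times\mathbb Z$, let $\theta^{(p)}_s(c)=\sum r_\alpha(h)^{-2}$, summed over $h\in\mathbb Z^s$ with $h_s\neq0$ and $h'\cdot z'+h_sc\equiv_p0$, and, given the residues $z_s^{(q)}$ for the primes $q<p$ in $\mathcal P_n$, $$T^{(p)}_s(c)=\theta^{(p)}_s(c)+2\sum_{\substack{q\in\mathcal P_n\\ q<p}}\ \sum_{\substack{h_s\ne0,\ h_s\not\equiv_p0\\ h'\cdot z'+h_sc\equiv_p0\\ h'\cdot z'+h_sz_s^{(q)}\equiv_q0}}r_\alpha(h)^{-2}+2\sum_{\substack{q\in\mathcal P_n\\ q>p}}\ \sum_{\substack{h_s\neq0,\ h_s\equiv_q0\\ h'\cdot z'+h_sc\equiv_p0\\ h'\cdot z'\equiv_q0}}r_\alpha(h)^{-2}.$$ The CBC-by-prime construction sets $z_1=1$; then for $s=2,\dots,d$ and for $p\in\mathcal P_n$ in increasing order it chooses $z_s^{(p)}$ as an element minimising $T^{(p)}_s$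 among the $\lceil\tau p\rceil$ residues with the smallest values of $\theta^{(p)}_s$ (ties are broken arbitrarily). The integer $z_s\in\{0,\dots,N-1\}$ is represented by its residues $z_s^{(p)}$, $p\in\mathcal P_n$ (Chinese remainder theorem). **Machine model.** Costs refer to a fixed program, independent of all parameters, for a real RAM: exact real arithmetic and comparisons, and arithmetic on natural numbers that are bounded by a fixed power of $nd$, at unit cost. Also at unit cost are $\sigma_\alpha(a/b)$, $\cos(2\pi a/b)$, $\sin(2\pi a/b)$ and $a^\alpha$ for natural numbers $a$ and (where it occurs) $b\ne0$, where $\sigma_\alpha(x)=\sum_{h\in\mathbb Z\setminus\{0\}}e^{2\pi i hx}|h|^{-2\alpha}$. Memory counts cells of working memory; the input ($n,d,\tau$, and the read-only weights $\gamma_1,\dots,\gamma_d$) and the append-only output list of the residues $z_s^{(p)}$, which can be read back, are not counted. **Proposition.** 1. The construction can always be carried out. There are constants $C_{\tau,\lambda}>0$ ($\tau\in(0,1)$, $\lambda\ge1/2$), depending only on $\tau$ and $\lambda$ and tending to infinity for $\tau\to0$ and for $\tau\to1$, such that for all $d,n,\alpha,\gamma,\tau$ as above every constructed vector $z^\star=(z_1^\star,\dots,z_d^\star)$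 satisfies, for every $1\le d'\le d$, $$e^{\rm ran}_{d'}\big((z^\star_1,\dots,z^\star_{d'})\big)\le\frac{(C_{\tau,\lambda}\ln n)^{1/2}}{n^{\lambda+1/2}}\,\big[\mu_{d',\alpha,\gamma,\lambda}\big]^\lambda\qquad\forall\lambda\in[1/2,\alpha).$$ Here $\mu_{d,\alpha,\gamma,\lambda}\to\infty$ for $\lambda\to\alpha$ (from below), and $\mu_{d,\alpha,\gamma,\lambda}\le\sum_{\emptyset\ne u\subset\mathbb N,\ |u|<\infty}\big(\prod_{j\in u}\gamma_j\big)^{1/\lambda}(2\zeta(\alpha/\lambda))^{|u|}$ for all $d$ whenever this last sum is finite, so that the error bound is then independent of the dimension. 2. There is a program that, for all $d,n,\alpha,\gamma,\tau$ as above, outputs a vector $z^\star\in\{0,\dots,N-1\}^d$ obtained by the construction, in time $O(d\,n^4/\ln n)$ and with $O(n^4/(\ln n)^2)$ memory; the implied constants are absolute. 3. There is a program that does the same with $O(n)$ memory, the time being larger by a factor $d$, that is, in time $O(d^2n^4/\ln n)$; the implied constants are absolute. -/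

import Mathlib

open scoped ENNReal

/-! ## Weighted Korobov space, lattice rules and the randomised error -/

namespace Korobov

/-- `r_α(h)` for product weights `γ`: the coordinates `1, …, s` are indexed from `0`, so the
weight of the first variable is `γ 0`. -/
noncomputable def r (α : ℝ) (γ : ℕ → ℝ) {s : ℕ} (h : Fin s → ℤ) : ℝ :=
  ∏ j ∈ Finset.univ.filter (fun j => h j ≠ 0), ((γ j)⁻¹ * |(h j : ℝ)| ^ α)

/-- `μ_{s,α,γ,λ} = ∑_{h ≠ 0} r_α(h)^{-1/λ}`. -/
noncomputable def mu (s : ℕ) (α : ℝ) (γ : ℕ → ℝ) (lam : ℝ) : ℝ :=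
  ∑' h : {h : Fin s → ℤ // h ≠ 0}, r α γ h.1 ^ (-(1 / lam))

/-- The norm of the weighted Korobov space (`∞` if `f` is not in the space). As `α > 1/2`, each
element of the space has an absolutely convergent Fourier series, so it is represented by a
unique continuous one-periodic function. -/
noncomputable def norm (α : ℝ) (γ : ℕ → ℝ) {s : ℕ} (f : C(UnitAddTorus (Fin s), ℂ)) : ℝ≥0∞ :=
  (∑' h : Fin s → ℤ,
    ENNReal.ofReal (r α γ h ^ 2 * ‖UnitAddTorus.mFourierCoeff f h‖ ^ 2)) ^ (1 / 2 : ℝ)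

/-- The integral over the unit cube. -/
noncomputable def integral {s : ℕ} (f : C(UnitAddTorus (Fin s), ℂ)) : ℂ :=
  ∫ x, f x ∂(MeasureTheory.Measure.pi fun _ : Fin s => (AddCircle.haarAddCircle (T := (1 : ℝ))))

/-- The rank-1 lattice rule with `m` points and generating vector `z`. -/
noncomputable def latticeRule (m : ℕ) {s : ℕ} (z : Fin s → ℤ)
    (f : C(UnitAddTorus (Fin s), ℂ)) : ℂ :=
  (1 / (m : ℂ)) * ∑ k ∈ Finset.range m,
    f (fun j => ((((k : ℝ) * (z j : ℝ)) / (m : ℝ) : ℝ) : UnitAddCircle))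

/-- The primes `p` with `n / 2 < p ≤ n`. -/
def primes (n : ℕ) : Finset ℕ :=
  (Finset.range (n + 1)).filter (fun p => n < 2 * p ∧ p.Prime)

/-- The randomised error (worst case expected error over the unit ball of the Korobov space) of
the lattice rule with fixed generating vector `z` and a number of points `p` drawn uniformly from
`primes n`. -/
noncomputable def randomisedError (α : ℝ) (γ : ℕ → ℝ) (n : ℕ) {s : ℕ} (z : Fin s → ℤ) : ℝ≥0∞ :=
  ⨆ (f : C(UnitAddTorus (Fin s), ℂ)) (_ : norm α γ f ≤ 1),
    ENNReal.ofReal ((1 / ((primes n).card : ℝ)) *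
      ∑ p ∈ primes n, ‖latticeRule p z f - integral f‖)

/-! ## The component-by-component, prime-by-prime construction -/

/-- `h' · z'` for the first `s` coordinates of `h ∈ ℤ^{s+1}`. -/
def dotInit {s : ℕ} (z : ℕ → ℤ) (h : Fin (s + 1) → ℤ) : ℤ :=
  ∑ j : Fin s, h j.castSucc * z j

/-- The search criterion `θ^{(p)}(c)` for the component with (zero-based) index `s`, when its
residue modulo `p` is `c` and the components before it are `z 0, …, z (s - 1)`. -/
noncomputable def theta (α : ℝ) (γ : ℕ → ℝ) (s : ℕ) (z : ℕ → ℤ) (p : ℕ) (c : ℤ) : ℝ :=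
  ∑' h : {h : Fin (s + 1) → ℤ // h (Fin.last s) ≠ 0 ∧
      (p : ℤ) ∣ dotInit z h + h (Fin.last s) * c}, r α γ h.1 ^ (-2 : ℝ)

/-- The search criterion `T^{(p)}(c)` for the component with (zero-based) index `s`, when its
residue modulo `p` is `c`. Of `z s` only the residues modulo the primes `q < p` enter. -/
noncomputable def critT (α : ℝ) (γ : ℕ → ℝ) (n s : ℕ) (z : ℕ → ℤ) (p : ℕ) (c : ℤ) : ℝ :=
  theta α γ s z p c
  + 2 * ∑ q ∈ (primes n).filter (fun q => q < p),
      ∑' h : {h : Fin (s + 1) → ℤ // h (Fin.last s) ≠ 0 ∧ ¬ (p : ℤ) ∣ h (Fin.last s) ∧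
        (p : ℤ) ∣ dotInit z h + h (Fin.last s) * c ∧
        (q : ℤ) ∣ dotInit z h + h (Fin.last s) * z s}, r α γ h.1 ^ (-2 : ℝ)
  + 2 * ∑ q ∈ (primes n).filter (fun q => p < q),
      ∑' h : {h : Fin (s + 1) → ℤ // h (Fin.last s) ≠ 0 ∧ (q : ℤ) ∣ h (Fin.last s) ∧
        (p : ℤ) ∣ dotInit z h + h (Fin.last s) * c ∧
        (q : ℤ) ∣ dotInit z h}, r α γ h.1 ^ (-2 : ℝ)

/-- `z 0, …, z (d - 1)` is a possible result of the construction (ties may be broken in any way):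
the first component is `1`; for every later component and every prime `p`, there is a set `B` of
`⌈τ p⌉` residues with the smallest values of `θ^{(p)}`, and the residue of the component modulo
`p` is an element of `B` that minimises `T^{(p)}` over `B`. -/
def IsConstructed (n : ℕ) (α : ℝ) (γ : ℕ → ℝ) (τ : ℝ) (d : ℕ) (z : ℕ → ℤ) : Prop :=
  z 0 = 1 ∧
  ∀ s : ℕ, 1 ≤ s → s < d → ∀ p ∈ primes n,
    ∃ B ⊆ Finset.range p, B.card = ⌈τ * (p : ℝ)⌉₊ ∧
      (∀ b ∈ B, ∀ c ∈ Finset.range p, c ∉ B → theta α γ s z p b ≤ theta α γ s z p c) ∧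
      ∃ b ∈ B, z s ≡ (b : ℤ) [ZMOD (p : ℤ)] ∧
        ∀ c ∈ B, critT α γ n s z p b ≤ critT α γ n s z p c

/-- The representation of `z 0, …, z (d - 1)` by residues: component by component, and for each
component its residues modulo the primes of `primes n` in increasing order. -/
def residues (n d : ℕ) (z : ℕ → ℤ) : List ℕ :=
  (List.range d).flatMap fun s =>
    ((List.range (n + 1)).filter fun p => decide (p ∈ primes n)).map fun p =>
      (z s % (p : ℤ)).toNat

/-- `σ_α(x) = ∑_{h ≠ 0} e^{2πihx} / |h|^{2α}` (a real number, by the symmetry `h ↦ -h`). -/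
noncomputable def sigma (α x : ℝ) : ℝ :=
  (∑' h : {h : ℤ // h ≠ 0},
    Complex.exp (2 * (Real.pi : ℂ) * Complex.I * (h.1 : ℂ) * (x : ℂ)) /
      ((|(h.1 : ℝ)| ^ (2 * α) : ℝ) : ℂ)).re

end Korobov

/-! ## A real RAM with a step count, a memory bound and a word size bound

Programs are finite texts. There are finitely many scalar variables in a program, a read-only
array with the weights `γ`, an append-only output list (which may be read back), and two working
memories with indirect addressing, one for natural numbers and one for real numbers. Arithmetic
on real numbers is exact; comparisons are possible, rounding is not. -/

namespace RealRAM

/-- The parameters of a run: the data `α`, `γ`, the number `d` of readable weights, the number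
`mem` of cells in each of the two working memories, and the largest natural number `word` that
may occur in the run. -/
structure Env where
  α : ℝ
  γ : ℕ → ℝ
  d : ℕ
  mem : ℕ
  word : ℕ

structure State where
  ivar : ℕ → ℕ
  rvar : ℕ → ℝ
  imem : ℕ → ℕ
  rmem : ℕ → ℝ
  out : List ℕ

/-- Expressions for natural numbers; `sub` is truncated. -/
inductive IExp where
  | const (c : ℕ)
  | var (x : ℕ)
  | add (a b : IExp)
  | sub (a b : IExp)
  | mul (a b : IExp)
  | div (a b : IExp)
  | mod (a b : IExp)
  | load (a : IExp)
  | output (a : IExp)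

namespace IExp

def eval (σ : State) : IExp → ℕ
  | const c => c
  | var x => σ.ivar x
  | add a b => a.eval σ + b.eval σ
  | sub a b => a.eval σ - b.eval σ
  | mul a b => a.eval σ * b.eval σ
  | div a b => a.eval σ / b.eval σ
  | mod a b => a.eval σ % b.eval σ
  | load a => σ.imem (a.eval σ)
  | output a => σ.out.getD (a.eval σ) 0

/-- The evaluation respects the limits of the machine: no number exceeds the word size, no
division by zero, no access outside the memory or the output. -/
def Safe (E : Env) (σ : State) : IExp → Prop
  | const c => c ≤ E.word
  | var x => σ.ivar x ≤ E.word
  | add a b => a.Safe E σ ∧ b.Safe E σ ∧ a.eval σ + b.eval σ ≤ E.word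
  | sub a b => a.Safe E σ ∧ b.Safe E σ
  | mul a b => a.Safe E σ ∧ b.Safe E σ ∧ a.eval σ * b.eval σ ≤ E.word
  | div a b => a.Safe E σ ∧ b.Safe E σ ∧ b.eval σ ≠ 0
  | mod a b => a.Safe E σ ∧ b.Safe E σ ∧ b.eval σ ≠ 0
  | load a => a.Safe E σ ∧ a.eval σ < E.mem ∧ σ.imem (a.eval σ) ≤ E.word
  | output a => a.Safe E σ ∧ a.eval σ < σ.out.length

/-- The number of operations. -/
def cost : IExp → ℕ
  | const _ => 1
  | var _ => 1
  | add a b => a.cost + b.cost + 1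
  | sub a b => a.cost + b.cost + 1
  | mul a b => a.cost + b.cost + 1
  | div a b => a.cost + b.cost + 1
  | mod a b => a.cost + b.cost + 1
  | load a => a.cost + 1
  | output a => a.cost + 1

end IExp

/-- Expressions for real numbers: variables, conversion of a natural number, field operations,
memory and weight access, and the unit-cost function values `σ_α(a/b)`, `cos(2πa/b)`,
`sin(2πa/b)` and `a^α` at natural numbers `a`, `b`. -/
inductive RExp where
  | var (x : ℕ)
  | ofNat (a : IExp)
  | add (a b : RExp)
  | sub (a b : RExp)
  | mul (a b : RExp)
  | div (a b : RExp)
  | load (a : IExp)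
  | weight (a : IExp)
  | sigma (a b : IExp)
  | cosTurn (a b : IExp)
  | sinTurn (a b : IExp)
  | powAlpha (a : IExp)

namespace RExp

noncomputable def eval (E : Env) (σ : State) : RExp → ℝ
  | var x => σ.rvar x
  | ofNat a => (a.eval σ : ℝ)
  | add a b => a.eval E σ + b.eval E σ
  | sub a b => a.eval E σ - b.eval E σ
  | mul a b => a.eval E σ * b.eval E σ
  | div a b => a.eval E σ / b.eval E σ
  | load a => σ.rmem (a.eval σ)
  | weight a => E.γ (a.eval σ)
  | sigma a b => Korobov.sigma E.α ((a.eval σ : ℝ) / (b.eval σ : ℝ))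
  | cosTurn a b => Real.cos (2 * Real.pi * ((a.eval σ : ℝ) / (b.eval σ : ℝ)))
  | sinTurn a b => Real.sin (2 * Real.pi * ((a.eval σ : ℝ) / (b.eval σ : ℝ)))
  | powAlpha a => (a.eval σ : ℝ) ^ E.α

def Safe (E : Env) (σ : State) : RExp → Prop
  | var _ => True
  | ofNat a => a.Safe E σ
  | add a b => a.Safe E σ ∧ b.Safe E σ
  | sub a b => a.Safe E σ ∧ b.Safe E σ
  | mul a b => a.Safe E σ ∧ b.Safe E σ
  | div a b => a.Safe E σ ∧ b.Safe E σ ∧ b.eval E σ ≠ 0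
  | load a => a.Safe E σ ∧ a.eval σ < E.mem
  | weight a => a.Safe E σ ∧ a.eval σ < E.d
  | sigma a b => a.Safe E σ ∧ b.Safe E σ ∧ b.eval σ ≠ 0
  | cosTurn a b => a.Safe E σ ∧ b.Safe E σ ∧ b.eval σ ≠ 0
  | sinTurn a b => a.Safe E σ ∧ b.Safe E σ ∧ b.eval σ ≠ 0
  | powAlpha a => a.Safe E σ

def cost : RExp → ℕ
  | var _ => 1
  | ofNat a => a.cost + 1
  | add a b => a.cost + b.cost + 1
  | sub a b => a.cost + b.cost + 1
  | mul a b => a.cost + b.cost + 1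
  | div a b => a.cost + b.cost + 1
  | load a => a.cost + 1
  | weight a => a.cost + 1
  | sigma a b => a.cost + b.cost + 1
  | cosTurn a b => a.cost + b.cost + 1
  | sinTurn a b => a.cost + b.cost + 1
  | powAlpha a => a.cost + 1

end RExp

/-- Tests. -/
inductive BExp where
  | ilt (a b : IExp)
  | ieq (a b : IExp)
  | rlt (a b : RExp)

namespace BExp

def Holds (E : Env) (σ : State) : BExp → Prop
  | ilt a b => a.eval σ < b.eval σ
  | ieq a b => a.eval σ = b.eval σ
  | rlt a b => a.eval E σ < b.eval E σ

def Safe (E : Env) (σ : State) : BExp → Prop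
  | ilt a b => a.Safe E σ ∧ b.Safe E σ
  | ieq a b => a.Safe E σ ∧ b.Safe E σ
  | rlt a b => a.Safe E σ ∧ b.Safe E σ

def cost : BExp → ℕ
  | ilt a b => a.cost + b.cost + 1
  | ieq a b => a.cost + b.cost + 1
  | rlt a b => a.cost + b.cost + 1

end BExp

/-- Programs. -/
inductive Prog where
  | skip
  | iset (x : ℕ) (e : IExp)
  | rset (x : ℕ) (e : RExp)
  | istore (a e : IExp)
  | rstore (a : IExp) (e : RExp)
  | emit (e : IExp)
  | seq (P Q : Prog)
  | cond (b : BExp) (P Q : Prog)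
  | loop (b : BExp) (P : Prog)

/-- `Exec E P σ σ' t`: started in the state `σ`, the program `P` halts in the state `σ'` after
exactly `t` operations, within the limits of the machine. -/
inductive Exec (E : Env) : Prog → State → State → ℕ → Prop
  | skip (σ : State) : Exec E Prog.skip σ σ 1
  | iset (σ : State) (x : ℕ) (e : IExp) (he : e.Safe E σ) :
      Exec E (Prog.iset x e) σ
        { σ with ivar := Function.update σ.ivar x (e.eval σ) } (e.cost + 1)
  | rset (σ : State) (x : ℕ) (e : RExp) (he : e.Safe E σ) :
      Exec E (Prog.rset x e) σ
        { σ with rvar := Function.update σ.rvar x (e.eval E σ) } (e.cost + 1)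
  | istore (σ : State) (a e : IExp) (ha : a.Safe E σ) (he : e.Safe E σ)
      (hm : a.eval σ < E.mem) :
      Exec E (Prog.istore a e) σ
        { σ with imem := Function.update σ.imem (a.eval σ) (e.eval σ) } (a.cost + e.cost + 1)
  | rstore (σ : State) (a : IExp) (e : RExp) (ha : a.Safe E σ) (he : e.Safe E σ)
      (hm : a.eval σ < E.mem) :
      Exec E (Prog.rstore a e) σ
        { σ with rmem := Function.update σ.rmem (a.eval σ) (e.eval E σ) } (a.cost + e.cost + 1)
  | emit (σ : State) (e : IExp) (he : e.Safe E σ) :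
      Exec E (Prog.emit e) σ { σ with out := σ.out ++ [e.eval σ] } (e.cost + 1)
  | seq {P Q : Prog} {σ₁ σ₂ σ₃ : State} {t u : ℕ}
      (hP : Exec E P σ₁ σ₂ t) (hQ : Exec E Q σ₂ σ₃ u) :
      Exec E (Prog.seq P Q) σ₁ σ₃ (t + u)
  | condTrue {b : BExp} {P Q : Prog} {σ σ' : State} {t : ℕ} (hs : b.Safe E σ)
      (hb : b.Holds E σ) (hP : Exec E P σ σ' t) :
      Exec E (Prog.cond b P Q) σ σ' (b.cost + 1 + t)
  | condFalse {b : BExp} {P Q : Prog} {σ σ' : State} {t : ℕ} (hs : b.Safe E σ)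
      (hb : ¬ b.Holds E σ) (hQ : Exec E Q σ σ' t) :
      Exec E (Prog.cond b P Q) σ σ' (b.cost + 1 + t)
  | loopStop {b : BExp} {P : Prog} {σ : State} (hs : b.Safe E σ) (hb : ¬ b.Holds E σ) :
      Exec E (Prog.loop b P) σ σ (b.cost + 1)
  | loopStep {b : BExp} {P : Prog} {σ₁ σ₂ σ₃ : State} {t u : ℕ} (hs : b.Safe E σ₁)
      (hb : b.Holds E σ₁) (hP : Exec E P σ₁ σ₂ t) (hL : Exec E (Prog.loop b P) σ₂ σ₃ u) :
      Exec E (Prog.loop b P) σ₁ σ₃ (b.cost + 1 + t + u)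

/-- The initial state: `n`, `d` and `τ` are given in variables, everything else is zero. -/
noncomputable def start (n d : ℕ) (τ : ℝ) : State where
  ivar := fun x => if x = 0 then n else if x = 1 then d else 0
  rvar := fun x => if x = 0 then τ else 0
  imem := fun _ => 0
  rmem := fun _ => 0
  out := []

/-- On the input `n`, `d`, `α`, `γ_1, …, γ_d`, `τ`, the program `P` halts with the output `o`
after `time` operations, using at most `mem` cells in each of the two working memories and natural
numbers of size at most `word`. -/
def Produces (P : Prog) (n d : ℕ) (α : ℝ) (γ : ℕ → ℝ) (τ : ℝ) (o : List ℕ)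
    (time mem word : ℕ) : Prop :=
  ∃ σ : State, Exec ⟨α, γ, d, mem, word⟩ P (start n d τ) σ time ∧ σ.out = o

end RealRAM

/-!
The error bound rests on the identity that the square of the error is a sum of values of the
criterion `T`. By the Cauchy–Schwarz inequality in the Korobov space, the worst case error summed
over the primes is at most the square root of `∑_{p,q} ∑_h r(h)⁻²`, where `h ≠ 0` runs through the
intersection of the dual lattices modulo `p` and `q` (`Korobov.randomisedError_le`). Splitting this
sum by the index of the last nonzero coordinate of `h`, and the pairs `q < p` according to whether
`p` divides that coordinate, one gets exactly the sum over all components and all primes of the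
values of `T` (`Korobov.sqError_succ`). For a single prime, the average of `θ^{1/(2λ)}` over all
residues is at most `2/p` times the part of `μ` that belongs to the component (Jensen's inequality
and double counting), so the `⌈τ p⌉` best residues have a small value of `θ`
(`Korobov.theta_le_of_smallest`). As a congruence modulo `p` with a coefficient prime to `p` has
only one solution `c`, the average of `T` over these residues is, up to a constant, at most the
bound for `θ` (`Korobov.critT_le_of_min`). The number of primes in `(n/2, n]` is of the order `n /
log n`: the upper bound is Chebyshev's, the lower one is the estimate of the central binomial
coefficient in the proof of Bertrand's postulate (`Korobov.exists_le_card_primes_mul_log`).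

For the programs, summation over `h` turns the criteria into finite sums of products of values of
`σ_α` at the points of lattices with `p q` points (`Korobov.critT_eq_critVal`). The terms of `T` for
`q > p` can be summed directly. Those for `q < p` are, for each of the `q` values of the second
index, a multiplicative convolution modulo `p`; over the powers of a generator it becomes a
correlation (`Korobov.smallSum_pow`), for which a fast Fourier transform is used. Only one transform
per pair of primes and index `l < q` is needed: both real sequences are packed into one complex
vector, with supports such that the imaginary part of the transform of the power spectrum is, up to
a factor, the correlation wanted (`Korobov.sum_normSq_sin`), and by linearity the power spectra of
all `q` are added up before they are transformed back by direct summation. With the length `L =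
O(n)` of the transforms, one component costs `O((n / log n)² · n · L log L)` operations for the
transforms, which is `O(n⁴ / log n)`. The products of the values of `σ_α` over the preceding
components are either kept in a table of `O(n⁴ / (log n)²)` cells, updated once per component, or
computed anew in `O(d)` operations when they are needed; this is the difference between the two
programs.

The correctness of the programs is proved in a calculus of total correctness with time bounds,
`RealRAM.Runs`, with `RealRAM.Runs.forP` for counting loops. -/

namespace Korobov

/-! ### The number of primes in `(n/2, n]` -/

theorem mem_primes {n p : ℕ} : p ∈ primes n ↔ p.Prime ∧ n < 2 * p ∧ p ≤ n := by
  simp only [primes, Finset.mem_filter, Finset.mem_range]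
  constructor
  · rintro ⟨h1, h2, h3⟩; exact ⟨h3, h2, by omega⟩
  · rintro ⟨h1, h2, h3⟩; exact ⟨by omega, h2, h1⟩

theorem card_primes_le (n : ℕ) : (primes n).card ≤ n := by
  have h : primes n ⊆ Finset.Icc 1 n := fun p hp => by
    have := mem_primes.1 hp
    exact Finset.mem_Icc.2 ⟨this.1.one_lt.le, this.2.2⟩
  simpa using Finset.card_le_card h

theorem card_primes_pos {n : ℕ} (hn : 2 ≤ n) : 0 < (primes n).card := by
  obtain ⟨p, hp, h1, h2⟩ := Nat.exists_prime_lt_and_le_two_mul (n / 2) (by omega)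
  exact Finset.card_pos.2 ⟨p, mem_primes.2 ⟨hp, by omega, by omega⟩⟩

/-- Chebyshev's upper bound: the product of the primes up to `n` is at most `4 ^ n`, and those
counted here are larger than `n / 2`. -/
theorem card_primes_mul_log_le {n : ℕ} (hn : 2 ≤ n) :
    ((primes n).card : ℝ) * Real.log n ≤ 3 * n := by
  have hn0 : (0 : ℝ) < n := by positivity
  have hlog4 : Real.log 4 = 2 * Real.log 2 := by
    rw [show (4 : ℝ) = 2 ^ 2 by norm_num, Real.log_pow]; norm_num
  have hl2 := Real.log_two_lt_d9
  rcases lt_or_ge n 4 with h4 | h4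
  · have h1 : Real.log n ≤ Real.log 4 := Real.log_le_log hn0 (by exact_mod_cast h4.le)
    have h2 : ((primes n).card : ℝ) ≤ n := by exact_mod_cast card_primes_le n
    have h3 : 0 ≤ Real.log n := Real.log_natCast_nonneg n
    nlinarith
  · have hn4 : (4 : ℝ) ≤ n := by exact_mod_cast h4
    have hsum : ((primes n).card : ℝ) * Real.log (n / 2) ≤ Real.log 4 * n := by
      refine le_trans ?_ (Chebyshev.theta_le_log4_mul_x hn0.le)
      rw [Chebyshev.theta_eq_sum_primesLE_log, ← nsmul_eq_mul, ← Finset.sum_const]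
      have hsub : primes n ⊆ n.primesLE := fun p hp => by
        have := mem_primes.1 hp
        exact Nat.mem_primesLE.2 ⟨this.2.2, this.1⟩
      refine le_trans (Finset.sum_le_sum fun p hp => ?_)
        (Finset.sum_le_sum_of_subset_of_nonneg hsub fun p _ _ => Real.log_natCast_nonneg p)
      have := (mem_primes.1 hp).2.1
      refine Real.log_le_log (by positivity) ?_
      have h' : (n : ℝ) < 2 * p := by exact_mod_cast this
      linarith
    have h5 : Real.log n / 2 ≤ Real.log (n / 2) := by
      rw [Real.log_div hn0.ne' (by norm_num)]
      have := Real.log_le_log (by norm_num) hn4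
      linarith
    have h6 : ((primes n).card : ℝ) * (Real.log n / 2) ≤ ((primes n).card : ℝ) * Real.log (n / 2) :=
      mul_le_mul_of_nonneg_left h5 (by positivity)
    nlinarith

/-- The quantitative form of the estimate behind Bertrand's postulate: the primes in `(m, 2m]`
contribute a factor of at most `2m` each to the central binomial coefficient, the others
contribute much less than `4 ^ m`. -/
theorem centralBinom_le_pow_card {m : ℕ} (hm : 2 < m) :
    m.centralBinom ≤ (2 * m) ^ (Nat.sqrt (2 * m)) * 4 ^ (2 * m / 3) *
      (2 * m) ^ ((Finset.Ioc m (2 * m)).filter Nat.Prime).card := by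
  have n2_pos : 1 ≤ 2 * m := by omega
  let f x := x ^ m.centralBinom.factorization x
  have hfp : ∀ p, ¬ p.Prime → f p = 1 := fun p hp => by
    simp only [f, Nat.factorization_eq_zero_of_not_prime _ hp, pow_zero]
  have hf2 : ∀ p, f p ≤ 2 * m := fun p => Nat.pow_factorization_choose_le (by omega)
  have hall : m.centralBinom = ∏ x ∈ (Finset.range (2 * m + 1)).filter Nat.Prime, f x := by
    rw [Finset.prod_filter_of_ne fun p _ h => by by_contra h'; exact h (hfp p h')]
    exact m.prod_pow_factorization_centralBinom.symm
  set S := (Finset.range (2 * m + 1)).filter Nat.Prime with hS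
  rw [hall, ← Finset.prod_filter_mul_prod_filter_not S (· ≤ m)]
  refine mul_le_mul' ?_ ?_
  · rw [← Finset.prod_filter_mul_prod_filter_not _ (· ≤ Nat.sqrt (2 * m))]
    refine mul_le_mul' ?_ ?_
    -- primes up to `√(2m)`: each prime power is at most `2m`
    · refine (Finset.prod_le_prod' fun p _ => hf2 p).trans ?_
      rw [Finset.prod_const]
      refine Nat.pow_le_pow_right n2_pos ?_
      have : (Finset.Icc 1 (Nat.sqrt (2 * m))).card = Nat.sqrt (2 * m) := by simp
      refine (Finset.card_le_card fun x hx => ?_).trans this.le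
      simp only [hS, Finset.mem_filter, Finset.mem_range] at hx
      exact Finset.mem_Icc.2 ⟨hx.1.1.2.one_lt.le, hx.2⟩
    -- primes in `(√(2m), m]` divide at most once, and those above `2m/3` not at all
    · refine le_trans ?_ (primorial_le_four_pow (2 * m / 3))
      rw [primorial]
      rw [← Finset.prod_filter_mul_prod_filter_not _ (· ≤ 2 * m / 3)]
      have h1 : ∏ x ∈ ((((S.filter (· ≤ m)).filter (¬ · ≤ Nat.sqrt (2 * m)))).filter
          (¬ · ≤ 2 * m / 3)), f x = 1 := by
        refine Finset.prod_eq_one fun p hp => ?_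
        simp only [Finset.mem_filter] at hp
        simp only [f]
        rw [Nat.factorization_centralBinom_of_two_mul_self_lt_three_mul hm hp.1.1.2 (by omega),
          pow_zero]
      rw [h1, mul_one]
      refine (Finset.prod_le_prod' (g := fun p => p) fun p hp => ?_).trans ?_
      · simp only [hS, Finset.mem_filter] at hp
        refine (pow_right_mono₀ hp.1.1.1.2.one_lt.le ?_).trans (pow_one p).le
        exact Nat.factorization_choose_le_one (Nat.sqrt_lt'.mp (not_le.1 hp.1.2))
      · refine Finset.prod_le_prod_of_subset_of_one_le' (fun p hp => ?_) ?_
        · simp only [hS, Finset.mem_filter] at hp ⊢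
          exact ⟨Finset.mem_range.2 (by omega), hp.1.1.1.2⟩
        · exact fun p hp _ => (Finset.mem_filter.1 hp).2.one_lt.le
  -- primes in `(m, 2m]`
  · refine (Finset.prod_le_prod' fun p _ => hf2 p).trans ?_
    rw [Finset.prod_const]
    refine Nat.pow_le_pow_right n2_pos (Finset.card_le_card fun x hx => ?_)
    simp only [hS, Finset.mem_filter, Finset.mem_range, Finset.mem_Ioc] at hx ⊢
    exact ⟨⟨by omega, by omega⟩, hx.1.2⟩

/-- Comparison of the bound above with `4 ^ m ≤ m * centralBinom m` for `m = n / 2`. -/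
theorem eventually_le_card_primes_mul_log :
    ∀ᶠ n : ℕ in Filter.atTop, (1 / 10 : ℝ) * n ≤ (primes n).card * Real.log n := by
  have hlog4 : Real.log 4 = 2 * Real.log 2 := by
    rw [show (4 : ℝ) = 2 ^ 2 by norm_num, Real.log_pow]; norm_num
  have hl2 := Real.log_two_gt_d9
  have ho : ∀ᶠ x : ℝ in Filter.atTop, Real.log x ≤ (1 / 100) * x ^ (1 / 2 : ℝ) := by
    filter_upwards [(isLittleO_log_rpow_atTop (by norm_num : (0 : ℝ) < 1 / 2)).bound
      (by norm_num : (0 : ℝ) < 1 / 100), Filter.eventually_ge_atTop 1] with x hx h1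
    have h2 : (0 : ℝ) ≤ x ^ (1 / 2 : ℝ) := by positivity
    rwa [Real.norm_of_nonneg (Real.log_nonneg h1), Real.norm_of_nonneg h2] at hx
  filter_upwards [tendsto_natCast_atTop_atTop.eventually ho, Filter.eventually_ge_atTop 100]
    with n hn hn1
  obtain ⟨m, hm⟩ : ∃ m, m = n / 2 := ⟨_, rfl⟩
  set k := ((Finset.Ioc m (2 * m)).filter Nat.Prime).card with hk
  have hkP : k ≤ (primes n).card := by
    refine Finset.card_le_card fun p hp => ?_
    simp only [Finset.mem_filter, Finset.mem_Ioc] at hp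
    exact mem_primes.2 ⟨hp.2, by omega, by omega⟩
  have h1 := Nat.four_pow_lt_mul_centralBinom m (by omega)
  have h2 := centralBinom_le_pow_card (m := m) (by omega)
  rw [← hk] at h2
  have h3 : 4 ^ m ≤ m * ((2 * m) ^ (Nat.sqrt (2 * m)) * 4 ^ (2 * m / 3) * (2 * m) ^ k) :=
    h1.le.trans (Nat.mul_le_mul_left _ h2)
  have hm0 : (0 : ℝ) < m := by
    have : 0 < m := by omega
    exact_mod_cast this
  -- of the main term `m log 4`, a third remains for the primes in `(m, 2m]`
  have h4 : (m : ℝ) * Real.log 4 ≤ Real.log m + (Nat.sqrt (2 * m) * Real.log (2 * m)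
      + ((2 * m / 3 : ℕ) : ℝ) * Real.log 4 + k * Real.log (2 * m)) := by
    have h3' : (4 : ℝ) ^ m ≤ m * ((2 * m) ^ (Nat.sqrt (2 * m)) * 4 ^ (2 * m / 3) *
      (2 * m) ^ k) := by exact_mod_cast h3
    have := Real.log_le_log (by positivity) h3'
    rwa [Real.log_pow, Real.log_mul (by positivity) (by positivity),
      Real.log_mul (by positivity) (by positivity), Real.log_mul (by positivity) (by positivity),
      Real.log_pow, Real.log_pow, Real.log_pow] at this
  have h2m : (2 * m : ℝ) ≤ n := by
    have : 2 * m ≤ n := by omega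
    exact_mod_cast this
  have hnm : (n : ℝ) ≤ 2 * m + 1 := by
    have : n ≤ 2 * m + 1 := by omega
    exact_mod_cast this
  have h5 : Real.log (2 * m) ≤ Real.log n := Real.log_le_log (by positivity) h2m
  have h6 : Real.log m ≤ Real.log n := Real.log_le_log (by positivity) (by linarith)
  have h7 : (Nat.sqrt (2 * m) : ℝ) ≤ √n := by
    refine Real.nat_sqrt_le_real_sqrt.trans (Real.sqrt_le_sqrt ?_)
    push_cast; exact h2m
  have h8 : ((2 * m / 3 : ℕ) : ℝ) ≤ 2 * m / 3 := by
    refine Nat.cast_div_le.trans (by push_cast; exact le_rfl)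
  have hn100 : (100 : ℝ) ≤ n := by exact_mod_cast hn1
  have hsq : √(n : ℝ) * √n = n := Real.mul_self_sqrt (by positivity)
  have hs0 : 10 ≤ √(n : ℝ) := by
    rw [show (10 : ℝ) = √100 by
      rw [show (100 : ℝ) = 10 ^ 2 by norm_num, Real.sqrt_sq (by norm_num)]]
    exact Real.sqrt_le_sqrt hn100
  rw [← Real.sqrt_eq_rpow] at hn
  have hl0 : 0 ≤ Real.log (2 * m) := Real.log_nonneg (by
    have : 1 ≤ 2 * m := by omega
    exact_mod_cast this)
  have h9 : (Nat.sqrt (2 * m) : ℝ) * Real.log (2 * m) ≤ √n * ((1 / 100) * √n) :=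
    mul_le_mul h7 (h5.trans hn) hl0 (by positivity)
  have h10 : (k : ℝ) * Real.log (2 * m) ≤ (primes n).card * Real.log n :=
    mul_le_mul (by exact_mod_cast hkP) h5 hl0 (by positivity)
  nlinarith

/-- The set of primes in `(n/2, n]` has at least `c n / log n` elements. -/
theorem exists_le_card_primes_mul_log :
    ∃ c : ℝ, 0 < c ∧ ∀ n : ℕ, 2 ≤ n → c * n ≤ (primes n).card * Real.log n := by
  obtain ⟨N, hN⟩ := Filter.eventually_atTop.1 eventually_le_card_primes_mul_log
  refine ⟨min (1 / 10) (Real.log 2 / (N + 1)), ?_, fun n hn => ?_⟩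
  · have := Real.log_pos (by norm_num : (1 : ℝ) < 2)
    positivity
  · have hn0 : (0 : ℝ) ≤ n := by positivity
    rcases le_total N n with h | h
    · exact (mul_le_mul_of_nonneg_right (min_le_left _ _) hn0).trans (hN n h)
    · refine (mul_le_mul_of_nonneg_right (min_le_right _ _) hn0).trans ?_
      have h1 : (1 : ℝ) ≤ (primes n).card := by exact_mod_cast card_primes_pos hn
      have h2 : Real.log 2 ≤ Real.log n := Real.log_le_log (by norm_num) (by exact_mod_cast hn)
      have h3 : Real.log 2 / (N + 1) * n ≤ Real.log 2 := by
        rw [div_mul_eq_mul_div, div_le_iff₀ (by positivity)]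
        have : (n : ℝ) ≤ N := by exact_mod_cast h
        have := Real.log_pos (by norm_num : (1 : ℝ) < 2)
        nlinarith
      have := Real.log_pos (by norm_num : (1 : ℝ) < 2)
      nlinarith

/-! ### Sums of powers of `r` over sets of frequencies -/

/-- The contribution of a single coordinate with weight `g` to `r`. -/
noncomputable def rho (α g : ℝ) (k : ℤ) : ℝ := if k = 0 then 1 else g⁻¹ * |(k : ℝ)| ^ α

theorem rho_zero (α g : ℝ) : rho α g 0 = 1 := by simp [rho]

theorem rho_pos {α g : ℝ} (hg : 0 < g) (k : ℤ) : 0 < rho α g k := by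
  unfold rho
  split_ifs with h
  · exact one_pos
  · have : (0 : ℝ) < |(k : ℝ)| := abs_pos.2 (Int.cast_ne_zero.2 h)
    positivity

theorem r_eq_prod (α : ℝ) (γ : ℕ → ℝ) {s : ℕ} (h : Fin s → ℤ) :
    r α γ h = ∏ j : Fin s, rho α (γ j) (h j) := by
  rw [r, Finset.prod_filter]
  refine Finset.prod_congr rfl fun j _ => ?_
  by_cases hj : h j = 0 <;> simp [rho, hj]

theorem r_pos {α : ℝ} {γ : ℕ → ℝ} (hγ : ∀ j, 0 < γ j) {s : ℕ} (h : Fin s → ℤ) : 0 < r α γ h := by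
  rw [r_eq_prod]; exact Finset.prod_pos fun j _ => rho_pos (hγ j) _

theorem r_zero (α : ℝ) (γ : ℕ → ℝ) {s : ℕ} : r α γ (0 : Fin s → ℤ) = 1 := by
  simp [r_eq_prod, rho_zero]

theorem r_snoc (α : ℝ) (γ : ℕ → ℝ) {s : ℕ} (h : Fin s → ℤ) (k : ℤ) :
    r α γ (Fin.snoc h k : Fin (s + 1) → ℤ) = r α γ h * rho α (γ s) k := by
  simp [r_eq_prod, Fin.prod_univ_castSucc]

theorem summable_abs_rpow {x : ℝ} (hx : 1 < x) : Summable fun k : ℤ => |(k : ℝ)| ^ (-x) :=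
  Real.summable_abs_int_rpow hx

theorem rho_rpow_of_ne {α g : ℝ} (hg : 0 < g) (x : ℝ) {k : ℤ} (hk : k ≠ 0) :
    rho α g k ^ (-x) = g ^ x * |(k : ℝ)| ^ (-(α * x)) := by
  have : (0 : ℝ) < |(k : ℝ)| := abs_pos.2 (Int.cast_ne_zero.2 hk)
  rw [rho, if_neg hk, Real.mul_rpow (by positivity) (by positivity), ← Real.rpow_mul this.le,
    Real.inv_rpow hg.le, Real.rpow_neg hg.le, inv_inv, mul_neg]

theorem summable_rho {α g x : ℝ} (hg : 0 < g) (hx : 1 < α * x) :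
    Summable fun k : ℤ => rho α g k ^ (-x) := by
  have h : Summable fun k : ℤ => g ^ x * |(k : ℝ)| ^ (-(α * x)) :=
    (summable_abs_rpow hx).mul_left _
  refine (summable_congr_cofinite ?_).1 h
  filter_upwards [(Set.finite_singleton (0 : ℤ)).compl_mem_cofinite] with k hk
  exact (rho_rpow_of_ne hg x hk).symm

/-- Summation over `ℤ^{s+1}` of a product of a function of the first `s` coordinates and a function
of the last one. -/
theorem hasSum_snoc {R : Type*} [NormedRing R] [CompleteSpace R] {s : ℕ}
    {F : (Fin (s + 1) → ℤ) → R} {f : (Fin s → ℤ) → R} {g : ℤ → R}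
    (hF : ∀ h k, F (Fin.snoc h k) = f h * g k)
    (hf : Summable fun h => ‖f h‖) (hg : Summable fun k => ‖g k‖) :
    (Summable fun h => ‖F h‖) ∧ ∑' h, F h = (∑' h, f h) * ∑' k, g k := by
  let e : (Fin s → ℤ) × ℤ ≃ (Fin (s + 1) → ℤ) :=
    (Equiv.prodComm _ _).trans (Fin.snocEquiv fun _ => ℤ)
  have he : ∀ y, F (e y) = f y.1 * g y.2 := fun y => hF y.1 y.2
  constructor
  · rw [← e.summable_iff]
    exact (Summable.mul_norm hf hg).congr fun y => by simp only [Function.comp_apply, he]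
  · rw [← e.tsum_eq, tsum_mul_tsum_of_summable_norm hf hg]
    exact tsum_congr he

theorem summable_r {α x : ℝ} {γ : ℕ → ℝ} (hγ : ∀ j, 0 < γ j) (hx : 1 < α * x) :
    ∀ s : ℕ, Summable fun h : Fin s → ℤ => r α γ h ^ (-x)
  | 0 => (hasSum_fintype _).summable
  | s + 1 => by
    have h1 := summable_r hγ hx s
    have h2 := summable_rho (α := α) (hγ s) hx
    exact (hasSum_snoc (F := fun h : Fin (s + 1) → ℤ => r α γ h ^ (-x))
      (f := fun h => r α γ h ^ (-x)) (g := fun k => rho α (γ s) k ^ (-x)) (fun h k => by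
        rw [r_snoc, Real.mul_rpow (r_pos hγ _).le (rho_pos (hγ s) _).le]) h1.norm h2.norm).1.of_norm

/-- The sum of `r_α(h)^{-x}` over the frequencies in `A`. -/
noncomputable def lsum (α : ℝ) (γ : ℕ → ℝ) (x : ℝ) {s : ℕ} (A : Set (Fin s → ℤ)) : ℝ :=
  ∑' h, A.indicator (fun h => r α γ h ^ (-x)) h

theorem tsum_subtype_eq_lsum (α : ℝ) (γ : ℕ → ℝ) (x : ℝ) {s : ℕ} (P : (Fin s → ℤ) → Prop) :
    ∑' h : {h // P h}, r α γ h.1 ^ (-x) = lsum α γ x {h | P h} :=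
  tsum_subtype {h | P h} fun h => r α γ h ^ (-x)

section lsum

variable {α x : ℝ} {γ : ℕ → ℝ} {s : ℕ}

theorem lsum_nonneg (hγ : ∀ j, 0 < γ j) (A : Set (Fin s → ℤ)) : 0 ≤ lsum α γ x A :=
  tsum_nonneg fun h => Set.indicator_nonneg (fun h _ => (Real.rpow_pos_of_pos (r_pos hγ h) _).le) h

theorem summable_indicator (hγ : ∀ j, 0 < γ j) (hx : 1 < α * x) (A : Set (Fin s → ℤ)) :
    Summable (A.indicator fun h => r α γ h ^ (-x)) :=
  (summable_r hγ hx s).indicator A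

theorem lsum_mono (hγ : ∀ j, 0 < γ j) (hx : 1 < α * x) {A B : Set (Fin s → ℤ)} (h : A ⊆ B) :
    lsum α γ x A ≤ lsum α γ x B :=
  (summable_indicator hγ hx A).tsum_le_tsum
    (Set.indicator_le_indicator_of_subset h fun h => (Real.rpow_pos_of_pos (r_pos hγ h) _).le)
    (summable_indicator hγ hx B)

theorem lsum_empty : lsum α γ x (∅ : Set (Fin s → ℤ)) = 0 := by simp [lsum]

theorem lsum_split (hγ : ∀ j, 0 < γ j) (hx : 1 < α * x) (A B : Set (Fin s → ℤ)) :
    lsum α γ x A = lsum α γ x (A ∩ B) + lsum α γ x (A ∩ Bᶜ) := by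
  rw [lsum, lsum, lsum, ← (summable_indicator hγ hx _).tsum_add (summable_indicator hγ hx _)]
  refine tsum_congr fun h => ?_
  by_cases h1 : h ∈ A <;> by_cases h2 : h ∈ B <;> simp [h1, h2]

/-- Double counting: if each frequency lies in at most `N` of the sets `A c`, which are all
contained in `B`. -/
theorem sum_lsum_le {ι : Type*} (hγ : ∀ j, 0 < γ j) (hx : 1 < α * x) (F : Finset ι)
    (A : ι → Set (Fin s → ℤ)) (B : Set (Fin s → ℤ)) (N : ℕ) (hAB : ∀ c ∈ F, A c ⊆ B)
    (hN : ∀ h ∈ B, ∀ G ⊆ F, (∀ c ∈ G, h ∈ A c) → G.card ≤ N) :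
    ∑ c ∈ F, lsum α γ x (A c) ≤ N * lsum α γ x B := by
  classical
  simp only [lsum]
  rw [← Summable.tsum_finsetSum fun c _ => summable_indicator hγ hx _, ← tsum_mul_left]
  refine Summable.tsum_le_tsum (fun h => ?_) (summable_sum fun c _ => summable_indicator hγ hx _)
    ((summable_indicator hγ hx _).mul_left _)
  have h0 : 0 ≤ r α γ h ^ (-x) := (Real.rpow_pos_of_pos (r_pos hγ h) _).le
  by_cases hB : h ∈ B
  · simp only [Set.indicator_apply, if_pos hB]
    rw [← Finset.sum_filter, Finset.sum_const, nsmul_eq_mul]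
    refine mul_le_mul_of_nonneg_right ?_ h0
    exact_mod_cast hN h hB _ (Finset.filter_subset _ _) fun c hc => (Finset.mem_filter.1 hc).2
  · rw [Finset.sum_eq_zero, Set.indicator_of_notMem hB, mul_zero]
    exact fun c hc => Set.indicator_of_notMem (fun h' => hB (hAB c hc h')) _

theorem lsum_image {t : ℕ} (φ : (Fin t → ℤ) → (Fin s → ℤ)) (hφ : Function.Injective φ)
    (A : Set (Fin s → ℤ)) (hA : A ⊆ Set.range φ) :
    lsum α γ x A = ∑' h, (φ ⁻¹' A).indicator (fun h => r α γ (φ h) ^ (-x)) h := by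
  rw [lsum, ← hφ.tsum_eq]
  · rfl
  · exact fun h hh => hA (Set.mem_of_indicator_ne_zero hh)

/-- Separation of the frequencies with vanishing last coordinate. -/
theorem lsum_last (hγ : ∀ j, 0 < γ j) (hx : 1 < α * x) (A : Set (Fin (s + 1) → ℤ)) :
    lsum α γ x A = lsum α γ x (A ∩ {h | h (Fin.last s) ≠ 0}) +
      lsum α γ x {h : Fin s → ℤ | (Fin.snoc h 0 : Fin (s + 1) → ℤ) ∈ A} := by
  rw [lsum_split hγ hx A {h | h (Fin.last s) ≠ 0}]
  congr 1
  rw [lsum_image (t := s) (fun h => (Fin.snoc h 0 : Fin (s + 1) → ℤ))]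
  · simp only [lsum, r_snoc, rho_zero, mul_one]
    classical
    refine tsum_congr fun h => ?_
    simp [Set.indicator_apply]
  · intro a b h
    have := congrArg Fin.init h
    simpa using this
  · rintro h ⟨-, h2⟩
    refine ⟨Fin.init h, ?_⟩
    have h3 : h (Fin.last s) = 0 := by simpa using h2
    show Fin.snoc (Fin.init h) 0 = h
    rw [← h3, Fin.snoc_init_self]

/-- Substitution `h_s = q k` for the frequencies whose last coordinate is divisible by `q`. -/
theorem lsum_dvd (hγ : ∀ j, 0 < γ j) {q : ℕ} (hq : 0 < q) (A : Set (Fin (s + 1) → ℤ)) :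
    lsum α γ x (A ∩ {h | h (Fin.last s) ≠ 0 ∧ (q : ℤ) ∣ h (Fin.last s)}) =
      (q : ℝ) ^ (-(α * x)) * lsum α γ x ({h | h (Fin.last s) ≠ 0} ∩
        {h | (Fin.snoc (Fin.init h) (q * h (Fin.last s)) : Fin (s + 1) → ℤ) ∈ A}) := by
  have hq0 : (q : ℤ) ≠ 0 := by positivity
  rw [lsum_image (t := s + 1)
    (fun h => (Fin.snoc (Fin.init h) (q * h (Fin.last s)) : Fin (s + 1) → ℤ)), lsum,
    ← tsum_mul_left]
  · classical
    refine tsum_congr fun h => ?_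
    simp only [Set.indicator_apply, Set.mem_preimage, Set.mem_inter_iff, Set.mem_ofPred_eq,
      Fin.snoc_last]
    by_cases h0 : h (Fin.last s) = 0
    · simp [h0]
    · have hr : r α γ (Fin.snoc (Fin.init h) (q * h (Fin.last s)) : Fin (s + 1) → ℤ) ^ (-x) =
          (q : ℝ) ^ (-(α * x)) * r α γ h ^ (-x) := by
        have h2 : r α γ h = r α γ (Fin.init h) * rho α (γ s) (h (Fin.last s)) := by
          rw [← r_snoc]; congr 1; exact (Fin.snoc_init_self h).symm
        have h3 : ((q * h (Fin.last s) : ℤ) : ℝ) = (q : ℝ) * (h (Fin.last s) : ℝ) := by push_cast; rfl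
        rw [r_snoc, h2, Real.mul_rpow (r_pos hγ _).le (rho_pos (hγ s) _).le,
          Real.mul_rpow (r_pos hγ _).le (rho_pos (hγ s) _).le,
          rho_rpow_of_ne (hγ s) x h0, rho_rpow_of_ne (hγ s) x (mul_ne_zero hq0 h0), h3, abs_mul,
          Real.mul_rpow (abs_nonneg _) (abs_nonneg _), Nat.abs_cast]
        ring
      by_cases hA : (Fin.snoc (Fin.init h) (q * h (Fin.last s)) : Fin (s + 1) → ℤ) ∈ A
      · simp [hA, h0, hq.ne', hr]
      · simp [hA]
  · intro a b h
    have h1 := congrArg Fin.init h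
    have h2 := congrFun h (Fin.last s)
    simp only [Fin.init_snoc, Fin.snoc_last] at h1 h2
    rw [← Fin.snoc_init_self a, ← Fin.snoc_init_self b, h1, mul_left_cancel₀ hq0 h2]
  · rintro h ⟨-, h1, k, hk⟩
    refine ⟨Fin.snoc (Fin.init h) k, ?_⟩
    show (Fin.snoc (Fin.init (Fin.snoc (Fin.init h) k : Fin (s + 1) → ℤ))
      (q * (Fin.snoc (Fin.init h) k : Fin (s + 1) → ℤ) (Fin.last s)) : Fin (s + 1) → ℤ) = h
    rw [Fin.init_snoc, Fin.snoc_last, ← hk, Fin.snoc_init_self]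

/-- Jensen's inequality for sums, `∑ a ^ t ≤ (∑ a) ^ t` for `t ≥ 1`; it turns the exponent `2` of
the error into the exponent `1 / λ` of `μ`. -/
theorem lsum_le_rpow (hγ : ∀ j, 0 < γ j) {t : ℝ} (ht : 1 ≤ t) (hx : 1 < α * x)
    (A : Set (Fin s → ℤ)) : lsum α γ (x * t) A ≤ lsum α γ x A ^ t := by
  set X := lsum α γ x A with hX
  have hX0 : 0 ≤ X := lsum_nonneg hγ A
  have hX1 : X ^ t = ∑' h, A.indicator (fun h => r α γ h ^ (-x)) h * X ^ (t - 1) := by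
    rw [tsum_mul_right, ← lsum, ← hX]
    rcases hX0.eq_or_lt with h | h
    · rw [← h, Real.zero_rpow (by linarith), zero_mul]
    · rw [Real.rpow_sub_one h.ne']; field_simp
  rw [hX1]
  have hxt : 1 < α * (x * t) := by nlinarith
  refine (summable_indicator hγ hxt A).tsum_le_tsum (fun h => ?_)
    ((summable_indicator hγ hx A).mul_right _)
  by_cases hA : h ∈ A
  · simp only [Set.indicator_of_mem hA]
    have hr := Real.rpow_pos_of_pos (r_pos (α := α) hγ h) (-x)
    have h1 : r α γ h ^ (-x) ≤ X := by
      have := (summable_indicator hγ hx A).le_tsum h fun j _ =>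
        Set.indicator_nonneg (fun h _ => (Real.rpow_pos_of_pos (r_pos hγ h) _).le) j
      rwa [Set.indicator_of_mem hA] at this
    calc r α γ h ^ (-(x * t)) = (r α γ h ^ (-x)) ^ t := by
          rw [← Real.rpow_mul (r_pos hγ h).le, neg_mul]
      _ = r α γ h ^ (-x) * (r α γ h ^ (-x)) ^ (t - 1) := by
          rw [Real.rpow_sub_one hr.ne']; field_simp
      _ ≤ _ := by
          refine mul_le_mul_of_nonneg_left (Real.rpow_le_rpow hr.le h1 (by linarith)) hr.le
  · simp [Set.indicator_of_notMem hA]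

end lsum

/-- The part of `μ` that comes from the frequencies whose last nonzero coordinate has index `s`. -/
noncomputable def muLast (α : ℝ) (γ : ℕ → ℝ) (x : ℝ) (s : ℕ) : ℝ :=
  lsum α γ x {h : Fin (s + 1) → ℤ | h (Fin.last s) ≠ 0}

theorem snoc_zero_eq_zero {s : ℕ} {h : Fin s → ℤ} :
    (Fin.snoc h 0 : Fin (s + 1) → ℤ) = 0 ↔ h = 0 := by
  constructor
  · intro h0
    have := congrArg Fin.init h0
    rw [Fin.init_snoc] at this
    rw [this]; rfl
  · rintro rfl
    ext j
    refine Fin.lastCases ?_ (fun j => ?_) j <;> simp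

theorem mu_eq_lsum (s : ℕ) (α : ℝ) (γ : ℕ → ℝ) (lam : ℝ) :
    mu s α γ lam = lsum α γ (1 / lam) {h : Fin s → ℤ | h ≠ 0} :=
  tsum_subtype_eq_lsum α γ (1 / lam) fun h : Fin s → ℤ => h ≠ 0

theorem mu_eq_sum {α lam : ℝ} {γ : ℕ → ℝ} (hγ : ∀ j, 0 < γ j) (hx : 1 < α * (1 / lam)) (d : ℕ) :
    mu d α γ lam = ∑ s ∈ Finset.range d, muLast α γ (1 / lam) s := by
  induction d with
  | zero =>
    rw [mu_eq_lsum, Finset.range_zero, Finset.sum_empty, ← lsum_empty]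
    congr 1
    ext h
    simp [Subsingleton.elim h 0]
  | succ s ih =>
    rw [Finset.sum_range_succ, ← ih, mu_eq_lsum, mu_eq_lsum, lsum_last hγ hx, add_comm]
    congr 2
    · ext h; simp [snoc_zero_eq_zero]
    · ext h
      simp only [Set.mem_inter_iff, Set.mem_ofPred_eq, and_iff_right_iff_imp]
      rintro h1 rfl
      exact h1 rfl

/-! ### The worst case error in terms of the frequencies on the dual lattices -/

/-- The character `x ↦ e^{2πix}`. -/
noncomputable def turn (x : ℝ) : ℂ := Complex.exp (2 * Real.pi * x * Complex.I)

theorem turn_add (x y : ℝ) : turn (x + y) = turn x * turn y := by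
  rw [turn, turn, turn, ← Complex.exp_add]; congr 1; push_cast; ring

theorem turn_int (m : ℤ) : turn m = 1 := by
  rw [turn, Complex.exp_eq_one_iff]; exact ⟨m, by push_cast; ring⟩

theorem turn_zero : turn 0 = 1 := by simpa using turn_int 0

theorem turn_sum {ι : Type*} (F : Finset ι) (x : ι → ℝ) :
    turn (∑ i ∈ F, x i) = ∏ i ∈ F, turn (x i) := by
  classical
  induction F using Finset.induction_on with
  | empty => simp [turn_zero]
  | insert a F ha ih => rw [Finset.sum_insert ha, Finset.prod_insert ha, turn_add, ih]

theorem turn_nat_mul (k : ℕ) (x : ℝ) : turn (k * x) = turn x ^ k := by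
  rw [turn, turn, ← Complex.exp_nat_mul]; congr 1; push_cast; ring

theorem norm_turn (x : ℝ) : ‖turn x‖ = 1 := by
  rw [turn, show (2 * Real.pi * x * Complex.I : ℂ) = ((2 * Real.pi * x : ℝ) : ℂ) * Complex.I by
    push_cast; ring, Complex.norm_exp_ofReal_mul_I]

theorem turn_eq_one_iff {x : ℝ} : turn x = 1 ↔ ∃ m : ℤ, x = m := by
  rw [turn, Complex.exp_eq_one_iff]
  refine exists_congr fun m => ?_
  have h : (2 * Real.pi * Complex.I : ℂ) ≠ 0 := by
    simp [Real.pi_ne_zero]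
  rw [show (2 * Real.pi * x * Complex.I : ℂ) = x * (2 * Real.pi * Complex.I) by ring,
    mul_left_inj' h]
  exact_mod_cast Iff.rfl

/-- Orthogonality of the characters of `ℤ/p`. -/
theorem sum_turn {p : ℕ} (hp : 0 < p) (m : ℤ) :
    ∑ k ∈ Finset.range p, turn (k * (m / p)) = if (p : ℤ) ∣ m then (p : ℂ) else 0 := by
  have hp0 : (p : ℝ) ≠ 0 := by positivity
  simp only [turn_nat_mul]
  split_ifs with h
  · obtain ⟨t, rfl⟩ := h
    have : turn (((p * t : ℤ) : ℝ) / p) = 1 := by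
      rw [show (((p * t : ℤ) : ℝ) / p) = ((t : ℤ) : ℝ) by push_cast; field_simp, turn_int]
    simp only [this, one_pow, Finset.sum_const, Finset.card_range, nsmul_eq_mul, mul_one]
  · have h1 : turn ((m : ℝ) / p) ≠ 1 := fun h' => by
      obtain ⟨t, ht⟩ := turn_eq_one_iff.1 h'
      rw [div_eq_iff hp0] at ht
      exact h ⟨t, by rw [mul_comm]; exact_mod_cast ht⟩
    rw [geom_sum_eq h1, ← turn_nat_mul, mul_div_cancel₀ _ hp0, turn_int, sub_self, zero_div]

/-- The product `h · z`. -/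
def dot {s : ℕ} (h : Fin s → ℤ) (z : ℕ → ℤ) : ℤ := ∑ j : Fin s, h j * z j

theorem mFourier_lattice {s : ℕ} (h : Fin s → ℤ) (z : ℕ → ℤ) (p k : ℕ) :
    UnitAddTorus.mFourier h
      (fun j : Fin s => ((((k : ℝ) * (z j : ℝ)) / (p : ℝ) : ℝ) : UnitAddCircle)) =
      turn (k * (dot h z / p)) := by
  show ∏ i : Fin s, fourier (h i) _ = _
  have h1 : (k * ((dot h z : ℤ) / p : ℝ) : ℝ) = ∑ i : Fin s, (h i : ℝ) * (k * z i / p) := by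
    rw [dot]; push_cast
    rw [Finset.sum_div, Finset.mul_sum]
    exact Finset.sum_congr rfl fun i _ => by ring
  rw [h1, turn_sum]
  refine Finset.prod_congr rfl fun i _ => ?_
  rw [fourier_coe_apply, turn]
  congr 1; push_cast; ring

theorem integral_eq_coeff {s : ℕ} (f : C(UnitAddTorus (Fin s), ℂ)) :
    integral f = UnitAddTorus.mFourierCoeff f 0 := by
  rw [UnitAddTorus.mFourierCoeff]
  simp only [neg_zero, UnitAddTorus.mFourier_zero, ContinuousMap.one_apply, one_smul]
  rfl

/-- A lattice rule integrates exactly those frequencies wrongly that lie on its dual lattice. -/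
theorem latticeRule_sub_integral {s : ℕ} (f : C(UnitAddTorus (Fin s), ℂ)) (z : ℕ → ℤ)
    (hf : Summable (UnitAddTorus.mFourierCoeff f)) {p : ℕ} (hp : 0 < p) :
    latticeRule p (fun j : Fin s => z j) f - integral f =
      ∑' h, {h : Fin s → ℤ | h ≠ 0 ∧ (p : ℤ) ∣ dot h z}.indicator
        (UnitAddTorus.mFourierCoeff f) h := by
  classical
  have hp0 : (p : ℂ) ≠ 0 := Nat.cast_ne_zero.2 hp.ne'
  have h1 : HasSum (fun h => {h : Fin s → ℤ | (p : ℤ) ∣ dot h z}.indicator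
      (UnitAddTorus.mFourierCoeff f) h) (latticeRule p (fun j : Fin s => z j) f) := by
    have := (hasSum_sum fun k (_ : k ∈ Finset.range p) =>
      UnitAddTorus.hasSum_mFourier_series_apply_of_summable hf
      (fun j : Fin s => ((((k : ℝ) * (z j : ℝ)) / (p : ℝ) : ℝ) : UnitAddCircle))).mul_left
        (1 / (p : ℂ))
    refine HasSum.congr_fun this fun h => ?_
    simp only [smul_eq_mul, mFourier_lattice]
    rw [← Finset.mul_sum, sum_turn hp, Set.indicator_apply]
    simp only [Set.mem_ofPred_eq]
    split_ifs
    · field_simp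
    · simp
  have h2 : HasSum (fun h => ({0} : Set (Fin s → ℤ)).indicator
      (UnitAddTorus.mFourierCoeff f) h) (integral f) := by
    rw [integral_eq_coeff]
    have := hasSum_single (f := ({0} : Set (Fin s → ℤ)).indicator (UnitAddTorus.mFourierCoeff f))
      0 (fun h hh => by simp [hh])
    simpa using this
  refine ((h1.sub h2).tsum_eq.symm).trans (tsum_congr fun h => ?_)
  by_cases h0 : h = 0
  · subst h0
    simp [dot]
  · simp [Set.indicator_apply, h0]

/-- The square of the bound for the error, up to the factor `|P_n|²`: the sum over all pairs of
primes of the terms on the intersection of the two dual lattices. -/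
noncomputable def sqError (α : ℝ) (γ : ℕ → ℝ) (n s : ℕ) (z : ℕ → ℤ) : ℝ :=
  ∑ p ∈ primes n, ∑ q ∈ primes n,
    lsum α γ 2 {h : Fin s → ℤ | h ≠ 0 ∧ (p : ℤ) ∣ dot h z ∧ (q : ℤ) ∣ dot h z}

theorem summable_of_norm_le_one {α : ℝ} {γ : ℕ → ℝ} {s : ℕ} {f : C(UnitAddTorus (Fin s), ℂ)}
    (hf : norm α γ f ≤ 1) :
    (Summable fun h => (r α γ h * ‖UnitAddTorus.mFourierCoeff f h‖) ^ (2 : ℝ)) ∧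
      ∑' h, (r α γ h * ‖UnitAddTorus.mFourierCoeff f h‖) ^ (2 : ℝ) ≤ 1 := by
  have h1 : ∑' h : Fin s → ℤ,
      ENNReal.ofReal (r α γ h ^ 2 * ‖UnitAddTorus.mFourierCoeff f h‖ ^ 2) ≤ 1 := by
    by_contra h
    rw [not_le] at h
    exact absurd hf (not_le.2 (ENNReal.one_lt_rpow h (by norm_num)))
  have hnn : ∀ h : Fin s → ℤ, 0 ≤ r α γ h ^ 2 * ‖UnitAddTorus.mFourierCoeff f h‖ ^ 2 :=
    fun h => by positivity
  have h2 : Summable fun h : Fin s → ℤ =>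
      r α γ h ^ 2 * ‖UnitAddTorus.mFourierCoeff f h‖ ^ 2 := by
    have := ENNReal.summable_toReal (ne_top_of_le_ne_top ENNReal.one_ne_top h1)
    exact this.congr fun h => ENNReal.toReal_ofReal (hnn h)
  have h3 : ∀ h : Fin s → ℤ, (r α γ h * ‖UnitAddTorus.mFourierCoeff f h‖) ^ (2 : ℝ) =
      r α γ h ^ 2 * ‖UnitAddTorus.mFourierCoeff f h‖ ^ 2 := fun h => by
    rw [Real.rpow_two, mul_pow]
  simp only [h3]
  refine ⟨h2, ?_⟩
  rw [← ENNReal.ofReal_tsum_of_nonneg hnn h2, ENNReal.ofReal_le_one] at h1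
  exact h1

/-- The Cauchy–Schwarz inequality: each frequency `h` contributes `ν(h) |f̂(h)|` to the sum of the
errors, where `ν(h)` is the number of primes whose dual lattice contains `h`. -/
theorem randomisedError_le {α : ℝ} {γ : ℕ → ℝ} (hγ : ∀ j, 0 < γ j) (hα : 1 / 2 < α) (n s : ℕ)
    (z : ℕ → ℤ) : randomisedError α γ n (fun j : Fin s => z j) ≤
      ENNReal.ofReal (1 / (primes n).card * √(sqError α γ n s z)) := by
  classical
  have hx : 1 < α * 2 := by linarith
  refine iSup₂_le fun f hf => ENNReal.ofReal_le_ofReal ?_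
  refine mul_le_mul_of_nonneg_left ?_ (by positivity)
  obtain ⟨hs, hs1⟩ := summable_of_norm_le_one hf
  set c := UnitAddTorus.mFourierCoeff (f : UnitAddTorus (Fin s) → ℂ) with hc
  let D : ℕ → Set (Fin s → ℤ) := fun p => {h | h ≠ 0 ∧ (p : ℤ) ∣ dot h z}
  let ν : (Fin s → ℤ) → ℝ := fun h => ∑ p ∈ primes n, (D p).indicator 1 h
  have hν0 : ∀ h, 0 ≤ ν h := fun h => Finset.sum_nonneg fun p _ =>
    Set.indicator_nonneg (fun _ _ => zero_le_one) h
  have hpt : ∀ h, ((r α γ h)⁻¹ * ν h) ^ (2 : ℝ) =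
      ∑ p ∈ primes n, ∑ q ∈ primes n, ({h : Fin s → ℤ | h ≠ 0 ∧ (p : ℤ) ∣ dot h z ∧
        (q : ℤ) ∣ dot h z}).indicator (fun h => r α γ h ^ (-2 : ℝ)) h := fun h => by
    have h1 : r α γ h ^ (-2 : ℝ) = ((r α γ h)⁻¹) ^ 2 := by
      rw [Real.rpow_neg (r_pos hγ h).le, Real.rpow_two, inv_pow]
    rw [Real.rpow_two, mul_pow, sq (ν h), Finset.sum_mul_sum, Finset.mul_sum]
    refine Finset.sum_congr rfl fun p _ => ?_
    rw [Finset.mul_sum]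
    refine Finset.sum_congr rfl fun q _ => ?_
    simp only [Set.indicator_apply, D, Set.mem_ofPred_eq, h1, Pi.one_apply]
    by_cases h0 : h = 0 <;> by_cases hp : (p : ℤ) ∣ dot h z <;>
      by_cases hq : (q : ℤ) ∣ dot h z <;> simp [h0, hp, hq]
  have hsum2 : Summable fun h => ((r α γ h)⁻¹ * ν h) ^ (2 : ℝ) := by
    simp only [hpt]
    exact summable_sum fun p _ => summable_sum fun q _ => summable_indicator hγ hx _
  have htsum2 : ∑' h, ((r α γ h)⁻¹ * ν h) ^ (2 : ℝ) = sqError α γ n s z := by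
    simp only [hpt]
    rw [Summable.tsum_finsetSum fun p _ => summable_sum fun q _ => summable_indicator hγ hx _]
    refine Finset.sum_congr rfl fun p _ => ?_
    rw [Summable.tsum_finsetSum fun q _ => summable_indicator hγ hx _]
    rfl
  -- the Fourier series converges absolutely, as `r ^ (-2)` is summable
  have hrc : Summable fun h => ‖c h‖ := by
    have h1 : Summable fun h : Fin s → ℤ => ((r α γ h)⁻¹) ^ (2 : ℝ) :=
      (summable_r hγ hx s).congr fun h => by
        rw [Real.rpow_neg (r_pos hγ h).le, Real.inv_rpow (r_pos hγ h).le]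
    have := (Real.summable_and_inner_le_Lp_mul_Lq_tsum_of_nonneg Real.HolderConjugate.two_two
      (fun h => mul_nonneg (r_pos hγ h).le (norm_nonneg (c h)))
      (fun h => (inv_pos.2 (r_pos (α := α) hγ h)).le) hs h1).1
    refine this.congr fun h => ?_
    have := (r_pos (α := α) hγ h).ne'
    field_simp
  have hcs := Real.summable_and_inner_le_Lp_mul_Lq_tsum_of_nonneg Real.HolderConjugate.two_two
      (fun h => mul_nonneg (r_pos hγ h).le (norm_nonneg (c h)))
      (fun h => mul_nonneg (inv_pos.2 (r_pos (α := α) hγ h)).le (hν0 h)) hs hsum2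
  have hmul : ∀ h, r α γ h * ‖c h‖ * ((r α γ h)⁻¹ * ν h) =
      ∑ p ∈ primes n, (D p).indicator (fun h => ‖c h‖) h := fun h => by
    have := (r_pos (α := α) hγ h).ne'
    rw [show r α γ h * ‖c h‖ * ((r α γ h)⁻¹ * ν h) = ‖c h‖ * ν h by field_simp, Finset.mul_sum]
    refine Finset.sum_congr rfl fun p _ => ?_
    by_cases hp : h ∈ D p <;> simp [hp]
  simp only [hmul] at hcs
  rw [Summable.tsum_finsetSum fun p _ => hrc.indicator _, htsum2] at hcs
  calc ∑ p ∈ primes n, ‖latticeRule p (fun j : Fin s => z j) f - integral f‖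
      ≤ ∑ p ∈ primes n, ∑' h, (D p).indicator (fun h => ‖c h‖) h := by
        refine Finset.sum_le_sum fun p hp => ?_
        rw [latticeRule_sub_integral f z hrc.of_norm (mem_primes.1 hp).1.pos]
        refine (norm_tsum_le_tsum_norm (hrc.of_norm.indicator _).norm).trans (le_of_eq ?_)
        refine tsum_congr fun h => ?_
        rw [norm_indicator_eq_indicator_norm]
    _ ≤ _ := hcs.2
    _ ≤ 1 * sqError α γ n s z ^ (1 / (2 : ℝ)) := by
        refine mul_le_mul_of_nonneg_right (Real.rpow_le_one ?_ hs1 (by norm_num)) ?_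
        · exact tsum_nonneg fun h => Real.rpow_nonneg
            (mul_nonneg (r_pos hγ h).le (norm_nonneg _)) _
        · rw [← htsum2]
          exact Real.rpow_nonneg (tsum_nonneg fun h => Real.rpow_nonneg
            (mul_nonneg (inv_pos.2 (r_pos hγ h)).le (hν0 h)) _) _
    _ = √(sqError α γ n s z) := by rw [one_mul, Real.sqrt_eq_rpow]

/-! ### The search criteria -/

theorem theta_eq_lsum (α : ℝ) (γ : ℕ → ℝ) (s : ℕ) (z : ℕ → ℤ) (p : ℕ) (c : ℤ) :
    theta α γ s z p c = lsum α γ 2 {h : Fin (s + 1) → ℤ | h (Fin.last s) ≠ 0 ∧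
      (p : ℤ) ∣ dotInit z h + h (Fin.last s) * c} :=
  tsum_subtype_eq_lsum α γ 2 _

theorem critT_eq_lsum (α : ℝ) (γ : ℕ → ℝ) (n s : ℕ) (z : ℕ → ℤ) (p : ℕ) (c : ℤ) :
    critT α γ n s z p c = theta α γ s z p c
      + 2 * ∑ q ∈ (primes n).filter (fun q => q < p),
        lsum α γ 2 {h : Fin (s + 1) → ℤ | h (Fin.last s) ≠ 0 ∧ ¬ (p : ℤ) ∣ h (Fin.last s) ∧
          (p : ℤ) ∣ dotInit z h + h (Fin.last s) * c ∧
          (q : ℤ) ∣ dotInit z h + h (Fin.last s) * z s}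
      + 2 * ∑ q ∈ (primes n).filter (fun q => p < q),
        lsum α γ 2 {h : Fin (s + 1) → ℤ | h (Fin.last s) ≠ 0 ∧ (q : ℤ) ∣ h (Fin.last s) ∧
          (p : ℤ) ∣ dotInit z h + h (Fin.last s) * c ∧ (q : ℤ) ∣ dotInit z h} := by
  rw [critT]
  congr 2
  · congr 1
    exact Finset.sum_congr rfl fun q _ => tsum_subtype_eq_lsum α γ 2 _
  · exact Finset.sum_congr rfl fun q _ => tsum_subtype_eq_lsum α γ 2 _

theorem dot_succ {s : ℕ} (h : Fin (s + 1) → ℤ) (z : ℕ → ℤ) :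
    dot h z = dotInit z h + h (Fin.last s) * z s := by
  simp [dot, dotInit, Fin.sum_univ_castSucc]

theorem dvd_dotInit_congr {s p : ℕ} {z z' : ℕ → ℤ} (hz : ∀ j < s, z j ≡ z' j [ZMOD p])
    {c c' : ℤ} (hc : c ≡ c' [ZMOD p]) (h : Fin (s + 1) → ℤ) :
    (p : ℤ) ∣ dotInit z h + h (Fin.last s) * c ↔
      (p : ℤ) ∣ dotInit z' h + h (Fin.last s) * c' := by
  have h1 : dotInit z h ≡ dotInit z' h [ZMOD p] := by
    unfold dotInit
    have : ∀ F : Finset (Fin s), ∑ j ∈ F, h j.castSucc * z j ≡ ∑ j ∈ F, h j.castSucc * z' j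
        [ZMOD p] := fun F => by
      classical
      induction F using Finset.induction_on with
      | empty => rfl
      | insert a F ha ih =>
        rw [Finset.sum_insert ha, Finset.sum_insert ha]
        exact ((hz a a.2).mul_left _).add ih
    exact this _
  have h2 : dotInit z h + h (Fin.last s) * c ≡ dotInit z' h + h (Fin.last s) * c' [ZMOD p] :=
    h1.add (hc.mul_left _)
  rw [← Int.modEq_zero_iff_dvd, ← Int.modEq_zero_iff_dvd]
  exact ⟨fun h => h2.symm.trans h, fun h => h2.trans h⟩

theorem dvd_dotInit_congr' {s p : ℕ} {z z' : ℕ → ℤ} (hz : ∀ j < s, z j ≡ z' j [ZMOD p])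
    (h : Fin (s + 1) → ℤ) : (p : ℤ) ∣ dotInit z h ↔ (p : ℤ) ∣ dotInit z' h := by
  simpa [Fin.snoc, dotInit] using dvd_dotInit_congr hz (Int.ModEq.refl 0) h

theorem theta_congr {α : ℝ} {γ : ℕ → ℝ} {s p : ℕ} {z z' : ℕ → ℤ}
    (hz : ∀ j < s, z j ≡ z' j [ZMOD p]) {c c' : ℤ} (hc : c ≡ c' [ZMOD p]) :
    theta α γ s z p c = theta α γ s z' p c' := by
  rw [theta_eq_lsum, theta_eq_lsum]
  simp only [dvd_dotInit_congr hz hc]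

/-- The criteria depend on the residues of the components only. -/
theorem critT_congr {α : ℝ} {γ : ℕ → ℝ} {n s p : ℕ} {z z' : ℕ → ℤ} (hp : p ∈ primes n)
    (hz : ∀ q ∈ primes n, ∀ j < s, z j ≡ z' j [ZMOD q])
    (hs : ∀ q ∈ primes n, q < p → z s ≡ z' s [ZMOD q]) {c c' : ℤ} (hc : c ≡ c' [ZMOD p]) :
    critT α γ n s z p c = critT α γ n s z' p c' := by
  rw [critT_eq_lsum, critT_eq_lsum, theta_congr (hz p hp) hc]
  congr 2
  · congr 1
    refine Finset.sum_congr rfl fun q hq => ?_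
    obtain ⟨hq, hqp⟩ := Finset.mem_filter.1 hq
    simp only [dvd_dotInit_congr (hz p hp) hc, dvd_dotInit_congr (hz q hq) (hs q hq hqp)]
  · refine Finset.sum_congr rfl fun q hq => ?_
    obtain ⟨hq, hqp⟩ := Finset.mem_filter.1 hq
    simp only [dvd_dotInit_congr (hz p hp) hc, dvd_dotInit_congr' (hz q hq)]

section bounds

variable {α x : ℝ} {γ : ℕ → ℝ} {s : ℕ}

/-- If `p` does not divide `h_s`, the congruence `h'·z' + h_s c ≡ 0` determines `c` modulo `p`, so
each frequency is counted at most once in a sum over residues `c`. -/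
theorem sum_lsum_not_dvd_le (hγ : ∀ j, 0 < γ j) (hx : 1 < α * x) {p : ℕ} (hp : p.Prime)
    (z : ℕ → ℤ) {F : Finset ℕ} (hF : F ⊆ Finset.range p) (C : Set (Fin (s + 1) → ℤ))
    (A : ℕ → Set (Fin (s + 1) → ℤ)) (hA : ∀ c ∈ F, ∀ h ∈ A c, h ∈ C ∧
      ¬ (p : ℤ) ∣ h (Fin.last s) ∧ (p : ℤ) ∣ dotInit z h + h (Fin.last s) * c) :
    ∑ c ∈ F, lsum α γ x (A c) ≤ lsum α γ x C := by
  have := sum_lsum_le hγ hx F A C 1 (fun c hc h hh => (hA c hc h hh).1) fun h _ G hG hGA => by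
    refine Finset.card_le_one.2 fun c hc c' hc' => ?_
    obtain ⟨-, h1, h2⟩ := hA c (hG hc) h (hGA c hc)
    obtain ⟨-, -, h3⟩ := hA c' (hG hc') h (hGA c' hc')
    have h4 : (p : ℤ) ∣ h (Fin.last s) * ((c : ℤ) - c') := by
      have := dvd_sub h2 h3
      rwa [show dotInit z h + h (Fin.last s) * (c : ℤ) - (dotInit z h + h (Fin.last s) * c') =
        h (Fin.last s) * ((c : ℤ) - c') by ring] at this
    have h5 := ((Nat.prime_iff_prime_int.1 hp).dvd_or_dvd h4).resolve_left h1
    have h6 : c ≡ c' [MOD p] := ((Nat.modEq_iff_dvd).2 (by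
      rw [← neg_sub, dvd_neg]; exact h5))
    have hc1 := Finset.mem_range.1 (hF (hG hc))
    have hc2 := Finset.mem_range.1 (hF (hG hc'))
    rwa [Nat.ModEq, Nat.mod_eq_of_lt hc1, Nat.mod_eq_of_lt hc2] at h6
  simpa using this

theorem rpow_neg_le_inv {q : ℕ} (hq : 0 < q) {y : ℝ} (hy : 1 ≤ y) : (q : ℝ) ^ (-y) ≤ (q : ℝ)⁻¹ := by
  rw [← Real.rpow_neg_one]
  exact Real.rpow_le_rpow_of_exponent_le (by exact_mod_cast hq) (by linarith)

theorem lsum_dvd_le (hγ : ∀ j, 0 < γ j) (hx : 1 < α * x) {p : ℕ} (hp : 0 < p)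
    (A : Set (Fin (s + 1) → ℤ)) (hA : ∀ h ∈ A, h (Fin.last s) ≠ 0 ∧ (p : ℤ) ∣ h (Fin.last s)) :
    lsum α γ x A ≤ (p : ℝ)⁻¹ * muLast α γ x s := by
  rw [← Set.inter_eq_left.2 (show A ⊆ {h | h (Fin.last s) ≠ 0 ∧ (p : ℤ) ∣ h (Fin.last s)} from hA),
    lsum_dvd hγ hp]
  exact mul_le_mul (rpow_neg_le_inv hp hx.le) (lsum_mono hγ hx Set.inter_subset_left)
    (lsum_nonneg hγ _) (by positivity)

/-- On average over `c`, the dual lattice takes a share of at most `2 / p` of the sum. -/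
theorem sum_theta_sets_le (hγ : ∀ j, 0 < γ j) (hx : 1 < α * x) {p : ℕ} (hp : p.Prime) (z : ℕ → ℤ) :
    ∑ c ∈ Finset.range p, lsum α γ x {h : Fin (s + 1) → ℤ | h (Fin.last s) ≠ 0 ∧
      (p : ℤ) ∣ dotInit z h + h (Fin.last s) * (c : ℕ)} ≤ 2 * muLast α γ x s := by
  have hp0 : (p : ℝ) ≠ 0 := Nat.cast_ne_zero.2 hp.ne_zero
  rw [Finset.sum_congr rfl fun c _ => lsum_split hγ hx _ {h | (p : ℤ) ∣ h (Fin.last s)},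
    Finset.sum_add_distrib, two_mul]
  refine add_le_add ?_ ?_
  · refine (Finset.sum_le_sum fun c _ => lsum_dvd_le hγ hx hp.pos _ fun h hh => ⟨hh.1.1, hh.2⟩).trans
      (le_of_eq ?_)
    rw [Finset.sum_const, Finset.card_range, nsmul_eq_mul]
    field_simp
  · exact sum_lsum_not_dvd_le hγ hx hp z le_rfl _ _ fun c _ h hh => ⟨hh.1.1, hh.2, hh.1.2⟩

theorem muLast_nonneg (hγ : ∀ j, 0 < γ j) : 0 ≤ muLast α γ x s := lsum_nonneg hγ _

/-- The residues with the smallest values of `θ` have a value of `θ` that is small in terms of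
the average. -/
theorem theta_le_of_smallest (hγ : ∀ j, 0 < γ j) {lam τ : ℝ} (hl : 1 / 2 ≤ lam) (hla : lam < α)
    (hτ1 : τ < 1) {p : ℕ} (hp : p.Prime) (z : ℕ → ℤ) {B : Finset ℕ}
    (hB : B ⊆ Finset.range p) (hcard : B.card = ⌈τ * (p : ℝ)⌉₊)
    (hmin : ∀ b ∈ B, ∀ c ∈ Finset.range p, c ∉ B → theta α γ s z p b ≤ theta α γ s z p c)
    {b : ℕ} (hb : b ∈ B) :
    theta α γ s z p b ≤ (2 * muLast α γ (1 / lam) s / ((1 - τ) * p)) ^ (2 * lam) := by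
  have hl0 : 0 < lam := by linarith
  have hx : 1 < α * (1 / lam) := by rw [mul_one_div, one_lt_div hl0]; exact hla
  have hp0 : (0 : ℝ) < p := by exact_mod_cast hp.pos
  -- the analogue of `θ` for the exponent `1 / λ`; its average over `c` is known
  set ψ : ℕ → ℝ := fun c => lsum α γ (1 / lam) {h : Fin (s + 1) → ℤ | h (Fin.last s) ≠ 0 ∧
      (p : ℤ) ∣ dotInit z h + h (Fin.last s) * (c : ℕ)} with hψ
  have hψ0 : ∀ c, 0 ≤ ψ c := fun c => lsum_nonneg hγ _
  have hθψ : ∀ c : ℕ, theta α γ s z p c ≤ ψ c ^ (2 * lam) := fun c => by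
    have := lsum_le_rpow (x := 1 / lam) hγ (by linarith : (1 : ℝ) ≤ 2 * lam) hx
      {h : Fin (s + 1) → ℤ | h (Fin.last s) ≠ 0 ∧
        (p : ℤ) ∣ dotInit z h + h (Fin.last s) * (c : ℕ)}
    rwa [show 1 / lam * (2 * lam) = 2 by field_simp, ← theta_eq_lsum] at this
  have hθ0 : 0 ≤ theta α γ s z p b := by rw [theta_eq_lsum]; exact lsum_nonneg hγ _
  -- the elements of `{b} ∪ Bᶜ` have at least the value of `θ` at `b`
  set G := insert b (Finset.range p \ B) with hG
  have hGcard : ((1 - τ) * p : ℝ) ≤ G.card := by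
    rw [hG, Finset.card_insert_of_notMem (by simp [hb]), Finset.card_sdiff_of_subset hB,
      Finset.card_range, hcard]
    have h1 : ⌈τ * (p : ℝ)⌉₊ ≤ p := Nat.ceil_le.2 (by nlinarith)
    push_cast [Nat.cast_sub h1]
    rcases le_or_gt 0 (τ * p) with h2 | h2
    · have := (Nat.ceil_lt_add_one h2).le; nlinarith
    · rw [Nat.ceil_eq_zero.2 h2.le] at hcard
      rw [Finset.card_eq_zero.1 hcard] at hb
      exact absurd hb (Finset.notMem_empty _)
  set t := theta α γ s z p b ^ (1 / (2 * lam)) with ht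
  have ht0 : 0 ≤ t := Real.rpow_nonneg hθ0 _
  have hle : ∀ c ∈ G, t ≤ ψ c := fun c hc => by
    have h1 : theta α γ s z p b ≤ theta α γ s z p c := by
      rw [hG, Finset.mem_insert, Finset.mem_sdiff] at hc
      rcases hc with rfl | hc
      · exact le_rfl
      · exact hmin b hb c hc.1 hc.2
    have h2 := Real.rpow_le_rpow hθ0 (h1.trans (hθψ c)) (by positivity : 0 ≤ 1 / (2 * lam))
    rwa [← Real.rpow_mul (hψ0 c), mul_one_div, div_self (by positivity), Real.rpow_one] at h2
  have hsum : G.card * t ≤ 2 * muLast α γ (1 / lam) s := by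
    rw [← nsmul_eq_mul, ← Finset.sum_const]
    refine (Finset.sum_le_sum hle).trans (le_trans ?_ (sum_theta_sets_le hγ hx hp z))
    refine Finset.sum_le_sum_of_subset_of_nonneg ?_ fun c _ _ => hψ0 c
    intro c hc
    rw [hG, Finset.mem_insert, Finset.mem_sdiff] at hc
    rcases hc with rfl | hc
    · exact hB hb
    · exact hc.1
  have h1τ : 0 < (1 - τ) * p := mul_pos (by linarith) hp0
  have ht1 : t ≤ 2 * muLast α γ (1 / lam) s / ((1 - τ) * p) := by
    rw [le_div_iff₀ h1τ]; nlinarith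
  have := Real.rpow_le_rpow ht0 ht1 (by linarith : 0 ≤ 2 * lam)
  rwa [ht, ← Real.rpow_mul hθ0, one_div_mul_cancel (by positivity), Real.rpow_one] at this

/-- The part of the second sum in `T` with `p ∣ h_s` is a small multiple of `θ`. -/
theorem lsum_dvd_dvd_le (hγ : ∀ j, 0 < γ j) (hα : 1 / 2 < α) {p q : ℕ} (hp : p.Prime)
    (hq : q.Prime) (hpq : p ≠ q) (z : ℕ → ℤ) (c : ℤ) :
    lsum α γ 2 ({h : Fin (s + 1) → ℤ | h (Fin.last s) ≠ 0 ∧ (q : ℤ) ∣ h (Fin.last s) ∧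
      (p : ℤ) ∣ dotInit z h + h (Fin.last s) * c ∧ (q : ℤ) ∣ dotInit z h} ∩
        {h | (p : ℤ) ∣ h (Fin.last s)}) ≤ (q : ℝ)⁻¹ * theta α γ s z p c := by
  have hx : 1 < α * 2 := by linarith
  refine (lsum_mono hγ hx (B := {h | (p : ℤ) ∣ h (Fin.last s) ∧ (p : ℤ) ∣ dotInit z h} ∩
    {h | h (Fin.last s) ≠ 0 ∧ (q : ℤ) ∣ h (Fin.last s)}) ?_).trans ?_
  · rintro h ⟨⟨h1, h2, h3, h4⟩, h5⟩
    have h5' : (p : ℤ) ∣ h (Fin.last s) := h5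
    exact ⟨⟨h5', (dvd_add_left (h5'.mul_right c)).1 h3⟩, h1, h2⟩
  · rw [lsum_dvd hγ hq.pos, theta_eq_lsum]
    refine mul_le_mul (rpow_neg_le_inv hq.pos hx.le) (lsum_mono hγ hx ?_)
      (lsum_nonneg hγ _) (by positivity)
    rintro h ⟨h1, h2, h3⟩
    simp only [Fin.snoc_last] at h2
    have h4 : (p : ℤ) ∣ h (Fin.last s) :=
      ((Nat.prime_iff_prime_int.1 hp).dvd_or_dvd h2).resolve_left fun h' =>
        hpq ((Nat.prime_dvd_prime_iff_eq hp hq).1 (by exact_mod_cast h'))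
    refine ⟨h1, dvd_add ?_ (h4.mul_right c)⟩
    simpa [dotInit, Fin.init] using h3

/-- The minimum of `T` over `B` is at most the average, in which each frequency is counted at most
once, up to those with `p ∣ h_s`. -/
theorem critT_le_of_min (hγ : ∀ j, 0 < γ j) (hα : 1 / 2 < α) {n : ℕ} (hn : 2 ≤ n) {τ Θ : ℝ}
    (hτ : 0 < τ) (hτ1 : τ < 1) {p : ℕ} (hp : p ∈ primes n) (z : ℕ → ℤ) {B : Finset ℕ}
    (hB : B ⊆ Finset.range p) (hcard : B.card = ⌈τ * (p : ℝ)⌉₊)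
    (hΘ : ∀ q ∈ primes n, theta α γ s z q (z s) ≤ Θ)
    (hΘB : ∀ b ∈ B, theta α γ s z p (b : ℕ) ≤ Θ)
    {b : ℕ} (hmin : ∀ c ∈ B, critT α γ n s z p b ≤ critT α γ n s z p c) :
    critT α γ n s z p b ≤ 13 / τ * Θ := by
  have hx : 1 < α * 2 := by linarith
  obtain ⟨hpp, hnp, hpn⟩ := mem_primes.1 hp
  have hn0 : (0 : ℝ) < n := by positivity
  have hp0 : (0 : ℝ) < p := by exact_mod_cast hpp.pos
  have hΘ0 : 0 ≤ Θ := le_trans (by rw [theta_eq_lsum]; exact lsum_nonneg hγ _) (hΘ p hp)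
  have hBτ : τ * p ≤ B.card := by rw [hcard]; exact Nat.le_ceil _
  have hnB : (n : ℝ) ≤ 2 / τ * B.card := by
    have : (n : ℝ) ≤ 2 * p := by exact_mod_cast hnp.le
    rw [div_mul_eq_mul_div, le_div_iff₀ hτ]
    nlinarith
  have hB0 : (0 : ℝ) < B.card := lt_of_lt_of_le (by positivity) hBτ
  have hcardP : ((primes n).card : ℝ) ≤ n := by exact_mod_cast card_primes_le n
  -- for `q < p`, summation over `c` only leaves the dual lattice modulo `q`
  have hS1 : ∀ q ∈ (primes n).filter (fun q => q < p), ∑ c ∈ B,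
      lsum α γ 2 {h : Fin (s + 1) → ℤ | h (Fin.last s) ≠ 0 ∧ ¬ (p : ℤ) ∣ h (Fin.last s) ∧
        (p : ℤ) ∣ dotInit z h + h (Fin.last s) * (c : ℕ) ∧
        (q : ℤ) ∣ dotInit z h + h (Fin.last s) * z s} ≤ Θ := fun q hq => by
    refine le_trans ?_ (hΘ q (Finset.mem_filter.1 hq).1)
    rw [theta_eq_lsum]
    exact sum_lsum_not_dvd_le hγ hx hpp z hB _ _ fun c _ h hh =>
      ⟨⟨hh.1, hh.2.2.2⟩, hh.2.1, hh.2.2.1⟩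
  -- for `q > p` it is the same, except for the frequencies with `p ∣ h_s`
  have hS2 : ∀ q ∈ (primes n).filter (fun q => p < q), ∑ c ∈ B,
      lsum α γ 2 {h : Fin (s + 1) → ℤ | h (Fin.last s) ≠ 0 ∧ (q : ℤ) ∣ h (Fin.last s) ∧
          (p : ℤ) ∣ dotInit z h + h (Fin.last s) * (c : ℕ) ∧ (q : ℤ) ∣ dotInit z h} ≤
        B.card * (2 / n * Θ) + Θ := fun q hq => by
    obtain ⟨hq, hpq⟩ := Finset.mem_filter.1 hq
    obtain ⟨hqq, hnq, -⟩ := mem_primes.1 hq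
    rw [Finset.sum_congr rfl fun c _ => lsum_split hγ hx _ {h | (p : ℤ) ∣ h (Fin.last s)},
      Finset.sum_add_distrib]
    refine add_le_add ?_ ?_
    · rw [← nsmul_eq_mul, ← Finset.sum_const]
      refine Finset.sum_le_sum fun c hc => ?_
      refine (lsum_dvd_dvd_le hγ hα hpp hqq hpq.ne z c).trans ?_
      have hq0 : (0 : ℝ) < q := by exact_mod_cast hqq.pos
      have hnq' : (n : ℝ) ≤ 2 * q := by exact_mod_cast hnq.le
      refine mul_le_mul ?_ (hΘB c hc) ?_ (by positivity)
      · rw [inv_eq_one_div, div_le_div_iff₀ hq0 hn0]; linarith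
      · rw [theta_eq_lsum]; exact lsum_nonneg hγ _
    · refine le_trans ?_ (hΘ q hq)
      rw [theta_eq_lsum]
      refine sum_lsum_not_dvd_le hγ hx hpp z hB _ _ fun c _ h hh => ?_
      exact ⟨⟨hh.1.1, dvd_add hh.1.2.2.2 (hh.1.2.1.mul_right _)⟩, hh.2, hh.1.2.2.1⟩
  have hf : ∀ P : ℕ → Prop, [DecidablePred P] → (((primes n).filter P).card : ℝ) ≤ n := fun P _ =>
    le_trans (by exact_mod_cast Finset.card_filter_le _ _) hcardP
  have hsum : B.card * critT α γ n s z p b ≤ B.card * Θ + 2 * (n * Θ) +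
      2 * (n * (B.card * (2 / n * Θ) + Θ)) := by
    rw [← nsmul_eq_mul, ← Finset.sum_const]
    refine (Finset.sum_le_sum hmin).trans ?_
    rw [Finset.sum_congr rfl fun c _ => critT_eq_lsum α γ n s z p (c : ℕ), Finset.sum_add_distrib,
      Finset.sum_add_distrib, ← Finset.mul_sum, ← Finset.mul_sum, Finset.sum_comm]
    refine add_le_add (add_le_add ?_ (mul_le_mul_of_nonneg_left ?_ two_pos.le))
      (mul_le_mul_of_nonneg_left ?_ two_pos.le)
    · rw [← nsmul_eq_mul, ← Finset.sum_const]
      exact Finset.sum_le_sum hΘB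
    · refine (Finset.sum_le_sum hS1).trans ?_
      rw [Finset.sum_const, nsmul_eq_mul]
      exact mul_le_mul_of_nonneg_right (hf _) hΘ0
    · rw [Finset.sum_comm]
      refine (Finset.sum_le_sum hS2).trans ?_
      rw [Finset.sum_const, nsmul_eq_mul]
      exact mul_le_mul_of_nonneg_right (hf _) (by positivity)
  have h1 : (n : ℝ) * (B.card * (2 / n * Θ) + Θ) = 2 * B.card * Θ + n * Θ := by field_simp
  rw [h1] at hsum
  have h2 : (n : ℝ) * Θ ≤ 2 / τ * B.card * Θ := mul_le_mul_of_nonneg_right hnB hΘ0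
  have h3 : (1 : ℝ) ≤ 1 / τ := by rw [le_div_iff₀ hτ]; linarith
  have h4 : B.card * Θ ≤ 1 / τ * (B.card * Θ) := le_mul_of_one_le_left (by positivity) h3
  -- `13 = 5 + 4 · 2`, where `n ≤ (2 / τ) |B|`
  have h5 : (B.card : ℝ) * critT α γ n s z p b ≤ B.card * (13 / τ * Θ) := by
    calc (B.card : ℝ) * critT α γ n s z p b
        ≤ 5 * (1 / τ * (B.card * Θ)) + 4 * (2 / τ * B.card * Θ) := by linarith
      _ = _ := by ring
  exact le_of_mul_le_mul_left h5 hB0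

/-- The bound for the first component, which is not chosen but `1`: then only multiples of `p`
contribute to `θ`. -/
theorem critT_first_le (hγ : ∀ j, 0 < γ j) {n : ℕ} (hn : 2 ≤ n) {lam : ℝ}
    (hl : 1 / 2 ≤ lam) (hla : lam < α) {p : ℕ} (hp : p ∈ primes n) (z : ℕ → ℤ) (hz : z 0 = 1) :
    critT α γ n 0 z p (z 0) ≤ 5 * (2 * muLast α γ (1 / lam) 0 / n) ^ (2 * lam) := by
  have hα : 1 / 2 < α := by linarith
  have hx : 1 < α * 2 := by linarith
  have hl0 : 0 < lam := by linarith
  have hx' : 1 < α * (1 / lam) := by rw [mul_one_div, one_lt_div hl0]; exact hla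
  obtain ⟨hpp, hnp, hpn⟩ := mem_primes.1 hp
  have hn0 : (0 : ℝ) < n := by positivity
  have hp0 : (0 : ℝ) < p := by exact_mod_cast hpp.pos
  have hdot : ∀ h : Fin 1 → ℤ, dotInit z h = 0 := fun h => by simp [dotInit]
  set Θ := (2 * muLast α γ (1 / lam) 0 / n) ^ (2 * lam)
  have hm0 := muLast_nonneg (α := α) (x := 1 / lam) (s := 0) hγ
  have hΘ0 : 0 ≤ Θ := by positivity
  have hθ : theta α γ 0 z p (z 0) ≤ Θ := by
    rw [theta_eq_lsum]
    have := lsum_le_rpow (x := 1 / lam) hγ (by linarith : (1 : ℝ) ≤ 2 * lam) hx'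
      {h : Fin (0 + 1) → ℤ | h (Fin.last 0) ≠ 0 ∧ (p : ℤ) ∣ dotInit z h + h (Fin.last 0) * z 0}
    rw [show 1 / lam * (2 * lam) = 2 by field_simp] at this
    refine this.trans (Real.rpow_le_rpow (lsum_nonneg hγ _) ?_ (by linarith))
    refine (lsum_dvd_le hγ hx' hpp.pos _ fun h hh => ⟨hh.1, ?_⟩).trans ?_
    · simpa [hdot, hz] using hh.2
    · have hnq' : (n : ℝ) ≤ 2 * p := by exact_mod_cast hnp.le
      rw [inv_mul_eq_div, div_le_div_iff₀ hp0 hn0]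
      nlinarith
  have h1 : ∀ q ∈ (primes n).filter (fun q => q < p),
      lsum α γ 2 {h : Fin (0 + 1) → ℤ | h (Fin.last 0) ≠ 0 ∧ ¬ (p : ℤ) ∣ h (Fin.last 0) ∧
        (p : ℤ) ∣ dotInit z h + h (Fin.last 0) * z 0 ∧
        (q : ℤ) ∣ dotInit z h + h (Fin.last 0) * z 0} = 0 := fun q _ => by
    rw [← lsum_empty (α := α) (γ := γ) (x := 2) (s := 1)]
    congr 1
    refine Set.eq_empty_iff_forall_notMem.2 fun h hh => hh.2.1 ?_
    simpa [hdot, hz] using hh.2.2.1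
  have h2 : ∀ q ∈ (primes n).filter (fun q => p < q),
      lsum α γ 2 {h : Fin (0 + 1) → ℤ | h (Fin.last 0) ≠ 0 ∧ (q : ℤ) ∣ h (Fin.last 0) ∧
        (p : ℤ) ∣ dotInit z h + h (Fin.last 0) * z 0 ∧ (q : ℤ) ∣ dotInit z h} ≤ 2 / n * Θ :=
    fun q hq => by
    obtain ⟨hq, hpq⟩ := Finset.mem_filter.1 hq
    obtain ⟨hqq, hnq, -⟩ := mem_primes.1 hq
    have hnq' : (n : ℝ) ≤ 2 * q := by exact_mod_cast hnq.le
    have hq0 : (0 : ℝ) < q := by exact_mod_cast hqq.pos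
    refine le_trans ?_ ((lsum_dvd_dvd_le hγ hα hpp hqq hpq.ne z (z 0)).trans (mul_le_mul ?_ hθ ?_ ?_))
    · refine lsum_mono hγ hx fun h hh => ⟨hh, ?_⟩
      simpa [hdot, hz] using hh.2.2.1
    · rw [inv_eq_one_div, div_le_div_iff₀ hq0 hn0]; linarith
    · rw [theta_eq_lsum]; exact lsum_nonneg hγ _
    · positivity
  rw [critT_eq_lsum, Finset.sum_eq_zero h1]
  have h3 : ∑ q ∈ (primes n).filter (fun q => p < q), lsum α γ 2 {h : Fin (0 + 1) → ℤ |
      h (Fin.last 0) ≠ 0 ∧ (q : ℤ) ∣ h (Fin.last 0) ∧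
        (p : ℤ) ∣ dotInit z h + h (Fin.last 0) * z 0 ∧ (q : ℤ) ∣ dotInit z h} ≤ n * (2 / n * Θ) := by
    refine (Finset.sum_le_sum h2).trans ?_
    rw [Finset.sum_const, nsmul_eq_mul]
    refine mul_le_mul_of_nonneg_right ?_ (by positivity)
    exact_mod_cast (Finset.card_filter_le _ _).trans (card_primes_le n)
  have h4 : (n : ℝ) * (2 / n * Θ) = 2 * Θ := by field_simp
  linarith

theorem sum_sum_symm (P : Finset ℕ) (f : ℕ → ℕ → ℝ) (hf : ∀ p q, f p q = f q p) :
    ∑ p ∈ P, ∑ q ∈ P, f p q =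
      ∑ p ∈ P, f p p + 2 * ∑ p ∈ P, ∑ q ∈ P.filter (fun q => q < p), f p q := by
  have h1 : ∀ p ∈ P, ∑ q ∈ P, f p q = f p p + (∑ q ∈ P.filter (fun q => q < p), f p q +
      ∑ q ∈ P.filter (fun q => p < q), f p q) := fun p hp => by
    rw [Finset.sum_filter, Finset.sum_filter, ← Finset.sum_add_distrib]
    have : f p p = ∑ q ∈ P, if p = q then f p q else 0 := by
      rw [Finset.sum_ite_eq P p, if_pos hp]
    rw [this, ← Finset.sum_add_distrib]
    refine Finset.sum_congr rfl fun q _ => ?_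
    rcases lt_trichotomy p q with h | rfl | h
    · simp [h, h.ne, h.not_gt]
    · simp
    · simp [h, h.ne', h.not_gt]
  rw [Finset.sum_congr rfl h1, Finset.sum_add_distrib, Finset.sum_add_distrib, two_mul]
  congr 2
  simp only [Finset.sum_filter]
  rw [Finset.sum_comm]
  refine Finset.sum_congr rfl fun p _ => Finset.sum_congr rfl fun q _ => ?_
  rw [hf]

/-- The square error is the sum of the values of the criterion `T`. In the pair `q < p`, the terms
with `p ∤ h_s` belong to `T^{(p)}`; those with `p ∣ h_s` do not depend on the residue modulo `p` and
belong to `T^{(q)}`. -/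
theorem sqError_succ (hγ : ∀ j, 0 < γ j) (hα : 1 / 2 < α) (n s : ℕ) (z : ℕ → ℤ) :
    sqError α γ n (s + 1) z = sqError α γ n s z + ∑ p ∈ primes n, critT α γ n s z p (z s) := by
  have hx : 1 < α * 2 := by linarith
  have h1 : ∀ p q : ℕ, lsum α γ 2 {h : Fin (s + 1) → ℤ | h ≠ 0 ∧ (p : ℤ) ∣ dot h z ∧
      (q : ℤ) ∣ dot h z} = lsum α γ 2 {h : Fin s → ℤ | h ≠ 0 ∧ (p : ℤ) ∣ dot h z ∧
      (q : ℤ) ∣ dot h z} + lsum α γ 2 {h : Fin (s + 1) → ℤ | h (Fin.last s) ≠ 0 ∧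
      (p : ℤ) ∣ dotInit z h + h (Fin.last s) * z s ∧
      (q : ℤ) ∣ dotInit z h + h (Fin.last s) * z s} := fun p q => by
    rw [lsum_last hγ hx, add_comm]
    congr 2
    · ext h
      simp only [Set.mem_ofPred_eq, dot_succ, Fin.snoc_last, ne_eq, snoc_zero_eq_zero]
      simp [dotInit, dot]
    · ext h
      simp only [Set.mem_inter_iff, Set.mem_ofPred_eq, dot_succ]
      constructor
      · exact fun h' => ⟨h'.2, h'.1.2⟩
      · refine fun h' => ⟨⟨?_, h'.2⟩, h'.1⟩
        rintro rfl
        exact h'.1 rfl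
  have h2 : ∀ p ∈ primes n, ∀ q ∈ (primes n).filter (fun q => q < p),
      lsum α γ 2 {h : Fin (s + 1) → ℤ | h (Fin.last s) ≠ 0 ∧
      (p : ℤ) ∣ dotInit z h + h (Fin.last s) * z s ∧
      (q : ℤ) ∣ dotInit z h + h (Fin.last s) * z s} =
      lsum α γ 2 {h : Fin (s + 1) → ℤ | h (Fin.last s) ≠ 0 ∧ ¬ (p : ℤ) ∣ h (Fin.last s) ∧
        (p : ℤ) ∣ dotInit z h + h (Fin.last s) * z s ∧
        (q : ℤ) ∣ dotInit z h + h (Fin.last s) * z s} +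
      lsum α γ 2 {h : Fin (s + 1) → ℤ | h (Fin.last s) ≠ 0 ∧ (p : ℤ) ∣ h (Fin.last s) ∧
          (q : ℤ) ∣ dotInit z h + h (Fin.last s) * z s ∧ (p : ℤ) ∣ dotInit z h} :=
    fun p hp q hq => by
    rw [lsum_split hγ hx _ {h | (p : ℤ) ∣ h (Fin.last s)}, add_comm]
    congr 2
    · ext h
      simp only [Set.mem_inter_iff, Set.mem_ofPred_eq, Set.mem_compl_iff]
      tauto
    · ext h
      simp only [Set.mem_inter_iff, Set.mem_ofPred_eq]
      constructor
      · rintro ⟨⟨h3, h4, h5⟩, h6⟩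
        exact ⟨h3, h6, h5, (dvd_add_left (h6.mul_right _)).1 h4⟩
      · rintro ⟨h3, h6, h5, h4⟩
        exact ⟨⟨h3, dvd_add h4 (h6.mul_right _), h5⟩, h6⟩
  simp only [sqError, h1, Finset.sum_add_distrib]
  congr 1
  rw [sum_sum_symm _ _ fun p q => by congr 1; ext h; simp only [Set.mem_ofPred_eq]; tauto]
  rw [Finset.sum_congr rfl fun p hp => Finset.sum_congr rfl (h2 p hp)]
  simp only [critT_eq_lsum, Finset.sum_add_distrib, ← Finset.mul_sum, theta_eq_lsum, and_self]
  rw [mul_add, add_assoc]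
  congr 3
  simp only [Finset.sum_filter]
  exact Finset.sum_comm

end bounds

theorem sqError_zero (α : ℝ) (γ : ℕ → ℝ) (n : ℕ) (z : ℕ → ℤ) : sqError α γ n 0 z = 0 := by
  refine Finset.sum_eq_zero fun p _ => Finset.sum_eq_zero fun q _ => ?_
  rw [← lsum_empty (α := α) (γ := γ) (x := 2) (s := 0)]
  congr 1
  exact Set.eq_empty_iff_forall_notMem.2 fun h hh => hh.1 (Subsingleton.elim _ _)

/-- Each value of `T` at a constructed component is bounded by the share of that component
in `μ`. -/
theorem critT_le {α : ℝ} {γ : ℕ → ℝ} (hγ : ∀ j, 0 < γ j) {n : ℕ} (hn : 2 ≤ n) {τ lam : ℝ}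
    (hτ : 0 < τ) (hτ1 : τ < 1) (hl : 1 / 2 ≤ lam) (hla : lam < α) {d : ℕ} {z : ℕ → ℤ}
    (hz : IsConstructed n α γ τ d z) {s : ℕ} (hs : s < d) {p : ℕ} (hp : p ∈ primes n) :
    critT α γ n s z p (z s) ≤
      13 / τ * (4 * muLast α γ (1 / lam) s / ((1 - τ) * n)) ^ (2 * lam) := by
  have hn0 : (0 : ℝ) < n := by positivity
  have h1τ : 0 < 1 - τ := by linarith
  have hm0 := muLast_nonneg (α := α) (x := 1 / lam) (s := s) hγ
  rcases Nat.eq_zero_or_pos s with rfl | hs0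
  · refine (critT_first_le hγ hn hl hla hp z hz.1).trans ?_
    have h1 : (5 : ℝ) ≤ 13 / τ := by rw [le_div_iff₀ hτ]; linarith
    refine mul_le_mul h1 (Real.rpow_le_rpow (by positivity) ?_ (by linarith)) (by positivity)
      (by positivity)
    rw [div_le_div_iff₀ hn0 (by positivity)]
    have : 0 ≤ muLast α γ (1 / lam) 0 * n := by positivity
    nlinarith
  · have key : ∀ q ∈ primes n, ∀ b : ℕ, theta α γ s z q b ≤
        (2 * muLast α γ (1 / lam) s / ((1 - τ) * q)) ^ (2 * lam) →
        theta α γ s z q b ≤ (4 * muLast α γ (1 / lam) s / ((1 - τ) * n)) ^ (2 * lam) :=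
      fun q hq b hb => by
      obtain ⟨hqq, hnq, -⟩ := mem_primes.1 hq
      have hnq' : (n : ℝ) ≤ 2 * q := by exact_mod_cast hnq.le
      have hq0 : (0 : ℝ) < q := by exact_mod_cast hqq.pos
      refine hb.trans (Real.rpow_le_rpow (by positivity) ?_ (by linarith))
      rw [div_le_div_iff₀ (by positivity) (by positivity)]
      have : 0 ≤ muLast α γ (1 / lam) s * (1 - τ) := by positivity
      nlinarith
    obtain ⟨B, hB, hcard, hsm, b, hb, hzb, hmin⟩ := hz.2 s hs0 hs p hp
    rw [critT_congr (z' := z) hp (fun _ _ _ _ => Int.ModEq.refl _) (fun _ _ _ => Int.ModEq.refl _) hzb]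
    refine critT_le_of_min hγ (by linarith) hn hτ hτ1 hp z hB hcard (fun q hq => ?_)
      (fun b hb => key p hp b (theta_le_of_smallest hγ hl hla hτ1 (mem_primes.1 hp).1 z hB hcard
        hsm hb)) hmin
    obtain ⟨B', hB', hcard', hsm', b', hb', hzb', -⟩ := hz.2 s hs0 hs q hq
    rw [theta_congr (z' := z) (fun _ _ => Int.ModEq.refl _) hzb']
    exact key q hq b' (theta_le_of_smallest hγ hl hla hτ1 (mem_primes.1 hq).1 z hB' hcard' hsm' hb')

/-- Summation over the components: `∑ a ^ (2λ) ≤ (∑ a) ^ (2λ)` as `2λ ≥ 1`. -/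
theorem sqError_le {α : ℝ} {γ : ℕ → ℝ} (hγ : ∀ j, 0 < γ j) {n : ℕ} (hn : 2 ≤ n) {τ lam : ℝ}
    (hτ : 0 < τ) (hτ1 : τ < 1) (hl : 1 / 2 ≤ lam) (hla : lam < α) {d : ℕ} {z : ℕ → ℤ}
    (hz : IsConstructed n α γ τ d z) {s : ℕ} (hs : s ≤ d) :
    sqError α γ n s z ≤ (primes n).card *
      (13 / τ * (4 / ((1 - τ) * n)) ^ (2 * lam)) * mu s α γ lam ^ (2 * lam) := by
  have hn0 : (0 : ℝ) < n := by positivity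
  have h1τ : 0 < 1 - τ := by linarith
  have hl0 : 0 < lam := by linarith
  have hx : 1 < α * (1 / lam) := by rw [mul_one_div, one_lt_div hl0]; exact hla
  induction s with
  | zero =>
    rw [sqError_zero]
    have : 0 ≤ mu 0 α γ lam := by rw [mu_eq_lsum]; exact lsum_nonneg hγ _
    positivity
  | succ s ih =>
    rw [sqError_succ hγ (by linarith)]
    have hM := muLast_nonneg (α := α) (x := 1 / lam) (s := s) hγ
    have hmu : 0 ≤ mu s α γ lam := by rw [mu_eq_lsum]; exact lsum_nonneg hγ _
    have h1 : ∑ p ∈ primes n, critT α γ n s z p (z s) ≤ (primes n).card *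
      (13 / τ * (4 / ((1 - τ) * n)) ^ (2 * lam)) * muLast α γ (1 / lam) s ^ (2 * lam) := by
      refine (Finset.sum_le_sum fun p hp => critT_le hγ hn hτ hτ1 hl hla hz hs hp).trans
        (le_of_eq ?_)
      rw [Finset.sum_const, nsmul_eq_mul, mul_div_right_comm,
        Real.mul_rpow (by positivity) hM]
      ring
    have h2 : mu s α γ lam ^ (2 * lam) + muLast α γ (1 / lam) s ^ (2 * lam) ≤
        mu (s + 1) α γ lam ^ (2 * lam) := by
      rw [mu_eq_sum hγ hx (s + 1), Finset.sum_range_succ, ← mu_eq_sum hγ hx]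
      exact Real.add_rpow_le_rpow_add hmu hM (by linarith)
    refine (add_le_add (ih (by omega)) h1).trans ?_
    rw [← mul_add]
    exact mul_le_mul_of_nonneg_left h2 (by positivity)

/-- The randomised error of every constructed vector; `c` is a constant for which there are at
least `c n / ln n` primes in `(n/2, n]`. -/
theorem randomisedError_constructed_le {c : ℝ} (hc : 0 < c) {α : ℝ} {γ : ℕ → ℝ}
    (hγ : ∀ j, 0 < γ j) {n : ℕ} (hn : 2 ≤ n) (hcn : c * n ≤ (primes n).card * Real.log n)
    {τ lam : ℝ}
    (hτ : 0 < τ) (hτ1 : τ < 1) (hl : 1 / 2 ≤ lam) (hla : lam < α) {d : ℕ} {z : ℕ → ℤ}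
    (hz : IsConstructed n α γ τ d z) {s : ℕ} (hs : s ≤ d) :
    randomisedError α γ n (fun j : Fin s => z j) ≤
      ENNReal.ofReal ((13 / (c * τ) * (4 / (1 - τ)) ^ (2 * lam) * Real.log n) ^ (1 / 2 : ℝ) /
        (n : ℝ) ^ (lam + 1 / 2) * mu s α γ lam ^ lam) := by
  have hn0 : (0 : ℝ) < n := by positivity
  have h1τ : 0 < 1 - τ := by linarith
  have hl0 : 0 < lam := by linarith
  have hlog : 0 < Real.log n := Real.log_pos (by exact_mod_cast hn)
  have hP : (0 : ℝ) < (primes n).card := by exact_mod_cast card_primes_pos hn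
  have hmu : 0 ≤ mu s α γ lam := by rw [mu_eq_lsum]; exact lsum_nonneg hγ _
  refine (randomisedError_le hγ (by linarith) n s z).trans (ENNReal.ofReal_le_ofReal ?_)
  set Q := (4 / (1 - τ)) ^ (2 * lam) with hQ
  have hQ0 : 0 < Q := by positivity
  have h1 : (4 / ((1 - τ) * n)) ^ (2 * lam) = Q / (n ^ lam) ^ 2 := by
    rw [← div_div, Real.div_rpow (by positivity) hn0.le, hQ,
      ← Real.rpow_natCast, ← Real.rpow_mul hn0.le]
    congr 2; push_cast; ring
  have h2 : mu s α γ lam ^ (2 * lam) = (mu s α γ lam ^ lam) ^ 2 := by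
    rw [← Real.rpow_natCast, ← Real.rpow_mul hmu]; congr 1; push_cast; ring
  have h3 : (n : ℝ) ^ (lam + 1 / 2) = n ^ lam * √n := by
    rw [Real.rpow_add hn0, ← Real.sqrt_eq_rpow]
  have h4 := sqError_le hγ hn hτ hτ1 hl hla hz hs
  rw [h1, h2] at h4
  rw [← Real.sqrt_eq_rpow, h3]
  have hR : 0 ≤ √(13 / (c * τ) * Q * Real.log n) / (n ^ lam * √n) * mu s α γ lam ^ lam := by
    positivity
  rw [one_div, inv_mul_le_iff₀ hP]
  refine Real.sqrt_le_iff.2 ⟨mul_nonneg hP.le hR, h4.trans ?_⟩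
  rw [mul_pow, mul_pow, div_pow, mul_pow, Real.sq_sqrt (by positivity), Real.sq_sqrt hn0.le,
    ← mul_assoc (((primes n).card : ℝ) ^ 2)]
  refine mul_le_mul_of_nonneg_right ?_ (by positivity)
  have h5 : (n : ℝ) ≤ (primes n).card * Real.log n / c := by
    rw [le_div_iff₀ hc]; linarith
  have h6 : 0 < (n : ℝ) ^ lam := by positivity
  calc (primes n).card * (13 / τ * (Q / ((n : ℝ) ^ lam) ^ 2))
      = (primes n).card * (13 / τ * (Q / ((n : ℝ) ^ lam) ^ 2)) / n * n := by field_simp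
    _ ≤ (primes n).card * (13 / τ * (Q / ((n : ℝ) ^ lam) ^ 2)) / n *
        ((primes n).card * Real.log n / c) := mul_le_mul_of_nonneg_left h5 (by positivity)
    _ = _ := by field_simp

/-! ### The quantity `μ` -/

/-- The values `ζ(y)` at real arguments `y > 1`. -/
noncomputable def zetaR (y : ℝ) : ℝ := ∑' k : ℕ, 1 / ((k : ℝ) + 1) ^ y

theorem summable_zetaR {y : ℝ} (hy : 1 < y) : Summable fun k : ℕ => 1 / ((k : ℝ) + 1) ^ y := by
  have := (summable_nat_add_iff 1).2 (Real.summable_one_div_nat_rpow.2 hy)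
  exact this.congr fun k => by push_cast; rfl

theorem riemannZeta_re {y : ℝ} (hy : 1 < y) : (riemannZeta (y : ℂ)).re = zetaR y := by
  rw [zeta_eq_tsum_one_div_nat_add_one_cpow (by simpa using hy), zetaR]
  have : ∀ k : ℕ, 1 / ((k : ℂ) + 1) ^ (y : ℂ) = ((1 / ((k : ℝ) + 1) ^ y : ℝ) : ℂ) := fun k => by
    push_cast
    rw [Complex.ofReal_cpow (by positivity)]
    push_cast; rfl
  simp only [this]
  rw [← Complex.ofReal_tsum, Complex.ofReal_re]

theorem zetaR_nonneg (y : ℝ) : 0 ≤ zetaR y := tsum_nonneg fun k => by positivity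

theorem tsum_rho {α g x : ℝ} (hg : 0 < g) (hx : 1 < α * x) :
    ∑' k : ℤ, rho α g k ^ (-x) = 1 + g ^ x * (2 * zetaR (α * x)) := by
  have h1 : ∀ k : ℕ, rho α g ((k : ℤ) + 1) ^ (-x) = g ^ x * (1 / ((k : ℝ) + 1) ^ (α * x)) :=
    fun k => by
    rw [rho_rpow_of_ne hg x (by omega)]
    push_cast
    rw [abs_of_pos (by positivity), Real.rpow_neg (by positivity), one_div]
  have h2 : ∀ k : ℕ, rho α g (-((k : ℤ) + 1)) ^ (-x) = g ^ x * (1 / ((k : ℝ) + 1) ^ (α * x)) :=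
    fun k => by
    rw [rho_rpow_of_ne hg x (by omega)]
    push_cast
    rw [abs_neg, abs_of_pos (by positivity),
      Real.rpow_neg (by positivity), one_div]
  have hs := summable_rho (α := α) hg hx
  have hz := (summable_zetaR hx).mul_left (g ^ x)
  rw [tsum_of_nat_of_neg_add_one (f := fun k => rho α g k ^ (-x))
    ((summable_nat_add_iff 1).1 (hz.congr fun k => by push_cast; exact (h1 k).symm))
    (hz.congr fun k => (h2 k).symm)]
  simp only [h2]
  rw [Summable.tsum_eq_zero_add
    ((summable_nat_add_iff 1).1 (hz.congr fun k => by push_cast; exact (h1 k).symm))]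
  push_cast
  simp only [h1]
  rw [tsum_mul_left, ← zetaR, rho_zero, Real.one_rpow]
  ring

theorem tsum_r {α x : ℝ} {γ : ℕ → ℝ} (hγ : ∀ j, 0 < γ j) (hx : 1 < α * x) (s : ℕ) :
    ∑' h : Fin s → ℤ, r α γ h ^ (-x) =
      ∏ j ∈ Finset.range s, (1 + γ j ^ x * (2 * zetaR (α * x))) := by
  induction s with
  | zero => simp [r_eq_prod]
  | succ s ih =>
    rw [Finset.prod_range_succ, ← ih, ← tsum_rho (hγ s) hx]
    exact (hasSum_snoc (F := fun h : Fin (s + 1) → ℤ => r α γ h ^ (-x))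
      (f := fun h => r α γ h ^ (-x)) (g := fun k => rho α (γ s) k ^ (-x)) (fun h k => by
        rw [r_snoc, Real.mul_rpow (r_pos hγ _).le (rho_pos (hγ s) _).le]) (summable_r hγ hx s).norm
        (summable_rho (hγ s) hx).norm).2

theorem mu_eq_prod {α lam : ℝ} {γ : ℕ → ℝ} (hγ : ∀ j, 0 < γ j) (hx : 1 < α * (1 / lam)) (s : ℕ) :
    mu s α γ lam =
      ∏ j ∈ Finset.range s, (1 + γ j ^ (1 / lam) * (2 * zetaR (α * (1 / lam)))) - 1 := by
  rw [← tsum_r hγ hx, mu_eq_lsum, eq_sub_iff_add_eq]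
  have h1 : lsum α γ (1 / lam) (Set.univ : Set (Fin s → ℤ)) =
      ∑' h : Fin s → ℤ, r α γ h ^ (-(1 / lam)) := by
    simp [lsum]
  rw [← h1, lsum_split hγ hx Set.univ {h | h ≠ 0}]
  congr 1
  · rw [Set.univ_inter]
  · rw [Set.univ_inter, show ({h : Fin s → ℤ | h ≠ 0}ᶜ : Set (Fin s → ℤ)) = {0} by ext; simp, lsum,
      tsum_eq_single 0 fun h hh => by simp [hh]]
    simp [r_zero]

theorem tendsto_zetaR : Filter.Tendsto zetaR (nhdsWithin 1 (Set.Ioi 1)) Filter.atTop := by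
  have h1 := tendsto_sub_mul_tsum_nat_rpow
  have h2 : Filter.Tendsto (fun y : ℝ => (y - 1)⁻¹) (nhdsWithin 1 (Set.Ioi 1)) Filter.atTop := by
    refine tendsto_inv_nhdsGT_zero.comp ?_
    refine tendsto_nhdsWithin_iff.2 ⟨?_, ?_⟩
    · refine Filter.Tendsto.mono_left ?_ nhdsWithin_le_nhds
      have : Continuous fun y : ℝ => y - 1 := by fun_prop
      simpa using this.tendsto 1
    · filter_upwards [self_mem_nhdsWithin] with y hy
      exact sub_pos.2 (Set.mem_Ioi.1 hy)
  refine (h2.atTop_mul_pos one_pos h1).congr' ?_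
  filter_upwards [self_mem_nhdsWithin] with y hy
  have hy1 : (1 : ℝ) < y := hy
  have hy' : y - 1 ≠ 0 := by linarith
  rw [← mul_assoc, inv_mul_cancel₀ hy', one_mul,
    Summable.tsum_eq_zero_add (Real.summable_one_div_nat_rpow.2 hy1)]
  simp [zetaR, Real.zero_rpow (by linarith : y ≠ 0)]

/-- The first component alone contributes `2 γ₀^{1/λ} ζ(α/λ)`, and `ζ` has a pole at `1`. -/
theorem tendsto_mu {α : ℝ} {γ : ℕ → ℝ} (hγ : ∀ j, 0 < γ j) (hα : 1 / 2 < α) {d : ℕ} (hd : 1 ≤ d) :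
    Filter.Tendsto (fun lam => mu d α γ lam) (nhdsWithin α (Set.Iio α)) Filter.atTop := by
  have hα0 : 0 < α := by linarith
  have h1 : Filter.Tendsto (fun lam : ℝ => α * (1 / lam)) (nhdsWithin α (Set.Iio α))
      (nhdsWithin 1 (Set.Ioi 1)) := by
    refine tendsto_nhdsWithin_iff.2 ⟨?_, ?_⟩
    · refine Filter.Tendsto.mono_left ?_ nhdsWithin_le_nhds
      have : ContinuousAt (fun lam : ℝ => α * (1 / lam)) α :=
        continuousAt_const.mul (continuousAt_const.div continuousAt_id hα0.ne')
      have h2 := this.tendsto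
      rwa [mul_one_div_cancel hα0.ne'] at h2
    · filter_upwards [Ioo_mem_nhdsLT hα0] with lam hl
      show 1 < α * (1 / lam)
      rw [mul_one_div, one_lt_div hl.1]; exact hl.2
  have h2 : Filter.Tendsto (fun lam : ℝ => γ 0 ^ (1 / lam)) (nhdsWithin α (Set.Iio α))
      (nhds (γ 0 ^ (1 / α))) := by
    refine Filter.Tendsto.mono_left ?_ nhdsWithin_le_nhds
    exact (Real.continuousAt_const_rpow (hγ 0).ne').tendsto.comp
      (continuousAt_const.div continuousAt_id hα0.ne').tendsto
  have h3 := Filter.Tendsto.pos_mul_atTop (Real.rpow_pos_of_pos (hγ 0) _) h2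
    ((tendsto_zetaR.comp h1).const_mul_atTop two_pos)
  refine Filter.tendsto_atTop_mono' _ ?_ h3
  filter_upwards [Ioo_mem_nhdsLT hα0] with lam hl
  have hx : 1 < α * (1 / lam) := by rw [mul_one_div, one_lt_div hl.1]; exact hl.2
  have h4 := mu_eq_prod hγ hx 1
  rw [Finset.prod_range_one, add_sub_cancel_left] at h4
  show γ 0 ^ (1 / lam) * (2 * zetaR (α * (1 / lam))) ≤ _
  rw [← h4, mu_eq_sum hγ hx, mu_eq_sum hγ hx]
  exact Finset.sum_le_sum_of_subset_of_nonneg (Finset.range_mono hd) fun s _ _ => muLast_nonneg hγ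

/-- Expansion of the product formula for `μ` over the subsets of `{0, …, d - 1}`. -/
theorem mu_le_tsum {α lam : ℝ} {γ : ℕ → ℝ} (hγ : ∀ j, 0 < γ j) (hl0 : 0 < lam) (hla : lam < α)
    (d : ℕ) (hs : Summable (fun u : {u : Finset ℕ // u.Nonempty} =>
      (∏ j ∈ u.1, γ j) ^ (1 / lam) * (2 * (riemannZeta ((α / lam : ℝ) : ℂ)).re) ^ u.1.card)) :
    mu d α γ lam ≤ ∑' u : {u : Finset ℕ // u.Nonempty},
      (∏ j ∈ u.1, γ j) ^ (1 / lam) * (2 * (riemannZeta ((α / lam : ℝ) : ℂ)).re) ^ u.1.card := by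
  classical
  have hx : 1 < α * (1 / lam) := by rw [mul_one_div, one_lt_div hl0]; exact hla
  have hz : (riemannZeta ((α / lam : ℝ) : ℂ)).re = zetaR (α * (1 / lam)) := by
    rw [← mul_one_div, riemannZeta_re hx]
  rw [hz] at hs ⊢
  set Z := 2 * zetaR (α * (1 / lam)) with hZ
  have hZ0 : 0 ≤ Z := mul_nonneg two_pos.le (zetaR_nonneg _)
  have hP0 : ∀ u : Finset ℕ, 0 < ∏ j ∈ u, γ j := fun u => Finset.prod_pos fun j _ => hγ j
  have h1 : mu d α γ lam = ∑ u ∈ (Finset.range d).powerset.filter Finset.Nonempty,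
      (∏ j ∈ u, γ j) ^ (1 / lam) * Z ^ u.card := by
    have h2 : ∏ j ∈ Finset.range d, (1 + γ j ^ (1 / lam) * Z) =
        ∑ u ∈ (Finset.range d).powerset, (∏ j ∈ u, γ j) ^ (1 / lam) * Z ^ u.card := by
      rw [Finset.prod_one_add]
      refine Finset.sum_congr rfl fun u _ => ?_
      rw [Finset.prod_mul_distrib, Finset.prod_const, Real.finsetProd_rpow _ _ fun j _ => (hγ j).le]
    rw [mu_eq_prod hγ hx, h2, ← Finset.sum_filter_add_sum_filter_not _ Finset.Nonempty,
      show (Finset.range d).powerset.filter (fun u => ¬ u.Nonempty) = {∅} by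
        ext u; simp only [Finset.mem_filter, Finset.mem_powerset, Finset.not_nonempty_iff_eq_empty,
          Finset.mem_singleton, and_iff_right_iff_imp]
        rintro rfl; exact Finset.empty_subset _]
    simp
  rw [h1, ← Finset.sum_subtype_of_mem (p := Finset.Nonempty)
    (fun u : Finset ℕ => (∏ j ∈ u, γ j) ^ (1 / lam) * Z ^ u.card)
    fun u hu => (Finset.mem_filter.1 hu).2]
  exact hs.sum_le_tsum _ fun u _ => mul_nonneg (Real.rpow_nonneg (hP0 u).le _) (pow_nonneg hZ0 _)

/-- The constant in the error bound; `c` is a constant for which there are at least `c n / ln n`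
primes in `(n/2, n]`. -/
noncomputable def errorConst (c τ lam : ℝ) : ℝ := 13 / (c * τ) * (4 / (1 - τ)) ^ (2 * lam)

theorem errorConst_pos {c τ : ℝ} (hc : 0 < c) (hτ : 0 < τ) (hτ1 : τ < 1) (lam : ℝ) :
    0 < errorConst c τ lam := by
  have : 0 < 1 - τ := by linarith
  unfold errorConst; positivity

theorem tendsto_errorConst_zero {c lam : ℝ} (hc : 0 < c) :
    Filter.Tendsto (fun τ => errorConst c τ lam) (nhdsWithin 0 (Set.Ioi 0)) Filter.atTop := by
  have h1 : Filter.Tendsto (fun τ : ℝ => 13 / (c * τ)) (nhdsWithin 0 (Set.Ioi 0)) Filter.atTop := by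
    have := tendsto_inv_nhdsGT_zero (𝕜 := ℝ).const_mul_atTop (by positivity : 0 < 13 / c)
    refine this.congr fun τ => ?_
    rw [← div_div, div_eq_mul_inv (13 / c)]
  have h2 : Filter.Tendsto (fun τ : ℝ => (4 / (1 - τ)) ^ (2 * lam)) (nhdsWithin 0 (Set.Ioi 0))
      (nhds ((4 / (1 - 0)) ^ (2 * lam))) := by
    refine Filter.Tendsto.mono_left ?_ nhdsWithin_le_nhds
    refine Filter.Tendsto.rpow_const ?_ (Or.inl (by norm_num))
    exact tendsto_const_nhds.div (tendsto_const_nhds.sub Filter.tendsto_id) (by norm_num)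
  exact h1.atTop_mul_pos (by positivity) h2

theorem tendsto_errorConst_one {c lam : ℝ} (hc : 0 < c) (hl : 0 < lam) :
    Filter.Tendsto (fun τ => errorConst c τ lam) (nhdsWithin 1 (Set.Iio 1)) Filter.atTop := by
  have h1 : Filter.Tendsto (fun τ : ℝ => 13 / (c * τ)) (nhdsWithin 1 (Set.Iio 1))
      (nhds (13 / (c * 1))) := by
    refine Filter.Tendsto.mono_left ?_ nhdsWithin_le_nhds
    exact tendsto_const_nhds.div (tendsto_const_nhds.mul Filter.tendsto_id) (by positivity)
  have h2 : Filter.Tendsto (fun τ : ℝ => 4 / (1 - τ)) (nhdsWithin 1 (Set.Iio 1)) Filter.atTop := by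
    refine (Filter.Tendsto.const_mul_atTop (by norm_num : (0 : ℝ) < 4)
      (tendsto_inv_nhdsGT_zero (𝕜 := ℝ).comp
      (tendsto_nhdsWithin_iff.2 ⟨?_, ?_⟩ :
        Filter.Tendsto (fun τ : ℝ => 1 - τ) (nhdsWithin 1 (Set.Iio 1)) _)))
    · refine Filter.Tendsto.mono_left ?_ nhdsWithin_le_nhds
      have : Continuous fun y : ℝ => 1 - y := by fun_prop
      simpa using this.tendsto 1
    · filter_upwards [self_mem_nhdsWithin] with y hy
      exact sub_pos.2 (Set.mem_Iio.1 hy)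
  exact h1.pos_mul_atTop (by positivity) ((tendsto_rpow_atTop (by positivity)).comp h2)

/-! ### The criteria as finite sums of products of kernel values -/

theorem turn_neg (x : ℝ) : turn (-x) = (starRingEnd ℂ) (turn x) := by
  rw [turn, turn, ← Complex.exp_conj]; congr 1
  have : (starRingEnd ℂ) 2 = 2 := map_ofNat _ 2
  simp [Complex.conj_ofReal, this]

theorem sigma_eq {α : ℝ} (x : ℝ) : (sigma α x : ℂ) =
    ∑' h : {h : ℤ // h ≠ 0}, ((|(h.1 : ℝ)| ^ (-(2 * α)) : ℝ) : ℂ) * turn (h.1 * x) := by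
  have h1 : ∀ h : {h : ℤ // h ≠ 0}, Complex.exp (2 * (Real.pi : ℂ) * Complex.I * (h.1 : ℂ) * (x : ℂ)) /
      ((|(h.1 : ℝ)| ^ (2 * α) : ℝ) : ℂ) =
      ((|(h.1 : ℝ)| ^ (-(2 * α)) : ℝ) : ℂ) * turn (h.1 * x) := fun h => by
    rw [Real.rpow_neg (abs_nonneg _), Complex.ofReal_inv, inv_mul_eq_div, turn]
    congr 2; push_cast; ring
  rw [sigma, tsum_congr h1, ← Complex.conj_eq_iff_re, Complex.conj_tsum]
  let e : {h : ℤ // h ≠ 0} ≃ {h : ℤ // h ≠ 0} :=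
    (Equiv.neg ℤ).subtypeEquiv fun a => by simp
  rw [← e.tsum_eq]
  refine tsum_congr fun h => ?_
  have : ((e h).1 : ℝ) = -(h.1 : ℝ) := by simp [e]
  rw [map_mul, Complex.conj_ofReal, this, abs_neg, neg_mul, turn_neg, Complex.conj_conj]

theorem sigma_add_int (α x : ℝ) (m : ℤ) : sigma α (x + m) = sigma α x := by
  apply Complex.ofReal_injective
  rw [sigma_eq, sigma_eq]
  refine tsum_congr fun h => ?_
  rw [mul_add, turn_add, ← Int.cast_mul, turn_int, mul_one]

theorem rho_sq {α g : ℝ} (hg : 0 < g) {k : ℤ} (hk : k ≠ 0) :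
    rho α g k ^ (-2 : ℝ) = g ^ 2 * |(k : ℝ)| ^ (-(2 * α)) := by
  rw [rho_rpow_of_ne hg 2 hk, mul_comm α 2, Real.rpow_two]

theorem summable_norm_turn {ι : Type*} {f : ι → ℝ} (hf : Summable f) (hf0 : ∀ i, 0 ≤ f i)
    (y : ι → ℝ) : Summable fun i => ‖(f i : ℂ) * turn (y i)‖ :=
  hf.congr fun i => by rw [norm_mul, norm_turn, mul_one, Complex.norm_real,
    Real.norm_of_nonneg (hf0 i)]

/-- The Fourier series of the kernel of the last coordinate, without the constant term. -/
theorem tsum_rho_turn_ne {α g : ℝ} (hg : 0 < g) (x : ℝ) :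
    ∑' k : ℤ, ((({k | k ≠ 0} : Set ℤ).indicator (fun k => rho α g k ^ (-2 : ℝ)) k : ℝ) : ℂ) *
      turn (k * x) = ((g ^ 2 * sigma α x : ℝ) : ℂ) := by
  have h1 : ∀ k : ℤ, ((({k | k ≠ 0} : Set ℤ).indicator (fun k => rho α g k ^ (-2 : ℝ)) k : ℝ) : ℂ) *
      turn (k * x) = (({k | k ≠ 0} : Set ℤ).indicator (fun k : ℤ => ((g ^ 2 : ℝ) : ℂ) *
        (((|(k : ℝ)| ^ (-(2 * α)) : ℝ) : ℂ) * turn (k * x))) k) := fun k => by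
    by_cases hk : k = 0
    · simp [hk]
    · have : k ∈ ({k | k ≠ 0} : Set ℤ) := hk
      rw [Set.indicator_of_mem this, Set.indicator_of_mem this, rho_sq hg hk]
      push_cast; ring
  rw [tsum_congr h1, ← tsum_subtype, tsum_mul_left, Complex.ofReal_mul, sigma_eq]
  rfl

theorem tsum_rho_turn {α g : ℝ} (hg : 0 < g) (hα : 1 / 2 < α) (x : ℝ) :
    ∑' k : ℤ, ((rho α g k ^ (-2 : ℝ) : ℝ) : ℂ) * turn (k * x) =
      ((1 + g ^ 2 * sigma α x : ℝ) : ℂ) := by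
  have hs : Summable fun k : ℤ => rho α g k ^ (-2 : ℝ) := summable_rho hg (by linarith)
  have h0 : ∀ k, 0 ≤ rho α g k ^ (-2 : ℝ) := fun k => (Real.rpow_pos_of_pos (rho_pos hg k) _).le
  have h2 := (summable_norm_turn (hs.indicator {k | k ≠ 0})
    (fun k => Set.indicator_nonneg (fun k _ => h0 k) k) fun k : ℤ => (k * x : ℝ)).of_norm
  have h3 : ∀ k : ℤ, ((rho α g k ^ (-2 : ℝ) : ℝ) : ℂ) * turn (k * x) =
      (if k = 0 then 1 else 0) + ((({k | k ≠ 0} : Set ℤ).indicator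
        (fun k => rho α g k ^ (-2 : ℝ)) k : ℝ) : ℂ) * turn (k * x) := fun k => by
    by_cases hk : k = 0
    · simp [hk, rho_zero, turn_zero]
    · have : k ∈ ({k | k ≠ 0} : Set ℤ) := hk
      rw [Set.indicator_of_mem this, if_neg hk, zero_add]
  rw [tsum_congr h3, Summable.tsum_add (hasSum_ite_eq 0 1).summable h2, tsum_ite_eq,
    tsum_rho_turn_ne hg]
  push_cast; rfl

/-- The reproducing kernel of the space in the first `s` variables. -/
theorem tsum_r_turn {α : ℝ} {γ : ℕ → ℝ} (hγ : ∀ j, 0 < γ j) (hα : 1 / 2 < α) (x : ℕ → ℝ) (s : ℕ) :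
    ∑' h : Fin s → ℤ, ((r α γ h ^ (-2 : ℝ) : ℝ) : ℂ) * turn (∑ j : Fin s, h j * x j) =
      ((∏ j ∈ Finset.range s, (1 + γ j ^ 2 * sigma α (x j)) : ℝ) : ℂ) := by
  have hx : 1 < α * 2 := by linarith
  induction s with
  | zero => simp [r_eq_prod, turn_zero]
  | succ s ih =>
    rw [Finset.prod_range_succ, Complex.ofReal_mul, ← ih, ← tsum_rho_turn (hγ s) hα]
    refine (hasSum_snoc (F := fun h : Fin (s + 1) → ℤ => ((r α γ h ^ (-2 : ℝ) : ℝ) : ℂ) *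
      turn (∑ j : Fin (s + 1), h j * x j)) (fun h k => ?_) ?_ ?_).2
    · rw [r_snoc, Real.mul_rpow (r_pos hγ _).le (rho_pos (hγ s) _).le, Fin.sum_univ_castSucc,
        turn_add]
      simp only [Fin.snoc_castSucc, Fin.snoc_last, Fin.val_castSucc, Fin.val_last]
      push_cast; ring
    · exact summable_norm_turn (summable_r hγ hx s)
        (fun h => (Real.rpow_pos_of_pos (r_pos hγ h) _).le) _
    · exact summable_norm_turn (summable_rho (hγ s) hx)
        (fun k => (Real.rpow_pos_of_pos (rho_pos (hγ s) k) _).le) _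

/-- The part of the reproducing kernel with nonzero last frequency. -/
theorem tsum_r_turn_last {α : ℝ} {γ : ℕ → ℝ} (hγ : ∀ j, 0 < γ j) (hα : 1 / 2 < α) (x : ℕ → ℝ)
    (s : ℕ) :
    (Summable fun h : Fin (s + 1) → ℤ => (({h : Fin (s + 1) → ℤ | h (Fin.last s) ≠ 0}.indicator
      (fun h => r α γ h ^ (-2 : ℝ)) h : ℝ) : ℂ) * turn (∑ j : Fin (s + 1), h j * x j)) ∧
    ∑' h : Fin (s + 1) → ℤ, (({h : Fin (s + 1) → ℤ | h (Fin.last s) ≠ 0}.indicator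
      (fun h => r α γ h ^ (-2 : ℝ)) h : ℝ) : ℂ) * turn (∑ j : Fin (s + 1), h j * x j) =
      (((∏ j ∈ Finset.range s, (1 + γ j ^ 2 * sigma α (x j))) * (γ s ^ 2 * sigma α (x s)) : ℝ) : ℂ)
    := by
  have hx : 1 < α * 2 := by linarith
  rw [Complex.ofReal_mul, ← tsum_r_turn hγ hα, ← tsum_rho_turn_ne (hγ s)]
  refine (hasSum_snoc (fun h k => ?_) ?_ ?_).imp Summable.of_norm id
  · rw [Fin.sum_univ_castSucc, turn_add]
    simp only [Fin.snoc_castSucc, Fin.snoc_last, Fin.val_castSucc, Fin.val_last]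
    have : ({h : Fin (s + 1) → ℤ | h (Fin.last s) ≠ 0}.indicator (fun h => r α γ h ^ (-2 : ℝ))
        (Fin.snoc h k)) = r α γ h ^ (-2 : ℝ) *
        ({k | k ≠ 0} : Set ℤ).indicator (fun k => rho α (γ s) k ^ (-2 : ℝ)) k := by
      by_cases hk : k = 0
      · simp [hk]
      · rw [Set.indicator_of_mem (show k ∈ {k | k ≠ 0} from hk), Set.indicator_of_mem
          (show (Fin.snoc h k : Fin (s + 1) → ℤ) ∈ {h : Fin (s + 1) → ℤ | h (Fin.last s) ≠ 0} by
            simpa using hk), r_snoc, Real.mul_rpow (r_pos hγ _).le (rho_pos (hγ s) _).le]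
    rw [this]
    push_cast; ring
  · exact summable_norm_turn (summable_r hγ hx s)
      (fun h => (Real.rpow_pos_of_pos (r_pos hγ h) _).le) _
  · exact summable_norm_turn ((summable_rho (hγ s) hx).indicator _)
      (fun k => Set.indicator_nonneg
        (fun k _ => (Real.rpow_pos_of_pos (rho_pos (hγ s) k) _).le) k) _

/-- A sum over the intersection of two dual lattices is an average of kernel values over the
points of the product of the lattices. -/
theorem sum_kernel {α : ℝ} {γ : ℕ → ℝ} (hγ : ∀ j, 0 < γ j) (hα : 1 / 2 < α) (s : ℕ) {p q : ℕ}
    (hp : 0 < p) (hq : 0 < q) (u v : ℕ → ℤ) :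
    ∑ k ∈ Finset.range p, ∑ l ∈ Finset.range q,
      (∏ j ∈ Finset.range s, (1 + γ j ^ 2 * sigma α (k * (u j / p) + l * (v j / q)))) *
        (γ s ^ 2 * sigma α (k * (u s / p) + l * (v s / q))) =
      p * q * lsum α γ 2 {h : Fin (s + 1) → ℤ | h (Fin.last s) ≠ 0 ∧ (p : ℤ) ∣ dot h u ∧
        (q : ℤ) ∣ dot h v} := by
  classical
  apply Complex.ofReal_injective
  push_cast
  have h1 := fun k l : ℕ => tsum_r_turn_last hγ hα
    (fun j => (k * (u j / p) + l * (v j / q) : ℝ)) s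
  have h2 : ∀ k l : ℕ, ∀ h : Fin (s + 1) → ℤ,
      turn (∑ j : Fin (s + 1), h j * (k * (u j / p) + l * (v j / q))) =
        turn (k * ((dot h u : ℤ) / p)) * turn (l * ((dot h v : ℤ) / q)) := fun k l h => by
    rw [← turn_add]; congr 1
    simp only [dot]
    push_cast
    rw [Finset.sum_div, Finset.sum_div, Finset.mul_sum, Finset.mul_sum, ← Finset.sum_add_distrib]
    exact Finset.sum_congr rfl fun j _ => by ring
  have h3 : ∀ h : Fin (s + 1) → ℤ, ∑ k ∈ Finset.range p, ∑ l ∈ Finset.range q,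
      (({h : Fin (s + 1) → ℤ | h (Fin.last s) ≠ 0}.indicator
      (fun h => r α γ h ^ (-2 : ℝ)) h : ℝ) : ℂ) *
        turn (∑ j : Fin (s + 1), h j * (k * (u j / p) + l * (v j / q))) =
      (p : ℂ) * q * (({h : Fin (s + 1) → ℤ | h (Fin.last s) ≠ 0 ∧ (p : ℤ) ∣ dot h u ∧
        (q : ℤ) ∣ dot h v}.indicator (fun h => r α γ h ^ (-2 : ℝ)) h : ℝ) : ℂ) := fun h => by
    simp only [h2, ← Finset.mul_sum, ← Finset.sum_mul, sum_turn hp, sum_turn hq,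
      Set.indicator_apply, Set.mem_ofPred_eq]
    by_cases a1 : h (Fin.last s) = 0 <;> by_cases a2 : (p : ℤ) ∣ dot h u <;>
      by_cases a3 : (q : ℤ) ∣ dot h v <;> simp [a1, a2, a3]
    ring
  have h4 : ∀ k l : ℕ, ((∏ j ∈ Finset.range s,
      (1 + (γ j : ℂ) ^ 2 * (sigma α (k * (u j / p) + l * (v j / q)) : ℂ))) *
        ((γ s : ℂ) ^ 2 * (sigma α (k * (u s / p) + l * (v s / q)) : ℂ))) = _ := fun k l => by
    have := (h1 k l).2.symm
    push_cast at this
    exact this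
  simp only [h4]
  rw [lsum, Complex.ofReal_tsum, ← tsum_mul_left, ← tsum_congr h3,
    Summable.tsum_finsetSum (f := fun (k : ℕ) (h : Fin (s + 1) → ℤ) => ∑ l ∈ Finset.range q, _)
      fun k _ => summable_sum fun l _ => (h1 k l).1]
  refine Finset.sum_congr rfl fun k _ => ?_
  rw [Summable.tsum_finsetSum fun l _ => (h1 k l).1]

/-- The product of the kernel values of the first `s` coordinates at the point with index `k` of
the lattice with `p` points and residues `u`, shifted by the point with index `l` of the lattice
with `q` points and residues `v`. -/
noncomputable def kern (α : ℝ) (γ : ℕ → ℝ) (s p q : ℕ) (u v : ℕ → ℕ) (k l : ℕ) : ℝ :=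
  ∏ j ∈ Finset.range s,
    (1 + γ j ^ 2 * sigma α (((k * u j * q + l * v j * p : ℕ) : ℝ) / ((p * q : ℕ) : ℝ)))

theorem kern_arg {p q : ℕ} (hp : 0 < p) (hq : 0 < q) (k l a b : ℕ) :
    ((k * a * q + l * b * p : ℕ) : ℝ) / ((p * q : ℕ) : ℝ) =
      k * (((a : ℤ) : ℝ) / p) + l * (((b : ℤ) : ℝ) / q) := by
  have : (p : ℝ) ≠ 0 := by positivity
  have : (q : ℝ) ≠ 0 := by positivity
  push_cast; field_simp

/-- `sum_kernel` for residues that are natural numbers, with integral numerators and denominators in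
the arguments of `σ_α`. -/
theorem sum_kern {α : ℝ} {γ : ℕ → ℝ} (hγ : ∀ j, 0 < γ j) (hα : 1 / 2 < α) (s : ℕ) {p q : ℕ}
    (hp : 0 < p) (hq : 0 < q) (u v : ℕ → ℕ) (a b : ℕ) :
    lsum α γ 2 {h : Fin (s + 1) → ℤ | h (Fin.last s) ≠ 0 ∧
      (p : ℤ) ∣ dotInit (fun j => u j) h + h (Fin.last s) * a ∧
      (q : ℤ) ∣ dotInit (fun j => v j) h + h (Fin.last s) * b} =
    γ s ^ 2 * (1 / (p * q) * ∑ l ∈ Finset.range q, ∑ k ∈ Finset.range p,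
      kern α γ s p q u v k l * sigma α (((k * a * q + l * b * p : ℕ) : ℝ) / ((p * q : ℕ) : ℝ))) := by
  have hp0 : (p : ℝ) ≠ 0 := by positivity
  have hq0 : (q : ℝ) ≠ 0 := by positivity
  have h1 := sum_kernel hγ hα s hp hq (fun j => if j < s then (u j : ℤ) else a)
    (fun j => if j < s then (v j : ℤ) else b)
  have h2 : ∀ k l : ℕ, (∏ j ∈ Finset.range s, (1 + γ j ^ 2 *
      sigma α (k * (((if j < s then (u j : ℤ) else a : ℤ) : ℝ) / p) +
        l * (((if j < s then (v j : ℤ) else b : ℤ) : ℝ) / q)))) = kern α γ s p q u v k l := fun k l =>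
    Finset.prod_congr rfl fun j hj => by
      rw [if_pos (Finset.mem_range.1 hj), if_pos (Finset.mem_range.1 hj), kern_arg hp hq]
  have h3 : ∀ (u : ℕ → ℕ) (a : ℕ) (h : Fin (s + 1) → ℤ),
      dot h (fun j => if j < s then (u j : ℤ) else a) =
        dotInit (fun j => (u j : ℤ)) h + h (Fin.last s) * a := fun u a h => by
    simp [dot_succ, dotInit]
  simp only [h2, h3, lt_irrefl, if_false] at h1
  have h4 := eq_div_of_mul_eq (mul_ne_zero hp0 hq0) ((mul_comm _ _).trans h1.symm)
  rw [h4, Finset.sum_comm]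
  simp only [kern_arg hp hq, Finset.mul_sum, Finset.sum_div]
  refine Finset.sum_congr rfl fun l _ => Finset.sum_congr rfl fun k _ => ?_
  field_simp

/-- `θ`, up to the factor `γ_s²`. -/
noncomputable def thetaVal (α : ℝ) (γ : ℕ → ℝ) (s p : ℕ) (u : ℕ → ℕ) (c : ℕ) : ℝ :=
  (∑ k ∈ Finset.range p, kern α γ s p p u u k 0 * sigma α (((k * c : ℕ) : ℝ) / (p : ℝ))) / p

theorem theta_eq_thetaVal {α : ℝ} {γ : ℕ → ℝ} (hγ : ∀ j, 0 < γ j) (hα : 1 / 2 < α) (s : ℕ) {p : ℕ}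
    (hp : 0 < p) (u : ℕ → ℕ) {z : ℕ → ℤ} (hz : ∀ j < s, z j ≡ u j [ZMOD p]) (c : ℕ) :
    theta α γ s z p c = γ s ^ 2 * thetaVal α γ s p u c := by
  have hp0 : (p : ℝ) ≠ 0 := by positivity
  rw [theta_congr hz (Int.ModEq.refl _), theta_eq_lsum]
  have := sum_kern hγ hα s hp one_pos u u c 0
  simp only [Nat.cast_one, one_dvd, and_true] at this
  rw [this, thetaVal, Finset.sum_range_one]
  congr 1
  rw [Finset.mul_sum, Finset.sum_div]
  refine Finset.sum_congr rfl fun k _ => ?_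
  have h1 : kern α γ s p 1 u u k 0 = kern α γ s p p u u k 0 := by
    refine Finset.prod_congr rfl fun j _ => ?_
    congr 3; push_cast; field_simp; ring
  rw [h1]
  simp only [mul_one, zero_mul, add_zero]
  field_simp

/-- The sum in the criterion `T^{(p)}(c)` that belongs to a prime `q < p`, up to constants and
without the terms with `k = 0`, which do not depend on `c`; `b` is the residue modulo `q` of the
current component. -/
noncomputable def smallSum (α : ℝ) (γ : ℕ → ℝ) (s p q : ℕ) (u v : ℕ → ℕ) (b c : ℕ) : ℝ :=
  ∑ l ∈ Finset.range q, ∑ k ∈ Finset.Ico 1 p,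
    kern α γ s p q u v k l * sigma α (((k * c * q + l * b * p : ℕ) : ℝ) / ((p * q : ℕ) : ℝ))

/-- The sum in the criterion `T^{(p)}(c)` that belongs to a prime `q > p`, up to constants. -/
noncomputable def largeSum (α : ℝ) (γ : ℕ → ℝ) (s p q : ℕ) (u v : ℕ → ℕ) (c : ℕ) : ℝ :=
  ∑ k ∈ Finset.range p, (∑ l ∈ Finset.range q, kern α γ s p q u v k l) *
    sigma α (((q * k * c : ℕ) : ℝ) / (p : ℝ))

/-- The criterion `T^{(p)}(c)`, up to the factor `γ_s²` and an additive constant, in terms of the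
residues `ρ`. -/
noncomputable def critVal (α : ℝ) (γ : ℕ → ℝ) (n s : ℕ) (ρ : ℕ → ℕ → ℕ) (p c : ℕ) : ℝ :=
  thetaVal α γ s p (fun j => ρ j p) c +
    ∑ q ∈ (primes n).filter (fun q => q < p),
      2 / ((p : ℝ) * q) * smallSum α γ s p q (fun j => ρ j p) (fun j => ρ j q) (ρ s q) c +
    ∑ q ∈ (primes n).filter (fun q => p < q),
      2 / ((q : ℝ) ^ α * (q : ℝ) ^ α * ((p : ℝ) * q)) *
        largeSum α γ s p q (fun j => ρ j p) (fun j => ρ j q) c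

/-- The constant `K` consists of the terms with `k = 0` and the frequencies with `p ∣ h_s`, neither
of which depend on `c`. -/
theorem lsum_small {α : ℝ} {γ : ℕ → ℝ} (hγ : ∀ j, 0 < γ j) (hα : 1 / 2 < α) (s : ℕ) {p q : ℕ}
    (hp : 0 < p) (hq : 0 < q) (u v : ℕ → ℕ) {z : ℕ → ℤ} (hz : ∀ j < s, z j ≡ u j [ZMOD p])
    (hz' : ∀ j < s, z j ≡ v j [ZMOD q]) (b : ℕ) (hb : z s ≡ b [ZMOD q]) : ∃ K : ℝ, ∀ c : ℕ,
    lsum α γ 2 {h : Fin (s + 1) → ℤ | h (Fin.last s) ≠ 0 ∧ ¬ (p : ℤ) ∣ h (Fin.last s) ∧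
        (p : ℤ) ∣ dotInit z h + h (Fin.last s) * c ∧
        (q : ℤ) ∣ dotInit z h + h (Fin.last s) * z s} =
      γ s ^ 2 * (1 / (p * q) * smallSum α γ s p q u v b c) + K := by
  have hx : 1 < α * 2 := by linarith
  refine ⟨γ s ^ 2 * (1 / (p * q) * ∑ l ∈ Finset.range q, kern α γ s p q u v 0 l *
      sigma α (((0 * 0 * q + l * b * p : ℕ) : ℝ) / ((p * q : ℕ) : ℝ))) -
      lsum α γ 2 {h : Fin (s + 1) → ℤ | h (Fin.last s) ≠ 0 ∧ (p : ℤ) ∣ h (Fin.last s) ∧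
        (p : ℤ) ∣ dotInit z h ∧ (q : ℤ) ∣ dotInit z h + h (Fin.last s) * z s}, fun c => ?_⟩
  have h1 := sum_kern hγ hα s hp hq u v c b
  simp only [← dvd_dotInit_congr hz (Int.ModEq.refl _), ← dvd_dotInit_congr hz' hb] at h1
  rw [lsum_split hγ hx _ {h | (p : ℤ) ∣ h (Fin.last s)}] at h1
  have h2 : ({h : Fin (s + 1) → ℤ | h (Fin.last s) ≠ 0 ∧
      (p : ℤ) ∣ dotInit z h + h (Fin.last s) * c ∧
      (q : ℤ) ∣ dotInit z h + h (Fin.last s) * z s} ∩ {h | (p : ℤ) ∣ h (Fin.last s)}ᶜ) =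
      {h : Fin (s + 1) → ℤ | h (Fin.last s) ≠ 0 ∧ ¬ (p : ℤ) ∣ h (Fin.last s) ∧
        (p : ℤ) ∣ dotInit z h + h (Fin.last s) * c ∧
        (q : ℤ) ∣ dotInit z h + h (Fin.last s) * z s} := by
    ext h; simp only [Set.mem_inter_iff, Set.mem_ofPred_eq, Set.mem_compl_iff]; tauto
  have h3 : ({h : Fin (s + 1) → ℤ | h (Fin.last s) ≠ 0 ∧
      (p : ℤ) ∣ dotInit z h + h (Fin.last s) * c ∧
      (q : ℤ) ∣ dotInit z h + h (Fin.last s) * z s} ∩ {h | (p : ℤ) ∣ h (Fin.last s)}) =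
      {h : Fin (s + 1) → ℤ | h (Fin.last s) ≠ 0 ∧ (p : ℤ) ∣ h (Fin.last s) ∧
        (p : ℤ) ∣ dotInit z h ∧ (q : ℤ) ∣ dotInit z h + h (Fin.last s) * z s} := by
    ext h; simp only [Set.mem_inter_iff, Set.mem_ofPred_eq]
    constructor
    · rintro ⟨⟨h3, h4, h5⟩, h6⟩
      exact ⟨h3, h6, (dvd_add_left (h6.mul_right _)).1 h4, h5⟩
    · rintro ⟨h3, h6, h4, h5⟩
      exact ⟨⟨h3, dvd_add h4 (h6.mul_right _), h5⟩, h6⟩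
  rw [h2, h3] at h1
  have h4 : ∀ l, ∑ k ∈ Finset.range p, kern α γ s p q u v k l *
      sigma α (((k * c * q + l * b * p : ℕ) : ℝ) / ((p * q : ℕ) : ℝ)) =
      kern α γ s p q u v 0 l * sigma α (((0 * 0 * q + l * b * p : ℕ) : ℝ) / ((p * q : ℕ) : ℝ)) +
      ∑ k ∈ Finset.Ico 1 p, kern α γ s p q u v k l *
      sigma α (((k * c * q + l * b * p : ℕ) : ℝ) / ((p * q : ℕ) : ℝ)) := fun l => by
    rw [Finset.range_eq_Ico, Finset.sum_eq_sum_Ico_succ_bot hp]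
    simp only [zero_mul, zero_add]
  rw [Finset.sum_congr rfl fun l _ => h4 l, Finset.sum_add_distrib, ← smallSum] at h1
  linarith

/-- The substitution `h_s = q k` leads to the factor `q ^ (-2α)` and the residue `q c`. -/
theorem lsum_large {α : ℝ} {γ : ℕ → ℝ} (hγ : ∀ j, 0 < γ j) (hα : 1 / 2 < α) (s : ℕ) {p q : ℕ}
    (hp : 0 < p) (hq : 0 < q) (u v : ℕ → ℕ) {z : ℕ → ℤ} (hz : ∀ j < s, z j ≡ u j [ZMOD p])
    (hz' : ∀ j < s, z j ≡ v j [ZMOD q]) (c : ℕ) :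
    lsum α γ 2 {h : Fin (s + 1) → ℤ | h (Fin.last s) ≠ 0 ∧ (q : ℤ) ∣ h (Fin.last s) ∧
          (p : ℤ) ∣ dotInit z h + h (Fin.last s) * c ∧ (q : ℤ) ∣ dotInit z h} =
      γ s ^ 2 * (1 / ((q : ℝ) ^ α * (q : ℝ) ^ α * ((p : ℝ) * q)) *
        largeSum α γ s p q u v c) := by
  have hq0 : (0 : ℝ) < q := by exact_mod_cast hq
  have hp0 : (0 : ℝ) < p := by exact_mod_cast hp
  have h1 := lsum_dvd (α := α) (x := 2) hγ hq ({h : Fin (s + 1) → ℤ |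
    (p : ℤ) ∣ dotInit z h + h (Fin.last s) * c ∧ (q : ℤ) ∣ dotInit z h})
  have h2 : ({h : Fin (s + 1) → ℤ |
      (p : ℤ) ∣ dotInit z h + h (Fin.last s) * c ∧ (q : ℤ) ∣ dotInit z h} ∩
      {h | h (Fin.last s) ≠ 0 ∧ (q : ℤ) ∣ h (Fin.last s)}) =
      {h : Fin (s + 1) → ℤ | h (Fin.last s) ≠ 0 ∧ (q : ℤ) ∣ h (Fin.last s) ∧
          (p : ℤ) ∣ dotInit z h + h (Fin.last s) * c ∧ (q : ℤ) ∣ dotInit z h} := by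
    ext h; simp only [Set.mem_inter_iff, Set.mem_ofPred_eq]; tauto
  have h3 := sum_kern hγ hα s hp hq u v (q * c) 0
  have h4 : ({h : Fin (s + 1) → ℤ | h (Fin.last s) ≠ 0} ∩
      {h | (Fin.snoc (Fin.init h) (q * h (Fin.last s)) : Fin (s + 1) → ℤ) ∈
        {h : Fin (s + 1) → ℤ |
          (p : ℤ) ∣ dotInit z h + h (Fin.last s) * c ∧ (q : ℤ) ∣ dotInit z h}}) =
      {h : Fin (s + 1) → ℤ | h (Fin.last s) ≠ 0 ∧
        (p : ℤ) ∣ dotInit (fun j => u j) h + h (Fin.last s) * (q * c : ℕ) ∧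
        (q : ℤ) ∣ dotInit (fun j => v j) h + h (Fin.last s) * (0 : ℕ)} := by
    ext h
    have h5 : ∀ k : ℤ, dotInit z (Fin.snoc (Fin.init h) k : Fin (s + 1) → ℤ) = dotInit z h :=
      fun k => by simp [dotInit, Fin.init]
    simp only [Set.mem_inter_iff, Set.mem_ofPred_eq, h5, Fin.snoc_last,
      ← dvd_dotInit_congr hz (Int.ModEq.refl _), ← dvd_dotInit_congr hz' (Int.ModEq.refl _)]
    rw [show (q : ℤ) * h (Fin.last s) * c = h (Fin.last s) * (q * c : ℕ) by push_cast; ring]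
    simp
  rw [h2, h4, h3] at h1
  rw [h1, show (q : ℝ) ^ (-(α * 2)) = 1 / ((q : ℝ) ^ α * (q : ℝ) ^ α) by
    rw [Real.rpow_neg hq0.le, ← Real.rpow_add hq0, one_div, mul_two]]
  have h6 : ∑ l ∈ Finset.range q, ∑ k ∈ Finset.range p, kern α γ s p q u v k l *
      sigma α (((k * (q * c) * q + l * 0 * p : ℕ) : ℝ) / ((p * q : ℕ) : ℝ)) =
      largeSum α γ s p q u v c := by
    rw [largeSum, Finset.sum_comm]
    refine Finset.sum_congr rfl fun k _ => ?_
    rw [Finset.sum_mul]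
    refine Finset.sum_congr rfl fun l _ => ?_
    congr 2
    push_cast; field_simp; ring
  rw [h6]
  field_simp

/-- As a function of `c`, the criterion `T` is an increasing affine function of `critVal`, so both
have the same minimisers. -/
theorem critT_eq_critVal {α : ℝ} {γ : ℕ → ℝ} (hγ : ∀ j, 0 < γ j) (hα : 1 / 2 < α) {n s p : ℕ}
    (hp : p ∈ primes n) (ρ : ℕ → ℕ → ℕ) {z : ℕ → ℤ}
    (hz : ∀ q ∈ primes n, ∀ j < s, z j ≡ ρ j q [ZMOD q])
    (hs : ∀ q ∈ primes n, q < p → z s ≡ ρ s q [ZMOD q]) : ∃ K : ℝ, ∀ c : ℕ,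
    critT α γ n s z p c = γ s ^ 2 * critVal α γ n s ρ p c + K := by
  have hp0 := (mem_primes.1 hp).1.pos
  have h1 : ∀ q, ∃ K : ℝ, q ∈ (primes n).filter (fun q => q < p) → ∀ c : ℕ,
      lsum α γ 2 {h : Fin (s + 1) → ℤ | h (Fin.last s) ≠ 0 ∧ ¬ (p : ℤ) ∣ h (Fin.last s) ∧
        (p : ℤ) ∣ dotInit z h + h (Fin.last s) * c ∧
        (q : ℤ) ∣ dotInit z h + h (Fin.last s) * z s} =
      γ s ^ 2 * (1 / (p * q) * smallSum α γ s p q (fun j => ρ j p) (fun j => ρ j q) (ρ s q) c) + K :=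
    fun q => by
    by_cases hq : q ∈ (primes n).filter (fun q => q < p)
    · obtain ⟨hqP, hqp⟩ := Finset.mem_filter.1 hq
      obtain ⟨K, hK⟩ := lsum_small hγ hα s hp0 (mem_primes.1 hqP).1.pos (fun j => ρ j p)
        (fun j => ρ j q) (hz p hp) (hz q hqP) (ρ s q) (hs q hqP hqp)
      exact ⟨K, fun _ => hK⟩
    · exact ⟨0, fun h => absurd h hq⟩
  choose K hK using h1
  refine ⟨2 * ∑ q ∈ (primes n).filter (fun q => q < p), K q, fun c => ?_⟩
  have h2 : ∀ q ∈ (primes n).filter (fun q => p < q), _ := fun q hq =>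
    lsum_large hγ hα s hp0 (mem_primes.1 (Finset.mem_filter.1 hq).1).1.pos (fun j => ρ j p)
      (fun j => ρ j q) (hz p hp) (hz q (Finset.mem_filter.1 hq).1) c
  rw [critT_eq_lsum, Finset.sum_congr rfl fun q hq => hK q hq c, Finset.sum_congr rfl h2,
    theta_eq_thetaVal hγ hα s hp0 (fun j => ρ j p) (hz p hp), critVal, Finset.sum_add_distrib]
  have h3 : ∀ A B B' C C' S : ℝ, 2 * B = γ s ^ 2 * B' → 2 * C = γ s ^ 2 * C' →
      γ s ^ 2 * A + 2 * (B + S) + 2 * C = γ s ^ 2 * (A + B' + C') + 2 * S := by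
    intro A B B' C C' S h h'; linarith
  refine h3 _ _ _ _ _ _ ?_ ?_ <;>
    rw [Finset.mul_sum, Finset.mul_sum] <;> refine Finset.sum_congr rfl fun q _ => ?_ <;> ring

/-! ### Fast Fourier transform and cyclic correlation -/

/-- The Fourier transform of length `T` of the subsequence `x (b), x (b + M), x (b + 2M), …`. -/
noncomputable def subDFT (x : ℕ → ℂ) (T M k b : ℕ) : ℂ :=
  ∑ i ∈ Finset.range T, x (b + i * M) * turn (((k * i : ℕ) : ℝ) / (T : ℝ))

theorem sum_range_two_mul {A : Type*} [AddCommMonoid A] (f : ℕ → A) (T : ℕ) :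
    ∑ i ∈ Finset.range (2 * T), f i =
      ∑ i ∈ Finset.range T, f (2 * i) + ∑ i ∈ Finset.range T, f (2 * i + 1) := by
  induction T with
  | zero => simp
  | succ T ih =>
    rw [show 2 * (T + 1) = 2 * T + 1 + 1 by ring, Finset.sum_range_succ, Finset.sum_range_succ, ih,
      Finset.sum_range_succ, Finset.sum_range_succ]
    abel

theorem turn_mod (k i T : ℕ) (hT : 0 < T) :
    turn (((k % T * i : ℕ) : ℝ) / T) = turn (((k * i : ℕ) : ℝ) / T) := by
  have hT0 : (T : ℝ) ≠ 0 := by positivity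
  have h2 := Nat.mod_add_div k T
  generalize k / T = e at h2
  have h1 : ((k * i : ℕ) : ℝ) / T = ((k % T * i : ℕ) : ℝ) / T + ((e * i : ℕ) : ℤ) := by
    conv_lhs => rw [← h2]
    push_cast; field_simp
  rw [h1, turn_add, turn_int, mul_one]

/-- The butterfly step of the fast Fourier transform. -/
theorem subDFT_two_mul (x : ℕ → ℂ) {T : ℕ} (hT : 0 < T) (H k b : ℕ) :
    subDFT x (2 * T) H k b = subDFT x T (2 * H) (k % T) b +
      turn ((k : ℝ) / ((2 * T : ℕ) : ℝ)) * subDFT x T (2 * H) (k % T) (b + H) := by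
  have hT0 : (T : ℝ) ≠ 0 := by positivity
  simp only [subDFT, turn_mod _ _ _ hT]
  rw [sum_range_two_mul, Finset.mul_sum]
  congr 1
  · refine Finset.sum_congr rfl fun i _ => ?_
    congr 2
    · ring
    · push_cast; field_simp
  · refine Finset.sum_congr rfl fun i _ => ?_
    rw [mul_left_comm, ← turn_add]
    congr 2
    · ring
    · push_cast; field_simp; ring

theorem subDFT_one (x : ℕ → ℂ) (M k b : ℕ) : subDFT x 1 M k b = x b := by
  rw [subDFT, Finset.sum_range_one]
  have : turn (((k * 0 : ℕ) : ℝ) / ((1 : ℕ) : ℝ)) = 1 := by simp [turn_zero]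
  rw [this, zero_mul, add_zero, mul_one]

theorem turn_re (x : ℝ) : (turn x).re = Real.cos (2 * Real.pi * x) := by
  rw [turn, show (2 * Real.pi * x * Complex.I : ℂ) = ((2 * Real.pi * x : ℝ) : ℂ) * Complex.I by
    push_cast; ring, Complex.exp_ofReal_mul_I_re]

theorem turn_im (x : ℝ) : (turn x).im = Real.sin (2 * Real.pi * x) := by
  rw [turn, show (2 * Real.pi * x * Complex.I : ℂ) = ((2 * Real.pi * x : ℝ) : ℂ) * Complex.I by
    push_cast; ring, Complex.exp_ofReal_mul_I_im]

/-- The Fourier transform of the power spectrum is the cyclic autocorrelation. -/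
theorem sum_normSq_turn (x : ℕ → ℂ) {L : ℕ} (hL : 0 < L) (t : ℕ) :
    ∑ k ∈ Finset.range L, (Complex.normSq (subDFT x L 1 k 0) : ℂ) *
      turn (((k * t : ℕ) : ℝ) / L) =
    L * ∑ m ∈ Finset.range L, ∑ m' ∈ Finset.range L,
      if (L : ℤ) ∣ m + t - m' then x m * (starRingEnd ℂ) (x m') else 0 := by
  have h1 : ∀ k ∈ Finset.range L, (Complex.normSq (subDFT x L 1 k 0) : ℂ) *
      turn (((k * t : ℕ) : ℝ) / L) = ∑ m ∈ Finset.range L, ∑ m' ∈ Finset.range L,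
        x m * (starRingEnd ℂ) (x m') * turn (k * (((m + t - m' : ℤ) : ℝ) / L)) := fun k _ => by
    rw [← Complex.mul_conj]
    simp only [subDFT, zero_add, mul_one, map_sum, map_mul]
    rw [Finset.sum_mul_sum, Finset.sum_mul]
    refine Finset.sum_congr rfl fun m _ => ?_
    rw [Finset.sum_mul]
    refine Finset.sum_congr rfl fun m' _ => ?_
    rw [← turn_neg, show (k : ℝ) * (((m + t - m' : ℤ) : ℝ) / L) =
      ((k * m : ℕ) : ℝ) / L + (-(((k * m' : ℕ) : ℝ) / L) + ((k * t : ℕ) : ℝ) / L) by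
      push_cast; ring, turn_add, turn_add]
    ring
  rw [Finset.sum_congr rfl h1, Finset.sum_comm, Finset.mul_sum]
  refine Finset.sum_congr rfl fun m _ => ?_
  rw [Finset.sum_comm, Finset.mul_sum]
  refine Finset.sum_congr rfl fun m' _ => ?_
  rw [← Finset.mul_sum, sum_turn hL]
  split_ifs <;> ring

/-- If `a` is supported in `[0, P)` and `b` in `[P, 3P)`, the correlation of `a` and `b` at the lags
`P, …, 2P - 1` can be read off from the power spectrum of `a + i b`: it is separated from the
correlation of `b` and `a` by the supports, and from the autocorrelations by being imaginary. -/
theorem sum_normSq_sin {a b : ℕ → ℝ} {L P j : ℕ} (hL : 5 * P ≤ L) (hj : j < P)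
    (ha : ∀ m, P ≤ m → m < L → a m = 0) (hb : ∀ m, m < L → ¬ (P ≤ m ∧ m < 3 * P) → b m = 0) :
    ∑ k ∈ Finset.range L, Complex.normSq (subDFT (fun m => ⟨a m, b m⟩) L 1 k 0) *
      Real.sin (2 * Real.pi * (((k * (j + P) : ℕ) : ℝ) / (L : ℝ))) =
    -(L * ∑ m ∈ Finset.range P, a m * b (m + (j + P))) := by
  have h1 := congrArg Complex.im
    (sum_normSq_turn (fun m => (⟨a m, b m⟩ : ℂ)) (by omega : 0 < L) (j + P))
  rw [Complex.im_sum, Finset.sum_congr rfl fun k _ => by rw [Complex.im_ofReal_mul, turn_im]] at h1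
  rw [h1, ← Complex.ofReal_natCast, Complex.im_ofReal_mul, Complex.im_sum, ← mul_neg,
    ← Finset.sum_neg_distrib]
  congr 1
  have h2 : Finset.range P ⊆ Finset.range L := Finset.range_mono (by omega)
  rw [Finset.sum_subset (f := fun m => -(a m * b (m + (j + P)))) h2 ?_]
  · refine Finset.sum_congr rfl fun m hm => ?_
    have hm := Finset.mem_range.1 hm
    rw [Complex.im_sum]
    by_cases hmL : m + (j + P) < L
    · rw [Finset.sum_eq_single (m + (j + P))]
      · simp only [Nat.cast_add, sub_self, dvd_zero, if_true, Complex.mul_im, Complex.conj_re,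
          Complex.conj_im]
        have : b m * a (m + (j + P)) = 0 := by
          rw [ha (m + (j + P)) (by omega) hmL, mul_zero]
        simp only [this]; ring
      · intro m' hm' hne
        have hm' := Finset.mem_range.1 hm'
        rw [if_neg]
        · rfl
        · rintro ⟨e, he⟩
          have : (e : ℤ) = 0 := by
            by_contra h0
            rcases lt_or_gt_of_ne h0 with h | h
            · have : (L : ℤ) * e ≤ L * (-1) := mul_le_mul_of_nonneg_left (by omega) (by omega)
              omega
            · have : (L : ℤ) * 1 ≤ L * e := mul_le_mul_of_nonneg_left (by omega) (by omega)
              omega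
          subst this
          omega
      · intro h; exact absurd (Finset.mem_range.2 hmL) h
    -- an index beyond `L` would need `m ≥ 3P`, where both sequences vanish
    · have ham : a m = 0 := ha m (by omega) hm
      have hbm : b m = 0 := hb m hm (by omega)
      have hz : (⟨a m, b m⟩ : ℂ) = 0 := by rw [ham, hbm]; rfl
      simp only [hz]
      simp [ham]
  · intro m hm hmP
    have hm := Finset.mem_range.1 hm
    rw [Finset.mem_range] at hmP
    rw [ha m (by omega) hm, zero_mul, neg_zero]

/-! ### Primitive roots -/

/-- `g` generates the multiplicative group modulo the prime `p`. -/
def IsGen (p g : ℕ) : Prop := 0 < g ∧ g < p ∧ ∀ i, 0 < i → i < p - 1 → g ^ i % p ≠ 1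

theorem exists_isGen {p : ℕ} (hp : p.Prime) : ∃ g, IsGen p g := by
  have : Fact p.Prime := ⟨hp⟩
  obtain ⟨g, hg⟩ := IsCyclic.exists_generator (α := (ZMod p)ˣ)
  have ho : orderOf g = p - 1 := by
    rw [orderOf_eq_card_of_forall_mem_zpowers hg, Nat.card_eq_fintype_card, ZMod.card_units]
  have hcast : (((g : ZMod p).val : ℕ) : ZMod p) = (g : ZMod p) := ZMod.natCast_zmod_val _
  refine ⟨(g : ZMod p).val, ?_, ZMod.val_lt _, fun i hi hip h => ?_⟩
  · rw [Nat.pos_iff_ne_zero, ne_eq, ZMod.val_eq_zero]; exact g.ne_zero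
  · have h1 : g ^ i = 1 := by
      apply Units.ext
      push_cast
      rw [← hcast, ← Nat.cast_pow, ← Nat.cast_one, ZMod.natCast_eq_natCast_iff]
      rw [Nat.ModEq, h, Nat.mod_eq_of_lt hp.one_lt]
    have := orderOf_le_of_pow_eq_one hi h1
    omega

theorem IsGen.pow_mod_pos {p g : ℕ} (hp : p.Prime) (hg : IsGen p g) (i : ℕ) : 0 < g ^ i % p := by
  rw [Nat.pos_iff_ne_zero]
  intro h
  have := hp.dvd_of_dvd_pow (Nat.dvd_of_mod_eq_zero h)
  exact absurd (Nat.le_of_dvd hg.1 this) (not_le.2 hg.2.1)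

theorem IsGen.pow_card {p g : ℕ} (hp : p.Prime) (hg : IsGen p g) : g ^ (p - 1) ≡ 1 [MOD p] := by
  have : Nat.Coprime g p :=
    (Nat.coprime_of_lt_prime hg.1.ne' hg.2.1 hp).symm
  have h := Nat.ModEq.pow_totient this
  rwa [Nat.totient_prime hp] at h

theorem IsGen.injOn {p g : ℕ} (hp : p.Prime) (hg : IsGen p g) :
    Set.InjOn (fun i => g ^ i % p) (Finset.range (p - 1) : Set ℕ) := by
  have hc : Nat.Coprime p g := Nat.coprime_of_lt_prime hg.1.ne' hg.2.1 hp
  have key : ∀ i j, i < j → j < p - 1 → g ^ i % p ≠ g ^ j % p := fun i j hij hj h => by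
    have h1 : g ^ i * 1 ≡ g ^ i * g ^ (j - i) [MOD p] := by
      rw [mul_one, ← pow_add, Nat.add_sub_cancel' hij.le]; exact h
    have h2 := Nat.ModEq.cancel_left_of_coprime (hc.pow_right i) h1
    exact hg.2.2 (j - i) (by omega) (by omega) ((show _ % p = _ % p from h2.symm).trans
      (Nat.mod_eq_of_lt hp.one_lt))
  intro i hi j hj h
  have hi := Finset.mem_range.1 hi
  have hj := Finset.mem_range.1 hj
  rcases lt_trichotomy i j with h1 | h1 | h1
  · exact absurd h (key i j h1 hj)
  · exact h1
  · exact absurd h.symm (key j i h1 hi)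

theorem IsGen.image {p g : ℕ} (hp : p.Prime) (hg : IsGen p g) :
    (Finset.range (p - 1)).image (fun i => g ^ i % p) = Finset.Ico 1 p := by
  refine Finset.eq_of_subset_of_card_le (fun x hx => ?_) ?_
  · obtain ⟨i, -, rfl⟩ := Finset.mem_image.1 hx
    exact Finset.mem_Ico.2 ⟨hg.pow_mod_pos hp i, Nat.mod_lt _ hp.pos⟩
  · rw [Finset.card_image_of_injOn (hg.injOn hp)]; simp

theorem IsGen.sum {p g : ℕ} (hp : p.Prime) (hg : IsGen p g) (f : ℕ → ℝ) :
    ∑ k ∈ Finset.Ico 1 p, f k = ∑ i ∈ Finset.range (p - 1), f (g ^ i % p) := by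
  rw [← hg.image hp, Finset.sum_image (hg.injOn hp)]

/-- The values of `σ_α` depend on the numerators modulo the denominators only. -/
theorem sigma_congr (α : ℝ) {p q a a' m : ℕ} (hp : 0 < p) (hq : 0 < q) (h : a ≡ a' [MOD p]) :
    sigma α (((a * q + m : ℕ) : ℝ) / ((p * q : ℕ) : ℝ)) =
      sigma α (((a' * q + m : ℕ) : ℝ) / ((p * q : ℕ) : ℝ)) := by
  have hp0 : (p : ℝ) ≠ 0 := by positivity
  have hq0 : (q : ℝ) ≠ 0 := by positivity
  obtain ⟨e, he⟩ := Nat.modEq_iff_dvd.1 h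
  have he' : (a' : ℝ) = a + p * e := by
    have : (a' : ℤ) = a + p * e := by linarith
    exact_mod_cast this
  rw [← sigma_add_int α _ e]
  congr 1
  push_cast
  rw [he']; field_simp; ring

/-- Over the powers of a generator, the sums over the nonzero residues modulo `p` become
correlations. -/
theorem smallSum_pow {α : ℝ} {γ : ℕ → ℝ} {s p q : ℕ} (hp : p.Prime) (hq : 0 < q) {g : ℕ}
    (hg : IsGen p g) (u v : ℕ → ℕ) (b j : ℕ) :
    smallSum α γ s p q u v b (g ^ j % p) = ∑ l ∈ Finset.range q, ∑ m ∈ Finset.range (p - 1),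
      kern α γ s p q u v (g ^ m % p) l *
        sigma α (((g ^ (m + (j + (p - 1))) % p * q + l * b * p : ℕ) : ℝ) /
          ((p * q : ℕ) : ℝ)) := by
  rw [smallSum]
  refine Finset.sum_congr rfl fun l _ => ?_
  rw [hg.sum hp]
  refine Finset.sum_congr rfl fun m _ => ?_
  congr 1
  refine sigma_congr α hp.pos hq ?_
  have h1 : g ^ m % p * (g ^ j % p) ≡ g ^ m * g ^ j [MOD p] :=
    (Nat.mod_modEq _ _).mul (Nat.mod_modEq _ _)
  have h2 : g ^ (m + (j + (p - 1))) ≡ g ^ m * g ^ j [MOD p] := by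
    rw [pow_add, pow_add, ← mul_assoc]
    simpa using (Nat.ModEq.refl (g ^ m * g ^ j)).mul (hg.pow_card hp)
  exact h1.trans (h2.symm.trans (Nat.mod_modEq _ _).symm)

/-- The residue `0` is not a power of the generator; there no correlation is needed. -/
theorem smallSum_zero {α : ℝ} {γ : ℕ → ℝ} {s p q : ℕ} (hp : p.Prime) {g : ℕ}
    (hg : IsGen p g) (u v : ℕ → ℕ) (b : ℕ) :
    smallSum α γ s p q u v b 0 = ∑ l ∈ Finset.range q, ∑ m ∈ Finset.range (p - 1),
      kern α γ s p q u v (g ^ m % p) l * sigma α (((l * b * p : ℕ) : ℝ) / ((p * q : ℕ) : ℝ)) := by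
  rw [smallSum]
  refine Finset.sum_congr rfl fun l _ => ?_
  rw [hg.sum hp]
  simp

/-! ### The smallest values of a function -/

/-- The number of predecessors of `c` when `0, …, p - 1` are ordered by the values of `f`, and by
size in the case of ties. -/
noncomputable def rankOf (f : ℕ → ℝ) (p c : ℕ) : ℕ := by
  classical
  exact ((Finset.range p).filter fun c' => f c' < f c ∨ (¬ f c < f c' ∧ c' < c)).card

theorem rankOf_lt {f : ℕ → ℝ} {p c c' : ℕ} (hc : c < p)
    (h : f c < f c' ∨ (¬ f c' < f c ∧ c < c')) : rankOf f p c < rankOf f p c' := by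
  classical
  unfold rankOf
  refine Finset.card_lt_card (Finset.ssubset_iff_of_subset (fun x hx => ?_) |>.2 ⟨c, ?_, ?_⟩)
  · simp only [Finset.mem_filter] at hx ⊢
    refine ⟨hx.1, ?_⟩
    simp only [not_lt] at h hx ⊢
    rcases hx.2 with h1 | h1 <;> rcases h with h2 | h2
    · exact Or.inl (h1.trans h2)
    · exact Or.inl (h1.trans_le h2.1)
    · exact Or.inl (h1.1.trans_lt h2)
    · exact Or.inr ⟨h1.1.trans h2.1, h1.2.trans h2.2⟩
  · simp only [Finset.mem_filter, Finset.mem_range]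
    exact ⟨hc, h⟩
  · simp

theorem rankOf_lt_card {f : ℕ → ℝ} {p c : ℕ} (hc : c < p) : rankOf f p c < p := by
  classical
  unfold rankOf
  have : ((Finset.range p).filter fun c' => f c' < f c ∨ (¬ f c < f c' ∧ c' < c)) ⊂
      Finset.range p := Finset.filter_ssubset.2 ⟨c, Finset.mem_range.2 hc, by simp⟩
  simpa using Finset.card_lt_card this

theorem card_rankOf_lt (f : ℕ → ℝ) {p M : ℕ} (hM : M ≤ p) :
    ((Finset.range p).filter fun c => rankOf f p c < M).card = M := by
  have hinj : Set.InjOn (rankOf f p) (Finset.range p : Set ℕ) := by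
    intro a ha b hb hab
    have ha := Finset.mem_range.1 ha
    have hb := Finset.mem_range.1 hb
    by_contra hne
    rcases lt_trichotomy (f a) (f b) with h | h | h
    · exact absurd hab (rankOf_lt ha (Or.inl h)).ne
    · rcases lt_or_gt_of_ne hne with h1 | h1
      · exact absurd hab (rankOf_lt ha (Or.inr ⟨h.not_gt, h1⟩)).ne
      · exact absurd hab (rankOf_lt hb (Or.inr ⟨h.not_lt, h1⟩)).ne'
    · exact absurd hab (rankOf_lt hb (Or.inl h)).ne'
  have himg : (Finset.range p).image (rankOf f p) = Finset.range p := by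
    refine Finset.eq_of_subset_of_card_le (fun x hx => ?_) ?_
    · obtain ⟨c, hc, rfl⟩ := Finset.mem_image.1 hx
      exact Finset.mem_range.2 (rankOf_lt_card (Finset.mem_range.1 hc))
    · rw [Finset.card_image_of_injOn hinj]
  have h2 : ((Finset.range p).filter fun c => rankOf f p c < M).image (rankOf f p) =
      Finset.range M := by
    ext x
    simp only [Finset.mem_image, Finset.mem_filter, Finset.mem_range]
    constructor
    · rintro ⟨c, hc, rfl⟩; exact hc.2
    · intro hx
      have : x ∈ (Finset.range p).image (rankOf f p) := by
        rw [himg]; exact Finset.mem_range.2 (by omega)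
      obtain ⟨c, hc, rfl⟩ := Finset.mem_image.1 this
      exact ⟨c, ⟨Finset.mem_range.1 hc, hx⟩, rfl⟩
  rw [← Finset.card_image_of_injOn (f := rankOf f p) (hinj.mono (by
    intro c hc; exact (Finset.mem_filter.1 hc).1)), h2, Finset.card_range]

theorem le_of_rankOf {f : ℕ → ℝ} {p M b c : ℕ} (hc : c < p) (hb : rankOf f p b < M)
    (hcM : ¬ rankOf f p c < M) : f b ≤ f c := by
  by_contra h
  exact hcM ((rankOf_lt hc (Or.inl (not_le.1 h))).trans hb)

end Korobov

namespace RealRAM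

/-! ### Total correctness with a time bound -/

/-- Started in `σ`, the program halts after at most `T` operations in a state that satisfies `Q`. -/
def Runs (E : Env) (P : Prog) (σ : State) (T : ℕ) (Q : State → Prop) : Prop :=
  ∃ σ' t, Exec E P σ σ' t ∧ t ≤ T ∧ Q σ'

/-- The programs without loops as functions on states. Loops are mapped to the identity; `Prog.Ok`
excludes them. -/
noncomputable def Prog.den (E : Env) : Prog → State → State
  | .skip, σ => σ
  | .iset x e, σ => { σ with ivar := Function.update σ.ivar x (e.eval σ) }
  | .rset x e, σ => { σ with rvar := Function.update σ.rvar x (e.eval E σ) }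
  | .istore a e, σ => { σ with imem := Function.update σ.imem (a.eval σ) (e.eval σ) }
  | .rstore a e, σ => { σ with rmem := Function.update σ.rmem (a.eval σ) (e.eval E σ) }
  | .emit e, σ => { σ with out := σ.out ++ [e.eval σ] }
  | .seq P Q, σ => Q.den E (P.den E σ)
  | .cond b P Q, σ => by classical exact if b.Holds E σ then P.den E σ else Q.den E σ
  | .loop _ _, σ => σ

/-- The program is free of loops and respects the limits of the machine when started in `σ`. -/
def Prog.Ok (E : Env) : Prog → State → Prop
  | .skip, _ => True
  | .iset _ e, σ => e.Safe E σ
  | .rset _ e, σ => e.Safe E σ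
  | .istore a e, σ => a.Safe E σ ∧ e.Safe E σ ∧ a.eval σ < E.mem
  | .rstore a e, σ => a.Safe E σ ∧ e.Safe E σ ∧ a.eval σ < E.mem
  | .emit e, σ => e.Safe E σ
  | .seq P Q, σ => P.Ok E σ ∧ Q.Ok E (P.den E σ)
  | .cond b P Q, σ => b.Safe E σ ∧ (b.Holds E σ → P.Ok E σ) ∧ (¬ b.Holds E σ → Q.Ok E σ)
  | .loop _ _, _ => False

/-- A bound for the running time of a program without loops; the value at a loop is meaningless. -/
def Prog.time : Prog → ℕ
  | .skip => 1
  | .iset _ e => e.cost + 1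
  | .rset _ e => e.cost + 1
  | .istore a e => a.cost + e.cost + 1
  | .rstore a e => a.cost + e.cost + 1
  | .emit e => e.cost + 1
  | .seq P Q => P.time + Q.time
  | .cond b P Q => b.cost + 1 + max P.time Q.time
  | .loop _ _ => 0

theorem Runs.mono {E : Env} {P : Prog} {σ : State} {T T' : ℕ} {Q Q' : State → Prop}
    (h : Runs E P σ T Q) (hT : T ≤ T') (hQ : ∀ σ', Q σ' → Q' σ') : Runs E P σ T' Q' := by
  obtain ⟨σ', t, h1, h2, h3⟩ := h
  exact ⟨σ', t, h1, h2.trans hT, hQ _ h3⟩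

theorem Runs.seq {E : Env} {P P' : Prog} {σ : State} {T T' : ℕ} {Q Q' : State → Prop}
    (h : Runs E P σ T Q) (h' : ∀ σ', Q σ' → Runs E P' σ' T' Q') :
    Runs E (Prog.seq P P') σ (T + T') Q' := by
  obtain ⟨σ', t, h1, h2, h3⟩ := h
  obtain ⟨σ'', t', h4, h5, h6⟩ := h' σ' h3
  exact ⟨σ'', t + t', Exec.seq h1 h4, add_le_add h2 h5, h6⟩

theorem Prog.exec_den {E : Env} {P : Prog} {σ : State} (h : P.Ok E σ) :
    ∃ t ≤ P.time, Exec E P σ (P.den E σ) t := by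
  induction P generalizing σ with
  | skip => exact ⟨_, le_rfl, Exec.skip σ⟩
  | iset x e => exact ⟨_, le_rfl, Exec.iset σ x e h⟩
  | rset x e => exact ⟨_, le_rfl, Exec.rset σ x e h⟩
  | istore a e => exact ⟨_, le_rfl, Exec.istore σ a e h.1 h.2.1 h.2.2⟩
  | rstore a e => exact ⟨_, le_rfl, Exec.rstore σ a e h.1 h.2.1 h.2.2⟩
  | emit e => exact ⟨_, le_rfl, Exec.emit σ e h⟩
  | seq P Q ihP ihQ =>
    obtain ⟨t, ht, h1⟩ := ihP h.1
    obtain ⟨t', ht', h2⟩ := ihQ h.2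
    exact ⟨t + t', add_le_add ht ht', Exec.seq h1 h2⟩
  | cond b P Q ihP ihQ =>
    by_cases hb : b.Holds E σ
    · obtain ⟨t, ht, h1⟩ := ihP (h.2.1 hb)
      refine ⟨b.cost + 1 + t, Nat.add_le_add_left (ht.trans (le_max_left _ _)) _, ?_⟩
      rw [Prog.den, if_pos hb]
      exact Exec.condTrue h.1 hb h1
    · obtain ⟨t, ht, h1⟩ := ihQ (h.2.2 hb)
      refine ⟨b.cost + 1 + t, Nat.add_le_add_left (ht.trans (le_max_right _ _)) _, ?_⟩
      rw [Prog.den, if_neg hb]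
      exact Exec.condFalse h.1 hb h1
  | loop b P _ => exact absurd h id

theorem Runs.block {E : Env} {P : Prog} {σ : State} {T : ℕ} {Q : State → Prop}
    (h : P.Ok E σ) (hT : P.time ≤ T) (hQ : Q (P.den E σ)) : Runs E P σ T Q := by
  obtain ⟨t, ht, h1⟩ := Prog.exec_den h
  exact ⟨_, t, h1, ht.trans hT, hQ⟩

theorem Runs.cond {E : Env} {b : BExp} {P P' : Prog} {σ : State} {T : ℕ} {Q : State → Prop}
    (hs : b.Safe E σ) (h : b.Holds E σ → Runs E P σ T Q) (h' : ¬ b.Holds E σ → Runs E P' σ T Q) :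
    Runs E (Prog.cond b P P') σ (b.cost + 1 + T) Q := by
  by_cases hb : b.Holds E σ
  · obtain ⟨σ', t, h1, h2, h3⟩ := h hb
    exact ⟨σ', _, Exec.condTrue hs hb h1, Nat.add_le_add_left h2 _, h3⟩
  · obtain ⟨σ', t, h1, h2, h3⟩ := h' hb
    exact ⟨σ', _, Exec.condFalse hs hb h1, Nat.add_le_add_left h2 _, h3⟩

/-- A loop with the invariant `J` that is left when the counter has reached `N`. -/
theorem Runs.loop {E : Env} {b : BExp} {P : Prog} {T N : ℕ} (J : ℕ → State → Prop)
    (hsafe : ∀ k ≤ N, ∀ σ, J k σ → b.Safe E σ ∧ (b.Holds E σ ↔ k < N))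
    (hstep : ∀ k < N, ∀ σ, J k σ → Runs E P σ T (J (k + 1))) {σ : State} (h0 : J 0 σ) :
    Runs E (Prog.loop b P) σ (N * (b.cost + 1 + T) + (b.cost + 1)) (J N) := by
  have key : ∀ m k, k + m = N → ∀ σ, J k σ →
      Runs E (Prog.loop b P) σ (m * (b.cost + 1 + T) + (b.cost + 1)) (J N) := by
    intro m
    induction m with
    | zero =>
      intro k hk σ hJ
      obtain rfl : k = N := by omega
      obtain ⟨h1, h2⟩ := hsafe k le_rfl σ hJ
      exact ⟨σ, _, Exec.loopStop h1 fun h => absurd (h2.1 h) (lt_irrefl _), by omega, hJ⟩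
    | succ m ih =>
      intro k hk σ hJ
      obtain ⟨h1, h2⟩ := hsafe k (by omega) σ hJ
      obtain ⟨σ', t, h3, h4, h5⟩ := hstep k (by omega) σ hJ
      obtain ⟨σ'', t', h6, h7, h8⟩ := ih (k + 1) (by omega) σ' h5
      refine ⟨σ'', _, Exec.loopStep h1 (h2.2 (by omega)) h3 h6, ?_, h8⟩
      rw [Nat.succ_mul]; omega
  exact key N 0 (zero_add N) σ h0

/-! ### Variables and memories that a program does not change -/

/-- The variable for natural numbers is a target of an assignment. -/
def Prog.wI : Prog → ℕ → Bool
  | .iset x _, y => x == y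
  | .seq P Q, y => P.wI y || Q.wI y
  | .cond _ P Q, y => P.wI y || Q.wI y
  | .loop _ P, y => P.wI y
  | _, _ => false

/-- The variable for real numbers is a target of an assignment. -/
def Prog.wR : Prog → ℕ → Bool
  | .rset x _, y => x == y
  | .seq P Q, y => P.wR y || Q.wR y
  | .cond _ P Q, y => P.wR y || Q.wR y
  | .loop _ P, y => P.wR y
  | _, _ => false

/-- The program contains an instruction that writes to the memory for natural numbers. -/
def Prog.wIMem : Prog → Bool
  | .istore _ _ => true
  | .seq P Q => P.wIMem || Q.wIMem
  | .cond _ P Q => P.wIMem || Q.wIMem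
  | .loop _ P => P.wIMem
  | _ => false

/-- The program contains an instruction that writes to the memory for real numbers. -/
def Prog.wRMem : Prog → Bool
  | .rstore _ _ => true
  | .seq P Q => P.wRMem || Q.wRMem
  | .cond _ P Q => P.wRMem || Q.wRMem
  | .loop _ P => P.wRMem
  | _ => false

/-- The program contains an instruction that writes to the output. -/
def Prog.wOut : Prog → Bool
  | .emit _ => true
  | .seq P Q => P.wOut || Q.wOut
  | .cond _ P Q => P.wOut || Q.wOut
  | .loop _ P => P.wOut
  | _ => false

/-- The states differ at most in those variables and memories which occur in `P` as targets. -/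
structure Agree (P : Prog) (σ σ' : State) : Prop where
  i : ∀ y, P.wI y = false → σ'.ivar y = σ.ivar y
  r : ∀ y, P.wR y = false → σ'.rvar y = σ.rvar y
  im : P.wIMem = false → σ'.imem = σ.imem
  rm : P.wRMem = false → σ'.rmem = σ.rmem
  o : P.wOut = false → σ'.out = σ.out

theorem Agree.refl (P : Prog) (σ : State) : Agree P σ σ :=
  ⟨fun _ _ => rfl, fun _ _ => rfl, fun _ => rfl, fun _ => rfl, fun _ => rfl⟩

theorem Agree.trans {P : Prog} {σ₁ σ₂ σ₃ : State} (h : Agree P σ₁ σ₂) (h' : Agree P σ₂ σ₃) :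
    Agree P σ₁ σ₃ :=
  ⟨fun y hy => (h'.i y hy).trans (h.i y hy), fun y hy => (h'.r y hy).trans (h.r y hy),
    fun hy => (h'.im hy).trans (h.im hy), fun hy => (h'.rm hy).trans (h.rm hy),
    fun hy => (h'.o hy).trans (h.o hy)⟩

theorem Agree.seq_left {P Q : Prog} {σ σ' : State} (h : Agree P σ σ') : Agree (P.seq Q) σ σ' :=
  ⟨fun y hy => h.i y (Bool.or_eq_false_iff.1 hy).1, fun y hy => h.r y (Bool.or_eq_false_iff.1 hy).1,
    fun hy => h.im (Bool.or_eq_false_iff.1 hy).1, fun hy => h.rm (Bool.or_eq_false_iff.1 hy).1,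
    fun hy => h.o (Bool.or_eq_false_iff.1 hy).1⟩

theorem Agree.seq_right {P Q : Prog} {σ σ' : State} (h : Agree Q σ σ') : Agree (P.seq Q) σ σ' :=
  ⟨fun y hy => h.i y (Bool.or_eq_false_iff.1 hy).2, fun y hy => h.r y (Bool.or_eq_false_iff.1 hy).2,
    fun hy => h.im (Bool.or_eq_false_iff.1 hy).2, fun hy => h.rm (Bool.or_eq_false_iff.1 hy).2,
    fun hy => h.o (Bool.or_eq_false_iff.1 hy).2⟩

theorem Agree.cond_left {b : BExp} {P Q : Prog} {σ σ' : State} (h : Agree P σ σ') :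
    Agree (Prog.cond b P Q) σ σ' :=
  ⟨(h.seq_left (Q := Q)).i, (h.seq_left (Q := Q)).r, (h.seq_left (Q := Q)).im,
    (h.seq_left (Q := Q)).rm, (h.seq_left (Q := Q)).o⟩

theorem Agree.cond_right {b : BExp} {P Q : Prog} {σ σ' : State} (h : Agree Q σ σ') :
    Agree (Prog.cond b P Q) σ σ' :=
  ⟨(h.seq_right (P := P)).i, (h.seq_right (P := P)).r, (h.seq_right (P := P)).im,
    (h.seq_right (P := P)).rm, (h.seq_right (P := P)).o⟩

theorem Agree.loop {b : BExp} {P : Prog} {σ σ' : State} (h : Agree P σ σ') :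
    Agree (Prog.loop b P) σ σ' := ⟨h.i, h.r, h.im, h.rm, h.o⟩

theorem Exec.agree {E : Env} {P : Prog} {σ σ' : State} {t : ℕ} (h : Exec E P σ σ' t) :
    Agree P σ σ' := by
  induction h with
  | skip σ => exact Agree.refl _ _
  | iset σ x e he =>
    refine ⟨fun y hy => Function.update_of_ne ?_ _ _, fun _ _ => rfl, fun _ => rfl, fun _ => rfl,
      fun _ => rfl⟩
    rintro rfl; simp [Prog.wI] at hy
  | rset σ x e he =>
    refine ⟨fun _ _ => rfl, fun y hy => Function.update_of_ne ?_ _ _, fun _ => rfl, fun _ => rfl,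
      fun _ => rfl⟩
    rintro rfl; simp [Prog.wR] at hy
  | istore σ a e ha he hm =>
    exact ⟨fun _ _ => rfl, fun _ _ => rfl, fun h => absurd h Bool.noConfusion, fun _ => rfl,
      fun _ => rfl⟩
  | rstore σ a e ha he hm =>
    exact ⟨fun _ _ => rfl, fun _ _ => rfl, fun _ => rfl, fun h => absurd h Bool.noConfusion,
      fun _ => rfl⟩
  | emit σ e he =>
    exact ⟨fun _ _ => rfl, fun _ _ => rfl, fun _ => rfl, fun _ => rfl,
      fun h => absurd h Bool.noConfusion⟩
  | seq _ _ ih ih' => exact ih.seq_left.trans ih'.seq_right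
  | condTrue _ _ _ ih => exact ih.cond_left
  | condFalse _ _ _ ih => exact ih.cond_right
  | loopStop _ _ => exact Agree.refl _ _
  | loopStep _ _ _ _ ih ih' => exact ih.loop.trans ih'

theorem Runs.agree {E : Env} {P : Prog} {σ : State} {T : ℕ} {Q : State → Prop}
    (h : Runs E P σ T Q) : Runs E P σ T fun σ' => Agree P σ σ' ∧ Q σ' := by
  obtain ⟨σ', t, h1, h2, h3⟩ := h
  exact ⟨σ', t, h1, h2, h1.agree, h3⟩

/-- `for x := 0, …, (var b) - 1 do P`. -/
def forP (x b : ℕ) (P : Prog) : Prog :=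
  .seq (.iset x (.const 0)) (.loop (.ilt (.var x) (.var b))
    (.seq P (.iset x (.add (.var x) (.const 1)))))

/-- The state after an assignment to a variable for natural numbers. -/
abbrev State.setI (σ : State) (x v : ℕ) : State := { σ with ivar := Function.update σ.ivar x v }

theorem Agree.setI {x b : ℕ} {P : Prog} (σ : State) (v : ℕ) : Agree (forP x b P) σ (σ.setI x v) := by
  refine ⟨fun y hy => Function.update_of_ne ?_ _ _, fun _ _ => rfl, fun _ => rfl, fun _ => rfl,
    fun _ => rfl⟩
  rintro rfl
  simp [forP, Prog.wI] at hy

theorem Agree.forP {x b : ℕ} {P : Prog} {σ σ' : State} (h : Agree P σ σ') :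
    Agree (forP x b P) σ σ' := by
  have := ((h.seq_left (Q := .iset x (.add (.var x) (.const 1)))).loop
    (b := .ilt (.var x) (.var b))).seq_right (P := .iset x (.const 0))
  exact this

/-- A counting loop. Besides the invariant `J`, everything that does not occur as a target in the
program is known to be unchanged. -/
theorem Runs.forP {E : Env} {x b : ℕ} {P : Prog} {T N : ℕ} {σ : State} (J : ℕ → State → Prop)
    (hN : σ.ivar b = N) (hw : N + 1 ≤ E.word) (hx : P.wI x = false) (hb : P.wI b = false)
    (hxb : x ≠ b) (h0 : J 0 (σ.setI x 0))
    (hstep : ∀ k < N, ∀ σ', Agree (forP x b P) σ σ' → σ'.ivar x = k → J k σ' →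
      Runs E P σ' T fun σ'' => J (k + 1) (σ''.setI x (k + 1))) :
    Runs E (RealRAM.forP x b P) σ (N * (T + 8) + 6)
      fun σ' => Agree (RealRAM.forP x b P) σ σ' ∧ σ'.ivar x = N ∧ J N σ' := by
  have hfb : (RealRAM.forP x b P).wI b = false := by
    simp [RealRAM.forP, Prog.wI, hb, hxb]
  refine Runs.mono (T := 2 + (N * (4 + (T + 4)) + 4)) ?_ (by
    rw [show N * (4 + (T + 4)) = N * (T + 8) by ring]; omega) fun _ h => h
  refine Runs.seq (Q := fun σ' => Agree (RealRAM.forP x b P) σ σ' ∧ σ'.ivar x = 0 ∧ J 0 σ') ?_ ?_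
  · exact Runs.block (Nat.zero_le _) le_rfl ⟨Agree.setI σ 0, Function.update_self _ _ _, h0⟩
  · rintro σ₁ ⟨h1, h2, h3⟩
    refine Runs.loop (b := .ilt (.var x) (.var b))
      (fun k σ' => Agree (RealRAM.forP x b P) σ σ' ∧ σ'.ivar x = k ∧ J k σ') ?_ ?_ ⟨h1, h2, h3⟩
    · rintro k hk σ' ⟨h4, h5, -⟩
      have hb' : σ'.ivar b = N := (h4.i b hfb).trans hN
      refine ⟨⟨?_, ?_⟩, ?_⟩
      · show σ'.ivar x ≤ E.word; omega
      · show σ'.ivar b ≤ E.word; omega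
      · show σ'.ivar x < σ'.ivar b ↔ k < N; rw [h5, hb']
    · rintro k hk σ' ⟨h4, h5, h6⟩
      refine Runs.seq (hstep k hk σ' h4 h5 h6).agree ?_
      rintro σ'' ⟨h7, h8⟩
      have hx' : σ''.ivar x = k := (h7.i x hx).trans h5
      have hden : (Prog.iset x (.add (.var x) (.const 1))).den E σ'' = σ''.setI x (k + 1) := by
        show σ''.setI x (σ''.ivar x + 1) = _
        rw [hx']
      refine Runs.block ⟨?_, ?_, ?_⟩ le_rfl ?_
      · show σ''.ivar x ≤ E.word; omega
      · show 1 ≤ E.word; omega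
      · show σ''.ivar x + 1 ≤ E.word; omega
      · rw [hden]
        exact ⟨(h4.trans h7.forP).trans (Agree.setI _ _), Function.update_self _ _ _, h8⟩

end RealRAM

namespace RealRAM

open Korobov (kern primes)

/-! ### The conventions for the variables and the memory

The programs use the following variables for natural numbers: `0` for `n`, `1` for `d`, `2` for the
number of primes, `3` for the length `L` of the Fourier transforms, `4` for the mode; `5` for the
current component, `6` and `7` for the index of the current prime `p` and `p` itself, `8` for a
generator modulo `p`; `9` and `10` for the index of another prime `q` and `q` itself, `11` and `12`
for the indices `l < q` and `k < p` of points of the lattices, `13` for powers of the generator,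
`14` for their exponents, `15` for residues; `23`, `24` and `25` for the best residue so far, the
rank of a residue, and whether a residue has been found; `26` for `p - 1`, `27` for the residue of
the current component modulo `q`; the others are auxiliary. The real variable `0` holds `τ`, `1` a
kernel product, `3` the weight of the contribution of `q`, and `4` the contribution of the smaller
primes to the criterion at the residue `0`.

The real memory consists of seven regions of length `L`, and the table of the kernel products in the
first mode. Region `0` holds sums of power spectra, `1` and `2` the real and imaginary parts of a
vector, `3` and `4` are used by the Fourier transform, `5` and `6` hold the values of `θ` and `T`.
-/

infixl:65 "+ᵢ" => IExp.add
infixl:65 "-ᵢ" => IExp.sub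
infixl:70 "*ᵢ" => IExp.mul
infixl:70 "/ᵢ" => IExp.div
infixl:70 "%ᵢ" => IExp.mod
infixl:65 "+ᵣ" => RExp.add
infixl:65 "-ᵣ" => RExp.sub
infixl:70 "*ᵣ" => RExp.mul
infixl:70 "/ᵣ" => RExp.div
infixr:50 ";;" => Prog.seq
prefix:max "‡" => IExp.var
prefix:max "♯" => IExp.const
prefix:max "§" => RExp.var

/-- The numerical data of a run and the limits of the machine: `P 0 < P 1 < … < P (NP - 1)` are the
primes in `(n/2, n]`, and `L` is the length of the Fourier transforms. -/
structure Setup (E : Env) (n d NP L md : ℕ) (P : ℕ → ℕ) : Prop where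
  two_le : 2 ≤ n
  one_le : 1 ≤ d
  alpha : 1 / 2 < E.α
  gamma : ∀ j, 0 < E.γ j
  NP_le : NP ≤ n
  NP_pos : 0 < NP
  mem_primes : ∀ i < NP, P i ∈ primes n
  mono : ∀ i j, i < j → j < NP → P i < P j
  surj : ∀ q ∈ primes n, ∃ i < NP, P i = q
  L_ge : 5 * n ≤ L
  L_le : L ≤ 10 * n
  L_pow : L = 2 ^ Nat.log 2 L
  mode : md ≤ 1
  word : 10000 * (n ^ 4 * d) ≤ E.word
  mem : 7 * L ≤ E.mem
  weights : E.d = d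

/-- The variables `0, …, 4` for natural numbers hold `n`, `d`, the number of primes, `L` and the
mode (`1` if the kernel products are stored in a table), the variable `0` for real numbers holds
`τ`, and the primes are stored in the memory for natural numbers. -/
structure Base (n d NP L md : ℕ) (τ : ℝ) (P : ℕ → ℕ) (σ : State) : Prop where
  iv0 : σ.ivar 0 = n
  iv1 : σ.ivar 1 = d
  iv2 : σ.ivar 2 = NP
  iv3 : σ.ivar 3 = L
  iv4 : σ.ivar 4 = md
  rv0 : σ.rvar 0 = τ
  im : ∀ i < NP, σ.imem i = P i

/-- The program does not change what `Base` is about. -/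
def Prog.keeps (P : Prog) : Bool :=
  !P.wI 0 && !P.wI 1 && !P.wI 2 && !P.wI 3 && !P.wI 4 && !P.wR 0 && !P.wIMem

theorem Base.agree {n d NP L md : ℕ} {τ : ℝ} {P : ℕ → ℕ} {σ σ' : State} {Q : Prog}
    (h : Base n d NP L md τ P σ) (hA : Agree Q σ σ') (hQ : Q.keeps = true) :
    Base n d NP L md τ P σ' := by
  simp only [Prog.keeps, Bool.and_eq_true, Bool.not_eq_true'] at hQ
  obtain ⟨⟨⟨⟨⟨⟨h0, h1⟩, h2⟩, h3⟩, h4⟩, h5⟩, h6⟩ := hQ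
  exact ⟨(hA.i 0 h0).trans h.iv0, (hA.i 1 h1).trans h.iv1, (hA.i 2 h2).trans h.iv2,
    (hA.i 3 h3).trans h.iv3, (hA.i 4 h4).trans h.iv4, (hA.r 0 h5).trans h.rv0,
    fun i hi => by rw [hA.im h6]; exact h.im i hi⟩

/-- The list consists of the first `len` of the residues `ρ`, ordered by components and primes. -/
structure OutIs (NP : ℕ) (P : ℕ → ℕ) (ρ : ℕ → ℕ → ℕ) (len : ℕ) (o : List ℕ) : Prop where
  eq : o = (List.range len).map fun a => ρ (a / NP) (P (a % NP))
  lt : ∀ j i, i < NP → ρ j (P i) < P i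

theorem OutIs.length {NP : ℕ} {P : ℕ → ℕ} {ρ : ℕ → ℕ → ℕ} {len : ℕ} {o : List ℕ}
    (h : OutIs NP P ρ len o) : o.length = len := by simp [h.eq]

theorem OutIs.get {NP : ℕ} {P : ℕ → ℕ} {ρ : ℕ → ℕ → ℕ} {len : ℕ} {o : List ℕ}
    (h : OutIs NP P ρ len o) {j i : ℕ} (hi : i < NP) (hl : j * NP + i < len) :
    o.getD (j * NP + i) 0 = ρ j (P i) := by
  rw [h.eq, List.getD_eq_getElem _ _ (by simpa using hl), List.getElem_map, List.getElem_range]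
  congr 2
  · rw [mul_comm, Nat.mul_add_div (by omega), Nat.div_eq_of_lt hi, add_zero]
  · rw [mul_comm, Nat.mul_add_mod, Nat.mod_eq_of_lt hi]

/-- The kernel product for the first `s` components and the primes with indices `i` and `j`. -/
noncomputable def Env.W (E : Env) (P : ℕ → ℕ) (ρ : ℕ → ℕ → ℕ) (s i j k l : ℕ) : ℝ :=
  kern E.α E.γ s (P i) (P j) (fun t => ρ t (P i)) (fun t => ρ t (P j)) k l

/-- The part of the memory from `7 L` on holds the kernel products, decreased by one: in this form
the empty memory is the correct table for `s = 0`. The address is a number in mixed radix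
representation with the digits `i`, `j`, `k`, `l`. -/
def TabOK (E : Env) (NP n L : ℕ) (P : ℕ → ℕ) (ρ : ℕ → ℕ → ℕ) (s : ℕ) (rm : ℕ → ℝ) : Prop :=
  NP * NP * n * n + 7 * L ≤ E.mem ∧ ∀ a < NP * NP * n * n, rm (7 * L + a) + 1 =
    E.W P ρ s (a / n / n / NP) (a / n / n % NP) (a / n % n) (a % n)

theorem digits_lt {NP n i j k l : ℕ} (hi : i < NP) (hj : j < NP) (hk : k < n) (hl : l < n) :
    ((i * NP + j) * n + k) * n + l < NP * NP * n * n := by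
  have h1 : i * NP + j + 1 ≤ NP * NP := by
    calc i * NP + j + 1 ≤ i * NP + NP := by omega
      _ = (i + 1) * NP := by ring
      _ ≤ NP * NP := Nat.mul_le_mul_right _ hi
  have h2 : (i * NP + j) * n + k + 1 ≤ NP * NP * n := by
    calc (i * NP + j) * n + k + 1 ≤ (i * NP + j) * n + n := by omega
      _ = (i * NP + j + 1) * n := by ring
      _ ≤ NP * NP * n := Nat.mul_le_mul_right _ h1
  calc ((i * NP + j) * n + k) * n + l + 1 ≤ ((i * NP + j) * n + k) * n + n := by omega
    _ = ((i * NP + j) * n + k + 1) * n := by ring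
    _ ≤ NP * NP * n * n := Nat.mul_le_mul_right _ h2

theorem mul_add_div_of_lt {a b c : ℕ} (h : c < b) : (a * b + c) / b = a := by
  rw [mul_comm, Nat.mul_add_div (by omega), Nat.div_eq_of_lt h, add_zero]

theorem mul_add_mod_of_lt {a b c : ℕ} (h : c < b) : (a * b + c) % b = c := by
  rw [mul_comm, Nat.mul_add_mod, Nat.mod_eq_of_lt h]

theorem TabOK.get {E : Env} {NP n L : ℕ} {P : ℕ → ℕ} {ρ : ℕ → ℕ → ℕ} {s : ℕ} {rm : ℕ → ℝ}
    (h : TabOK E NP n L P ρ s rm) {i j k l : ℕ} (hi : i < NP) (hj : j < NP) (hk : k < n)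
    (hl : l < n) : rm (7 * L + (((i * NP + j) * n + k) * n + l)) + 1 = E.W P ρ s i j k l := by
  rw [h.2 _ (digits_lt hi hj hk hl), mul_add_div_of_lt hl, mul_add_mod_of_lt hl,
    mul_add_div_of_lt hk, mul_add_mod_of_lt hk, mul_add_div_of_lt hj, mul_add_mod_of_lt hj]

/-- The setting in the step for the component with index `s`, when `len` residues are known. -/
structure Ctx (E : Env) (n d NP L md : ℕ) (τ : ℝ) (P : ℕ → ℕ) (ρ : ℕ → ℕ → ℕ) (s len : ℕ)
    (σ : State) : Prop extends Base n d NP L md τ P σ where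
  out : OutIs NP P ρ len σ.out
  iv5 : σ.ivar 5 = s
  lt : s < d
  len_ge : s * NP ≤ len
  tab : md = 1 → TabOK E NP n L P ρ s σ.rmem

/-- The real memory is the same outside of `[lo, hi)`. -/
def Same (lo hi : ℕ) (σ σ' : State) : Prop := ∀ a, a < lo ∨ hi ≤ a → σ'.rmem a = σ.rmem a

theorem Same.trans {lo hi : ℕ} {σ₁ σ₂ σ₃ : State} (h : Same lo hi σ₁ σ₂) (h' : Same lo hi σ₂ σ₃) :
    Same lo hi σ₁ σ₃ := fun a ha => (h' a ha).trans (h a ha)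

theorem Same.mono {lo hi lo' hi' : ℕ} {σ σ' : State} (h : Same lo hi σ σ') (h1 : lo' ≤ lo)
    (h2 : hi ≤ hi') : Same lo' hi' σ σ' := fun a ha => h a (by omega)

theorem Agree.same {Q : Prog} {σ σ' : State} (h : Agree Q σ σ') (hQ : Q.wRMem = false)
    (lo hi : ℕ) : Same lo hi σ σ' := fun _ _ => by rw [h.rm hQ]

theorem Ctx.agree {E : Env} {n d NP L md : ℕ} {τ : ℝ} {P : ℕ → ℕ} {ρ : ℕ → ℕ → ℕ} {s len : ℕ}
    {σ σ' : State} {Q : Prog} (h : Ctx E n d NP L md τ P ρ s len σ) (hA : Agree Q σ σ')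
    (hQ : (Q.keeps && !Q.wI 5 && !Q.wOut) = true) (hs : Same 0 (7 * L) σ σ') :
    Ctx E n d NP L md τ P ρ s len σ' := by
  simp only [Bool.and_eq_true, Bool.not_eq_true'] at hQ
  obtain ⟨⟨h1, h2⟩, h3⟩ := hQ
  refine ⟨h.toBase.agree hA h1, by rw [hA.o h3]; exact h.out, (hA.i 5 h2).trans h.iv5, h.lt,
    h.len_ge, fun hmd => ⟨(h.tab hmd).1, fun a ha => ?_⟩⟩
  rw [hs _ (Or.inr (Nat.le_add_right _ _))]
  exact (h.tab hmd).2 a ha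

section Setup

variable {E : Env} {n d NP L md : ℕ} {P : ℕ → ℕ}

theorem Setup.prime (h : Setup E n d NP L md P) {i : ℕ} (hi : i < NP) : (P i).Prime :=
  (Korobov.mem_primes.1 (h.mem_primes i hi)).1

theorem Setup.le (h : Setup E n d NP L md P) {i : ℕ} (hi : i < NP) : P i ≤ n :=
  (Korobov.mem_primes.1 (h.mem_primes i hi)).2.2

theorem Setup.le_pow (h : Setup E n d NP L md P) : n ≤ n ^ 4 ∧ d ≤ n ^ 4 * d ∧ n ^ 4 ≤ n ^ 4 * d ∧
    n * d ≤ n ^ 4 * d := by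
  have h1 : 1 ≤ n ^ 4 := Nat.one_le_pow _ _ (by have := h.two_le; omega)
  have h2 : n ≤ n ^ 4 := Nat.le_self_pow (by norm_num) n
  exact ⟨h2, Nat.le_mul_of_pos_left _ h1, Nat.le_mul_of_pos_right _ h.one_le,
    Nat.mul_le_mul_right _ h2⟩

theorem mul3_le {a b c n : ℕ} (ha : a ≤ n) (hb : b ≤ n) (hc : c ≤ n) (hn : 1 ≤ n) :
    a * b * c ≤ n ^ 4 :=
  calc a * b * c ≤ n * n * n := Nat.mul_le_mul (Nat.mul_le_mul ha hb) hc
    _ = n ^ 3 := by ring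
    _ ≤ n ^ 4 := Nat.pow_le_pow_right hn (by norm_num)

theorem mul2_le {a b n : ℕ} (ha : a ≤ n) (hb : b ≤ n) (hn : 1 ≤ n) : a * b ≤ n ^ 4 := by
  simpa using mul3_le ha hb hn hn

/-- The address of a residue in the output. -/
theorem Setup.addr (h : Setup E n d NP L md P) {t i : ℕ} (ht : t < d) (hi : i < NP) :
    t * NP + i ≤ n ^ 4 * d ∧ t * NP ≤ n ^ 4 * d := by
  have h1 : (t + 1) * NP ≤ d * n := Nat.mul_le_mul ht h.NP_le
  have h2 : n * d ≤ n ^ 4 * d := h.le_pow.2.2.2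
  rw [Nat.succ_mul, mul_comm d] at h1
  omega

end Setup

/-! ### Access to the kernel products -/

/-- The number of operations for access to a kernel product, up to a factor: one if there is a
table, else the product is computed. -/
def gT (md s : ℕ) : ℕ := if md = 1 then 1 else s + 1

theorem one_le_gT (md s : ℕ) : 1 ≤ gT md s := by unfold gT; split <;> omega

/-- The argument of `σ_α` for the component with index `x`, at the indices `k` (variable `12`) and
`l` (variable `11`). -/
def argI (x : IExp) : IExp :=
  ‡12 *ᵢ .output (x *ᵢ ‡2 +ᵢ ‡6) *ᵢ ‡10 +ᵢ ‡11 *ᵢ .output (x *ᵢ ‡2 +ᵢ ‡9) *ᵢ ‡7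

/-- One plus the weighted kernel value of the component with index `x`. -/
def factorR (x : IExp) : RExp :=
  .ofNat ♯1 +ᵣ .weight x *ᵣ .weight x *ᵣ .sigma (argI x) (‡7 *ᵢ ‡10)

/-- The address of the kernel product in the table. -/
def addrI : IExp := ♯7 *ᵢ ‡3 +ᵢ (((‡6 *ᵢ ‡2 +ᵢ ‡9) *ᵢ ‡0 +ᵢ ‡12) *ᵢ ‡0 +ᵢ ‡11)

/-- The kernel product for the first `s` components (variable `5`) at the primes with the indices
`i` and `j` (variables `6` and `9`) and the point `k`, `l` is put into the variable `1`. -/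
def getW : Prog :=
  .cond (.ieq ‡4 ♯1) (.rset 1 (.load addrI +ᵣ .ofNat ♯1))
    (.rset 1 (.ofNat ♯1) ;; forP 21 5 (.rset 1 (§1 *ᵣ factorR ‡21)))

/-- The variables which determine a kernel product. -/
structure At (n NP : ℕ) (P : ℕ → ℕ) (i j k l : ℕ) (σ : State) : Prop where
  iv6 : σ.ivar 6 = i
  iv7 : σ.ivar 7 = P i
  iv9 : σ.ivar 9 = j
  iv10 : σ.ivar 10 = P j
  iv12 : σ.ivar 12 = k
  iv11 : σ.ivar 11 = l
  hi : i < NP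
  hj : j < NP
  hk : k < n
  hl : l < n

theorem At.agree {n NP : ℕ} {P : ℕ → ℕ} {i j k l : ℕ} {σ σ' : State} {Q : Prog}
    (h : At n NP P i j k l σ) (hA : Agree Q σ σ')
    (hQ : (!Q.wI 6 && !Q.wI 7 && !Q.wI 9 && !Q.wI 10 && !Q.wI 11 && !Q.wI 12) = true) :
    At n NP P i j k l σ' := by
  simp only [Bool.and_eq_true, Bool.not_eq_true'] at hQ
  obtain ⟨⟨⟨⟨⟨h1, h2⟩, h3⟩, h4⟩, h5⟩, h6⟩ := hQ
  exact ⟨(hA.i _ h1).trans h.iv6, (hA.i _ h2).trans h.iv7, (hA.i _ h3).trans h.iv9,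
    (hA.i _ h4).trans h.iv10, (hA.i _ h6).trans h.iv12, (hA.i _ h5).trans h.iv11, h.hi, h.hj,
    h.hk, h.hl⟩

section getW

variable {E : Env} {n d NP L md : ℕ} {τ : ℝ} {P : ℕ → ℕ} {ρ : ℕ → ℕ → ℕ} {s i j k l len : ℕ}
  {σ : State}

theorem factorR_spec (hS : Setup E n d NP L md P) (hB : Base n d NP L md τ P σ)
    (hO : OutIs NP P ρ len σ.out) (hat : At n NP P i j k l σ) {x : IExp} {t : ℕ}
    (hx : x.Safe E σ) (hxt : x.eval σ = t) (ht : (t + 1) * NP ≤ len) (hd : t < d) :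
    (factorR x).Safe E σ ∧ (factorR x).eval E σ = 1 + E.γ t ^ 2 * Korobov.sigma E.α
      (((k * ρ t (P i) * P j + l * ρ t (P j) * P i : ℕ) : ℝ) / ((P i * P j : ℕ) : ℝ)) := by
  obtain ⟨iv6, iv7, iv9, iv10, iv12, iv11, hi, hj, hk, hl⟩ := hat
  have hti : t * NP + i < len := by rw [Nat.succ_mul] at ht; omega
  have htj : t * NP + j < len := by rw [Nat.succ_mul] at ht; omega
  have e1 := hO.get hi hti
  have e2 := hO.get hj htj
  have l1 := (hO.lt t i hi).le.trans (hS.le hi)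
  have l2 := (hO.lt t j hj).le.trans (hS.le hj)
  have pi := hS.le hi
  have pj := hS.le hj
  have hNP := hS.NP_le
  have h2 := hS.two_le
  obtain ⟨hn, hd', hn4, -⟩ := hS.le_pow
  have b1 : k * ρ t (P i) * P j ≤ n ^ 4 := mul3_le hk.le l1 pj (by omega)
  have b2 : l * ρ t (P j) * P i ≤ n ^ 4 := mul3_le hl.le l2 pi (by omega)
  have b3 : k * ρ t (P i) ≤ n ^ 4 := mul2_le hk.le l1 (by omega)
  have b4 : l * ρ t (P j) ≤ n ^ 4 := mul2_le hl.le l2 (by omega)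
  have b5 : P i * P j ≤ n ^ 4 := mul2_le pi pj (by omega)
  obtain ⟨b6, b7⟩ := hS.addr hd hi
  obtain ⟨b8, -⟩ := hS.addr hd hj
  have W := hS.word
  have pij : P i * P j ≠ 0 := mul_ne_zero (hS.prime hi).ne_zero (hS.prime hj).ne_zero
  constructor
  · simp only [factorR, argI, RExp.Safe, IExp.Safe, IExp.eval, hx, hxt, iv6, iv7, iv9, iv10, iv11,
      iv12, hB.iv2, e1, e2, hS.weights, hO.length, true_and, ne_eq]
    repeat' apply And.intro
    all_goals first | assumption | omega
  · simp only [factorR, argI, RExp.eval, IExp.eval, hxt, iv6, iv7, iv9, iv10, iv11, iv12, hB.iv2,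
      e1, e2]
    push_cast; ring

theorem getW_spec (hS : Setup E n d NP L md P) (hC : Ctx E n d NP L md τ P ρ s len σ)
    (hat : At n NP P i j k l σ) :
    Runs E getW σ (100 * gT md s) fun σ' => σ'.rvar 1 = E.W P ρ s i j k l := by
  have hB := hC.toBase
  obtain ⟨hn, hd', hn4, -⟩ := hS.le_pow
  have W := hS.word
  have h2 := hS.two_le
  have hmode := hS.mode
  by_cases hmd : md = 1
  · have hT := hC.tab hmd
    refine Runs.mono (T := 4 + 60) (Runs.cond ?_ (fun _ => ?_) fun h => ?_)
      (by rw [gT, if_pos hmd]; omega) fun _ h => h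
    · simp only [BExp.Safe, IExp.Safe, hB.iv4]; omega
    · have := digits_lt hat.hi hat.hj hat.hk hat.hl
      have := hT.1
      have hLn := hS.L_le
      have hi := hat.hi
      have hj := hat.hj
      have hk := hat.hk
      have hl := hat.hl
      have hNP := hS.NP_le
      have b0 : NP * NP * n * n ≤ n ^ 4 :=
        calc NP * NP * n * n ≤ n * n * n * n := by gcongr
          _ = n ^ 4 := by ring
      have a1 : i * NP ≤ i * NP + j := Nat.le_add_right _ _
      have a2 : i * NP + j ≤ (i * NP + j) * n := Nat.le_mul_of_pos_right _ (by omega)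
      have a3 : (i * NP + j) * n + k ≤ ((i * NP + j) * n + k) * n :=
        Nat.le_mul_of_pos_right _ (by omega)
      refine Runs.block ?_ (by simp [Prog.time, RExp.cost, IExp.cost, addrI]) ?_
      · simp only [Prog.Ok, RExp.Safe, addrI, IExp.Safe, IExp.eval, hB.iv3, hat.iv6, hB.iv2,
          hat.iv9, hB.iv0, hat.iv12, hat.iv11]
        repeat' apply And.intro
        all_goals omega
      · simp only [Prog.den, Function.update_self, RExp.eval, addrI, IExp.eval, hB.iv3, hat.iv6,
          hB.iv2, hat.iv9, hB.iv0, hat.iv12,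
          hat.iv11, Nat.cast_one]
        exact hT.get hat.hi hat.hj hat.hk hat.hl
    · exact absurd hB.iv4 (by rw [hmd]; exact h)
  · refine Runs.mono (T := 4 + (3 + (s * (60 + 8) + 6))) (Runs.cond ?_ (fun h => ?_) fun _ => ?_)
      (by rw [gT, if_neg hmd]; omega) fun _ h => h
    · simp only [BExp.Safe, IExp.Safe, hB.iv4]; omega
    · exact absurd (hB.iv4.symm.trans h) hmd
    · refine Runs.seq (Q := fun σ' => Agree (.rset 1 (.ofNat ♯1)) σ σ' ∧ σ'.rvar 1 = 1) ?_ ?_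
      · refine (Runs.block ?_ (by simp [Prog.time, RExp.cost, IExp.cost]) ?_).agree
        · simp only [Prog.Ok, RExp.Safe, IExp.Safe]; omega
        · simp [Prog.den, RExp.eval, IExp.eval]
      · rintro σ₁ ⟨hA, h1⟩
        have hC1 := hC.agree hA rfl (hA.same rfl _ _)
        have hat1 := hat.agree hA rfl
        have hsd := hC.lt
        refine (Runs.forP (J := fun t σ' => σ'.rvar 1 = E.W P ρ t i j k l) (N := s) hC1.iv5
          (by omega) rfl rfl (by norm_num) ?_ ?_).mono le_rfl fun _ h => h.2.2
        · simpa [Env.W, kern] using h1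
        · intro t ht σ₂ hA2 h21 hJ
          have hC2 := hC1.agree hA2 rfl (hA2.same rfl _ _)
          have hat2 := hat1.agree hA2 rfl
          obtain ⟨f1, f2⟩ := factorR_spec hS hC2.toBase hC2.out hat2 (x := ‡21) (t := t)
            (by show σ₂.ivar 21 ≤ _; omega) h21
            (le_trans (Nat.mul_le_mul_right _ ht) hC2.len_ge) (by omega)
          refine Runs.block ⟨trivial, f1⟩
            (by simp [Prog.time, RExp.cost, IExp.cost, factorR, argI]) ?_
          show Function.update σ₂.rvar 1 (σ₂.rvar 1 * (factorR ‡21).eval E σ₂) 1 = _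
          rw [Function.update_self, f2, hJ, Env.W, Env.W, kern, kern, Finset.prod_range_succ]

end getW

end RealRAM

namespace RealRAM

open Korobov (subDFT subDFT_one subDFT_two_mul turn turn_re turn_im)

/-! ### The fast Fourier transform -/

/-- The address of a cell in the region with number `r`; all regions have the length `L`. -/
def cell (r : ℕ) (a : IExp) : IExp := ♯r *ᵢ ‡3 +ᵢ a

/-- The complex number with the given addresses of its real and its imaginary part. -/
def State.cx (σ : State) (a b : ℕ) : ℂ := ⟨σ.rmem a, σ.rmem b⟩

/-- One output value of a stage of the transform, for the index in variable `18`. -/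
def fftPoint : Prog :=
  .iset 19 (‡18 /ᵢ ‡17) ;;
  .iset 20 ((‡19 %ᵢ ‡16) *ᵢ (♯2 *ᵢ ‡17) +ᵢ ‡18 %ᵢ ‡17) ;;
  .rset 6 (.load (cell 1 ‡20) +ᵣ (.cosTurn ‡19 (♯2 *ᵢ ‡16) *ᵣ .load (cell 1 (‡20 +ᵢ ‡17)) -ᵣ
    .sinTurn ‡19 (♯2 *ᵢ ‡16) *ᵣ .load (cell 2 (‡20 +ᵢ ‡17)))) ;;
  .rset 7 (.load (cell 2 ‡20) +ᵣ (.cosTurn ‡19 (♯2 *ᵢ ‡16) *ᵣ .load (cell 2 (‡20 +ᵢ ‡17)) +ᵣ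
    .sinTurn ‡19 (♯2 *ᵢ ‡16) *ᵣ .load (cell 1 (‡20 +ᵢ ‡17)))) ;;
  .rstore (cell 3 ‡18) §6 ;;
  .rstore (cell 4 ‡18) §7

/-- The result of a stage is copied back, here for the index in variable `18`. -/
def fftCopy : Prog :=
  .rstore (cell 1 ‡18) (.load (cell 3 ‡18)) ;; .rstore (cell 2 ‡18) (.load (cell 4 ‡18))

/-- The transforms of length `T` (variable `16`) are combined to those of length `2 T`. -/
def fftStage : Prog :=
  .iset 17 (‡3 /ᵢ (♯2 *ᵢ ‡16)) ;; forP 18 3 fftPoint ;; forP 18 3 fftCopy ;;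
  .iset 16 (♯2 *ᵢ ‡16)

/-- The discrete Fourier transform of the complex vector in the regions `1` and `2`. -/
def fft : Prog := .iset 16 ♯1 ;; .loop (.ilt ‡16 ‡3) fftStage

section fft

variable {E : Env} {n d NP L md : ℕ} {P : ℕ → ℕ} {σ : State}

theorem cx_update {σ : State} {rm : ℕ → ℝ} {a b i m : ℕ} {v w : ℝ} {L : ℕ} (hi : i < L)
    (hm : m < L) (hab : a + L ≤ b)
    (h : σ.rmem = Function.update (Function.update rm (a + i) v) (b + i) w) :
    σ.cx (a + m) (b + m) = if m = i then ⟨v, w⟩ else ⟨rm (a + m), rm (b + m)⟩ := by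
  have h1 : a + m ≠ b + i := by omega
  have h2 : b + m ≠ a + i := by omega
  rw [State.cx, h, Function.update_of_ne h1]
  split_ifs with h3
  · subst h3; rw [Function.update_self, Function.update_self]
  · rw [Function.update_of_ne (by omega), Function.update_of_ne (by omega),
      Function.update_of_ne (by omega)]

theorem same_update {σ σ' : State} {lo hi a b : ℕ} {v w : ℝ} (ha : lo ≤ a ∧ a < hi)
    (hb : lo ≤ b ∧ b < hi)
    (h : σ'.rmem = Function.update (Function.update σ.rmem a v) b w) : Same lo hi σ σ' := by
  intro x hx
  rw [h, Function.update_of_ne (by omega), Function.update_of_ne (by omega)]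

/-- One butterfly: the entry at `k * H + b` becomes the value `subDFT x (2 * T) H k b`. -/
theorem fftPoint_spec (hS : Setup E n d NP L md P) {T H idx : ℕ} (h3 : σ.ivar 3 = L)
    (h16 : σ.ivar 16 = T) (h17 : σ.ivar 17 = H) (h18 : σ.ivar 18 = idx) (hTH : T * (2 * H) = L)
    (hidx : idx < L) {x : ℕ → ℂ}
    (hD : ∀ k < T, ∀ b < 2 * H,
      σ.cx (L + (k * (2 * H) + b)) (2 * L + (k * (2 * H) + b)) = subDFT x T (2 * H) k b) :
    Runs E fftPoint σ 200 fun σ' => Same (3 * L) (5 * L) σ σ' ∧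
      ∀ m < L, σ'.cx (3 * L + m) (4 * L + m) = if m = idx then
        subDFT x (2 * T) H (idx / H) (idx % H) else σ.cx (3 * L + m) (4 * L + m) := by
  have hL := hS.L_ge
  have hL' := hS.L_le
  have hn := hS.le_pow
  have hw := hS.word
  have hm := hS.mem
  have h2 := hS.two_le
  have hH : 0 < H := Nat.pos_of_ne_zero fun h => by subst h; omega
  have hT : 0 < T := Nat.pos_of_ne_zero fun h => by subst h; omega
  have hHL : 2 * H ≤ L := hTH ▸ Nat.le_mul_of_pos_left _ hT
  have hTL : 2 * T ≤ L := by
    rw [← hTH, show T * (2 * H) = 2 * T * H by ring]; exact Nat.le_mul_of_pos_right _ hH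
  have hk : idx / H % T < T := Nat.mod_lt _ hT
  have hb : idx % H < H := Nat.mod_lt _ hH
  have hkH : idx / H ≤ idx := Nat.div_le_self _ _
  have ha : idx / H % T * (2 * H) + 2 * H ≤ L := by
    rw [← hTH, ← Nat.succ_mul]; exact Nat.mul_le_mul_right _ hk
  have d1 := hD _ hk (idx % H) (by omega)
  have d2 := hD _ hk (idx % H + H) (by omega)
  set a := idx / H % T * (2 * H) with haa
  have key : ∀ σ' : State, σ'.rmem = Function.update (Function.update σ.rmem (3 * L + idx)
      (subDFT x (2 * T) H (idx / H) (idx % H)).re) (4 * L + idx)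
      (subDFT x (2 * T) H (idx / H) (idx % H)).im → Same (3 * L) (5 * L) σ σ' ∧
      ∀ m < L, σ'.cx (3 * L + m) (4 * L + m) = if m = idx then
        subDFT x (2 * T) H (idx / H) (idx % H) else σ.cx (3 * L + m) (4 * L + m) := by
    intro σ' h
    refine ⟨same_update (by omega) (by omega) h, fun m hm => ?_⟩
    rw [cx_update hidx hm (by omega) h]; rfl
  refine Runs.block ?_ (by simp [fftPoint, Prog.time, RExp.cost, IExp.cost, cell]) (key _ ?_)
  · simp only [fftPoint, Prog.Ok, RExp.Safe, IExp.Safe, cell, Prog.den, IExp.eval,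
      Function.update_apply, h3, h16, h17, h18, Nat.reduceEqDiff, if_false,
      if_true, ← haa]
    repeat' apply And.intro
    all_goals first | trivial | omega
  · rw [subDFT_two_mul x hT]
    rw [Complex.ext_iff, State.cx] at d1 d2
    simp only [fftPoint, Prog.den, IExp.eval, RExp.eval, cell, Function.update_apply, h3, h16, h17,
      h18, Nat.reduceEqDiff, if_false, if_true, ← haa, one_mul, add_assoc,
      Complex.add_re, Complex.add_im, Complex.mul_re, Complex.mul_im, turn_re, turn_im, ← d1.1,
      ← d1.2, ← d2.1, ← d2.2]

theorem fftCopy_spec (hS : Setup E n d NP L md P) {idx : ℕ} (h3 : σ.ivar 3 = L)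
    (h18 : σ.ivar 18 = idx) (hidx : idx < L) :
    Runs E fftCopy σ 30 fun σ' => Same L (3 * L) σ σ' ∧
      ∀ m < L, σ'.cx (L + m) (2 * L + m) = if m = idx then
        σ.cx (3 * L + idx) (4 * L + idx) else σ.cx (L + m) (2 * L + m) := by
  have hL := hS.L_ge
  have hL' := hS.L_le
  have hn := hS.le_pow
  have hw := hS.word
  have hm := hS.mem
  have key : ∀ σ' : State, σ'.rmem = Function.update (Function.update σ.rmem (L + idx)
      (σ.rmem (3 * L + idx))) (2 * L + idx) (σ.rmem (4 * L + idx)) → Same L (3 * L) σ σ' ∧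
      ∀ m < L, σ'.cx (L + m) (2 * L + m) = if m = idx then
        σ.cx (3 * L + idx) (4 * L + idx) else σ.cx (L + m) (2 * L + m) := by
    intro σ' h
    refine ⟨same_update (by omega) (by omega) h, fun m hm => ?_⟩
    rw [cx_update hidx hm (by omega) h]; rfl
  refine Runs.block ?_ (by simp [fftCopy, Prog.time, RExp.cost, IExp.cost, cell]) (key _ ?_)
  · simp only [fftCopy, Prog.Ok, RExp.Safe, IExp.Safe, cell, Prog.den, IExp.eval, h3, h18]
    repeat' apply And.intro
    all_goals omega
  · have : 4 * L + idx ≠ L + idx := by omega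
    simp only [fftCopy, Prog.den, IExp.eval, RExp.eval, cell, h3, h18, one_mul,
      Function.update_of_ne this]

theorem fftStage_spec (hS : Setup E n d NP L md P) {T H : ℕ} (h3 : σ.ivar 3 = L)
    (h16 : σ.ivar 16 = T) (hTH : T * (2 * H) = L) {x : ℕ → ℂ}
    (hD : ∀ k < T, ∀ b < 2 * H,
      σ.cx (L + (k * (2 * H) + b)) (2 * L + (k * (2 * H) + b)) = subDFT x T (2 * H) k b) :
    Runs E fftStage σ (300 * L) fun σ' => Same L (5 * L) σ σ' ∧ σ'.ivar 16 = 2 * T ∧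
      ∀ k < 2 * T, ∀ b < H,
        σ'.cx (L + (k * H + b)) (2 * L + (k * H + b)) = subDFT x (2 * T) H k b := by
  have hL := hS.L_ge
  have hL' := hS.L_le
  have hn := hS.le_pow
  have hw := hS.word
  have h2 := hS.two_le
  have hH : 0 < H := Nat.pos_of_ne_zero fun h => by subst h; omega
  have hT : 0 < T := Nat.pos_of_ne_zero fun h => by subst h; omega
  have hTL : 2 * T ≤ L := by
    rw [← hTH, show T * (2 * H) = 2 * T * H by ring]; exact Nat.le_mul_of_pos_right _ hH
  have hdiv : L / (2 * T) = H := by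
    rw [← hTH, show T * (2 * H) = 2 * T * H by ring]; exact Nat.mul_div_cancel_left _ (by omega)
  refine Runs.mono (T := 6 + ((L * (200 + 8) + 6) + ((L * (30 + 8) + 6) + 4))) ?_ (by omega)
    fun _ h => h
  refine Runs.seq (Q := fun σ' => Agree (.iset 17 (‡3 /ᵢ (♯2 *ᵢ ‡16))) σ σ' ∧ σ'.ivar 17 = H)
    (Runs.block ?_ (by simp [Prog.time, IExp.cost]) ?_).agree ?_
  · simp only [Prog.Ok, IExp.Safe, h3, h16, IExp.eval]; omega
  · simp only [Prog.den, Function.update_self, IExp.eval, h3, h16, hdiv]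
  rintro σ₁ ⟨hA1, h17⟩
  have hs1 := hA1.same rfl L (5 * L)
  refine Runs.seq (Runs.forP (J := fun i σ' => Same (3 * L) (5 * L) σ₁ σ' ∧
    ∀ m < i, σ'.cx (3 * L + m) (4 * L + m) = subDFT x (2 * T) H (m / H) (m % H)) (N := L)
    ((hA1.i 3 rfl).trans h3) (by omega) rfl rfl (by norm_num) ?_ ?_) ?_
  · exact ⟨fun _ _ => rfl, fun m hm => absurd hm (Nat.not_lt_zero _)⟩
  · rintro i hi σ' hA h18 ⟨hs, hJ⟩
    refine (fftPoint_spec hS (T := T) (H := H) (idx := i) (x := x) (by rw [hA.i 3 rfl, hA1.i 3 rfl, h3])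
      (by rw [hA.i 16 rfl, hA1.i 16 rfl, h16]) (by rw [hA.i 17 rfl, h17]) h18 hTH hi ?_).mono le_rfl ?_
    · intro k hk b hb
      have : k * (2 * H) + b < L := by
        have := Nat.mul_le_mul_right (2 * H) (Nat.succ_le_of_lt hk)
        rw [Nat.succ_mul, hTH] at this; omega
      rw [State.cx, hs _ (by omega), hs _ (by omega), hA1.rm rfl, ← hD k hk b hb]; rfl
    · rintro σ'' ⟨hs', hJ'⟩
      refine ⟨hs.trans hs', fun m hm => ?_⟩
      show σ''.cx _ _ = _
      rw [hJ' m (by omega)]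
      split_ifs with h
      · rw [h]
      · exact hJ m (by omega)
  rintro σ₂ ⟨hA2, -, hs2, hJ2⟩
  have hrm1 : σ₁.rmem = σ.rmem := hA1.rm rfl
  refine Runs.seq (Runs.forP (J := fun i σ' => Same L (3 * L) σ₂ σ' ∧
    ∀ m < i, σ'.cx (L + m) (2 * L + m) = subDFT x (2 * T) H (m / H) (m % H)) (N := L)
    (by rw [hA2.i 3 rfl, hA1.i 3 rfl, h3]) (by omega) rfl rfl (by norm_num) ?_ ?_) ?_
  · exact ⟨fun _ _ => rfl, fun m hm => absurd hm (Nat.not_lt_zero _)⟩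
  · rintro i hi σ' hA h18 ⟨hs, hJ⟩
    refine (fftCopy_spec hS (by rw [hA.i 3 rfl, hA2.i 3 rfl, hA1.i 3 rfl, h3]) h18 hi).mono
      le_rfl ?_
    rintro σ'' ⟨hs', hJ'⟩
    refine ⟨hs.trans hs', fun m hm => ?_⟩
    show σ''.cx _ _ = _
    rw [hJ' m (by omega)]
    split_ifs with h
    · rw [State.cx, hs _ (by omega), hs _ (by omega), h, ← hJ2 i hi]; rfl
    · exact hJ m (by omega)
  rintro σ₃ ⟨hA3, -, hs3, hJ3⟩
  have h16' : σ₃.ivar 16 = T := by rw [hA3.i 16 rfl, hA2.i 16 rfl, hA1.i 16 rfl, h16]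
  refine Runs.block ?_ (by simp [Prog.time, IExp.cost]) ⟨?_, ?_, ?_⟩
  · simp only [Prog.Ok, IExp.Safe, h16', IExp.eval]; omega
  · intro a ha
    show σ₃.rmem a = _
    rw [hs3 a (by omega), hs2 a (by omega), hrm1]
  · simp only [Prog.den, Function.update_self, IExp.eval, h16']
  · intro k hk b hb
    have : k * H + b < L := by
      have := Nat.mul_le_mul_right H (Nat.succ_le_of_lt hk)
      rw [Nat.succ_mul, show 2 * T * H = T * (2 * H) by ring, hTH] at this; omega
    refine (hJ3 _ this).trans ?_
    rw [mul_add_div_of_lt hb, mul_add_mod_of_lt hb]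

/-- After `t` stages, the vector consists of the transforms of length `2 ^ t` of the subsequences
with step `2 ^ (e - t)`, where `L = 2 ^ e`. -/
theorem fft_spec (hS : Setup E n d NP L md P) (h3 : σ.ivar 3 = L) {x : ℕ → ℂ}
    (hx : ∀ m < L, σ.cx (L + m) (2 * L + m) = x m) :
    Runs E fft σ (400 * (L * (Nat.log 2 L + 1))) fun σ' => Same L (5 * L) σ σ' ∧
      ∀ k < L, σ'.cx (L + k) (2 * L + k) = subDFT x L 1 k 0 := by
  have hL := hS.L_ge
  have hL' := hS.L_le
  have hn := hS.le_pow
  have hw := hS.word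
  have h2 := hS.two_le
  have hpow := hS.L_pow
  set e := Nat.log 2 L with he
  refine Runs.mono (T := 2 + (e * (4 + 300 * L) + 4)) ?_ (by
    have : e ≤ L * e := Nat.le_mul_of_pos_left _ (by omega)
    rw [Nat.mul_add L, Nat.mul_add e, show e * (300 * L) = 300 * (L * e) by ring]; omega)
    fun _ h => h
  refine Runs.seq (Q := fun σ' => Agree (.iset 16 ♯1) σ σ' ∧ σ'.ivar 16 = 1)
    (Runs.block ?_ (by simp [Prog.time, IExp.cost]) ?_).agree ?_
  · simp only [Prog.Ok, IExp.Safe]; omega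
  · simp only [Prog.den, Function.update_self, IExp.eval]
  rintro σ₁ ⟨hA1, h16⟩
  have hrm1 : σ₁.rmem = σ.rmem := hA1.rm rfl
  refine (Runs.loop (b := .ilt ‡16 ‡3) (N := e) (T := 300 * L) (J := fun t σ' => Same L (5 * L) σ σ' ∧
    σ'.ivar 3 = L ∧ σ'.ivar 16 = 2 ^ t ∧ ∀ k < 2 ^ t, ∀ b < 2 ^ (e - t),
      σ'.cx (L + (k * 2 ^ (e - t) + b)) (2 * L + (k * 2 ^ (e - t) + b)) =
        subDFT x (2 ^ t) (2 ^ (e - t)) k b) ?_ ?_ ?_).mono le_rfl ?_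
  · rintro t ht σ' ⟨-, h3', h16', -⟩
    have : 2 ^ t ≤ L := by rw [hpow]; exact Nat.pow_le_pow_right (by norm_num) ht
    refine ⟨?_, ?_⟩
    · simp only [BExp.Safe, IExp.Safe, h3', h16']; omega
    · simp only [BExp.Holds, IExp.eval, h3', h16']
      rw [hpow]; exact Nat.pow_lt_pow_iff_right (by norm_num)
  · rintro t ht σ' ⟨hs, h3', h16', hJ⟩
    have e1 : e - t = e - (t + 1) + 1 := by omega
    have e2 : (2 : ℕ) ^ (e - t) = 2 * 2 ^ (e - (t + 1)) := by rw [e1, pow_succ, mul_comm]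
    have e3 : (2 : ℕ) ^ (t + 1) = 2 * 2 ^ t := by rw [pow_succ, mul_comm]
    rw [e2] at hJ
    refine (fftStage_spec hS h3' h16' (H := 2 ^ (e - (t + 1))) (x := x) ?_ hJ).agree.mono le_rfl ?_
    · rw [← e2, ← pow_add, Nat.add_sub_cancel' ht.le, ← hpow]
    · rintro σ'' ⟨hA, hs', h16'', hJ'⟩
      rw [e3]
      exact ⟨hs.trans hs', (hA.i 3 rfl).trans h3', h16'', hJ'⟩
  · refine ⟨fun a _ => by rw [hrm1], (hA1.i 3 rfl).trans h3, by rw [h16, pow_zero], ?_⟩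
    intro k hk b hb
    rw [Nat.sub_zero, ← hpow] at hb
    obtain rfl : k = 0 := by simpa using hk
    rw [zero_mul, zero_add, pow_zero, subDFT_one, ← hx b hb, State.cx, hrm1]; rfl
  · rintro σ' ⟨hs, -, -, hJ⟩
    refine ⟨hs, fun k hk => ?_⟩
    have := hJ k (hpow ▸ hk) 0 (by positivity)
    simp only [Nat.sub_self, pow_zero, mul_one, add_zero] at this
    rw [← hpow] at this
    exact this

end fft
end RealRAM

namespace RealRAM

open Korobov (subDFT sigma)

/-! ### The contribution of a smaller prime to the search criterion -/

/-- The two real sequences whose correlation gives the contribution of a smaller prime are written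
to the regions `1` and `2`, here the entries with the index in variable `14`. -/
def fillPoint : Prog :=
  .cond (.ilt ‡14 ‡26)
    (.iset 12 ‡13 ;; getW ;; .rstore (cell 1 ‡14) §1 ;; .rstore (cell 2 ‡14) (.ofNat ♯0) ;;
      .rset 4 (§4 +ᵣ §3 *ᵣ (§1 *ᵣ .sigma (‡11 *ᵢ ‡27 *ᵢ ‡7) (‡7 *ᵢ ‡10))))
    (.rstore (cell 1 ‡14) (.ofNat ♯0) ;; .cond (.ilt ‡14 (♯3 *ᵢ ‡26))
      (.rstore (cell 2 ‡14) (.sigma (‡13 *ᵢ ‡10 +ᵢ ‡11 *ᵢ ‡27 *ᵢ ‡7) (‡7 *ᵢ ‡10)))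
      (.rstore (cell 2 ‡14) (.ofNat ♯0))) ;;
  .iset 13 (‡13 *ᵢ ‡8 %ᵢ ‡7)

/-- Both sequences, for the index `l` (variable `11`). -/
def fill : Prog := .iset 13 ♯1 ;; forP 14 3 fillPoint

/-- The variables which determine the contribution of the prime with index `j` to the criterion for
the prime with index `i`: the generator `g` modulo `P i`, the known residue `b` modulo `P j`, and
the real factor `w`. -/
structure Pair (n NP : ℕ) (P : ℕ → ℕ) (i j g b : ℕ) (w : ℝ) (σ : State) : Prop where
  iv6 : σ.ivar 6 = i
  iv7 : σ.ivar 7 = P i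
  iv9 : σ.ivar 9 = j
  iv10 : σ.ivar 10 = P j
  iv8 : σ.ivar 8 = g
  iv26 : σ.ivar 26 = P i - 1
  iv27 : σ.ivar 27 = b
  rv3 : σ.rvar 3 = w
  hi : i < NP
  hj : j < NP
  hg : g ≤ n
  hb : b ≤ n

theorem Pair.agree {n NP : ℕ} {P : ℕ → ℕ} {i j g b : ℕ} {w : ℝ} {σ σ' : State} {Q : Prog}
    (h : Pair n NP P i j g b w σ) (hA : Agree Q σ σ')
    (hQ : (!Q.wI 6 && !Q.wI 7 && !Q.wI 9 && !Q.wI 10 && !Q.wI 8 && !Q.wI 26 && !Q.wI 27 && !Q.wR 3)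
      = true) :
    Pair n NP P i j g b w σ' := by
  simp only [Bool.and_eq_true, Bool.not_eq_true'] at hQ
  obtain ⟨⟨⟨⟨⟨⟨⟨h1, h2⟩, h3⟩, h4⟩, h5⟩, h6⟩, h7⟩, h8⟩ := hQ
  exact ⟨(hA.i _ h1).trans h.iv6, (hA.i _ h2).trans h.iv7, (hA.i _ h3).trans h.iv9,
    (hA.i _ h4).trans h.iv10, (hA.i _ h5).trans h.iv8, (hA.i _ h6).trans h.iv26,
    (hA.i _ h7).trans h.iv27, (hA.r _ h8).trans h.rv3, h.hi, h.hj, h.hg, h.hb⟩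

/-- The first sequence: kernel products at the powers of `g`. -/
noncomputable def Env.seqA (E : Env) (P : ℕ → ℕ) (ρ : ℕ → ℕ → ℕ) (s i j g l m : ℕ) : ℝ :=
  if m < P i - 1 then E.W P ρ s i j (g ^ m % P i) l else 0

/-- The second sequence: values of `σ_α` at the powers of `g`. It extends over two periods, shifted
by one period to have a support disjoint from that of the first sequence. -/
noncomputable def Env.seqB (E : Env) (P : ℕ → ℕ) (i j g b l m : ℕ) : ℝ :=
  if P i - 1 ≤ m ∧ m < 3 * (P i - 1) then
    sigma E.α (((g ^ m % P i * P j + l * b * P i : ℕ) : ℝ) / ((P i * P j : ℕ) : ℝ)) else 0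

section fill

variable {E : Env} {n d NP L md : ℕ} {τ : ℝ} {P : ℕ → ℕ} {ρ : ℕ → ℕ → ℕ} {s i j g b l len : ℕ}
  {w : ℝ} {σ : State}

theorem fillPoint_spec (hS : Setup E n d NP L md P) (hC : Ctx E n d NP L md τ P ρ s len σ)
    (hp : Pair n NP P i j g b w σ) (h11 : σ.ivar 11 = l) (hl : l < P j) {m : ℕ} (hm : m < L)
    (h14 : σ.ivar 14 = m) (h13 : σ.ivar 13 = g ^ m % P i) :
    Runs E fillPoint σ (200 * gT md s) fun σ' => Same L (3 * L) σ σ' ∧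
      σ'.ivar 13 = g ^ (m + 1) % P i ∧
      σ'.rvar 4 = σ.rvar 4 + w * (E.seqA P ρ s i j g l m *
        sigma E.α (((l * b * P i : ℕ) : ℝ) / ((P i * P j : ℕ) : ℝ))) ∧
      ∀ m' < L, σ'.cx (L + m') (2 * L + m') = if m' = m then
        ⟨E.seqA P ρ s i j g l m, E.seqB P i j g b l m⟩ else σ.cx (L + m') (2 * L + m') := by
  have hLn := hS.L_le
  have hw := hS.word
  have hmem := hS.mem
  have h2 := hS.two_le
  obtain ⟨hn, -, hn4, -⟩ := hS.le_pow
  have pi := hS.le hp.hi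
  have pj := hS.le hp.hj
  have pi0 := (hS.prime hp.hi).pos
  have hG := one_le_gT md s
  have hgm : g ^ m % P i < P i := Nat.mod_lt _ pi0
  have hg := hp.hg
  have hb := hp.hb
  have b1 : P i * P j ≤ n ^ 4 := mul2_le pi pj (by omega)
  have b2 : l * b * P i ≤ n ^ 4 := mul3_le (hl.le.trans pj) hb pi (by omega)
  have b3 : l * b ≤ n ^ 4 := mul2_le (hl.le.trans pj) hb (by omega)
  have b4 : g ^ m % P i * P j ≤ n ^ 4 := mul2_le (hgm.le.trans pi) pj (by omega)
  have b5 : g ^ m % P i * g ≤ n ^ 4 := mul2_le (hgm.le.trans pi) hg (by omega)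
  have pij : P i * P j ≠ 0 := mul_ne_zero pi0.ne' (hS.prime hp.hj).ne_zero
  have h3 := hC.iv3
  refine Runs.mono (T := (4 + (100 * gT md s + 60)) + 6) ?_ (by omega) fun _ h => h
  -- what remains to be shown in each case is which values are stored
  have key : ∀ (σ' : State) (u v : ℝ), σ'.rmem = Function.update (Function.update σ.rmem (L + m) u)
      (2 * L + m) v → u = E.seqA P ρ s i j g l m → v = E.seqB P i j g b l m →
      Same L (3 * L) σ σ' ∧ ∀ m' < L, σ'.cx (L + m') (2 * L + m') = if m' = m then
        ⟨E.seqA P ρ s i j g l m, E.seqB P i j g b l m⟩ else σ.cx (L + m') (2 * L + m') := by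
    intro σ' u v h hu hv
    refine ⟨same_update (by omega) (by omega) h, fun m' hm' => ?_⟩
    rw [cx_update hm hm' (by omega) h, hu, hv]; rfl
  refine Runs.seq (Q := fun σ' => (Same L (3 * L) σ σ' ∧ σ'.ivar 13 = g ^ m % P i ∧
      σ'.ivar 8 = g ∧ σ'.ivar 7 = P i ∧
      σ'.rvar 4 = σ.rvar 4 + w * (E.seqA P ρ s i j g l m *
        sigma E.α (((l * b * P i : ℕ) : ℝ) / ((P i * P j : ℕ) : ℝ)))) ∧
      ∀ m' < L, σ'.cx (L + m') (2 * L + m') = if m' = m then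
        ⟨E.seqA P ρ s i j g l m, E.seqB P i j g b l m⟩ else σ.cx (L + m') (2 * L + m')) ?_ ?_
  · refine Runs.cond ?_ (fun hlt => ?_) fun hge => ?_
    · simp only [BExp.Safe, IExp.Safe, h14, hp.iv26]; omega
    · have hlt : m < P i - 1 := by
        simpa only [BExp.Holds, IExp.eval, h14, hp.iv26] using hlt
      refine Runs.mono (T := 2 + (100 * gT md s + 50)) ?_ (by omega) fun _ h => h
      refine Runs.seq (Q := fun σ' => Agree (.iset 12 ‡13) σ σ' ∧ σ'.ivar 12 = g ^ m % P i)
        (Runs.block ?_ le_rfl ?_).agree ?_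
      · simp only [Prog.Ok, IExp.Safe, h13]; omega
      · simp only [Prog.den, Function.update_self, IExp.eval, h13]
      rintro σ₁ ⟨hA1, h12⟩
      have hC1 := hC.agree hA1 rfl (hA1.same rfl _ _)
      have hp1 := hp.agree hA1 rfl
      refine Runs.seq (getW_spec hS hC1 (i := i) (j := j) (k := g ^ m % P i) (l := l)
        ⟨hp1.iv6, hp1.iv7, hp1.iv9, hp1.iv10, h12, (hA1.i 11 rfl).trans h11, hp.hi, hp.hj,
          by omega, by omega⟩).agree ?_
      rintro σ₂ ⟨hA2, hW⟩
      have hp2 := hp1.agree hA2 rfl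
      have h14' : σ₂.ivar 14 = m := by rw [hA2.i 14 rfl, hA1.i 14 rfl, h14]
      have h13' : σ₂.ivar 13 = g ^ m % P i := by rw [hA2.i 13 rfl, hA1.i 13 rfl, h13]
      have h11' : σ₂.ivar 11 = l := by rw [hA2.i 11 rfl, hA1.i 11 rfl, h11]
      have h3' : σ₂.ivar 3 = L := by rw [hA2.i 3 rfl, hA1.i 3 rfl, h3]
      have hrm : σ₂.rmem = σ.rmem := by rw [hA2.rm rfl, hA1.rm rfl]
      have hr4 : σ₂.rvar 4 = σ.rvar 4 := by rw [hA2.r 4 rfl, hA1.r 4 rfl]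
      have hnB : E.seqB P i j g b l m = 0 := if_neg (by omega)
      have hA : E.seqA P ρ s i j g l m = E.W P ρ s i j (g ^ m % P i) l := if_pos hlt
      obtain ⟨k1, k2⟩ := key { σ₂ with
        rmem := Function.update (Function.update σ₂.rmem (L + m) (σ₂.rvar 1)) (2 * L + m) 0 }
        (σ₂.rvar 1) 0 (by rw [hrm]) (by rw [hW, hA]) hnB.symm
      refine Runs.block ?_ (by simp [Prog.time, RExp.cost, IExp.cost, cell])
        ⟨⟨?_, h13', hp2.iv8, hp2.iv7, ?_⟩, ?_⟩
      · simp only [Prog.Ok, RExp.Safe, IExp.Safe, cell, Prog.den, IExp.eval, h3', h14', h11',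
          hp2.iv27, hp2.iv7, hp2.iv10]
        repeat' apply And.intro
        all_goals first | trivial | assumption | omega
      · simp only [Prog.den, IExp.eval, RExp.eval, cell, h3', h14', one_mul, Nat.cast_zero]
        exact k1
      · simp only [Prog.den, IExp.eval, RExp.eval, Function.update_self, hp2.rv3, h11',
          hp2.iv27, hp2.iv7, hp2.iv10, hW, hr4, hA]
      · simp only [Prog.den, IExp.eval, RExp.eval, cell, h3', h14', one_mul, Nat.cast_zero]
        exact k2
    · have hge : ¬ m < P i - 1 := by
        simpa only [BExp.Holds, IExp.eval, h14, hp.iv26] using hge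
      have hA : E.seqA P ρ s i j g l m = 0 := if_neg hge
      refine Runs.mono (T := 8 + (6 + 24)) ?_ (by omega) fun _ h => h
      refine Runs.seq (Q := fun σ' => Agree (.rstore (cell 1 ‡14) (.ofNat ♯0)) σ σ' ∧
        σ'.rmem = Function.update σ.rmem (L + m) 0)
        (Runs.block ?_ (by simp [Prog.time, RExp.cost, IExp.cost, cell]) ?_).agree ?_
      · simp only [Prog.Ok, RExp.Safe, IExp.Safe, cell, IExp.eval, h3, h14]; omega
      · simp only [Prog.den, RExp.eval, IExp.eval, cell, h3, h14, one_mul, Nat.cast_zero]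
      rintro σ₁ ⟨hA1, hrm⟩
      have hp1 := hp.agree hA1 rfl
      have h3' : σ₁.ivar 3 = L := by rw [hA1.i 3 rfl, h3]
      have h14' : σ₁.ivar 14 = m := by rw [hA1.i 14 rfl, h14]
      have h13' : σ₁.ivar 13 = g ^ m % P i := by rw [hA1.i 13 rfl, h13]
      have h11' : σ₁.ivar 11 = l := by rw [hA1.i 11 rfl, h11]
      have hr4 : σ₁.rvar 4 = σ.rvar 4 := by rw [hA1.r 4 rfl]
      refine Runs.cond ?_ (fun hlt => ?_) fun hge' => ?_
      · simp only [BExp.Safe, IExp.Safe, IExp.eval, h14', hp1.iv26]; omega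
      · have hlt : m < 3 * (P i - 1) := by
          simpa only [BExp.Holds, IExp.eval, h14', hp1.iv26] using hlt
        obtain ⟨k1, k2⟩ := key { σ₁ with rmem := Function.update σ₁.rmem (2 * L + m) (sigma E.α
          (((g ^ m % P i * P j + l * b * P i : ℕ) : ℝ) / ((P i * P j : ℕ) : ℝ))) } 0 _
          (by rw [hrm]) hA.symm (if_pos ⟨by omega, hlt⟩).symm
        refine Runs.block ?_ (by simp [Prog.time, RExp.cost, IExp.cost, cell])
          ⟨⟨?_, h13', hp1.iv8, hp1.iv7, ?_⟩, ?_⟩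
        · simp only [Prog.Ok, RExp.Safe, IExp.Safe, cell, IExp.eval, h3', h14', h11', h13',
            hp1.iv27, hp1.iv7, hp1.iv10]
          repeat' apply And.intro
          all_goals first | trivial | assumption | omega
        · simp only [Prog.den, IExp.eval, RExp.eval, cell, h3', h14', h11', h13', hp1.iv27, hp1.iv7,
            hp1.iv10]
          exact k1
        · simp only [Prog.den, hr4, hA, zero_mul, mul_zero, add_zero]
        · simp only [Prog.den, IExp.eval, RExp.eval, cell, h3', h14', h11', h13', hp1.iv27, hp1.iv7,
            hp1.iv10]
          exact k2
      · have hge' : ¬ m < 3 * (P i - 1) := by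
          simpa only [BExp.Holds, IExp.eval, h14', hp1.iv26] using hge'
        obtain ⟨k1, k2⟩ := key { σ₁ with rmem := Function.update σ₁.rmem (2 * L + m) 0 } 0 0
          (by rw [hrm]) hA.symm (if_neg (by omega)).symm
        refine Runs.block ?_ (by simp [Prog.time, RExp.cost, IExp.cost, cell])
          ⟨⟨?_, h13', hp1.iv8, hp1.iv7, ?_⟩, ?_⟩
        · simp only [Prog.Ok, RExp.Safe, IExp.Safe, cell, IExp.eval, h3', h14']; omega
        · simp only [Prog.den, IExp.eval, RExp.eval, cell, h3', h14', Nat.cast_zero]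
          exact k1
        · simp only [Prog.den, hr4, hA, zero_mul, mul_zero, add_zero]
        · simp only [Prog.den, IExp.eval, RExp.eval, cell, h3', h14', Nat.cast_zero]
          exact k2
  · rintro σ' ⟨⟨hs, h13', h8, h7, hr⟩, hcx⟩
    refine Runs.block ?_ (by simp [Prog.time, IExp.cost]) ⟨hs, ?_, hr, hcx⟩
    · simp only [Prog.Ok, IExp.Safe, IExp.eval, h13', h8, h7]; omega
    · simp only [Prog.den, IExp.eval, Function.update_self, h13', h8, h7]
      rw [pow_succ, Nat.mod_mul_mod]

theorem fill_spec (hS : Setup E n d NP L md P) (hC : Ctx E n d NP L md τ P ρ s len σ)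
    (hp : Pair n NP P i j g b w σ) (h11 : σ.ivar 11 = l) (hl : l < P j) :
    Runs E fill σ (300 * (L * gT md s)) fun σ' => Same L (3 * L) σ σ' ∧
      σ'.rvar 4 = σ.rvar 4 + w * ∑ m ∈ Finset.range (P i - 1), E.W P ρ s i j (g ^ m % P i) l *
        sigma E.α (((l * b * P i : ℕ) : ℝ) / ((P i * P j : ℕ) : ℝ)) ∧
      ∀ m < L, σ'.cx (L + m) (2 * L + m) = ⟨E.seqA P ρ s i j g l m, E.seqB P i j g b l m⟩ := by
  have hL := hS.L_ge
  have hLn := hS.L_le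
  have hw := hS.word
  have h2 := hS.two_le
  obtain ⟨hn, -, hn4, -⟩ := hS.le_pow
  have pi := hS.le hp.hi
  have p1 := (hS.prime hp.hi).one_lt
  have hG := one_le_gT md s
  refine Runs.mono (T := 2 + (L * (200 * gT md s + 8) + 6)) ?_ (by
    have : L ≤ L * gT md s := Nat.le_mul_of_pos_right _ hG
    rw [Nat.mul_add, show L * (200 * gT md s) = 200 * (L * gT md s) by ring]; omega) fun _ h => h
  refine Runs.seq (Q := fun σ' => Agree (.iset 13 ♯1) σ σ' ∧ σ'.ivar 13 = 1)
    (Runs.block ?_ le_rfl ?_).agree ?_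
  · simp only [Prog.Ok, IExp.Safe]; omega
  · simp only [Prog.den, Function.update_self, IExp.eval]
  rintro σ₁ ⟨hA1, h13⟩
  have hC1 := hC.agree hA1 rfl (hA1.same rfl _ _)
  have hp1 := hp.agree hA1 rfl
  have hrm1 := hA1.rm rfl
  refine (Runs.forP (J := fun t σ' => Same L (3 * L) σ σ' ∧ σ'.ivar 13 = g ^ t % P i ∧
      σ'.rvar 4 = σ.rvar 4 + w * ∑ m ∈ Finset.range t, E.seqA P ρ s i j g l m *
        sigma E.α (((l * b * P i : ℕ) : ℝ) / ((P i * P j : ℕ) : ℝ)) ∧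
      ∀ m < t, σ'.cx (L + m) (2 * L + m) = ⟨E.seqA P ρ s i j g l m, E.seqB P i j g b l m⟩)
      (N := L) hC1.iv3 (by omega) rfl rfl (by norm_num) ?_ ?_).mono le_rfl ?_
  · refine ⟨fun a _ => by show σ₁.rmem a = _; rw [hrm1], ?_, ?_,
      fun m hm => absurd hm (Nat.not_lt_zero _)⟩
    · show σ₁.ivar 13 = _
      rw [h13, pow_zero, Nat.mod_eq_of_lt p1]
    · show σ₁.rvar 4 = _
      rw [hA1.r 4 rfl, Finset.sum_range_zero, mul_zero, add_zero]
  · rintro t ht σ' hA h14 ⟨hs, h13', hr, hJ⟩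
    have hs1 : Same L (3 * L) σ₁ σ' := fun a ha => by rw [hs a ha, hrm1]
    refine (fillPoint_spec hS (hC1.agree hA rfl (hs1.mono (by omega) (by omega)))
      (hp1.agree hA rfl) (by rw [hA.i 11 rfl, hA1.i 11 rfl, h11]) hl ht h14 h13').mono le_rfl ?_
    rintro σ'' ⟨hs', h13'', hr', hJ'⟩
    refine ⟨hs.trans hs', h13'', ?_, fun m hm => ?_⟩
    · show σ''.rvar 4 = _
      rw [hr', hr, Finset.sum_range_succ]; ring
    · show σ''.cx _ _ = _
      rw [hJ' m (by omega)]
      split_ifs with h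
      · rw [h]
      · exact hJ m (by omega)
  · rintro σ' ⟨-, -, hs, -, hr, hJ⟩
    refine ⟨hs, ?_, hJ⟩
    rw [hr]
    congr 2
    rw [← Finset.sum_subset (Finset.range_mono (by omega : P i - 1 ≤ L))]
    · refine Finset.sum_congr rfl fun m hm => ?_
      rw [Env.seqA, if_pos (Finset.mem_range.1 hm)]
    · intro m _ hm
      rw [Env.seqA, if_neg (by simpa using hm), zero_mul]

end fill
end RealRAM

namespace RealRAM

open Korobov (subDFT sigma)

/-! ### Loops that write to one region -/

/-- The first cells of region `r` are set to the values of `e`, as many as variable `b` says. -/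
def storeLoop (x b r : ℕ) (e : RExp) : Prog := forP x b (.rstore (cell r ‡x) e)

/-- The values may depend on the part of the memory that the loop has not changed so far. -/
theorem storeLoop_spec {E : Env} {n d NP L md : ℕ} {P : ℕ → ℕ} {σ : State}
    (hS : Setup E n d NP L md P) {x b r N T : ℕ} {e : RExp} (v : ℕ → ℝ) (hr : r ≤ 6) (hx3 : x ≠ 3)
    (hxb : x ≠ b) (h3 : σ.ivar 3 = L) (hN : σ.ivar b = N) (hNL : N ≤ L) (hT : e.cost ≤ T)
    (he : ∀ c < N, ∀ σ', Agree (storeLoop x b r e) σ σ' → σ'.ivar x = c →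
      Same (r * L) (r * L + c) σ σ' → e.Safe E σ' ∧ e.eval E σ' = v c) :
    Runs E (storeLoop x b r e) σ (N * (T + 14) + 6) fun σ' => Agree (storeLoop x b r e) σ σ' ∧
      Same (r * L) (r * L + L) σ σ' ∧ ∀ c < N, σ'.rmem (r * L + c) = v c := by
  have hLn := hS.L_le
  have hw := hS.word
  have hmem := hS.mem
  obtain ⟨hn, -, hn4, -⟩ := hS.le_pow
  have h2 := hS.two_le
  have hrL : r * L ≤ 6 * L := Nat.mul_le_mul_right _ hr
  refine (Runs.forP (T := T + 6) (J := fun c σ' => Same (r * L) (r * L + c) σ σ' ∧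
    ∀ c' < c, σ'.rmem (r * L + c') = v c') hN (by omega) rfl rfl hxb
    ⟨fun _ _ => rfl, fun _ h => absurd h (Nat.not_lt_zero _)⟩ ?_).mono le_rfl ?_
  · rintro c hc σ' hA hx ⟨hs, hJ⟩
    obtain ⟨h1, h4⟩ := he c hc σ' hA hx hs
    have h3' : σ'.ivar 3 = L := by
      rw [hA.i 3 (by simp [forP, Prog.wI, hx3]), h3]
    refine Runs.block ?_ (by simp only [Prog.time, IExp.cost, cell]; omega) ⟨?_, ?_⟩
    · simp only [Prog.Ok, IExp.Safe, IExp.eval, cell, h3', hx]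
      refine ⟨?_, h1, ?_⟩ <;> omega
    · intro a ha
      simp only [Prog.den, IExp.eval, cell, h3', hx]
      rw [Function.update_of_ne (by omega), hs a (by omega)]
    · intro c' hc'
      simp only [Prog.den, IExp.eval, cell, h3', hx]
      by_cases hcc : c' = c
      · rw [hcc, Function.update_self, h4]
      · rw [Function.update_of_ne (by omega), hJ c' (by omega)]
  · rintro σ' ⟨hA, -, hs, hJ⟩
    exact ⟨hA, hs.mono le_rfl (by omega), hJ⟩

/-- The values of `e` are added to the first cells of region `r`. -/
def addLoop (x b r : ℕ) (e : RExp) : Prog := storeLoop x b r (.load (cell r ‡x) +ᵣ e)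

theorem addLoop_spec {E : Env} {n d NP L md : ℕ} {P : ℕ → ℕ} {σ : State}
    (hS : Setup E n d NP L md P) {x b r N T : ℕ} {e : RExp} (v : ℕ → ℝ) (hr : r ≤ 6) (hx3 : x ≠ 3)
    (hxb : x ≠ b) (h3 : σ.ivar 3 = L) (hN : σ.ivar b = N) (hNL : N ≤ L) (hT : e.cost ≤ T)
    (he : ∀ c < N, ∀ σ', Agree (addLoop x b r e) σ σ' → σ'.ivar x = c →
      Same (r * L) (r * L + c) σ σ' → e.Safe E σ' ∧ e.eval E σ' = v c) :
    Runs E (addLoop x b r e) σ (N * (T + 25) + 6) fun σ' => Agree (addLoop x b r e) σ σ' ∧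
      Same (r * L) (r * L + L) σ σ' ∧
      ∀ c < N, σ'.rmem (r * L + c) = σ.rmem (r * L + c) + v c := by
  have hLn := hS.L_le
  have hw := hS.word
  have hmem := hS.mem
  obtain ⟨hn, -, hn4, -⟩ := hS.le_pow
  have h2 := hS.two_le
  have hrL : r * L ≤ 6 * L := Nat.mul_le_mul_right _ hr
  refine (storeLoop_spec hS (T := T + 7) (fun c => σ.rmem (r * L + c) + v c) hr hx3 hxb h3 hN hNL
    (by simp only [RExp.cost, IExp.cost, cell]; omega) ?_).mono (by
      have : N * (T + 7 + 14) ≤ N * (T + 25) := Nat.mul_le_mul_left _ (by omega)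
      omega) fun _ h => h
  intro c hc σ' hA hx hs
  obtain ⟨h1, h4⟩ := he c hc σ' hA hx hs
  have h3' : σ'.ivar 3 = L := by
    rw [hA.i 3 (by simp [storeLoop, forP, Prog.wI, hx3]), h3]
  constructor
  · simp only [RExp.Safe, IExp.Safe, IExp.eval, cell, h3', hx]
    refine ⟨?_, h1⟩
    omega
  · simp only [RExp.eval, IExp.eval, cell, h3', hx, h4]
    rw [hs _ (by omega)]

/-! ### The contribution of a smaller prime to the search criterion, summed up -/

/-- The contribution of the index `l` (variable `11`). -/
def smallLine : Prog :=
  fill ;; fft ;; addLoop 18 3 0 (§3 *ᵣ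
    (.load (cell 1 ‡18) *ᵣ .load (cell 1 ‡18) +ᵣ .load (cell 2 ‡18) *ᵣ .load (cell 2 ‡18)))

/-- The contribution of the prime in variable `10` to the criterion for the larger prime in
variable `7`: the weighted power spectra are added up in region `0`, and the value at the residue
`0` in the real variable `4`. -/
def smallQ : Prog :=
  .iset 27 (.output (‡5 *ᵢ ‡2 +ᵢ ‡9)) ;; .rset 3 (.ofNat ♯2 /ᵣ (.ofNat ‡7 *ᵣ .ofNat ‡10)) ;;
  forP 11 10 smallLine

/-- The power spectrum of the two sequences for the index `l`. -/
noncomputable def Env.spectrum (E : Env) (P : ℕ → ℕ) (ρ : ℕ → ℕ → ℕ) (L s i j g b l k : ℕ) : ℝ :=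
  Complex.normSq (subDFT (fun m => ⟨E.seqA P ρ s i j g l m, E.seqB P i j g b l m⟩) L 1 k 0)

/-- The summand for the index `l` at the residue `0`. -/
noncomputable def Env.zeroLine (E : Env) (P : ℕ → ℕ) (ρ : ℕ → ℕ → ℕ) (s i j g b l : ℕ) : ℝ :=
  ∑ m ∈ Finset.range (P i - 1), E.W P ρ s i j (g ^ m % P i) l *
    sigma E.α (((l * b * P i : ℕ) : ℝ) / ((P i * P j : ℕ) : ℝ))

section small

variable {E : Env} {n d NP L md : ℕ} {τ : ℝ} {P : ℕ → ℕ} {ρ : ℕ → ℕ → ℕ} {s i j g b l len : ℕ}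
  {w : ℝ} {σ : State}

theorem smallLine_spec (hS : Setup E n d NP L md P) (hC : Ctx E n d NP L md τ P ρ s len σ)
    (hp : Pair n NP P i j g b w σ) (h11 : σ.ivar 11 = l) (hl : l < P j) :
    Runs E smallLine σ (800 * (L * (gT md s + Nat.log 2 L))) fun σ' => Same 0 (5 * L) σ σ' ∧
      σ'.rvar 4 = σ.rvar 4 + w * E.zeroLine P ρ s i j g b l ∧
      ∀ k < L, σ'.rmem k = σ.rmem k + w * E.spectrum P ρ L s i j g b l k := by
  have hL := hS.L_ge
  have hLn := hS.L_le
  have hw := hS.word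
  have hmem := hS.mem
  have h2 := hS.two_le
  obtain ⟨hn, -, hn4, -⟩ := hS.le_pow
  have hG := one_le_gT md s
  refine Runs.mono (T := 300 * (L * gT md s) + (400 * (L * (Nat.log 2 L + 1)) +
    (L * (40 + 25) + 6))) ?_ (by
      have : L ≤ L * gT md s := Nat.le_mul_of_pos_right _ hG
      rw [Nat.mul_add L (gT md s), Nat.mul_add L (Nat.log 2 L)]; omega) fun _ h => h
  refine Runs.seq (fill_spec hS hC hp h11 hl).agree ?_
  rintro σ₁ ⟨hA1, hs1, hr1, hx1⟩
  refine Runs.seq (fft_spec hS (by rw [hA1.i 3 rfl, hC.iv3]) hx1).agree ?_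
  rintro σ₂ ⟨hA2, hs2, hx2⟩
  refine (addLoop_spec hS (fun k => w * E.spectrum P ρ L s i j g b l k) (T := 40)
    (by norm_num) (by norm_num) (by norm_num) (by rw [hA2.i 3 rfl, hA1.i 3 rfl, hC.iv3])
    (by rw [hA2.i 3 rfl, hA1.i 3 rfl, hC.iv3]) le_rfl (by simp [RExp.cost, IExp.cost, cell])
    ?_).mono le_rfl ?_
  · intro c hc σ₃ hA3 h18 hs3
    have h3' : σ₃.ivar 3 = L := by rw [hA3.i 3 rfl, hA2.i 3 rfl, hA1.i 3 rfl, hC.iv3]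
    have hw3 : σ₃.rvar 3 = w := by rw [hA3.r 3 rfl, hA2.r 3 rfl, hA1.r 3 rfl, hp.rv3]
    constructor
    · simp only [RExp.Safe, IExp.Safe, IExp.eval, cell, h3', h18, true_and]; omega
    · simp only [RExp.eval, IExp.eval, cell, h3', h18, hw3, one_mul]
      have h := hx2 c hc
      rw [State.cx, Complex.ext_iff] at h
      rw [hs3 _ (by omega), hs3 _ (by omega), Env.spectrum, Complex.normSq_apply, ← h.1, ← h.2]
  · rintro σ₃ ⟨hA3, hs3, hx3⟩
    refine ⟨fun a ha => ?_, ?_, fun k hk => ?_⟩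
    · rw [hs3 a (by omega), hs2 a (by omega), hs1 a (by omega)]
    · rw [hA3.r 4 rfl, hA2.r 4 rfl, hr1]; rfl
    · have := hx3 k hk
      rw [zero_mul, zero_add] at this
      rw [this, hs2 k (by omega), hs1 k (by omega)]

theorem smallQ_spec (hS : Setup E n d NP L md P) (hC : Ctx E n d NP L md τ P ρ s len σ)
    (hi : i < NP) (hj : j < NP) (h6 : σ.ivar 6 = i) (h7 : σ.ivar 7 = P i) (h9 : σ.ivar 9 = j)
    (h10 : σ.ivar 10 = P j) (h8 : σ.ivar 8 = g) (h26 : σ.ivar 26 = P i - 1) (hg : g ≤ n)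
    (hlen : s * NP + j < len) :
    Runs E smallQ σ (900 * (n * (L * (gT md s + Nat.log 2 L)))) fun σ' => Same 0 (5 * L) σ σ' ∧
      σ'.rvar 4 = σ.rvar 4 + 2 / ((P i : ℝ) * P j) *
        ∑ l ∈ Finset.range (P j), E.zeroLine P ρ s i j g (ρ s (P j)) l ∧
      ∀ k < L, σ'.rmem k = σ.rmem k + 2 / ((P i : ℝ) * P j) *
        ∑ l ∈ Finset.range (P j), E.spectrum P ρ L s i j g (ρ s (P j)) l k := by
  have hL := hS.L_ge
  have hLn := hS.L_le
  have hw := hS.word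
  have h2 := hS.two_le
  obtain ⟨hn, hd, hn4, -⟩ := hS.le_pow
  have pi := hS.le hi
  have pj := hS.le hj
  have pi0 := hS.prime hi
  have pj0 := hS.prime hj
  have hG := one_le_gT md s
  have b1 := hS.addr hC.lt hj
  have hNP := hS.NP_le
  have hb := (hC.out.lt s j hj).le.trans (hS.le hj)
  have hget := hC.out.get hj hlen
  have hlg : 1 ≤ gT md s + Nat.log 2 L := by omega
  refine Runs.mono (T := 7 + (9 + (P j * (800 * (L * (gT md s + Nat.log 2 L)) + 8) + 6))) ?_ (by
    set X := L * (gT md s + Nat.log 2 L)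
    have hLX : L ≤ X := Nat.le_mul_of_pos_right _ hlg
    have h5 : P j * (800 * X + 8) ≤ n * (808 * X) := Nat.mul_le_mul pj (by omega)
    rw [show n * (808 * X) = 808 * (n * X) by ring] at h5
    have : X ≤ n * X := Nat.le_mul_of_pos_left _ (by omega)
    omega) fun _ h => h
  refine Runs.seq (Q := fun σ' => Agree (.iset 27 (.output (‡5 *ᵢ ‡2 +ᵢ ‡9))) σ σ' ∧
    σ'.ivar 27 = ρ s (P j)) (Runs.block ?_ le_rfl ?_).agree ?_
  · simp only [Prog.Ok, IExp.Safe, IExp.eval, hC.iv5, hC.iv2, h9, hC.out.length]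
    have := hC.lt
    omega
  · simp only [Prog.den, Function.update_self, IExp.eval, hC.iv5, hC.iv2, h9, hget]
  rintro σ₁ ⟨hA1, h27⟩
  refine Runs.seq (Q := fun σ' => Agree (.rset 3 (.ofNat ♯2 /ᵣ (.ofNat ‡7 *ᵣ .ofNat ‡10))) σ₁ σ' ∧
    σ'.rvar 3 = 2 / ((P i : ℝ) * P j)) (Runs.block ?_ le_rfl ?_).agree ?_
  · simp only [Prog.Ok, RExp.Safe, IExp.Safe, RExp.eval, IExp.eval, hA1.i 7 rfl, hA1.i 10 rfl, h7,
      h10]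
    refine ⟨by omega, by omega, ?_⟩
    have := pi0.ne_zero
    have := pj0.ne_zero
    positivity
  · simp only [Prog.den, RExp.eval, IExp.eval, Function.update_self, hA1.i 7 rfl, hA1.i 10 rfl, h7,
      h10]
    norm_num
  rintro σ₂ ⟨hA2, hr3⟩
  have hC2 := (hC.agree hA1 rfl (hA1.same rfl _ _)).agree hA2 rfl (hA2.same rfl _ _)
  have hp2 : Pair n NP P i j g (ρ s (P j)) (2 / ((P i : ℝ) * P j)) σ₂ :=
    ⟨by rw [hA2.i 6 rfl, hA1.i 6 rfl, h6], by rw [hA2.i 7 rfl, hA1.i 7 rfl, h7],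
      by rw [hA2.i 9 rfl, hA1.i 9 rfl, h9], by rw [hA2.i 10 rfl, hA1.i 10 rfl, h10],
      by rw [hA2.i 8 rfl, hA1.i 8 rfl, h8], by rw [hA2.i 26 rfl, hA1.i 26 rfl, h26],
      by rw [hA2.i 27 rfl, h27], hr3, hi, hj, hg, hb⟩
  have hrm : σ₂.rmem = σ.rmem := by rw [hA2.rm rfl, hA1.rm rfl]
  have hr4 : σ₂.rvar 4 = σ.rvar 4 := by rw [hA2.r 4 rfl, hA1.r 4 rfl]
  refine (Runs.forP (J := fun t σ' => Same 0 (5 * L) σ₂ σ' ∧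
      σ'.rvar 4 = σ₂.rvar 4 + 2 / ((P i : ℝ) * P j) *
        ∑ l ∈ Finset.range t, E.zeroLine P ρ s i j g (ρ s (P j)) l ∧
      ∀ k < L, σ'.rmem k = σ₂.rmem k + 2 / ((P i : ℝ) * P j) *
        ∑ l ∈ Finset.range t, E.spectrum P ρ L s i j g (ρ s (P j)) l k)
      (N := P j) hp2.iv10 (by omega) rfl rfl (by norm_num) ?_ ?_).mono le_rfl ?_
  · exact ⟨fun _ _ => rfl, by simp, fun k _ => by simp⟩
  · rintro t ht σ' hA h11 ⟨hs, hr, hx⟩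
    refine (smallLine_spec hS (hC2.agree hA rfl (hs.mono le_rfl (by omega))) (hp2.agree hA rfl)
      h11 ht).mono le_rfl ?_
    rintro σ'' ⟨hs', hr', hx'⟩
    refine ⟨hs.trans hs', ?_, fun k hk => ?_⟩
    · show σ''.rvar 4 = _
      rw [hr', hr, Finset.sum_range_succ]; ring
    · show σ''.rmem k = _
      rw [hx' k hk, hx k hk, Finset.sum_range_succ]; ring
  · rintro σ' ⟨-, -, hs, hr, hx⟩
    rw [hr4] at hr
    rw [hrm] at hx
    exact ⟨fun a ha => by rw [hs a ha, hrm], hr, hx⟩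

end small

/-! ### The contribution of a larger prime to the search criterion -/

/-- The sum of the kernel products over `l` is put into the real variable `2`. -/
def sumW : Prog := .rset 2 (.ofNat ♯0) ;; forP 11 10 (getW ;; .rset 2 (§2 +ᵣ §1))

/-- The contribution of the prime in variable `10` to the criterion for the smaller prime in
variable `7` is added to region `6`. -/
def largeQ : Prog :=
  .rset 3 (.ofNat ♯2 /ᵣ (.powAlpha ‡10 *ᵣ .powAlpha ‡10 *ᵣ (.ofNat ‡7 *ᵣ .ofNat ‡10))) ;;
  forP 12 7 (sumW ;; addLoop 15 7 6 (§3 *ᵣ (§2 *ᵣ .sigma (‡10 *ᵢ ‡12 *ᵢ ‡15) ‡7)))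

section large

variable {E : Env} {n d NP L md : ℕ} {τ : ℝ} {P : ℕ → ℕ} {ρ : ℕ → ℕ → ℕ} {s i j k len : ℕ}
  {σ : State}

theorem sumW_spec (hS : Setup E n d NP L md P) (hC : Ctx E n d NP L md τ P ρ s len σ)
    (hi : i < NP) (hj : j < NP) (h6 : σ.ivar 6 = i) (h7 : σ.ivar 7 = P i) (h9 : σ.ivar 9 = j)
    (h10 : σ.ivar 10 = P j) (h12 : σ.ivar 12 = k) (hk : k < n) :
    Runs E sumW σ (130 * (n * gT md s)) fun σ' =>
      σ'.rvar 2 = ∑ l ∈ Finset.range (P j), E.W P ρ s i j k l := by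
  have hw := hS.word
  have h2 := hS.two_le
  obtain ⟨hn, -, hn4, -⟩ := hS.le_pow
  have pj := hS.le hj
  have hG := one_le_gT md s
  refine Runs.mono (T := 3 + (P j * (100 * gT md s + 4 + 8) + 6)) ?_ (by
    have h5 : P j * (100 * gT md s + 4 + 8) ≤ n * (112 * gT md s) := Nat.mul_le_mul pj (by omega)
    rw [show n * (112 * gT md s) = 112 * (n * gT md s) by ring] at h5
    have : n ≤ n * gT md s := Nat.le_mul_of_pos_right _ hG
    omega) fun _ h => h
  refine Runs.seq (Q := fun σ' => Agree (.rset 2 (.ofNat ♯0)) σ σ' ∧ σ'.rvar 2 = 0)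
    (Runs.block ?_ le_rfl ?_).agree ?_
  · simp only [Prog.Ok, RExp.Safe, IExp.Safe]; omega
  · simp only [Prog.den, Function.update_self, RExp.eval, IExp.eval, Nat.cast_zero]
  rintro σ₁ ⟨hA1, hr2⟩
  have hC1 := hC.agree hA1 rfl (hA1.same rfl _ _)
  refine (Runs.forP (J := fun t σ' => σ'.rvar 2 = ∑ l ∈ Finset.range t, E.W P ρ s i j k l)
    (N := P j) (by rw [hA1.i 10 rfl, h10]) (by omega) rfl rfl (by norm_num) (by simpa using hr2)
    ?_).mono le_rfl fun _ h => h.2.2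
  rintro t ht σ' hA h11 hJ
  refine Runs.seq (getW_spec hS (hC1.agree hA rfl (hA.same rfl _ _)) (i := i) (j := j) (k := k)
    (l := t) ⟨by rw [hA.i 6 rfl, hA1.i 6 rfl, h6], by rw [hA.i 7 rfl, hA1.i 7 rfl, h7],
      by rw [hA.i 9 rfl, hA1.i 9 rfl, h9], by rw [hA.i 10 rfl, hA1.i 10 rfl, h10],
      by rw [hA.i 12 rfl, hA1.i 12 rfl, h12], h11, hi, hj, hk, by omega⟩).agree ?_
  rintro σ'' ⟨hA', hW⟩
  refine Runs.block ⟨trivial, trivial⟩ le_rfl ?_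
  show Function.update σ''.rvar 2 (σ''.rvar 2 + σ''.rvar 1) 2 = _
  rw [Function.update_self, hA'.r 2 rfl, hJ, hW, Finset.sum_range_succ]

theorem largeQ_spec (hS : Setup E n d NP L md P) (hC : Ctx E n d NP L md τ P ρ s len σ)
    (hi : i < NP) (hj : j < NP) (h6 : σ.ivar 6 = i) (h7 : σ.ivar 7 = P i) (h9 : σ.ivar 9 = j)
    (h10 : σ.ivar 10 = P j) :
    Runs E largeQ σ (400 * (n * (n * gT md s))) fun σ' => Same (6 * L) (7 * L) σ σ' ∧
      ∀ c < P i, σ'.rmem (6 * L + c) = σ.rmem (6 * L + c) +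
        2 / ((P j : ℝ) ^ E.α * (P j : ℝ) ^ E.α * ((P i : ℝ) * P j)) *
          ∑ k ∈ Finset.range (P i), (∑ l ∈ Finset.range (P j), E.W P ρ s i j k l) *
            sigma E.α (((P j * k * c : ℕ) : ℝ) / (P i : ℝ)) := by
  have hL := hS.L_ge
  have hw := hS.word
  have h2 := hS.two_le
  obtain ⟨hn, -, hn4, -⟩ := hS.le_pow
  have pi := hS.le hi
  have pj := hS.le hj
  have pi0 := (hS.prime hi).pos
  have pj0 := (hS.prime hj).pos
  have hG := one_le_gT md s
  refine Runs.mono (T := 20 + (P i * (130 * (n * gT md s) + (P i * (30 + 25) + 6) + 8) + 6)) ?_ (by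
    have h5 : n ≤ n * gT md s := Nat.le_mul_of_pos_right _ hG
    have h6 : P i * (130 * (n * gT md s) + (P i * (30 + 25) + 6) + 8) ≤
      n * (300 * (n * gT md s)) := Nat.mul_le_mul pi (by omega)
    rw [show n * (300 * (n * gT md s)) = 300 * (n * (n * gT md s)) by ring] at h6
    have : n * gT md s ≤ n * (n * gT md s) := Nat.le_mul_of_pos_left _ (by omega)
    omega) fun _ h => h
  set w : ℝ := 2 / ((P j : ℝ) ^ E.α * (P j : ℝ) ^ E.α * ((P i : ℝ) * P j)) with hwdef
  refine Runs.seq (Q := fun σ' => Agree (.rset 3 (.ofNat ♯2 /ᵣ (.powAlpha ‡10 *ᵣ .powAlpha ‡10 *ᵣ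
    (.ofNat ‡7 *ᵣ .ofNat ‡10)))) σ σ' ∧ σ'.rvar 3 = w)
    (Runs.block ?_ (by simp [Prog.time, RExp.cost, IExp.cost]) ?_).agree ?_
  · simp only [Prog.Ok, RExp.Safe, IExp.Safe, RExp.eval, IExp.eval, h7, h10]
    refine ⟨by omega, by omega, ?_⟩
    positivity
  · simp only [Prog.den, RExp.eval, IExp.eval, Function.update_self, h7, h10]
    norm_num [hwdef]
  rintro σ₁ ⟨hA1, hr3⟩
  have hC1 := hC.agree hA1 rfl (hA1.same rfl _ _)
  have hrm1 := hA1.rm rfl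
  refine (Runs.forP (J := fun t σ' => Same (6 * L) (7 * L) σ₁ σ' ∧
      ∀ c < P i, σ'.rmem (6 * L + c) = σ₁.rmem (6 * L + c) + w *
          ∑ k ∈ Finset.range t, (∑ l ∈ Finset.range (P j), E.W P ρ s i j k l) *
            sigma E.α (((P j * k * c : ℕ) : ℝ) / (P i : ℝ)))
      (N := P i) (by rw [hA1.i 7 rfl, h7]) (by omega) rfl rfl (by norm_num) ?_ ?_).mono le_rfl ?_
  · exact ⟨fun _ _ => rfl, fun c _ => by simp⟩
  · rintro t ht σ₂ hA2 h12 ⟨hs2, hx2⟩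
    have hC2 := hC1.agree hA2 rfl (hs2.mono (by omega) (by omega))
    refine Runs.seq (sumW_spec hS hC2 hi hj (by rw [hA2.i 6 rfl, hA1.i 6 rfl, h6])
      (by rw [hA2.i 7 rfl, hA1.i 7 rfl, h7]) (by rw [hA2.i 9 rfl, hA1.i 9 rfl, h9])
      (by rw [hA2.i 10 rfl, hA1.i 10 rfl, h10]) h12 (by omega)).agree ?_
    rintro σ₃ ⟨hA3, hr2⟩
    have h7' : σ₃.ivar 7 = P i := by rw [hA3.i 7 rfl, hA2.i 7 rfl, hA1.i 7 rfl, h7]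
    have h10' : σ₃.ivar 10 = P j := by rw [hA3.i 10 rfl, hA2.i 10 rfl, hA1.i 10 rfl, h10]
    have h12' : σ₃.ivar 12 = t := by rw [hA3.i 12 rfl, h12]
    have hr3' : σ₃.rvar 3 = w := by rw [hA3.r 3 rfl, hA2.r 3 rfl, hr3]
    have hrm3 : σ₃.rmem = σ₂.rmem := hA3.rm rfl
    refine (addLoop_spec hS (fun c => w * ((∑ l ∈ Finset.range (P j), E.W P ρ s i j t l) *
      sigma E.α (((P j * t * c : ℕ) : ℝ) / (P i : ℝ)))) (T := 30) (by norm_num) (by norm_num)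
      (by norm_num) (by rw [hA3.i 3 rfl, hC2.iv3]) h7' (by omega)
      (by simp [RExp.cost, IExp.cost]) ?_).mono le_rfl ?_
    · intro c hc σ' hA h15 hs
      have b1 : P j * t * c ≤ n ^ 4 := mul3_le pj (ht.le.trans pi) (hc.le.trans pi) (by omega)
      have b2 : P j * t ≤ n ^ 4 := mul2_le pj (ht.le.trans pi) (by omega)
      constructor
      · simp only [RExp.Safe, IExp.Safe, IExp.eval, hA.i 10 rfl, hA.i 12 rfl, hA.i 7 rfl, h10',
          h12', h7', h15]
        repeat' apply And.intro
        all_goals first | trivial | omega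
      · simp only [RExp.eval, IExp.eval, hA.i 10 rfl, hA.i 12 rfl, hA.i 7 rfl, h10',
          h12', h7', h15, hA.r 3 rfl, hA.r 2 rfl, hr3', hr2]
    · rintro σ' ⟨hA, hs, hx⟩
      refine ⟨fun a ha => ?_, fun c hc => ?_⟩
      · show σ'.rmem a = _
        rw [hs a (by omega), hrm3, hs2 a ha]
      · show σ'.rmem _ = _
        rw [hx c hc, hrm3, hx2 c hc, Finset.sum_range_succ]; ring
  · rintro σ' ⟨-, -, hs, hx⟩
    rw [hrm1] at hx
    exact ⟨fun a ha => by rw [hs a ha, hrm1], hx⟩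

end large

end RealRAM

namespace RealRAM

open Korobov (sigma thetaVal IsGen exists_isGen)

/-! ### Finding a generator -/

/-- The residue in variable `15` becomes the new value of variable `8` if it is a generator, that
is, if none of its powers with the exponents `1, …, p - 2` is `1`. -/
def testGen : Prog :=
  .iset 22 ♯1 ;; .iset 13 ♯1 ;;
  forP 14 28 (.iset 13 (‡13 *ᵢ ‡15 %ᵢ ‡7) ;; .cond (.ieq ‡13 ♯1) (.iset 22 ♯0) .skip) ;;
  .cond (.ieq ‡22 ♯1) (.cond (.ieq ‡15 ♯0) .skip (.iset 8 ‡15)) .skip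

/-- A generator of the multiplicative group modulo the prime in variable `7`. -/
def findGen : Prog := .iset 28 (‡7 -ᵢ ♯2) ;; forP 15 7 testGen

section gen

variable {E : Env} {n d NP L md : ℕ} {P : ℕ → ℕ} {σ : State}

theorem testGen_spec (hS : Setup E n d NP L md P) {p c : ℕ} (hp : p.Prime) (hpn : p ≤ n)
    (h7 : σ.ivar 7 = p) (h28 : σ.ivar 28 = p - 2) (h15 : σ.ivar 15 = c) (hc : c < p) :
    Runs E testGen σ (100 * n) fun σ' => (IsGen p c → σ'.ivar 8 = c) ∧
      (¬ IsGen p c → σ'.ivar 8 = σ.ivar 8) := by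
  have hw := hS.word
  have h2 := hS.two_le
  obtain ⟨hn, -, hn4, -⟩ := hS.le_pow
  have hp0 := hp.pos
  refine Runs.mono (T := 2 + (2 + (((p - 2) * (20 + 8) + 6) + 20))) ?_ (by omega) fun _ h => h
  refine Runs.seq (Q := fun σ' => Agree (.iset 22 ♯1) σ σ' ∧ σ'.ivar 22 = 1)
    (Runs.block ?_ le_rfl ?_).agree ?_
  · simp only [Prog.Ok, IExp.Safe]; omega
  · simp only [Prog.den, Function.update_self, IExp.eval]
  rintro σ₁ ⟨hA1, h22⟩
  refine Runs.seq (Q := fun σ' => Agree (.iset 13 ♯1) σ₁ σ' ∧ σ'.ivar 13 = 1)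
    (Runs.block ?_ le_rfl ?_).agree ?_
  · simp only [Prog.Ok, IExp.Safe]; omega
  · simp only [Prog.den, Function.update_self, IExp.eval]
  rintro σ₂ ⟨hA2, h13⟩
  refine Runs.seq (Runs.forP (J := fun m σ' => σ'.ivar 13 = c ^ m % p ∧
    ((σ'.ivar 22 = 1 ∧ ∀ m', 0 < m' → m' ≤ m → c ^ m' % p ≠ 1) ∨
      (σ'.ivar 22 = 0 ∧ ∃ m', 0 < m' ∧ m' ≤ m ∧ c ^ m' % p = 1))) (N := p - 2)
    (by rw [hA2.i 28 rfl, hA1.i 28 rfl, h28]) (by omega) rfl rfl (by norm_num) ?_ ?_) ?_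
  · refine ⟨?_, Or.inl ⟨?_, fun m' h h' => by omega⟩⟩
    · show σ₂.ivar 13 = _
      rw [h13, pow_zero, Nat.mod_eq_of_lt hp.one_lt]
    · show σ₂.ivar 22 = _
      rw [hA2.i 22 rfl, h22]
  · rintro m hm σ' hA h14 ⟨h13', hJ⟩
    have h15' : σ'.ivar 15 = c := by rw [hA.i 15 rfl, hA2.i 15 rfl, hA1.i 15 rfl, h15]
    have h7' : σ'.ivar 7 = p := by rw [hA.i 7 rfl, hA2.i 7 rfl, hA1.i 7 rfl, h7]
    have hlt : c ^ m % p < p := Nat.mod_lt _ hp0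
    have hlt' : c ^ (m + 1) % p < p := Nat.mod_lt _ hp0
    have b1 : c ^ m % p * c ≤ n ^ 4 := mul2_le (by omega) (by omega) (by omega)
    have hx : c ^ m % p * c % p = c ^ (m + 1) % p := by rw [pow_succ, Nat.mod_mul_mod]
    refine Runs.mono (T := 6 + (4 + 2)) ?_ (by omega) fun _ h => h
    refine Runs.seq (Q := fun σ'' => Agree (.iset 13 (‡13 *ᵢ ‡15 %ᵢ ‡7)) σ' σ'' ∧
      σ''.ivar 13 = c ^ (m + 1) % p) (Runs.block ?_ le_rfl ?_).agree ?_
    · simp only [Prog.Ok, IExp.Safe, IExp.eval, h13', h15', h7']; omega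
    · simp only [Prog.den, Function.update_self, IExp.eval, h13', h15', h7', hx]
    rintro σ₃ ⟨hA3, h13''⟩
    refine Runs.cond ?_ (fun h => ?_) fun h => ?_
    · simp only [BExp.Safe, IExp.Safe, h13'']; omega
    · have h : c ^ (m + 1) % p = 1 := h13'' ▸ h
      refine Runs.block (Nat.zero_le _) le_rfl ⟨h13'', Or.inr ⟨rfl, m + 1, by omega, le_rfl, h⟩⟩
    · have h : c ^ (m + 1) % p ≠ 1 := h13'' ▸ h
      refine Runs.block trivial (by simp [Prog.time]) ⟨h13'', ?_⟩
      show (σ₃.ivar 22 = 1 ∧ _) ∨ (σ₃.ivar 22 = 0 ∧ _)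
      rw [hA3.i 22 rfl]
      rcases hJ with ⟨h22', hJ⟩ | ⟨h22', m', h1, h2, h3⟩
      · refine Or.inl ⟨h22', fun m' h1 h2 => ?_⟩
        rcases Nat.lt_or_ge m' (m + 1) with h3 | h3
        · exact hJ m' h1 (by omega)
        · rw [show m' = m + 1 by omega]; exact h
      · exact Or.inr ⟨h22', m', h1, by omega, h3⟩
  · rintro σ₃ ⟨hA3, -, -, hJ⟩
    have h15' : σ₃.ivar 15 = c := by rw [hA3.i 15 rfl, hA2.i 15 rfl, hA1.i 15 rfl, h15]
    have h8' : σ₃.ivar 8 = σ.ivar 8 := by rw [hA3.i 8 rfl, hA2.i 8 rfl, hA1.i 8 rfl]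
    have hcp : c ≤ E.word := by omega
    refine Runs.block ?_ (by simp [Prog.time, BExp.cost, IExp.cost]) ?_
    · simp only [Prog.Ok, BExp.Safe, IExp.Safe, h15']
      rcases hJ with ⟨h, -⟩ | ⟨h, -⟩ <;> simp only [h] <;> simp <;> omega
    · rcases hJ with ⟨h, hJ⟩ | ⟨h, m', h1, h2, h3⟩
      · rcases Nat.eq_zero_or_pos c with h0 | h0
        · have : ¬ IsGen p c := fun h => absurd h.1 (by omega)
          simp [Prog.den, BExp.Holds, IExp.eval, h, h15', h0, h8', h0 ▸ this]
        · have : IsGen p c := ⟨h0, hc, fun i hi hi' => hJ i hi (by omega)⟩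
          simp [Prog.den, BExp.Holds, IExp.eval, h, h15', h0.ne', this]
      · have : ¬ IsGen p c := fun h => h.2.2 m' h1 (by omega) h3
        simp [Prog.den, BExp.Holds, IExp.eval, h, this, h8']

theorem findGen_spec (hS : Setup E n d NP L md P) {p : ℕ} (hp : p.Prime) (hpn : p ≤ n)
    (h7 : σ.ivar 7 = p) :
    Runs E findGen σ (200 * (n * n)) fun σ' => IsGen p (σ'.ivar 8) := by
  have hw := hS.word
  have h2 := hS.two_le
  obtain ⟨hn, -, hn4, -⟩ := hS.le_pow
  have hp0 := hp.pos
  refine Runs.mono (T := 4 + (p * (100 * n + 8) + 6)) ?_ (by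
    have h1 : p * (100 * n + 8) ≤ n * (110 * n) := Nat.mul_le_mul hpn (by omega)
    rw [show n * (110 * n) = 110 * (n * n) by ring] at h1
    have : 2 * 2 ≤ n * n := Nat.mul_le_mul h2 h2
    omega) fun _ h => h
  refine Runs.seq (Q := fun σ' => Agree (.iset 28 (‡7 -ᵢ ♯2)) σ σ' ∧ σ'.ivar 28 = p - 2)
    (Runs.block ?_ le_rfl ?_).agree ?_
  · simp only [Prog.Ok, IExp.Safe, h7]; omega
  · simp only [Prog.den, Function.update_self, IExp.eval, h7]
  rintro σ₁ ⟨hA1, h28⟩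
  refine (Runs.forP (J := fun c σ' => (∀ g < c, ¬ IsGen p g) ∨ IsGen p (σ'.ivar 8)) (N := p)
    (by rw [hA1.i 7 rfl, h7]) (by omega) rfl rfl (by norm_num)
    (Or.inl fun g hg => absurd hg (Nat.not_lt_zero _)) ?_).mono le_rfl ?_
  · rintro c hc σ' hA h15 hJ
    refine (testGen_spec hS hp hpn (by rw [hA.i 7 rfl, hA1.i 7 rfl, h7])
      (by rw [hA.i 28 rfl, h28]) h15 hc).mono le_rfl ?_
    rintro σ'' ⟨h3, h4⟩
    show _ ∨ IsGen p (σ''.ivar 8)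
    by_cases hgen : IsGen p c
    · rw [h3 hgen]; exact Or.inr hgen
    · rw [h4 hgen]
      refine hJ.imp_left fun h g hg => ?_
      rcases Nat.lt_or_ge g c with h5 | h5
      · exact h g h5
      · rw [show g = c by omega]; exact hgen
  · rintro σ' ⟨-, -, hJ⟩
    rcases hJ with h | h
    · obtain ⟨g, hg⟩ := exists_isGen hp
      exact absurd hg (h g hg.2.1)
    · exact h

end gen

/-! ### The criterion `θ` -/

/-- The values of `θ` are put into the regions `5` and `6`; in the latter the other terms of `T` are
added later. -/
def thetaP : Prog :=
  .iset 9 ‡6 ;; .iset 10 ‡7 ;; .iset 11 ♯0 ;;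
  storeLoop 15 7 5 (.ofNat ♯0) ;; storeLoop 15 7 6 (.ofNat ♯0) ;;
  forP 12 7 (getW ;; addLoop 15 7 5 (§1 *ᵣ .sigma (‡12 *ᵢ ‡15) ‡7 /ᵣ .ofNat ‡7) ;;
    addLoop 15 7 6 (§1 *ᵣ .sigma (‡12 *ᵢ ‡15) ‡7 /ᵣ .ofNat ‡7))

/-- The value of `θ`, up to a factor, for the prime with index `i`. -/
noncomputable def Env.theta (E : Env) (P : ℕ → ℕ) (ρ : ℕ → ℕ → ℕ) (s i c : ℕ) : ℝ :=
  thetaVal E.α E.γ s (P i) (fun t => ρ t (P i)) c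

section theta

variable {E : Env} {n d NP L md : ℕ} {τ : ℝ} {P : ℕ → ℕ} {ρ : ℕ → ℕ → ℕ} {s i len : ℕ}
  {σ : State}

theorem thetaP_spec (hS : Setup E n d NP L md P) (hC : Ctx E n d NP L md τ P ρ s len σ)
    (hi : i < NP) (h6 : σ.ivar 6 = i) (h7 : σ.ivar 7 = P i) :
    Runs E thetaP σ (1000 * (n * (n * gT md s))) fun σ' => Same (5 * L) (7 * L) σ σ' ∧
      ∀ c < P i, σ'.rmem (5 * L + c) = E.theta P ρ s i c ∧
        σ'.rmem (6 * L + c) = E.theta P ρ s i c := by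
  have hL := hS.L_ge
  have hw := hS.word
  have h2 := hS.two_le
  obtain ⟨hn, -, hn4, -⟩ := hS.le_pow
  have pi := hS.le hi
  have pi0 := (hS.prime hi).pos
  have hG := one_le_gT md s
  have hNP := hS.NP_le
  refine Runs.mono (T := 2 + (2 + (2 + ((P i * (2 + 14) + 6) + ((P i * (2 + 14) + 6) +
    (P i * (100 * gT md s + ((P i * (30 + 25) + 6) + (P i * (30 + 25) + 6)) + 8) + 6)))))) ?_ (by
    have h5 : n ≤ n * gT md s := Nat.le_mul_of_pos_right _ hG
    have h8 : gT md s ≤ n * gT md s := Nat.le_mul_of_pos_left _ (by omega)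
    have h6 : P i * (100 * gT md s + ((P i * (30 + 25) + 6) + (P i * (30 + 25) + 6)) + 8) ≤
      n * (300 * (n * gT md s)) := Nat.mul_le_mul pi (by omega)
    rw [show n * (300 * (n * gT md s)) = 300 * (n * (n * gT md s)) by ring] at h6
    have : n * gT md s ≤ n * (n * gT md s) := Nat.le_mul_of_pos_left _ (by omega)
    omega) fun _ h => h
  refine Runs.seq (Q := fun σ' => Agree (.iset 9 ‡6) σ σ' ∧ σ'.ivar 9 = i)
    (Runs.block ?_ le_rfl ?_).agree ?_
  · simp only [Prog.Ok, IExp.Safe, h6]; omega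
  · simp only [Prog.den, Function.update_self, IExp.eval, h6]
  rintro σ₁ ⟨hA1, h9⟩
  refine Runs.seq (Q := fun σ' => Agree (.iset 10 ‡7) σ₁ σ' ∧ σ'.ivar 10 = P i)
    (Runs.block ?_ le_rfl ?_).agree ?_
  · simp only [Prog.Ok, IExp.Safe, hA1.i 7 rfl, h7]; omega
  · simp only [Prog.den, Function.update_self, IExp.eval, hA1.i 7 rfl, h7]
  rintro σ₂ ⟨hA2, h10⟩
  refine Runs.seq (Q := fun σ' => Agree (.iset 11 ♯0) σ₂ σ' ∧ σ'.ivar 11 = 0)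
    (Runs.block (Nat.zero_le _) le_rfl ?_).agree ?_
  · simp only [Prog.den, Function.update_self, IExp.eval]
  rintro σ₃ ⟨hA3, h11⟩
  have h73 : σ₃.ivar 7 = P i := by rw [hA3.i 7 rfl, hA2.i 7 rfl, hA1.i 7 rfl, h7]
  have h33 : σ₃.ivar 3 = L := by rw [hA3.i 3 rfl, hA2.i 3 rfl, hA1.i 3 rfl, hC.iv3]
  refine Runs.seq (storeLoop_spec hS (fun _ => 0) (T := 2) (by norm_num) (by norm_num)
    (by norm_num) h33 h73 (by omega) (by simp [RExp.cost, IExp.cost])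
    fun c hc σ' hA h15 hs => ⟨Nat.zero_le _, Nat.cast_zero⟩) ?_
  rintro σ₄ ⟨hA4, hs4, hx4⟩
  refine Runs.seq (storeLoop_spec hS (fun _ => 0) (T := 2) (by norm_num) (by norm_num)
    (by norm_num) (by rw [hA4.i 3 rfl, h33]) (by rw [hA4.i 7 rfl, h73]) (by omega)
    (by simp [RExp.cost, IExp.cost]) fun c hc σ' hA h15 hs => ⟨Nat.zero_le _, Nat.cast_zero⟩) ?_
  rintro σ₅ ⟨hA5, hs5, hx5⟩
  have hs5' : Same (5 * L) (7 * L) σ σ₅ := fun a ha => by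
    rw [hs5 a (by omega), hs4 a (by omega), hA3.rm rfl, hA2.rm rfl, hA1.rm rfl]
  have hs05 : Same 0 (7 * L) σ σ₅ := hs5'.mono (Nat.zero_le _) le_rfl
  have hC5 : Ctx E n d NP L md τ P ρ s len σ₅ := by
    refine (((hC.agree hA1 rfl (hA1.same rfl _ _)).agree hA2 rfl (hA2.same rfl _ _)).agree hA3 rfl
      (hA3.same rfl _ _)).agree (hA4.seq_left.trans (hA5.seq_right)) rfl ?_
    exact fun a ha => by rw [hs5 a (by omega), hs4 a (by omega)]
  refine (Runs.forP (J := fun t σ' => Same (5 * L) (7 * L) σ₅ σ' ∧ ∀ c < P i,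
      (σ'.rmem (5 * L + c) = (∑ k ∈ Finset.range t, E.W P ρ s i i k 0 *
        sigma E.α (((k * c : ℕ) : ℝ) / (P i : ℝ))) / P i) ∧
      (σ'.rmem (6 * L + c) = (∑ k ∈ Finset.range t, E.W P ρ s i i k 0 *
        sigma E.α (((k * c : ℕ) : ℝ) / (P i : ℝ))) / P i)) (N := P i)
      (by rw [hA5.i 7 rfl, hA4.i 7 rfl, h73]) (by omega) rfl rfl (by norm_num) ?_ ?_).mono le_rfl ?_
  · refine ⟨fun _ _ => rfl, fun c hc => ?_⟩
    rw [Finset.sum_range_zero, zero_div]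
    exact ⟨(hs5 _ (by omega)).trans (hx4 c hc), hx5 c hc⟩
  · rintro t ht σ' hA h12 ⟨hs, hx⟩
    have hC' := hC5.agree hA rfl (hs.mono (Nat.zero_le _) le_rfl)
    have h7' : σ'.ivar 7 = P i := by rw [hA.i 7 rfl, hA5.i 7 rfl, hA4.i 7 rfl, h73]
    refine Runs.seq (getW_spec hS hC' (i := i) (j := i) (k := t) (l := 0)
      ⟨by rw [hA.i 6 rfl, hA5.i 6 rfl, hA4.i 6 rfl, hA3.i 6 rfl, hA2.i 6 rfl, hA1.i 6 rfl, h6], h7',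
        by rw [hA.i 9 rfl, hA5.i 9 rfl, hA4.i 9 rfl, hA3.i 9 rfl, hA2.i 9 rfl, h9],
        by rw [hA.i 10 rfl, hA5.i 10 rfl, hA4.i 10 rfl, hA3.i 10 rfl, h10], h12,
        by rw [hA.i 11 rfl, hA5.i 11 rfl, hA4.i 11 rfl, h11], hi, hi, by omega, by omega⟩).agree ?_
    rintro σ₆ ⟨hA6, hW⟩
    have hrm6 := hA6.rm rfl
    have he : ∀ c < P i, ∀ σ'' : State, σ''.rvar 1 = σ₆.rvar 1 → σ''.ivar 7 = P i →
        σ''.ivar 12 = t → σ''.ivar 15 = c →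
        (RExp.Safe E σ'' (§1 *ᵣ .sigma (‡12 *ᵢ ‡15) ‡7 /ᵣ .ofNat ‡7)) ∧
        RExp.eval E σ'' (§1 *ᵣ .sigma (‡12 *ᵢ ‡15) ‡7 /ᵣ .ofNat ‡7) = E.W P ρ s i i t 0 *
          sigma E.α (((t * c : ℕ) : ℝ) / (P i : ℝ)) / P i := by
      intro c hc σ'' e1 e2 e3 e4
      have b : t * c ≤ n ^ 4 := mul2_le (by omega) (by omega) (by omega)
      constructor
      · simp only [RExp.Safe, IExp.Safe, IExp.eval, RExp.eval, e2, e3, e4]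
        have : (P i : ℝ) ≠ 0 := by positivity
        repeat' apply And.intro
        all_goals first | trivial | assumption | omega
      · simp only [RExp.eval, IExp.eval, e1, e2, e3, e4, hW]
    refine Runs.seq (addLoop_spec hS (fun c => E.W P ρ s i i t 0 *
      sigma E.α (((t * c : ℕ) : ℝ) / (P i : ℝ)) / P i) (T := 30) (by norm_num) (by norm_num)
      (by norm_num) (by rw [hA6.i 3 rfl, hC'.iv3]) (by rw [hA6.i 7 rfl, h7']) (by omega)
      (by simp [RExp.cost, IExp.cost]) fun c hc σ'' hA'' h15 _ => he c hc σ'' (hA''.r 1 rfl)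
        (by rw [hA''.i 7 rfl, hA6.i 7 rfl, h7']) (by rw [hA''.i 12 rfl, hA6.i 12 rfl, h12]) h15) ?_
    rintro σ₇ ⟨hA7, hs7, hx7⟩
    refine (addLoop_spec hS (fun c => E.W P ρ s i i t 0 *
      sigma E.α (((t * c : ℕ) : ℝ) / (P i : ℝ)) / P i) (T := 30) (by norm_num) (by norm_num)
      (by norm_num) (by rw [hA7.i 3 rfl, hA6.i 3 rfl, hC'.iv3])
      (by rw [hA7.i 7 rfl, hA6.i 7 rfl, h7']) (by omega) (by simp [RExp.cost, IExp.cost])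
      fun c hc σ'' hA'' h15 _ => he c hc σ'' (by rw [hA''.r 1 rfl, hA7.r 1 rfl])
        (by rw [hA''.i 7 rfl, hA7.i 7 rfl, hA6.i 7 rfl, h7'])
        (by rw [hA''.i 12 rfl, hA7.i 12 rfl, hA6.i 12 rfl, h12]) h15).mono le_rfl ?_
    rintro σ₈ ⟨hA8, hs8, hx8⟩
    refine ⟨fun a ha => ?_, fun c hc => ⟨?_, ?_⟩⟩
    · show σ₈.rmem a = _
      rw [hs8 a (by omega), hs7 a (by omega), hrm6, hs a (by omega)]
    · show σ₈.rmem _ = _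
      rw [hs8 _ (by omega), hx7 c hc, hrm6, (hx c hc).1, Finset.sum_range_succ, add_div]
    · show σ₈.rmem _ = _
      rw [hx8 c hc, hs7 _ (by omega), hrm6, (hx c hc).2, Finset.sum_range_succ, add_div]
  · rintro σ' ⟨-, -, hs, hx⟩
    exact ⟨hs5'.trans hs, hx⟩

end theta

end RealRAM

namespace RealRAM

open Korobov (sigma IsGen critVal smallSum largeSum primes sum_normSq_sin smallSum_pow smallSum_zero)

/-! ### The contributions of all primes to the search criterion -/

/-- The contribution of the prime with the index in variable `9`. -/
def jStep : Prog :=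
  .iset 10 (.load ‡9) ;; .cond (.ilt ‡9 ‡6) smallQ (.cond (.ilt ‡6 ‡9) largeQ .skip)

/-- The contributions of all primes. -/
def jLoop : Prog := storeLoop 18 3 0 (.ofNat ♯0) ;; .rset 4 (.ofNat ♯0) ;; forP 9 2 jStep

/-- The weighted sum of a function of the primes that are smaller than the one with index `i`. -/
noncomputable def smallerSum (P : ℕ → ℕ) (i : ℕ) (N : ℕ) (f : ℕ → ℝ) : ℝ :=
  ∑ j ∈ Finset.range N, if j < i then 2 / ((P i : ℝ) * P j) * f j else 0

/-- The weighted sum of a function of the primes that are larger than the one with index `i`. -/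
noncomputable def Env.largerSum (E : Env) (P : ℕ → ℕ) (i : ℕ) (N : ℕ) (f : ℕ → ℝ) : ℝ :=
  ∑ j ∈ Finset.range N, if i < j then
    2 / ((P j : ℝ) ^ E.α * (P j : ℝ) ^ E.α * ((P i : ℝ) * P j)) * f j else 0

/-- The contribution of the prime with index `j` to the criterion for a smaller prime. -/
noncomputable def Env.large (E : Env) (P : ℕ → ℕ) (ρ : ℕ → ℕ → ℕ) (s i c j : ℕ) : ℝ :=
  ∑ k ∈ Finset.range (P i), (∑ l ∈ Finset.range (P j), E.W P ρ s i j k l) *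
    sigma E.α (((P j * k * c : ℕ) : ℝ) / (P i : ℝ))

section jLoop

variable {E : Env} {n d NP L md : ℕ} {τ : ℝ} {P : ℕ → ℕ} {ρ : ℕ → ℕ → ℕ} {s i j g len : ℕ}
  {σ : State}

theorem jStep_spec (hS : Setup E n d NP L md P) (hC : Ctx E n d NP L md τ P ρ s len σ)
    (hlen : len = s * NP + i) (hi : i < NP) (hj : j < NP) (h6 : σ.ivar 6 = i) (h7 : σ.ivar 7 = P i)
    (h9 : σ.ivar 9 = j) (h8 : σ.ivar 8 = g) (h26 : σ.ivar 26 = P i - 1) (hg : g ≤ n) :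
    Runs E jStep σ (950 * (n * (L * (gT md s + Nat.log 2 L)))) fun σ' =>
      (∀ a, 5 * L ≤ a ∧ a < 6 * L ∨ 7 * L ≤ a → σ'.rmem a = σ.rmem a) ∧
      (σ'.rvar 4 = σ.rvar 4 + if j < i then 2 / ((P i : ℝ) * P j) *
        ∑ l ∈ Finset.range (P j), E.zeroLine P ρ s i j g (ρ s (P j)) l else 0) ∧
      (∀ k < L, σ'.rmem k = σ.rmem k + if j < i then 2 / ((P i : ℝ) * P j) *
        ∑ l ∈ Finset.range (P j), E.spectrum P ρ L s i j g (ρ s (P j)) l k else 0) ∧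
      ∀ c < P i, σ'.rmem (6 * L + c) = σ.rmem (6 * L + c) + if i < j then
        2 / ((P j : ℝ) ^ E.α * (P j : ℝ) ^ E.α * ((P i : ℝ) * P j)) * E.large P ρ s i c j else 0 := by
  have hL := hS.L_ge
  have hw := hS.word
  have hmem := hS.mem
  have h2 := hS.two_le
  obtain ⟨hn, -, hn4, -⟩ := hS.le_pow
  have pi := hS.le hi
  have pj := hS.le hj
  have hNP := hS.NP_le
  have hG := one_le_gT md s
  set X := n * (L * (gT md s + Nat.log 2 L)) with hX
  have hX1 : 10 ≤ X := by
    have h3 : 2 * (10 * 1) ≤ X := Nat.mul_le_mul h2 (Nat.mul_le_mul (by omega) (by omega))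
    omega
  have hX2 : n * (n * gT md s) ≤ X :=
    Nat.mul_le_mul_left _ (Nat.mul_le_mul (by omega) (by omega))
  refine Runs.mono (T := 3 + (4 + (4 + 900 * X))) ?_ (by omega) fun _ h => h
  refine Runs.seq (Q := fun σ' => Agree (.iset 10 (.load ‡9)) σ σ' ∧ σ'.ivar 10 = P j)
    (Runs.block ?_ le_rfl ?_).agree ?_
  · simp only [Prog.Ok, IExp.Safe, IExp.eval, h9, hC.im j hj]; omega
  · simp only [Prog.den, Function.update_self, IExp.eval, h9, hC.im j hj]
  rintro σ₁ ⟨hA1, h10⟩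
  have hC1 := hC.agree hA1 rfl (hA1.same rfl _ _)
  have hrm := hA1.rm rfl
  have h61 : σ₁.ivar 6 = i := by rw [hA1.i 6 rfl, h6]
  have h71 : σ₁.ivar 7 = P i := by rw [hA1.i 7 rfl, h7]
  have h91 : σ₁.ivar 9 = j := by rw [hA1.i 9 rfl, h9]
  rw [← hrm, ← hA1.r 4 rfl]
  refine Runs.cond ?_ (fun hlt => ?_) fun hge => ?_
  · simp only [BExp.Safe, IExp.Safe, h61, h91]; omega
  · have hlt : j < i := by simpa only [BExp.Holds, IExp.eval, h61, h91] using hlt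
    refine (smallQ_spec hS hC1 hi hj h61 h71 h91 h10 (by rw [hA1.i 8 rfl, h8])
      (by rw [hA1.i 26 rfl, h26]) hg (by omega)).mono (by omega) ?_
    rintro σ' ⟨hs, hr, hx⟩
    refine ⟨fun a ha => hs a (by omega), by rw [hr, if_pos hlt], fun k hk => by
      rw [hx k hk, if_pos hlt], fun c hc => ?_⟩
    rw [hs _ (by omega), if_neg (by omega), add_zero]
  · have hge : ¬ j < i := by simpa only [BExp.Holds, IExp.eval, h61, h91] using hge
    refine Runs.cond ?_ (fun hlt => ?_) fun hge' => ?_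
    · simp only [BExp.Safe, IExp.Safe, h61, h91]; omega
    · have hlt : i < j := by simpa only [BExp.Holds, IExp.eval, h61, h91] using hlt
      refine (largeQ_spec hS hC1 hi hj h61 h71 h91 h10).agree.mono (by omega) ?_
      rintro σ' ⟨hA, hs, hx⟩
      refine ⟨fun a ha => hs a (by omega), by rw [hA.r 4 rfl, if_neg hge, add_zero], fun k hk => by
        rw [hs k (by omega), if_neg hge, add_zero], fun c hc => ?_⟩
      rw [hx c hc, if_pos hlt]; rfl
    · have hge' : ¬ i < j := by simpa only [BExp.Holds, IExp.eval, h61, h91] using hge'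
      refine Runs.block trivial (by simp only [Prog.time]; omega) ?_
      simp only [if_neg hge, if_neg hge', add_zero, Prog.den]
      simp

theorem jLoop_spec (hS : Setup E n d NP L md P) (hC : Ctx E n d NP L md τ P ρ s len σ)
    (hlen : len = s * NP + i) (hi : i < NP) (h6 : σ.ivar 6 = i) (h7 : σ.ivar 7 = P i)
    (h8 : σ.ivar 8 = g) (h26 : σ.ivar 26 = P i - 1) (hg : g ≤ n) :
    Runs E jLoop σ (1000 * (NP * (n * (L * (gT md s + Nat.log 2 L))))) fun σ' =>
      (∀ a, 5 * L ≤ a ∧ a < 6 * L ∨ 7 * L ≤ a → σ'.rmem a = σ.rmem a) ∧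
      (σ'.rvar 4 = smallerSum P i NP fun j =>
        ∑ l ∈ Finset.range (P j), E.zeroLine P ρ s i j g (ρ s (P j)) l) ∧
      (∀ k < L, σ'.rmem k = smallerSum P i NP fun j =>
        ∑ l ∈ Finset.range (P j), E.spectrum P ρ L s i j g (ρ s (P j)) l k) ∧
      ∀ c < P i, σ'.rmem (6 * L + c) = σ.rmem (6 * L + c) +
        E.largerSum P i NP fun j => E.large P ρ s i c j := by
  have hL := hS.L_ge
  have hLn := hS.L_le
  have hw := hS.word
  have hmem := hS.mem
  have h2 := hS.two_le
  obtain ⟨hn, -, hn4, -⟩ := hS.le_pow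
  have pi := hS.le hi
  have hNP := hS.NP_le
  have hNP0 := hS.NP_pos
  have hG := one_le_gT md s
  set X := n * (L * (gT md s + Nat.log 2 L)) with hX
  have hX1 : 2 * L ≤ X := Nat.mul_le_mul h2 (Nat.le_mul_of_pos_right _ (by omega))
  refine Runs.mono (T := (L * (2 + 14) + 6) + (3 + (NP * (950 * X + 8) + 6))) ?_ (by
    have h5 : NP * (950 * X + 8) ≤ NP * (960 * X) := Nat.mul_le_mul_left _ (by omega)
    rw [show NP * (960 * X) = 960 * (NP * X) by ring] at h5
    have : X ≤ NP * X := Nat.le_mul_of_pos_left _ (by omega)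
    omega) fun _ h => h
  refine Runs.seq (storeLoop_spec hS (fun _ => 0) (T := 2) (by norm_num) (by norm_num)
    (by norm_num) hC.iv3 hC.iv3 le_rfl (by simp [RExp.cost, IExp.cost])
    fun c hc σ' hA h15 hs => ⟨Nat.zero_le _, Nat.cast_zero⟩) ?_
  rintro σ₁ ⟨hA1, hs1, hx1⟩
  rw [zero_mul, zero_add] at hs1
  have hC1 := hC.agree hA1 rfl (hs1.mono le_rfl (by omega))
  refine Runs.seq (Q := fun σ' => Agree (.rset 4 (.ofNat ♯0)) σ₁ σ' ∧ σ'.rvar 4 = 0)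
    (Runs.block (Nat.zero_le _) le_rfl ?_).agree ?_
  · simp only [Prog.den, Function.update_self, IExp.eval, RExp.eval, Nat.cast_zero]
  rintro σ₂ ⟨hA2, hr2⟩
  have hC2 := hC1.agree hA2 rfl (hA2.same rfl _ _)
  have hrm2 := hA2.rm rfl
  have e : ∀ y, (storeLoop 18 3 0 (.ofNat ♯0)).wI y = false → σ₂.ivar y = σ.ivar y := fun y hy => by
    rw [hA2.i y rfl, hA1.i y hy]
  refine (Runs.forP (J := fun t σ' =>
      (∀ a, 5 * L ≤ a ∧ a < 6 * L ∨ 7 * L ≤ a → σ'.rmem a = σ₂.rmem a) ∧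
      (σ'.rvar 4 = smallerSum P i t fun j =>
        ∑ l ∈ Finset.range (P j), E.zeroLine P ρ s i j g (ρ s (P j)) l) ∧
      (∀ k < L, σ'.rmem k = smallerSum P i t fun j =>
        ∑ l ∈ Finset.range (P j), E.spectrum P ρ L s i j g (ρ s (P j)) l k) ∧
      ∀ c < P i, σ'.rmem (6 * L + c) = σ₂.rmem (6 * L + c) +
        E.largerSum P i t fun j => E.large P ρ s i c j) (N := NP)
      hC2.iv2 (by omega) rfl rfl (by norm_num) ?_ ?_).mono le_rfl ?_
  · refine ⟨fun _ _ => rfl, hr2, fun k hk => ?_, fun c hc => ?_⟩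
    · show σ₂.rmem k = _
      have := hx1 k hk
      rw [zero_mul, zero_add] at this
      rw [hrm2, this]; rfl
    · rw [Env.largerSum, Finset.sum_range_zero, add_zero]
  · rintro t ht σ' hA h9 ⟨hs, hr, hx, hy⟩
    refine (jStep_spec hS (hC2.agree hA rfl fun a ha => hs a (by omega)) hlen hi ht
      (by rw [hA.i 6 rfl, e 6 rfl, h6]) (by rw [hA.i 7 rfl, e 7 rfl, h7]) h9
      (by rw [hA.i 8 rfl, e 8 rfl, h8]) (by rw [hA.i 26 rfl, e 26 rfl, h26]) hg).mono le_rfl ?_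
    rintro σ'' ⟨hs', hr', hx', hy'⟩
    refine ⟨fun a ha => (hs' a ha).trans (hs a ha), ?_, fun k hk => ?_, fun c hc => ?_⟩
    · show σ''.rvar 4 = _
      rw [hr', hr, smallerSum, smallerSum, Finset.sum_range_succ]
    · show σ''.rmem k = _
      rw [hx' k hk, hx k hk, smallerSum, smallerSum, Finset.sum_range_succ]
    · show σ''.rmem _ = _
      rw [hy' c hc, hy c hc, Env.largerSum, Env.largerSum, Finset.sum_range_succ, add_assoc]
  · rintro σ' ⟨-, -, hs, hr, hx, hy⟩
    refine ⟨fun a ha => ?_, hr, hx, fun c hc => ?_⟩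
    · rw [hs a ha, hrm2, hs1 a (by omega)]
    · rw [hy c hc, hrm2, hs1 _ (by omega)]

end jLoop

/-! ### The search criterion from the power spectra -/

/-- The correlation for the exponent in variable `14`, with the factor `-L`, is put into the real
variable `2`. -/
def corr : Prog :=
  .rset 2 (.ofNat ♯0) ;;
  forP 18 3 (.rset 2 (§2 +ᵣ .load (cell 0 ‡18) *ᵣ .sinTurn (‡18 *ᵢ (‡14 +ᵢ ‡26)) ‡3))

/-- The values of the criterion are completed in region `6`: the contribution of the smaller primes
is added at the residue `0`, and at the powers of the generator. -/
def combine : Prog :=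
  .rstore (cell 6 ♯0) (.load (cell 6 ♯0) +ᵣ §4) ;; .iset 13 ♯1 ;;
  forP 14 26 (corr ;; .rstore (cell 6 ‡13) (.load (cell 6 ‡13) -ᵣ §2 /ᵣ .ofNat ‡3) ;;
    .iset 13 (‡13 *ᵢ ‡8 %ᵢ ‡7))

/-- The imaginary part of the Fourier transform of a spectrum `f` of length `L`, at the index `m +
M`. -/
noncomputable def sinSum (L M : ℕ) (f : ℕ → ℝ) (m : ℕ) : ℝ :=
  ∑ k ∈ Finset.range L, f k * Real.sin (2 * Real.pi * (((k * (m + M) : ℕ) : ℝ) / (L : ℝ)))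

section combine

variable {E : Env} {n d NP L md : ℕ} {τ : ℝ} {P : ℕ → ℕ} {ρ : ℕ → ℕ → ℕ} {s i j g len : ℕ}
  {σ : State}

theorem corr_spec (hS : Setup E n d NP L md P) {M m : ℕ} (hM : M ≤ n) (hm : m ≤ n)
    (h3 : σ.ivar 3 = L) (h14 : σ.ivar 14 = m) (h26 : σ.ivar 26 = M) :
    Runs E corr σ (40 * L) fun σ' => σ'.rvar 2 = sinSum L M σ.rmem m := by
  have hL := hS.L_ge
  have hLn := hS.L_le
  have hw := hS.word
  have hmem := hS.mem
  have h2 := hS.two_le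
  obtain ⟨hn, -, hn4, -⟩ := hS.le_pow
  have hnn : n * n ≤ n ^ 4 := mul2_le le_rfl le_rfl (by omega)
  refine Runs.mono (T := 3 + (L * (20 + 8) + 6)) ?_ (by omega) fun _ h => h
  refine Runs.seq (Q := fun σ' => Agree (.rset 2 (.ofNat ♯0)) σ σ' ∧ σ'.rvar 2 = 0)
    (Runs.block (Nat.zero_le _) le_rfl ?_).agree ?_
  · simp only [Prog.den, Function.update_self, IExp.eval, RExp.eval, Nat.cast_zero]
  rintro σ₁ ⟨hA1, hr1⟩
  have hrm := hA1.rm rfl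
  refine (Runs.forP (J := fun t σ' => σ'.rvar 2 = ∑ k ∈ Finset.range t, σ.rmem k *
      Real.sin (2 * Real.pi * (((k * (m + M) : ℕ) : ℝ) / (L : ℝ)))) (N := L)
    (by rw [hA1.i 3 rfl, h3]) (by omega) rfl rfl (by norm_num) hr1 ?_).mono le_rfl
      fun _ h => h.2.2
  rintro k hk σ' hA h18 hJ
  have b : k * (m + M) ≤ 10 * n * (2 * n) := Nat.mul_le_mul (by omega) (by omega)
  rw [show 10 * n * (2 * n) = 20 * (n * n) by ring] at b
  have h3' : σ'.ivar 3 = L := by rw [hA.i 3 rfl, hA1.i 3 rfl, h3]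
  have h14' : σ'.ivar 14 = m := by rw [hA.i 14 rfl, hA1.i 14 rfl, h14]
  have h26' : σ'.ivar 26 = M := by rw [hA.i 26 rfl, hA1.i 26 rfl, h26]
  have hrm' : σ'.rmem = σ.rmem := by rw [hA.rm rfl, hrm]
  refine Runs.block ?_ (by simp [Prog.time, RExp.cost, IExp.cost, cell]) ?_
  · simp only [Prog.Ok, RExp.Safe, IExp.Safe, IExp.eval, cell, h3', h14', h26', h18]
    repeat' apply And.intro
    all_goals first | trivial | omega
  · simp only [Prog.den, RExp.eval, IExp.eval, cell, h3', h14', h26', h18, Function.update_self,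
      hJ, hrm', zero_mul, zero_add]
    rw [Finset.sum_range_succ]

theorem combine_spec (hS : Setup E n d NP L md P) {p : ℕ} (hp : p.Prime) (hpn : p ≤ n)
    (hg : IsGen p g) (h3 : σ.ivar 3 = L) (h7 : σ.ivar 7 = p) (h8 : σ.ivar 8 = g)
    (h26 : σ.ivar 26 = p - 1) {f : ℕ → ℝ} (hf : ∀ k < L, σ.rmem k = f k) :
    Runs E combine σ (100 * (n * L)) fun σ' => Same (6 * L) (7 * L) σ σ' ∧
      σ'.rmem (6 * L) = σ.rmem (6 * L) + σ.rvar 4 ∧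
      ∀ m < p - 1, σ'.rmem (6 * L + g ^ m % p) = σ.rmem (6 * L + g ^ m % p) -
        sinSum L (p - 1) f m / L := by
  have hL := hS.L_ge
  have hLn := hS.L_le
  have hw := hS.word
  have hmem := hS.mem
  have h2 := hS.two_le
  obtain ⟨hn, -, hn4, -⟩ := hS.le_pow
  have hL0 : (L : ℝ) ≠ 0 := by
    have : 0 < L := by omega
    positivity
  refine Runs.mono (T := 20 + (2 + ((p - 1) * (40 * L + (20 + 6) + 8) + 6))) ?_ (by
    have h5 : (p - 1) * (40 * L + (20 + 6) + 8) ≤ n * (50 * L) := Nat.mul_le_mul (by omega) (by omega)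
    rw [show n * (50 * L) = 50 * (n * L) by ring] at h5
    have : 2 * L ≤ n * L := Nat.mul_le_mul_right _ h2
    omega) fun _ h => h
  refine Runs.seq (Q := fun σ' => Agree (.rstore (cell 6 ♯0) (.load (cell 6 ♯0) +ᵣ §4)) σ σ' ∧
    σ'.rmem = Function.update σ.rmem (6 * L) (σ.rmem (6 * L) + σ.rvar 4))
    (Runs.block ?_ (by simp [Prog.time, RExp.cost, IExp.cost, cell]) ?_).agree ?_
  · simp only [Prog.Ok, RExp.Safe, IExp.Safe, IExp.eval, cell, h3, and_true]; omega
  · simp only [Prog.den, RExp.eval, IExp.eval, cell, h3, add_zero]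
  rintro σ₁ ⟨hA1, hrm1⟩
  refine Runs.seq (Q := fun σ' => Agree (.iset 13 ♯1) σ₁ σ' ∧ σ'.ivar 13 = 1)
    (Runs.block ?_ le_rfl ?_).agree ?_
  · simp only [Prog.Ok, IExp.Safe]; omega
  · simp only [Prog.den, Function.update_self, IExp.eval]
  rintro σ₂ ⟨hA2, h13⟩
  have hrm2 : σ₂.rmem = σ₁.rmem := hA2.rm rfl
  have hs2 : Same (6 * L) (6 * L + 1) σ σ₂ := fun a ha => by
    rw [hrm2, hrm1, Function.update_of_ne (by omega)]
  refine (Runs.forP (J := fun t σ' => Same (6 * L + 1) (7 * L) σ₂ σ' ∧ σ'.ivar 13 = g ^ t % p ∧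
      (∀ m < t, σ'.rmem (6 * L + g ^ m % p) = σ.rmem (6 * L + g ^ m % p) -
        sinSum L (p - 1) f m / L) ∧
      ∀ m < p - 1, t ≤ m → σ'.rmem (6 * L + g ^ m % p) = σ.rmem (6 * L + g ^ m % p)) (N := p - 1)
    (by rw [hA2.i 26 rfl, hA1.i 26 rfl, h26]) (by omega) rfl rfl (by norm_num) ?_ ?_).mono le_rfl ?_
  · refine ⟨fun _ _ => rfl, ?_, fun m hm => absurd hm (Nat.not_lt_zero _), fun m hm _ => ?_⟩
    · show σ₂.ivar 13 = _
      rw [h13, pow_zero, Nat.mod_eq_of_lt hp.one_lt]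
    · have := hg.pow_mod_pos hp m
      exact hs2 _ (by omega)
  · rintro t ht σ' hA h14 ⟨hs, h13', hJ, hJ'⟩
    have h3' : σ'.ivar 3 = L := by rw [hA.i 3 rfl, hA2.i 3 rfl, hA1.i 3 rfl, h3]
    have h7' : σ'.ivar 7 = p := by rw [hA.i 7 rfl, hA2.i 7 rfl, hA1.i 7 rfl, h7]
    have h8' : σ'.ivar 8 = g := by rw [hA.i 8 rfl, hA2.i 8 rfl, hA1.i 8 rfl, h8]
    refine Runs.seq (corr_spec hS (M := p - 1) (m := t) (by omega) (by omega) h3' h14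
      (by rw [hA.i 26 rfl, hA2.i 26 rfl, hA1.i 26 rfl, h26])).agree ?_
    rintro σ₃ ⟨hA3, hr3⟩
    have hsin : sinSum L (p - 1) σ'.rmem t = sinSum L (p - 1) f t :=
      Finset.sum_congr rfl fun k hk => by
        have hk := Finset.mem_range.1 hk
        rw [hs k (by omega), hs2 k (by omega), hf k hk]
    rw [hsin] at hr3
    have hrm3 := hA3.rm rfl
    have h33 : σ₃.ivar 3 = L := by rw [hA3.i 3 rfl, h3']
    have h133 : σ₃.ivar 13 = g ^ t % p := by rw [hA3.i 13 rfl, h13']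
    have h73 : σ₃.ivar 7 = p := by rw [hA3.i 7 rfl, h7']
    have h83 : σ₃.ivar 8 = g := by rw [hA3.i 8 rfl, h8']
    have hlt : g ^ t % p < p := Nat.mod_lt _ hp.pos
    have hpos := hg.pow_mod_pos hp t
    have hg2 := hg.2.1
    have b : g ^ t % p * g ≤ n ^ 4 := mul2_le (by omega) (by omega) (by omega)
    have hx : g ^ t % p * g % p = g ^ (t + 1) % p := by rw [pow_succ, Nat.mod_mul_mod]
    refine Runs.block ?_ (by simp [Prog.time, RExp.cost, IExp.cost, cell]) ⟨?_, ?_, ?_, ?_⟩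
    · simp only [Prog.Ok, RExp.Safe, IExp.Safe, RExp.eval, IExp.eval, cell, Prog.den, h33, h133,
        h73, h83]
      repeat' apply And.intro
      all_goals first | trivial | assumption | omega
    · intro a ha
      simp only [Prog.den, IExp.eval, cell, h33, h133]
      rw [Function.update_of_ne (by omega), hrm3, hs a ha]
    · simp only [Prog.den, IExp.eval, h133, h73, h83, hx]
      rw [Function.update_of_ne (by norm_num), Function.update_self]
    · intro m hm
      simp only [Prog.den, IExp.eval, RExp.eval, cell, h33, h133, hr3, hrm3]
      rcases Nat.lt_or_ge m t with hmt | hmt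
      · have hne : g ^ m % p ≠ g ^ t % p := fun h => hmt.ne (hg.injOn hp
          (Finset.mem_coe.2 (Finset.mem_range.2 (by omega)))
          (Finset.mem_coe.2 (Finset.mem_range.2 ht)) h)
        rw [Function.update_of_ne (by omega), hJ m hmt]
      · rw [show m = t by omega, Function.update_self, hJ' t ht le_rfl]
    · intro m hm hmt
      simp only [Prog.den, IExp.eval, cell, h33, h133, hrm3]
      have hne : g ^ m % p ≠ g ^ t % p := fun h => absurd (hg.injOn hp
          (Finset.mem_coe.2 (Finset.mem_range.2 hm))
          (Finset.mem_coe.2 (Finset.mem_range.2 ht)) h) (by omega)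
      rw [Function.update_of_ne (by omega), hJ' m hm (by omega)]
  · rintro σ' ⟨-, -, hs, -, hJ, -⟩
    refine ⟨fun a ha => ?_, ?_, hJ⟩
    · rw [hs a (by omega), hs2 a (by omega)]
    · rw [hs _ (by omega), hrm2, hrm1, Function.update_self]

end combine

/-! ### Correctness of the computation of the search criterion -/

section correct

variable {E : Env} {n d NP L md : ℕ} {P : ℕ → ℕ} {ρ : ℕ → ℕ → ℕ} {s i j g : ℕ}

/-- The transform of the power spectra gives the terms of `T`, with the factor `-L`. -/
theorem sinSum_spectrum (hS : Setup E n d NP L md P) (hi : i < NP) (hj : j < NP)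
    (hg : IsGen (P i) g) {m : ℕ} (hm : m < P i - 1) (b : ℕ) :
    ∑ l ∈ Finset.range (P j), sinSum L (P i - 1) (E.spectrum P ρ L s i j g b l) m =
      -(L * smallSum E.α E.γ s (P i) (P j) (fun t => ρ t (P i)) (fun t => ρ t (P j)) b
        (g ^ m % P i)) := by
  have hL := hS.L_ge
  have pi := hS.le hi
  rw [smallSum_pow (hS.prime hi) (hS.prime hj).pos hg, Finset.mul_sum, ← Finset.sum_neg_distrib]
  refine Finset.sum_congr rfl fun l _ => ?_
  rw [sinSum]
  simp only [Env.spectrum]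
  rw [sum_normSq_sin (a := E.seqA P ρ s i j g l) (b := E.seqB P i j g b l) (by omega) hm
    (fun m' h _ => if_neg (by omega)) fun m' _ h => if_neg h]
  congr 2
  refine Finset.sum_congr rfl fun m' hm' => ?_
  have hm' := Finset.mem_range.1 hm'
  rw [Env.seqA, Env.seqB, if_pos hm', if_pos (by omega), Env.W]

theorem sinSum_smallerSum {f : ℕ → ℕ → ℝ} {N M m : ℕ} :
    sinSum L M (fun k => smallerSum P i N fun j => f j k) m =
      smallerSum P i N fun j => sinSum L M (f j) m := by
  simp only [sinSum, smallerSum, Finset.sum_mul, Finset.mul_sum, ite_mul, zero_mul]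
  rw [Finset.sum_comm]
  refine Finset.sum_congr rfl fun j _ => ?_
  split_ifs
  · refine Finset.sum_congr rfl fun k _ => by ring
  · simp

theorem Setup.lt_iff (hS : Setup E n d NP L md P) (hi : i < NP) (hj : j < NP) :
    P j < P i ↔ j < i := by
  refine ⟨fun h => ?_, fun h => hS.mono j i h hi⟩
  rcases lt_trichotomy j i with h1 | h1 | h1
  · exact h1
  · exact absurd h (by rw [h1]; exact lt_irrefl _)
  · exact absurd (hS.mono i j h1 hj) (not_lt.2 h.le)

theorem Setup.sum_primes (hS : Setup E n d NP L md P) (f : ℕ → ℝ) :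
    ∑ q ∈ primes n, f q = ∑ j ∈ Finset.range NP, f (P j) := by
  have h : primes n = (Finset.range NP).image P := by
    ext q
    simp only [Finset.mem_image, Finset.mem_range]
    exact ⟨hS.surj q, fun ⟨j, hj, h⟩ => h ▸ hS.mem_primes j hj⟩
  rw [h, Finset.sum_image]
  intro a ha b hb hab
  have ha := Finset.mem_range.1 (Finset.mem_coe.1 ha)
  have hb := Finset.mem_range.1 (Finset.mem_coe.1 hb)
  rcases lt_trichotomy a b with h1 | h1 | h1
  · exact absurd hab (hS.mono a b h1 hb).ne
  · exact h1
  · exact absurd hab (hS.mono b a h1 ha).ne'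

theorem critVal_eq (hS : Setup E n d NP L md P) (hi : i < NP) (c : ℕ) :
    critVal E.α E.γ n s ρ (P i) c = E.theta P ρ s i c +
      (smallerSum P i NP fun j => smallSum E.α E.γ s (P i) (P j) (fun t => ρ t (P i))
        (fun t => ρ t (P j)) (ρ s (P j)) c) + E.largerSum P i NP fun j => E.large P ρ s i c j := by
  rw [critVal, Finset.sum_filter, Finset.sum_filter, hS.sum_primes, hS.sum_primes, Env.theta,
    smallerSum, Env.largerSum]
  congr 1
  · congr 1
    refine Finset.sum_congr rfl fun j hj => ?_
    simp only [hS.lt_iff hi (Finset.mem_range.1 hj)]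
  · refine Finset.sum_congr rfl fun j hj => ?_
    simp only [hS.lt_iff (Finset.mem_range.1 hj) hi]
    rfl

end correct

end RealRAM

namespace Korobov

/-! ### The rule of the construction in terms of residues -/

theorem kern_congr {α : ℝ} {γ : ℕ → ℝ} {s p q : ℕ} {u v u' v' : ℕ → ℕ} (hu : ∀ j < s, u j = u' j)
    (hv : ∀ j < s, v j = v' j) (k l : ℕ) : kern α γ s p q u v k l = kern α γ s p q u' v' k l :=
  Finset.prod_congr rfl fun j hj => by
    rw [hu j (Finset.mem_range.1 hj), hv j (Finset.mem_range.1 hj)]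

theorem thetaVal_congr {α : ℝ} {γ : ℕ → ℝ} {s p : ℕ} {u u' : ℕ → ℕ} (hu : ∀ j < s, u j = u' j)
    (c : ℕ) : thetaVal α γ s p u c = thetaVal α γ s p u' c := by
  simp only [thetaVal, kern_congr hu hu]

theorem critVal_congr {α : ℝ} {γ : ℕ → ℝ} {n s p : ℕ} {ρ ρ' : ℕ → ℕ → ℕ}
    (h : ∀ j < s, ∀ q, ρ j q = ρ' j q) (hs : ∀ q < p, ρ s q = ρ' s q) (c : ℕ) :
    critVal α γ n s ρ p c = critVal α γ n s ρ' p c := by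
  have hk : ∀ q k l, kern α γ s p q (fun j => ρ j p) (fun j => ρ j q) k l =
      kern α γ s p q (fun j => ρ' j p) (fun j => ρ' j q) k l := fun q k l =>
    kern_congr (fun j hj => h j hj p) (fun j hj => h j hj q) k l
  rw [critVal, critVal, thetaVal_congr fun j hj => h j hj p]
  congr 1
  · congr 1
    refine Finset.sum_congr rfl fun q hq => ?_
    simp only [smallSum, hk, hs q (Finset.mem_filter.1 hq).2]
  · refine Finset.sum_congr rfl fun q _ => ?_
    simp only [largeSum, hk]

/-- The residue of the component with index `s` modulo `p` obeys the rule of the construction,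
expressed by the computed values. -/
def Good (α : ℝ) (γ : ℕ → ℝ) (n : ℕ) (τ : ℝ) (ρ : ℕ → ℕ → ℕ) (s p : ℕ) : Prop :=
  ∃ B ⊆ Finset.range p, B.card = ⌈τ * (p : ℝ)⌉₊ ∧
    (∀ b ∈ B, ∀ c ∈ Finset.range p, c ∉ B →
      thetaVal α γ s p (fun j => ρ j p) b ≤ thetaVal α γ s p (fun j => ρ j p) c) ∧
    ρ s p ∈ B ∧ ∀ c ∈ B, critVal α γ n s ρ p (ρ s p) ≤ critVal α γ n s ρ p c

theorem Good.congr {α : ℝ} {γ : ℕ → ℝ} {n : ℕ} {τ : ℝ} {ρ ρ' : ℕ → ℕ → ℕ} {s p : ℕ}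
    (hG : Good α γ n τ ρ s p) (h : ∀ j < s, ∀ q, ρ j q = ρ' j q)
    (hs : ∀ q ≤ p, ρ s q = ρ' s q) : Good α γ n τ ρ' s p := by
  obtain ⟨B, h1, h2, h3, h4, h5⟩ := hG
  have e1 := fun c => thetaVal_congr (α := α) (γ := γ) (p := p) (fun j hj => h j hj p) c
  have e2 := fun c => critVal_congr (α := α) (γ := γ) (n := n) h (fun q hq => hs q hq.le) c
  refine ⟨B, h1, h2, fun b hb c hc hcB => ?_, by rwa [← hs p le_rfl], fun c hc => ?_⟩
  · rw [← e1, ← e1]; exact h3 b hb c hc hcB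
  · rw [← e2, ← e2, ← hs p le_rfl]; exact h5 c hc

end Korobov

namespace RealRAM

open Korobov (IsGen critVal Good rankOf card_rankOf_lt le_of_rankOf rankOf_lt_card)

/-! ### The choice of a residue -/

/-- The values of the search criteria `θ` and `T` for the prime in variable `7`, up to constants,
are put into the regions `5` and `6`. -/
def critP : Prog := findGen ;; thetaP ;; jLoop ;; combine

/-- The rank of the residue in variable `15` is put into variable `24`. -/
def rankP : Prog :=
  .iset 24 ♯0 ;; forP 29 7 (.cond (.rlt (.load (cell 5 ‡29)) (.load (cell 5 ‡15)))
    (.iset 24 (‡24 +ᵢ ♯1)) (.cond (.rlt (.load (cell 5 ‡15)) (.load (cell 5 ‡29))) .skip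
      (.cond (.ilt ‡29 ‡15) (.iset 24 (‡24 +ᵢ ♯1)) .skip)))

/-- The residue in variable `15` becomes the best one so far. -/
def takeP : Prog := .iset 23 ‡15 ;; .iset 25 ♯1

/-- Among the residues with rank less than `τ p`, one that minimises the criterion is put into
variable `23`. As the rank is a natural number, this means that it is less than `⌈τ p⌉`, so no
rounding is needed. -/
def selectP : Prog :=
  .iset 25 ♯0 ;; forP 15 7 (rankP ;; .cond (.rlt (.ofNat ‡24) (§0 *ᵣ .ofNat ‡7))
    (.cond (.ieq ‡25 ♯0) takeP
      (.cond (.rlt (.load (cell 6 ‡15)) (.load (cell 6 ‡23))) takeP .skip)) .skip)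

/-- The choice of the residue for the prime with the index in variable `6`. -/
def primeStep : Prog :=
  .iset 7 (.load ‡6) ;; .iset 26 (‡7 -ᵢ ♯1) ;; critP ;; selectP ;; .emit ‡23

section choice

variable {E : Env} {n d NP L md : ℕ} {τ : ℝ} {P : ℕ → ℕ} {ρ : ℕ → ℕ → ℕ} {s i len : ℕ}
  {σ : State}

theorem critP_spec (hS : Setup E n d NP L md P) (hC : Ctx E n d NP L md τ P ρ s len σ)
    (hlen : len = s * NP + i) (hi : i < NP) (h6 : σ.ivar 6 = i) (h7 : σ.ivar 7 = P i)
    (h26 : σ.ivar 26 = P i - 1) :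
    Runs E critP σ (3000 * (NP * (n * (L * (gT md s + Nat.log 2 L))))) fun σ' =>
      Same 0 (7 * L) σ σ' ∧ ∀ c < P i, σ'.rmem (5 * L + c) = E.theta P ρ s i c ∧
        σ'.rmem (6 * L + c) = critVal E.α E.γ n s ρ (P i) c := by
  have hL := hS.L_ge
  have pi := hS.le hi
  have hp := hS.prime hi
  have h2 := hS.two_le
  have hG := one_le_gT md s
  have hNP := hS.NP_pos
  refine Runs.mono (T := 200 * (n * n) + (1000 * (n * (n * gT md s)) +
    (1000 * (NP * (n * (L * (gT md s + Nat.log 2 L)))) + 100 * (n * L)))) ?_ (by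
    set X := n * (L * (gT md s + Nat.log 2 L)) with hX
    have h3 : X ≤ NP * X := Nat.le_mul_of_pos_left _ hNP
    have h4 : n * L ≤ X := Nat.mul_le_mul_left _ (Nat.le_mul_of_pos_right _ (by omega))
    have h5 : n * n ≤ n * L := Nat.mul_le_mul_left _ (by omega)
    have h6 : n * (n * gT md s) ≤ X :=
      Nat.mul_le_mul_left _ (Nat.mul_le_mul (by omega) (by omega))
    omega) fun _ h => h
  refine Runs.seq (findGen_spec hS hp pi h7).agree ?_
  rintro σ₁ ⟨hA1, hgen⟩
  set g := σ₁.ivar 8 with hgdef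
  have hC1 := hC.agree hA1 rfl (hA1.same rfl _ _)
  refine Runs.seq (thetaP_spec hS hC1 hi (by rw [hA1.i 6 rfl, h6])
    (by rw [hA1.i 7 rfl, h7])).agree ?_
  rintro σ₂ ⟨hA2, hs2, hx2⟩
  have hC2 := hC1.agree hA2 rfl (hs2.mono (Nat.zero_le _) le_rfl)
  refine Runs.seq (jLoop_spec hS hC2 (g := g) hlen hi (by rw [hA2.i 6 rfl, hA1.i 6 rfl, h6])
    (by rw [hA2.i 7 rfl, hA1.i 7 rfl, h7]) (hA2.i 8 rfl)
    (by rw [hA2.i 26 rfl, hA1.i 26 rfl, h26]) (hgen.2.1.le.trans pi)).agree ?_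
  rintro σ₃ ⟨hA3, hs3, hr3, hx3, hy3⟩
  have hC3 := hC2.agree hA3 rfl fun a ha => hs3 a (by omega)
  refine (combine_spec hS hp pi hgen hC3.iv3 (by rw [hA3.i 7 rfl, hA2.i 7 rfl, hA1.i 7 rfl, h7])
    (by rw [hA3.i 8 rfl, hA2.i 8 rfl])
    (by rw [hA3.i 26 rfl, hA2.i 26 rfl, hA1.i 26 rfl, h26]) hx3).mono le_rfl ?_
  rintro σ₄ ⟨hs4, h0, hpow⟩
  have hp0 := hp.pos
  refine ⟨fun a ha => ?_, fun c hc => ⟨?_, ?_⟩⟩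
  · rw [hs4 a (by omega), hs3 a (by omega), hs2 a (by omega), hA1.rm rfl]
  · rw [hs4 _ (by omega), hs3 _ (by omega), (hx2 c hc).1]
  · rw [critVal_eq hS hi]
    rcases Nat.eq_zero_or_pos c with rfl | hc0
    · have h3 := hy3 0 hp0
      rw [(hx2 0 hp0).2, add_zero] at h3
      rw [add_zero, h0, h3, hr3, add_right_comm]
      congr 2
      refine congrArg (smallerSum P i NP) (funext fun j => ?_)
      rw [Korobov.smallSum_zero hp hgen]
      rfl
    -- the nonzero residues are the powers of the generator
    · have hmem : c ∈ (Finset.range (P i - 1)).image fun m => g ^ m % P i := by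
        rw [hgen.image hp]; exact Finset.mem_Ico.2 ⟨hc0, hc⟩
      obtain ⟨m, hm, rfl⟩ := Finset.mem_image.1 hmem
      have hm := Finset.mem_range.1 hm
      have hL0 : (L : ℝ) ≠ 0 := by
        have : 0 < L := by omega
        positivity
      rw [hpow m hm, hy3 _ hc, (hx2 _ hc).2, sinSum_smallerSum, sub_eq_add_neg, add_right_comm]
      congr 2
      rw [smallerSum, smallerSum, Finset.sum_div, ← Finset.sum_neg_distrib]
      refine Finset.sum_congr rfl fun j hj => ?_
      split_ifs with hji
      · have e : sinSum L (P i - 1) (fun k => ∑ l ∈ Finset.range (P j),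
            E.spectrum P ρ L s i j g (ρ s (P j)) l k) m = ∑ l ∈ Finset.range (P j),
              sinSum L (P i - 1) (E.spectrum P ρ L s i j g (ρ s (P j)) l) m := by
          simp only [sinSum, Finset.sum_mul]
          exact Finset.sum_comm
        rw [e, sinSum_spectrum hS hi (Finset.mem_range.1 hj) hgen hm]
        field_simp
      · simp

theorem rankP_spec (hS : Setup E n d NP L md P) {p c : ℕ} {f : ℕ → ℝ} (hp : p ≤ n)
    (h3 : σ.ivar 3 = L) (h7 : σ.ivar 7 = p) (h15 : σ.ivar 15 = c) (hc : c < p)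
    (hf : ∀ c < p, σ.rmem (5 * L + c) = f c) :
    Runs E rankP σ (100 * n) fun σ' => σ'.ivar 24 = rankOf f p c := by
  have hL := hS.L_ge
  have hLn := hS.L_le
  have hw := hS.word
  have hmem := hS.mem
  have h2 := hS.two_le
  obtain ⟨hn, -, hn4, -⟩ := hS.le_pow
  refine Runs.mono (T := 2 + (p * (70 + 8) + 6)) ?_ (by omega) fun _ h => h
  refine Runs.seq (Q := fun σ' => Agree (.iset 24 ♯0) σ σ' ∧ σ'.ivar 24 = 0)
    (Runs.block (Nat.zero_le _) le_rfl ?_).agree ?_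
  · simp only [Prog.den, Function.update_self, IExp.eval]
  rintro σ₁ ⟨hA1, h24⟩
  classical
  refine (Runs.forP (J := fun t σ' => σ'.ivar 24 =
    ((Finset.range t).filter fun c' => f c' < f c ∨ (¬ f c < f c' ∧ c' < c)).card) (N := p)
    (by rw [hA1.i 7 rfl, h7]) (by omega) rfl rfl (by norm_num) (by simpa using h24)
    ?_).mono le_rfl ?_
  · rintro t ht σ' hA h29 hJ
    have h3' : σ'.ivar 3 = L := by rw [hA.i 3 rfl, hA1.i 3 rfl, h3]
    have h15' : σ'.ivar 15 = c := by rw [hA.i 15 rfl, hA1.i 15 rfl, h15]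
    have hrm : σ'.rmem = σ.rmem := by rw [hA.rm rfl, hA1.rm rfl]
    have hcard : ((Finset.range t).filter fun c' => f c' < f c ∨ (¬ f c < f c' ∧ c' < c)).card ≤ t := by
      simpa using Finset.card_filter_le (Finset.range t) fun c' =>
        f c' < f c ∨ (¬ f c < f c' ∧ c' < c)
    rw [Finset.range_add_one, Finset.filter_insert]
    set A := (Finset.range t).filter fun c' => f c' < f c ∨ (¬ f c < f c' ∧ c' < c) with hA'
    have hnot : t ∉ A := by simp [hA']
    refine Runs.block ?_ (by simp [Prog.time, BExp.cost, RExp.cost, IExp.cost, cell]) ?_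
    · simp only [Prog.Ok, BExp.Safe, RExp.Safe, IExp.Safe, IExp.eval, cell, h3', h15', h29, hJ]
      refine ⟨⟨?_, ?_⟩, fun _ => ?_, fun _ => ⟨⟨?_, ?_⟩, fun _ => trivial, fun _ =>
        ⟨?_, fun _ => ?_, fun _ => trivial⟩⟩⟩
      all_goals omega
    · simp only [Prog.den, BExp.Holds, RExp.eval, IExp.eval, cell, h3', h15', h29, hrm, hf t ht,
        hf c hc]
      by_cases h1 : f t < f c
      · rw [if_pos h1, if_pos (Or.inl h1), Finset.card_insert_of_notMem hnot, hJ]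
        simp
      · rw [if_neg h1]
        by_cases h4 : f c < f t
        · rw [if_pos h4, if_neg (by tauto), Function.update_of_ne (by norm_num), hJ]
        · rw [if_neg h4]
          by_cases h5 : t < c
          · rw [if_pos h5, if_pos (Or.inr ⟨h4, h5⟩), Finset.card_insert_of_notMem hnot, hJ]
            simp
          · rw [if_neg h5, if_neg (by tauto), Function.update_of_ne (by norm_num), hJ]
  · rintro σ' ⟨-, -, hJ⟩
    rw [hJ, rankOf]

theorem selectP_spec (hS : Setup E n d NP L md P) {p : ℕ} {f T : ℕ → ℝ} (hp : p ≤ n) (hp0 : 0 < p)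
    (hτ : 0 < τ) (hτ1 : τ < 1) (h3 : σ.ivar 3 = L) (h7 : σ.ivar 7 = p) (hr0 : σ.rvar 0 = τ)
    (hf : ∀ c < p, σ.rmem (5 * L + c) = f c) (hT : ∀ c < p, σ.rmem (6 * L + c) = T c) :
    Runs E selectP σ (200 * (n * n)) fun σ' => σ'.ivar 23 < p ∧
      rankOf f p (σ'.ivar 23) < ⌈τ * (p : ℝ)⌉₊ ∧
      ∀ c < p, rankOf f p c < ⌈τ * (p : ℝ)⌉₊ → T (σ'.ivar 23) ≤ T c := by
  have hL := hS.L_ge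
  have hLn := hS.L_le
  have hw := hS.word
  have hmem := hS.mem
  have h2 := hS.two_le
  obtain ⟨hn, -, hn4, -⟩ := hS.le_pow
  refine Runs.mono (T := 2 + (p * (100 * n + 60 + 8) + 6)) ?_ (by
    have h5 : p * (100 * n + 60 + 8) ≤ n * (140 * n) := Nat.mul_le_mul (by omega) (by omega)
    rw [show n * (140 * n) = 140 * (n * n) by ring] at h5
    have : 2 * 2 ≤ n * n := Nat.mul_le_mul h2 h2
    omega) fun _ h => h
  set M := ⌈τ * (p : ℝ)⌉₊ with hM
  refine Runs.seq (Q := fun σ' => Agree (.iset 25 ♯0) σ σ' ∧ σ'.ivar 25 = 0)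
    (Runs.block (Nat.zero_le _) le_rfl ?_).agree ?_
  · simp only [Prog.den, Function.update_self, IExp.eval]
  rintro σ₁ ⟨hA1, h25⟩
  -- variable `25` says whether one of the residues tested so far is admissible
  refine (Runs.forP (J := fun t σ' => (σ'.ivar 25 = 0 ∧ ∀ c < t, ¬ rankOf f p c < M) ∨
      (σ'.ivar 25 = 1 ∧ σ'.ivar 23 < t ∧ rankOf f p (σ'.ivar 23) < M ∧
        ∀ c < t, rankOf f p c < M → T (σ'.ivar 23) ≤ T c)) (N := p)
    (by rw [hA1.i 7 rfl, h7]) (by omega) rfl rfl (by norm_num)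
    (Or.inl ⟨by rw [← h25]; rfl, fun c hc => absurd hc (Nat.not_lt_zero _)⟩) ?_).mono le_rfl ?_
  · rintro t ht σ' hA h15 hJ
    have h3' : σ'.ivar 3 = L := by rw [hA.i 3 rfl, hA1.i 3 rfl, h3]
    have h7' : σ'.ivar 7 = p := by rw [hA.i 7 rfl, hA1.i 7 rfl, h7]
    have hrm : σ'.rmem = σ.rmem := by rw [hA.rm rfl, hA1.rm rfl]
    refine Runs.seq (rankP_spec hS hp h3' h7' h15 ht fun c hc => by rw [hrm, hf c hc]).agree ?_
    rintro σ₂ ⟨hA2, h24⟩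
    have h32 : σ₂.ivar 3 = L := by rw [hA2.i 3 rfl, h3']
    have h72 : σ₂.ivar 7 = p := by rw [hA2.i 7 rfl, h7']
    have h152 : σ₂.ivar 15 = t := by rw [hA2.i 15 rfl, h15]
    have hr02 : σ₂.rvar 0 = τ := by rw [hA2.r 0 rfl, hA.r 0 rfl, hA1.r 0 rfl, hr0]
    have hrm2 : σ₂.rmem = σ.rmem := by rw [hA2.rm rfl, hrm]
    rw [← hA2.i 25 rfl, ← hA2.i 23 rfl] at hJ
    have hrk := rankOf_lt_card (f := f) ht
    have hext : ∀ c < t + 1, c < t ∨ c = t := fun c hc => by omega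
    have hcl : ∀ r : ℕ, (r : ℝ) < τ * (p : ℝ) ↔ r < M := fun r => by rw [hM, Nat.lt_ceil]
    refine Runs.block ?_ (by simp [Prog.time, BExp.cost, RExp.cost, IExp.cost, cell, takeP]) ?_
    · simp only [Prog.Ok, takeP, BExp.Safe, BExp.Holds, RExp.Safe, IExp.Safe, IExp.eval, cell, h32,
        h152, h24, h72]
      refine ⟨⟨by omega, trivial, by omega⟩, fun _ => ⟨by omega, fun _ => by omega, fun h => ?_⟩,
        fun _ => trivial⟩
      have : σ₂.ivar 23 < t := by
        rcases hJ with hJ | hJ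
        · exact absurd hJ.1 h
        · exact hJ.2.1
      refine ⟨by omega, fun _ => by omega, fun _ => trivial⟩
    · simp only [Prog.den, takeP, BExp.Holds, RExp.eval, IExp.eval, cell, h32, h152, h24, h72, hr02,
        hrm2, hT t ht, hcl]
      by_cases h1 : rankOf f p t < M
      · rw [if_pos h1]
        rcases hJ with ⟨h4, h5⟩ | ⟨h4, h5, h6, h8⟩
        · rw [if_pos h4]
          refine Or.inr ?_
          simp only [Function.update_apply, Nat.reduceEqDiff, if_false,
            if_true]
          refine ⟨trivial, by omega, h1, fun c hc hcM => ?_⟩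
          rcases hext c hc with h | h
          · exact absurd hcM (h5 c h)
          · rw [h]
        · rw [if_neg (by omega), hT _ (h5.trans ht)]
          by_cases h9 : T t < T (σ₂.ivar 23)
          · rw [if_pos h9]
            refine Or.inr ?_
            simp only [Function.update_apply, Nat.reduceEqDiff, if_false,
              if_true]
            refine ⟨trivial, by omega, h1, fun c hc hcM => ?_⟩
            rcases hext c hc with h | h
            · exact h9.le.trans (h8 c h hcM)
            · rw [h]
          · rw [if_neg h9]
            refine Or.inr ?_
            simp only [Function.update_apply, Nat.reduceEqDiff, if_false]
            refine ⟨h4, by omega, h6, fun c hc hcM => ?_⟩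
            rcases hext c hc with h | h
            · exact h8 c h hcM
            · rw [h]; exact not_lt.1 h9
      · rw [if_neg h1]
        simp only [Function.update_apply, Nat.reduceEqDiff, if_false]
        rcases hJ with ⟨h4, h5⟩ | ⟨h4, h5, h6, h8⟩
        · refine Or.inl ⟨h4, fun c hc => ?_⟩
          rcases hext c hc with h | h
          · exact h5 c h
          · rw [h]; exact h1
        · refine Or.inr ⟨h4, by omega, h6, fun c hc hcM => ?_⟩
          rcases hext c hc with h | h
          · exact h8 c h hcM
          · exact absurd (h ▸ hcM) h1
  · rintro σ' ⟨-, -, hJ⟩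
    have hp0' : (0 : ℝ) < p := by exact_mod_cast hp0
    have hMp : M ≤ p := Nat.ceil_le.2 (by nlinarith)
    have hM0 : 0 < M := Nat.ceil_pos.2 (by positivity)
    have hcard := card_rankOf_lt f hMp
    rcases hJ with ⟨-, hJ⟩ | ⟨-, hJ⟩
    -- there are `M > 0` admissible residues, so one has been found
    · obtain ⟨c, hc⟩ := Finset.card_pos.1 (hcard ▸ hM0)
      rw [Finset.mem_filter, Finset.mem_range] at hc
      exact absurd hc.2 (hJ c hc.1)
    · exact hJ

/-- The residues after the choice of a further one. -/
def extend (P : ℕ → ℕ) (ρ : ℕ → ℕ → ℕ) (s i b : ℕ) (t q : ℕ) : ℕ :=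
  if t = s ∧ q = P i then b else ρ t q

theorem OutIs.append {o : List ℕ} (hS : Setup E n d NP L md P)
    (h : OutIs NP P ρ (s * NP + i) o) (hi : i < NP) {b : ℕ} (hb : b < P i) :
    OutIs NP P (extend P ρ s i b) (s * NP + (i + 1)) (o ++ [b]) := by
  constructor
  · rw [← add_assoc, List.range_succ, List.map_append, h.eq]
    congr 1
    · refine List.map_congr_left fun a ha => ?_
      have ha := List.mem_range.1 ha
      rw [extend, if_neg]
      rintro ⟨h1, h2⟩
      have hm : a % NP < NP := Nat.mod_lt _ hS.NP_pos
      have h3 : a % NP = i := by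
        rcases lt_trichotomy (a % NP) i with h3 | h3 | h3
        · exact absurd h2 (hS.mono _ _ h3 hi).ne
        · exact h3
        · exact absurd h2 (hS.mono _ _ h3 hm).ne'
      have := Nat.div_add_mod' a NP
      rw [h1, h3] at this
      omega
    · rw [List.map_singleton, mul_add_div_of_lt hi, mul_add_mod_of_lt hi, extend,
        if_pos ⟨rfl, rfl⟩]
  · intro j i' hi'
    rw [extend]
    split_ifs with h1
    · rw [h1.2]; exact hb
    · exact h.lt j i' hi'

/-- The residue that is appended to the output obeys the rule of the construction. -/
theorem primeStep_spec (hS : Setup E n d NP L md P) (hτ : 0 < τ) (hτ1 : τ < 1)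
    (hC : Ctx E n d NP L md τ P ρ s (s * NP + i) σ) (hi : i < NP) (h6 : σ.ivar 6 = i) :
    Runs E primeStep σ (4000 * (NP * (n * (L * (gT md s + Nat.log 2 L))))) fun σ' =>
      ∃ b, Good E.α E.γ n τ (extend P ρ s i b) s (P i) ∧
        Ctx E n d NP L md τ P (extend P ρ s i b) s (s * NP + (i + 1)) σ' := by
  have hL := hS.L_ge
  have hw := hS.word
  have hmem := hS.mem
  have pi := hS.le hi
  have hp := hS.prime hi
  have hp0 := hp.pos
  have h2 := hS.two_le
  obtain ⟨hn, hd, hn4, -⟩ := hS.le_pow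
  have hG := one_le_gT md s
  have hNP := hS.NP_pos
  have hNPn := hS.NP_le
  refine Runs.mono (T := 3 + (4 + (3000 * (NP * (n * (L * (gT md s + Nat.log 2 L)))) +
    (200 * (n * n) + 2)))) ?_ (by
    set X := n * (L * (gT md s + Nat.log 2 L)) with hX
    have h3 : X ≤ NP * X := Nat.le_mul_of_pos_left _ hNP
    have h4 : n * L ≤ X := Nat.mul_le_mul_left _ (Nat.le_mul_of_pos_right _ (by omega))
    have h5 : n * n ≤ n * L := Nat.mul_le_mul_left _ (by omega)
    have : 2 * 2 ≤ n * n := Nat.mul_le_mul h2 h2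
    omega) fun _ h => h
  refine Runs.seq (Q := fun σ' => Agree (.iset 7 (.load ‡6)) σ σ' ∧ σ'.ivar 7 = P i)
    (Runs.block ?_ le_rfl ?_).agree ?_
  · simp only [Prog.Ok, IExp.Safe, IExp.eval, h6, hC.im i hi]; omega
  · simp only [Prog.den, Function.update_self, IExp.eval, h6, hC.im i hi]
  rintro σ₁ ⟨hA1, h7⟩
  refine Runs.seq (Q := fun σ' => Agree (.iset 26 (‡7 -ᵢ ♯1)) σ₁ σ' ∧ σ'.ivar 26 = P i - 1)
    (Runs.block ?_ le_rfl ?_).agree ?_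
  · simp only [Prog.Ok, IExp.Safe, h7]; omega
  · simp only [Prog.den, Function.update_self, IExp.eval, h7]
  rintro σ₂ ⟨hA2, h26⟩
  have hC2 := (hC.agree hA1 rfl (hA1.same rfl _ _)).agree hA2 rfl (hA2.same rfl _ _)
  refine Runs.seq (critP_spec hS hC2 rfl hi (by rw [hA2.i 6 rfl, hA1.i 6 rfl, h6])
    (by rw [hA2.i 7 rfl, h7]) h26).agree ?_
  rintro σ₃ ⟨hA3, hs3, hx3⟩
  have hC3 := hC2.agree hA3 rfl hs3
  refine Runs.seq (selectP_spec hS pi hp0 hτ hτ1 hC3.iv3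
    (by rw [hA3.i 7 rfl, hA2.i 7 rfl, h7]) hC3.rv0 (fun c hc => (hx3 c hc).1)
    (fun c hc => (hx3 c hc).2)).agree ?_
  rintro σ₄ ⟨hA4, hb, hrk, hmin⟩
  have hC4 := hC3.agree hA4 rfl (hA4.same rfl _ _)
  set b := σ₄.ivar 23 with hbdef
  refine Runs.block (by simp only [Prog.Ok, IExp.Safe, ← hbdef]; omega) le_rfl ⟨b, ?_, ?_⟩
  · have e1 : ∀ c, Korobov.thetaVal E.α E.γ s (P i) (fun j => extend P ρ s i b j (P i)) c =
        E.theta P ρ s i c := fun c => Korobov.thetaVal_congr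
      (fun j hj => if_neg fun h => hj.ne h.1) c
    have e2 : ∀ c, critVal E.α E.γ n s (extend P ρ s i b) (P i) c =
        critVal E.α E.γ n s ρ (P i) c := fun c => Korobov.critVal_congr
      (fun j hj q => if_neg fun h => hj.ne h.1) (fun q hq => if_neg fun h => hq.ne h.2) c
    have e3 : extend P ρ s i b s (P i) = b := if_pos ⟨rfl, rfl⟩
    have hp0' : (0 : ℝ) < P i := by exact_mod_cast hp0
    refine ⟨(Finset.range (P i)).filter fun c => rankOf (E.theta P ρ s i) (P i) c < ⌈τ * (P i : ℝ)⌉₊,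
      Finset.filter_subset _ _, card_rankOf_lt _ (Nat.ceil_le.2 (by nlinarith)), ?_, ?_, ?_⟩
    · intro a ha c hc hcB
      rw [e1, e1]
      refine le_of_rankOf (Finset.mem_range.1 hc) (Finset.mem_filter.1 ha).2 fun h => hcB ?_
      exact Finset.mem_filter.2 ⟨hc, h⟩
    · rw [e3]; exact Finset.mem_filter.2 ⟨Finset.mem_range.2 hb, hrk⟩
    · intro c hc
      rw [e3, e2, e2]
      obtain ⟨h1, h3⟩ := Finset.mem_filter.1 hc
      exact hmin c (Finset.mem_range.1 h1) h3
  · have hlen := hC4.len_ge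
    refine ⟨⟨hC4.iv0, hC4.iv1, hC4.iv2, hC4.iv3, hC4.iv4, hC4.rv0, hC4.im⟩,
      hC4.out.append hS hi hb, hC4.iv5, hC4.lt, Nat.le_add_right _ _, fun hmd => ?_⟩
    obtain ⟨h1, h3⟩ := hC4.tab hmd
    refine ⟨h1, fun a ha => (h3 a ha).trans ?_⟩
    exact Korobov.kern_congr (fun j hj => (if_neg fun h => hj.ne h.1).symm)
      (fun j hj => (if_neg fun h => hj.ne h.1).symm) _ _

end choice

end RealRAM

namespace RealRAM

open Korobov (primes Good)

/-! ### The table of the kernel products -/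

/-- The digits of the table address in variable `18`, and the primes with the indices found. -/
def decode : Prog :=
  .iset 11 (‡18 %ᵢ ‡0) ;; .iset 12 (‡18 /ᵢ ‡0 %ᵢ ‡0) ;; .iset 9 (‡18 /ᵢ ‡0 /ᵢ ‡0 %ᵢ ‡2) ;;
  .iset 6 (‡18 /ᵢ ‡0 /ᵢ ‡0 /ᵢ ‡2) ;; .iset 7 (.load ‡6) ;; .iset 10 (.load ‡9)

/-- The table is multiplied by the factors of the component before the current one. -/
def tabUpdate : Prog :=
  .iset 28 (‡2 *ᵢ ‡2 *ᵢ ‡0 *ᵢ ‡0) ;; forP 18 28 (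
    decode ;; .rstore (cell 7 ‡18)
      ((.load (cell 7 ‡18) +ᵣ .ofNat ♯1) *ᵣ factorR (‡5 -ᵢ ♯1) -ᵣ .ofNat ♯1))

/-- The step for the component in variable `5`; the first component is `1`. -/
def step : Prog :=
  .cond (.ieq ‡5 ♯0) (forP 6 2 (.emit ♯1))
    (.cond (.ieq ‡4 ♯1) tabUpdate .skip ;; forP 6 2 primeStep)

/-- The situation before the step for the component with index `s`. The table is only updated at the
beginning of the next step, except for the first one; hence the index `s - 1`, which is `0` for
`s = 0` as well. -/
structure Inv (E : Env) (n d NP L md : ℕ) (τ : ℝ) (P : ℕ → ℕ) (ρ : ℕ → ℕ → ℕ) (s : ℕ)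
    (σ : State) : Prop extends Base n d NP L md τ P σ where
  out : OutIs NP P ρ (s * NP) σ.out
  tab : md = 1 → TabOK E NP n L P ρ (s - 1) σ.rmem
  one : 0 < s → ∀ i < NP, ρ 0 (P i) = 1
  good : ∀ t, 0 < t → t < s → ∀ i < NP, Good E.α E.γ n τ ρ t (P i)

section step

variable {E : Env} {n d NP L md : ℕ} {τ : ℝ} {P : ℕ → ℕ} {ρ : ℕ → ℕ → ℕ} {s : ℕ} {σ : State}

theorem Setup.table_le (hS : Setup E n d NP L md P) : NP * NP * n * n ≤ n ^ 4 := by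
  have := hS.NP_le
  calc NP * NP * n * n ≤ n * n * n * n := by gcongr
    _ = n ^ 4 := by ring

theorem tabUpdate_spec (hS : Setup E n d NP L md P) (hB : Base n d NP L md τ P σ)
    (hO : OutIs NP P ρ (s * NP) σ.out) (hT : TabOK E NP n L P ρ (s - 1) σ.rmem)
    (h5 : σ.ivar 5 = s) (hs : 0 < s) (hsd : s < d) :
    Runs E tabUpdate σ (300 * (NP * (NP * (n * n)))) fun σ' => TabOK E NP n L P ρ s σ'.rmem := by
  have hL := hS.L_ge
  have hLn := hS.L_le
  have hw := hS.word
  have h2 := hS.two_le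
  obtain ⟨hn, hd, hn4, -⟩ := hS.le_pow
  have htab := hS.table_le
  have hNP := hS.NP_pos
  have hNPn := hS.NP_le
  have hmem := hT.1
  have e0 : NP * NP * n * n = NP * (NP * (n * n)) := by ring
  have e1 : 1 ≤ NP * (NP * (n * n)) :=
    Nat.mul_pos hNP (Nat.mul_pos hNP (Nat.mul_pos (by omega) (by omega)))
  have a1 : NP * NP ≤ NP * NP * n := Nat.le_mul_of_pos_right _ (by omega)
  have a2 : NP * NP * n ≤ NP * NP * n * n := Nat.le_mul_of_pos_right _ (by omega)
  set N := NP * NP * n * n with hN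
  refine Runs.mono (T := 8 + (N * (200 + 8) + 6)) ?_ (by omega) fun _ h => h
  refine Runs.seq (Q := fun σ' => Agree (.iset 28 (‡2 *ᵢ ‡2 *ᵢ ‡0 *ᵢ ‡0)) σ σ' ∧ σ'.ivar 28 = N)
    (Runs.block ?_ le_rfl ?_).agree ?_
  · simp only [Prog.Ok, IExp.Safe, IExp.eval, hB.iv2, hB.iv0, ← hN]; omega
  · simp only [Prog.den, Function.update_self, IExp.eval, hB.iv2, hB.iv0, ← hN]
  rintro σ₁ ⟨hA1, h28⟩
  have hB1 := hB.agree hA1 rfl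
  have hrm1 := hA1.rm rfl
  refine (Runs.forP (J := fun a σ' => ∀ a' < N, σ'.rmem (7 * L + a') + 1 =
      E.W P ρ (if a' < a then s else s - 1) (a' / n / n / NP) (a' / n / n % NP) (a' / n % n)
        (a' % n)) (N := N) h28 (by omega) rfl rfl (by norm_num) ?_ ?_).mono le_rfl ?_
  · intro a' ha'
    rw [if_neg (Nat.not_lt_zero _)]
    show σ₁.rmem _ + 1 = _
    rw [hrm1]
    exact hT.2 a' ha'
  · intro a ha σ' hA h18 hJ
    have hB' := hB1.agree hA rfl
    have h5' : σ'.ivar 5 = s := by rw [hA.i 5 rfl, hA1.i 5 rfl, h5]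
    have hO' : OutIs NP P ρ (s * NP) σ'.out := by rw [hA.o rfl, hA1.o rfl]; exact hO
    set l := a % n with hl
    set k := a / n % n with hk
    set j := a / n / n % NP with hj
    set i := a / n / n / NP with hi
    have hln : l < n := Nat.mod_lt _ (by omega)
    have hkn : k < n := Nat.mod_lt _ (by omega)
    have hjN : j < NP := Nat.mod_lt _ hNP
    have hiN : i < NP := by
      rw [hi, Nat.div_div_eq_div_mul, Nat.div_div_eq_div_mul]
      refine Nat.div_lt_of_lt_mul ?_
      rw [show n * (n * NP) * NP = NP * NP * n * n by ring]
      exact ha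
    have hPi := hB'.im i hiN
    have hPj := hB'.im j hjN
    have pin := hS.le hiN
    have pjn := hS.le hjN
    refine Runs.mono (T := 60 + 140) ?_ le_rfl fun _ h => h
    refine Runs.seq (Q := fun σ'' => Agree decode σ' σ'' ∧ At n NP P i j k l σ'')
      (Runs.block ?_ (by simp [decode, Prog.time, IExp.cost]) ?_).agree ?_
    · have h0 : n ≠ 0 := by omega
      have h02 : NP ≠ 0 := by omega
      have q1 : a / n ≤ a := Nat.div_le_self _ _
      simp only [decode, Prog.Ok, Prog.den, IExp.Safe, IExp.eval, Function.update_apply,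
        Nat.reduceEqDiff, if_false, if_true, h18, hB'.iv0, hB'.iv2, ← hi, ← hj, hPi, hPj]
      repeat' apply And.intro
      all_goals first | assumption | omega
    · refine ⟨?_, ?_, ?_, ?_, ?_, ?_, hiN, hjN, hkn, hln⟩
      all_goals simp only [decode, Prog.den, IExp.eval, Function.update_apply,
        Nat.reduceEqDiff, if_false, if_true, h18, hB'.iv0, hB'.iv2, ← hi, ← hj, ← hk, ← hl, hPi, hPj]
    rintro σ₂ ⟨hA2, hat⟩
    have hB2 := hB'.agree hA2 rfl
    have h52 : σ₂.ivar 5 = s := by rw [hA2.i 5 rfl, h5']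
    have h182 : σ₂.ivar 18 = a := by rw [hA2.i 18 rfl, h18]
    have hrm2 := hA2.rm rfl
    obtain ⟨f1, f2⟩ := factorR_spec hS hB2 (by rw [hA2.o rfl]; exact hO') hat
      (x := ‡5 -ᵢ ♯1) (t := s - 1) ⟨by show σ₂.ivar 5 ≤ _; omega, by show 1 ≤ _; omega⟩
      (by show σ₂.ivar 5 - 1 = _; rw [h52]) (by rw [show s - 1 + 1 = s by omega]) (by omega)
    refine Runs.block ?_ (by simp [Prog.time, RExp.cost, IExp.cost, factorR, argI, cell]) ?_
    · simp only [Prog.Ok, RExp.Safe, IExp.Safe, IExp.eval, cell, f1, hB2.iv3, h182, and_true]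
      omega
    · intro a' ha'
      simp only [Prog.den, RExp.eval, IExp.eval, cell, f2, hB2.iv3, h182, Nat.cast_one, hrm2]
      by_cases hcase : a' = a
      · rw [hcase, Function.update_self, hJ a ha, if_neg (lt_irrefl _), if_pos (Nat.lt_succ_self _),
          sub_add_cancel, Env.W, Env.W, Korobov.kern, Korobov.kern]
        conv_rhs => rw [show s = s - 1 + 1 by omega, Finset.prod_range_succ]
      · rw [Function.update_of_ne (by omega), hJ a' ha']
        by_cases h : a' < a
        · rw [if_pos h, if_pos (by omega)]
        · rw [if_neg h, if_neg (by omega)]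
  · rintro σ' ⟨-, -, hJ⟩
    refine ⟨hmem, fun a ha => ?_⟩
    rw [hJ a ha, if_pos ha]

theorem gT_mono {t : ℕ} (h : s ≤ t) : gT md s ≤ gT md t := by
  unfold gT; split <;> omega

theorem step_spec (hS : Setup E n d NP L md P) (hτ : 0 < τ) (hτ1 : τ < 1)
    (hI : Inv E n d NP L md τ P ρ s σ) (h5 : σ.ivar 5 = s) (hsd : s < d) :
    Runs E step σ (5000 * (NP * (NP * (n * (L * (gT md d + Nat.log 2 L)))))) fun σ' =>
      ∃ ρ', Inv E n d NP L md τ P ρ' (s + 1) σ' := by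
  have hL := hS.L_ge
  have hw := hS.word
  have h2 := hS.two_le
  obtain ⟨hn, hd, hn4, -⟩ := hS.le_pow
  have hNP := hS.NP_pos
  have hNPn := hS.NP_le
  have hG := one_le_gT md d
  set X := n * (L * (gT md d + Nat.log 2 L)) with hX
  have hX1 : n * n ≤ X := Nat.mul_le_mul_left _
    (le_trans (by omega) (Nat.le_mul_of_pos_right _ (by omega)))
  have hX2 : NP * (n * n) ≤ NP * X := Nat.mul_le_mul_left _ hX1
  have hX3 : NP * (NP * (n * n)) ≤ NP * (NP * X) := Nat.mul_le_mul_left _ hX2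
  have hX4 : 4 ≤ n * n := Nat.mul_le_mul h2 h2
  have hX5 : X ≤ NP * X := Nat.le_mul_of_pos_left _ hNP
  have hX6 : NP * X ≤ NP * (NP * X) := Nat.le_mul_of_pos_left _ hNP
  have hX7 : NP ≤ NP * X := Nat.le_mul_of_pos_right _ (by omega)
  refine Runs.mono (T := 4 + (4 + 300 * (NP * (NP * (n * n))) +
    (NP * (4000 * (NP * X) + 8) + 6))) ?_ (by
      have : NP * (4000 * (NP * X) + 8) ≤ NP * (4010 * (NP * X)) :=
        Nat.mul_le_mul_left _ (by omega)
      rw [show NP * (4010 * (NP * X)) = 4010 * (NP * (NP * X)) by ring] at this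
      omega) fun _ h => h
  refine Runs.cond ?_ (fun h0 => ?_) fun h0 => ?_
  · simp only [BExp.Safe, IExp.Safe, h5]; omega
  · obtain rfl : s = 0 := by simpa only [BExp.Holds, IExp.eval, h5] using h0
    have hO0 := hI.out.eq
    refine (Runs.forP (T := 2) (J := fun i σ' => σ'.out = List.replicate i 1) (N := NP) hI.iv2
      (by omega) rfl rfl (by norm_num) ?_ ?_).mono ?_ ?_
    · show σ.out = _
      rw [hO0, zero_mul]; rfl
    · intro i hi σ' hA h6 hJ
      refine Runs.block (by simp only [Prog.Ok, IExp.Safe]; omega) le_rfl ?_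
      show σ'.out ++ [1] = _
      rw [hJ, List.replicate_succ']
    · have : NP * (2 + 8) ≤ NP * (4000 * (NP * X) + 8) := Nat.mul_le_mul_left _ (by
        have := Nat.mul_pos hNP (by omega : 0 < X)
        omega)
      omega
    · rintro σ' ⟨hA, -, hJ⟩
      refine ⟨fun _ _ => 1, hI.toBase.agree hA rfl, ⟨?_, fun _ i hi => (hS.prime hi).one_lt⟩,
        fun hmd => ?_, fun _ _ _ => rfl, fun t ht ht' => absurd ht' (by omega)⟩
      · rw [hJ, List.map_const', List.length_range, zero_add, one_mul]
      · obtain ⟨t1, t2⟩ := hI.tab hmd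
        exact ⟨t1, fun a ha => by rw [hA.rm rfl]; exact t2 a ha⟩
  · have h0 : s ≠ 0 := by simpa only [BExp.Holds, IExp.eval, h5] using h0
    have hmode := hS.mode
    refine Runs.seq (Q := fun σ' => Agree (.cond (.ieq ‡4 ♯1) tabUpdate .skip) σ σ' ∧
      (md = 1 → TabOK E NP n L P ρ s σ'.rmem))
      (Runs.cond (T := 300 * (NP * (NP * (n * n)))) ?_ (fun h => ?_) fun h => ?_).agree ?_
    · simp only [BExp.Safe, IExp.Safe, hI.iv4]; omega
    · have h : md = 1 := by simpa only [BExp.Holds, IExp.eval, hI.iv4] using h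
      exact (tabUpdate_spec hS hI.toBase hI.out (hI.tab h) h5 (by omega) hsd).mono le_rfl
        fun _ h _ => h
    · have h : md ≠ 1 := by simpa only [BExp.Holds, IExp.eval, hI.iv4] using h
      have hpos := Nat.mul_pos hNP (Nat.mul_pos hNP (by omega : 0 < n * n))
      exact Runs.block trivial (by simp only [Prog.time]; omega) fun h' => absurd h' h
    rintro σ₁ ⟨hA1, hT1⟩
    have hB1 := hI.toBase.agree hA1 rfl
    refine (Runs.forP (T := 4000 * (NP * X)) (J := fun i σ' => ∃ ρ',
        Ctx E n d NP L md τ P ρ' s (s * NP + i) σ' ∧ (∀ i' < NP, ρ' 0 (P i') = 1) ∧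
        (∀ t, 0 < t → t < s → ∀ i' < NP, Good E.α E.γ n τ ρ' t (P i')) ∧
        ∀ i' < i, Good E.α E.γ n τ ρ' s (P i')) (N := NP) hB1.iv2 (by omega) rfl rfl (by norm_num)
        ?_ ?_).mono le_rfl ?_
    · refine ⟨ρ, ⟨⟨hB1.iv0, hB1.iv1, hB1.iv2, hB1.iv3, hB1.iv4, hB1.rv0, hB1.im⟩, ?_, ?_, hsd,
        Nat.le_add_right _ _, hT1⟩, hI.one (by omega), hI.good,
        fun i' hi' => absurd hi' (Nat.not_lt_zero _)⟩
      · show OutIs NP P ρ _ σ₁.out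
        rw [hA1.o rfl]; exact hI.out
      · show σ₁.ivar 5 = s
        rw [hA1.i 5 rfl, h5]
    · rintro i hi σ' hA h6 ⟨ρ', hC, hone, hgood, hgood'⟩
      refine (primeStep_spec hS hτ hτ1 hC hi h6).mono ?_ ?_
      · refine Nat.mul_le_mul_left _ (Nat.mul_le_mul_left _ (Nat.mul_le_mul_left _
          (Nat.mul_le_mul_left _ (Nat.add_le_add_right (gT_mono hsd.le) _))))
      · rintro σ'' ⟨b, hg, hC'⟩
        have hne : ∀ j < s, ∀ q, ρ' j q = extend P ρ' s i b j q := fun j hj q =>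
          (if_neg fun h => hj.ne h.1).symm
        refine ⟨extend P ρ' s i b, ?_, ?_, ?_, ?_⟩
        · exact ⟨⟨hC'.iv0, hC'.iv1, hC'.iv2, hC'.iv3, hC'.iv4, hC'.rv0, hC'.im⟩, hC'.out, hC'.iv5,
            hC'.lt, hC'.len_ge, hC'.tab⟩
        · intro i' hi'
          rw [← hne 0 (by omega)]
          exact hone i' hi'
        · intro t ht hts i' hi'
          exact (hgood t ht hts i' hi').congr (fun j hj => hne j (by omega)) fun q _ => hne t hts q
        · intro i' hi'
          rcases Nat.lt_or_ge i' i with h | h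
          · refine (hgood' i' h).congr hne fun q hq => (if_neg fun h' => ?_).symm
            have := hS.mono i' i h hi
            rw [h'.2] at hq
            omega
          · rw [show i' = i by omega]; exact hg
    · rintro σ' ⟨-, -, ρ', hC, hone, hgood, hgood'⟩
      refine ⟨ρ', hC.toBase, ?_, hC.tab, fun _ => hone, fun t ht ht' i hi => ?_⟩
      · have := hC.out
        rwa [← Nat.succ_mul] at this
      · rcases Nat.lt_or_ge t s with h | h
        · exact hgood t ht h i hi
        · rw [show t = s by omega]; exact hgood' i hi

theorem steps_spec (hS : Setup E n d NP L md P) (hτ : 0 < τ) (hτ1 : τ < 1)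
    (hB : Base n d NP L md τ P σ) (ho : σ.out = [])
    (hT : md = 1 → NP * NP * n * n + 7 * L ≤ E.mem) (hrm : ∀ a, σ.rmem a = 0) :
    Runs E (forP 5 1 step) σ
      (6000 * (d * (NP * (NP * (n * (L * (gT md d + Nat.log 2 L))))))) fun σ' =>
      ∃ ρ, Inv E n d NP L md τ P ρ d σ' := by
  have hL := hS.L_ge
  have hw := hS.word
  have h2 := hS.two_le
  have hd1 := hS.one_le
  obtain ⟨hn, hd, hn4, -⟩ := hS.le_pow
  have hNP := hS.NP_pos
  have hG := one_le_gT md d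
  set X := NP * (NP * (n * (L * (gT md d + Nat.log 2 L)))) with hX
  have hX1 : 0 < X := Nat.mul_pos hNP (Nat.mul_pos hNP (Nat.mul_pos (by omega)
    (Nat.mul_pos (by omega) (by omega))))
  have hdX : d ≤ d * X := Nat.le_mul_of_pos_right _ hX1
  refine (Runs.forP (T := 5000 * X) (J := fun s σ' => ∃ ρ, Inv E n d NP L md τ P ρ s σ') (N := d)
    hB.iv1 (by omega) rfl rfl (by norm_num) ?_ ?_).mono ?_ fun _ h => h.2.2
  · refine ⟨fun _ _ => 1, ⟨hB.iv0, hB.iv1, hB.iv2, hB.iv3, hB.iv4, hB.rv0, hB.im⟩,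
      ⟨by rw [zero_mul]; exact ho, fun _ i hi => (hS.prime hi).one_lt⟩,
      fun hmd => ⟨hT hmd, fun a _ => ?_⟩, fun h => absurd h (lt_irrefl _),
      fun t _ ht => absurd ht (Nat.not_lt_zero _)⟩
    show σ.rmem _ + 1 = _
    rw [hrm, Env.W, Korobov.kern, Finset.prod_range_zero, zero_add]
  · rintro s hs σ' hA h5 ⟨ρ, hI⟩
    refine (step_spec hS hτ hτ1 hI h5 hs).mono le_rfl ?_
    rintro σ'' ⟨ρ', hI'⟩
    exact ⟨ρ', ⟨hI'.iv0, hI'.iv1, hI'.iv2, hI'.iv3, hI'.iv4, hI'.rv0, hI'.im⟩, hI'.out, hI'.tab,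
      hI'.one, hI'.good⟩
  · rw [Nat.mul_add, show d * (5000 * X) = 5000 * (d * X) by ring]
    omega

end step

end RealRAM

namespace RealRAM

open Korobov (primes mem_primes)

/-! ### The list of the primes and the length of the transforms -/

/-- The primes in `(n/2, n]` that are smaller than `t`, in increasing order. -/
def primeList (n t : ℕ) : List ℕ := (List.range t).filter fun p => decide (p ∈ primes n)

/-- The prime in `(n/2, n]` with the index `i`. -/
def nthPrime (n i : ℕ) : ℕ := (primeList n (n + 1)).getD i 0

theorem mem_primeList {n p : ℕ} : p ∈ primeList n (n + 1) ↔ p ∈ primes n := by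
  rw [primeList, List.mem_filter, List.mem_range, decide_eq_true_eq, and_iff_right_iff_imp]
  exact fun h => Nat.lt_succ_of_le (mem_primes.1 h).2.2

theorem primeList_pairwise (n t : ℕ) : (primeList n t).Pairwise (· < ·) :=
  List.pairwise_lt_range.filter _

theorem length_primeList (n : ℕ) : (primeList n (n + 1)).length = (primes n).card := by
  rw [← List.toFinset_card_of_nodup ((primeList_pairwise n (n + 1)).imp fun h => h.ne)]
  congr 1
  ext p
  rw [List.mem_toFinset, mem_primeList]

theorem primeList_succ (n t : ℕ) :
    primeList n (t + 1) = if t ∈ primes n then primeList n t ++ [t] else primeList n t := by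
  rw [primeList, List.range_succ, List.filter_append]
  split_ifs with h <;> simp [h, primeList]

/-- The length of the Fourier transforms: the smallest power of two that is at least `5 n`, as
required by `Korobov.sum_normSq_sin`. -/
def fftLen (n : ℕ) : ℕ := 2 ^ Nat.clog 2 (5 * n)

theorem fftLen_bounds {n : ℕ} (hn : 2 ≤ n) : 5 * n ≤ fftLen n ∧ fftLen n ≤ 10 * n := by
  refine ⟨Nat.le_pow_clog (by norm_num) _, ?_⟩
  have h1 := Nat.pow_pred_clog_lt_self (b := 2) (by norm_num) (x := 5 * n) (by omega)
  have h2 : 0 < Nat.clog 2 (5 * n) := Nat.clog_pos (by norm_num) (by omega)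
  have h3 : fftLen n = 2 * 2 ^ (Nat.clog 2 (5 * n)).pred := by
    rw [fftLen, ← pow_succ', Nat.pred_eq_sub_one, Nat.sub_add_cancel h2]
  omega

theorem log_fftLen (n : ℕ) : Nat.log 2 (fftLen n) = Nat.clog 2 (5 * n) :=
  Nat.log_pow (by norm_num) _

theorem setup {E : Env} {n d md : ℕ} (hn : 2 ≤ n) (hd : 1 ≤ d) (hα : 1 / 2 < E.α)
    (hγ : ∀ j, 0 < E.γ j) (hmd : md ≤ 1) (hw : 10000 * (n ^ 4 * d) ≤ E.word)
    (hmem : 7 * fftLen n ≤ E.mem) (hEd : E.d = d) :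
    Setup E n d (primes n).card (fftLen n) md (nthPrime n) := by
  have hlen := length_primeList n
  have hget : ∀ i (hi : i < (primes n).card),
      nthPrime n i = (primeList n (n + 1))[i]'(by rw [hlen]; exact hi) := fun i hi =>
    List.getD_eq_getElem _ _ _
  refine ⟨hn, hd, hα, hγ, Korobov.card_primes_le n, Korobov.card_primes_pos hn, fun i hi => ?_,
    fun i j hij hj => ?_, fun q hq => ?_, (fftLen_bounds hn).1, (fftLen_bounds hn).2, ?_, hmd, hw,
    hmem, hEd⟩
  · rw [hget i hi, ← mem_primeList]
    exact List.getElem_mem _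
  · rw [hget i (hij.trans hj), hget j hj]
    exact List.pairwise_iff_getElem.1 (primeList_pairwise n (n + 1)) _ _ _ _ hij
  · obtain ⟨i, hi, h⟩ := List.mem_iff_getElem.1 (mem_primeList.2 hq)
    rw [hlen] at hi
    exact ⟨i, hi, (hget i hi).trans h⟩
  · rw [log_fftLen]; rfl

/-- Variable `22` becomes `1` if variable `6` is a prime, and `0` otherwise. -/
def testPrime : Prog :=
  .iset 22 ♯1 ;; forP 14 6 (.cond (.ilt ‡14 ♯2) .skip
    (.cond (.ieq (‡6 %ᵢ ‡14) ♯0) (.iset 22 ♯0) .skip))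

/-- The primes are put into the memory for natural numbers, and their number into variable `2`. -/
def primesP : Prog :=
  .iset 28 (‡0 +ᵢ ♯1) ;; forP 6 28 (.cond (.ilt ‡0 (♯2 *ᵢ ‡6))
    (testPrime ;; .cond (.ieq ‡22 ♯1) (.istore ‡2 ‡6 ;; .iset 2 (‡2 +ᵢ ♯1)) .skip) .skip)

/-- The length of the transforms is put into variable `3`. -/
def sizeP : Prog := .iset 3 ♯1 ;; .loop (.ilt ‡3 (♯5 *ᵢ ‡0)) (.iset 3 (♯2 *ᵢ ‡3))

section prep

variable {E : Env} {n : ℕ} {σ : State}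

theorem testPrime_spec (hw : 10000 * n ≤ E.word) {x : ℕ} (hx : 2 ≤ x) (hxn : x ≤ n)
    (h6 : σ.ivar 6 = x) :
    Runs E testPrime σ (40 * n) fun σ' => σ'.ivar 22 = if x.Prime then 1 else 0 := by
  refine Runs.mono (T := 2 + (x * (25 + 8) + 6)) ?_ (by omega) fun _ h => h
  refine Runs.seq (Q := fun σ' => Agree (.iset 22 ♯1) σ σ' ∧ σ'.ivar 22 = 1)
    (Runs.block ?_ le_rfl ?_).agree ?_
  · simp only [Prog.Ok, IExp.Safe]; omega
  · simp only [Prog.den, Function.update_self, IExp.eval]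
  rintro σ₁ ⟨hA1, h22⟩
  refine (Runs.forP (J := fun t σ' => (σ'.ivar 22 = 1 ∧ ∀ m, 2 ≤ m → m < t → ¬ m ∣ x) ∨
      (σ'.ivar 22 = 0 ∧ ∃ m, 2 ≤ m ∧ m < t ∧ m ∣ x)) (N := x) (by rw [hA1.i 6 rfl, h6]) (by omega)
      rfl rfl (by norm_num) (Or.inl ⟨by rw [← h22]; rfl, fun m h1 h2 => by omega⟩) ?_).mono
      le_rfl ?_
  · intro t ht σ' hA h14 hJ
    have h6' : σ'.ivar 6 = x := by rw [hA.i 6 rfl, hA1.i 6 rfl, h6]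
    refine Runs.block ?_ (by simp [Prog.time, BExp.cost, IExp.cost]) ?_
    · simp only [Prog.Ok, BExp.Safe, BExp.Holds, IExp.Safe, IExp.eval, h14, h6']
      refine ⟨by omega, fun _ => trivial, fun h => ⟨by omega, fun _ => by omega, fun _ => trivial⟩⟩
    · simp only [Prog.den, BExp.Holds, IExp.eval, h14, h6']
      by_cases h1 : t < 2
      · rw [if_pos h1, Function.update_of_ne (by norm_num)]
        rcases hJ with ⟨h2, h3⟩ | ⟨h2, m, h3, h4, h5⟩
        · exact Or.inl ⟨h2, fun m h4 h5 => by omega⟩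
        · exact Or.inr ⟨h2, m, h3, by omega, h5⟩
      · rw [if_neg h1]
        by_cases h2 : x % t = 0
        · rw [if_pos h2]
          refine Or.inr ⟨by simp, t, by omega, by omega, Nat.dvd_of_mod_eq_zero h2⟩
        · rw [if_neg h2, Function.update_of_ne (by norm_num)]
          rcases hJ with ⟨h4, h3⟩ | ⟨h4, m, h3, h5, h6⟩
          · refine Or.inl ⟨h4, fun m h5 h6 => ?_⟩
            rcases Nat.lt_or_ge m t with h7 | h7
            · exact h3 m h5 h7
            · rw [show m = t by omega]
              exact fun h => h2 (Nat.mod_eq_zero_of_dvd h)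
          · exact Or.inr ⟨h4, m, h3, by omega, h6⟩
  · rintro σ' ⟨-, -, hJ⟩
    rcases hJ with ⟨h1, h2⟩ | ⟨h1, m, h2, h3, h4⟩
    · rw [h1, if_pos (Nat.prime_def_lt'.2 ⟨hx, h2⟩)]
    · rw [h1, if_neg fun h => (Nat.prime_def_lt'.1 h).2 m h2 h3 h4]

theorem primesP_spec (hw : 10000 * n ≤ E.word) (hmem : n < E.mem) (hn : 2 ≤ n)
    (h0 : σ.ivar 0 = n) (h2 : σ.ivar 2 = 0) :
    Runs E primesP σ (200 * (n * n)) fun σ' => σ'.ivar 2 = (primes n).card ∧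
      ∀ i < (primes n).card, σ'.imem i = nthPrime n i := by
  refine Runs.mono (T := 4 + ((n + 1) * (6 + (40 * n + 20) + 8) + 6)) ?_ (by
    have h1 : (n + 1) * (6 + (40 * n + 20) + 8) ≤ 2 * n * (60 * n) :=
      Nat.mul_le_mul (by omega) (by omega)
    rw [show 2 * n * (60 * n) = 120 * (n * n) by ring] at h1
    have : 2 * 2 ≤ n * n := Nat.mul_le_mul hn hn
    omega) fun _ h => h
  refine Runs.seq (Q := fun σ' => Agree (.iset 28 (‡0 +ᵢ ♯1)) σ σ' ∧ σ'.ivar 28 = n + 1)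
    (Runs.block ?_ le_rfl ?_).agree ?_
  · simp only [Prog.Ok, IExp.Safe, IExp.eval, h0]; omega
  · simp only [Prog.den, Function.update_self, IExp.eval, h0]
  rintro σ₁ ⟨hA1, h28⟩
  refine (Runs.forP (J := fun t σ' => σ'.ivar 2 = (primeList n t).length ∧
      ∀ i < (primeList n t).length, σ'.imem i = (primeList n t).getD i 0) (N := n + 1) h28
      (by omega) rfl rfl (by norm_num) ?_ ?_).mono le_rfl ?_
  · refine ⟨?_, fun i hi => absurd hi (Nat.not_lt_zero _)⟩
    show σ₁.ivar 2 = _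
    rw [hA1.i 2 rfl, h2]; rfl
  · rintro t ht σ' hA h6 ⟨hJ, hJ'⟩
    have h0' : σ'.ivar 0 = n := by rw [hA.i 0 rfl, hA1.i 0 rfl, h0]
    have hlt : (primeList n t).length ≤ t := by
      simpa [primeList] using List.length_filter_le (fun p => decide (p ∈ primes n)) (List.range t)
    have hskip : ¬ t ∈ primes n → primeList n (t + 1) = primeList n t := fun h => by
      rw [primeList_succ, if_neg h]
    refine Runs.cond ?_ (fun hb => ?_) fun hb => ?_
    · simp only [BExp.Safe, IExp.Safe, IExp.eval, h6, h0']; omega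
    · have hb : n < 2 * t := by simpa only [BExp.Holds, IExp.eval, h6, h0'] using hb
      refine Runs.seq (testPrime_spec hw (by omega) (by omega) h6).agree ?_
      rintro σ₂ ⟨hA2, h22⟩
      have h62 : σ₂.ivar 6 = t := by rw [hA2.i 6 rfl, h6]
      rw [← hA2.i 2 rfl] at hJ
      rw [← hA2.im rfl] at hJ'
      refine Runs.block ?_ (by simp [Prog.time, BExp.cost, IExp.cost]) ?_
      · simp only [Prog.Ok, BExp.Safe, IExp.Safe, IExp.eval, Prog.den, h22, h62, hJ]
        have : (if t.Prime then 1 else 0) ≤ 1 := by split <;> omega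
        exact ⟨by omega, fun _ => ⟨⟨by omega, by omega, by omega⟩, by omega⟩, fun _ => trivial⟩
      · simp only [Prog.den, BExp.Holds, IExp.eval, h22, h62, hJ]
        by_cases hp : t.Prime
        · have hmem : t ∈ primes n := mem_primes.2 ⟨hp, hb, by omega⟩
          simp only [if_pos hp, if_true]
          rw [primeList_succ, if_pos hmem, List.length_append, List.length_singleton]
          refine ⟨by simp, fun i hi => ?_⟩
          rcases Nat.lt_or_ge i (primeList n t).length with h | h
          · rw [Function.update_of_ne h.ne, hJ' i h, List.getD_append _ _ _ _ h]
          · rw [show i = (primeList n t).length by omega, Function.update_self,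
              List.getD_append_right _ _ _ _ le_rfl, Nat.sub_self]
            rfl
        · simp only [if_neg hp, zero_ne_one, if_false]
          rw [hskip fun h => hp (mem_primes.1 h).1, Function.update_of_ne (by norm_num)]
          exact ⟨hJ, hJ'⟩
    · have hb : ¬ n < 2 * t := by simpa only [BExp.Holds, IExp.eval, h6, h0'] using hb
      refine Runs.block trivial (by simp only [Prog.time]; omega) ?_
      show σ'.ivar 2 = _ ∧ _
      rw [hskip fun h => hb (mem_primes.1 h).2.1]
      exact ⟨hJ, hJ'⟩
  · rintro σ' ⟨-, -, hJ, hJ'⟩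
    rw [length_primeList] at hJ hJ'
    exact ⟨hJ, hJ'⟩

theorem sizeP_spec (hw : 10000 * n ≤ E.word) (hn : 2 ≤ n) (h0 : σ.ivar 0 = n) :
    Runs E sizeP σ (200 * n) fun σ' => σ'.ivar 3 = fftLen n := by
  have hL := (fftLen_bounds hn).2
  set e := Nat.clog 2 (5 * n) with he
  have hfl : fftLen n = 2 ^ e := rfl
  have hee : e ≤ fftLen n := (Nat.lt_pow_self (by norm_num)).le
  refine Runs.mono (T := 2 + (e * (6 + 4) + 6)) ?_ (by omega) fun _ h => h
  refine Runs.seq (Q := fun σ' => Agree (.iset 3 ♯1) σ σ' ∧ σ'.ivar 3 = 1)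
    (Runs.block ?_ le_rfl ?_).agree ?_
  · simp only [Prog.Ok, IExp.Safe]; omega
  · simp only [Prog.den, Function.update_self, IExp.eval]
  rintro σ₁ ⟨hA1, h3⟩
  refine (Runs.loop (b := .ilt ‡3 (♯5 *ᵢ ‡0)) (N := e) (T := 4)
    (J := fun t σ' => σ'.ivar 0 = n ∧ σ'.ivar 3 = 2 ^ t) ?_ ?_
    ⟨by rw [hA1.i 0 rfl, h0], by rw [h3, pow_zero]⟩).mono le_rfl fun _ h => h.2
  · rintro t ht σ' ⟨h0', h3'⟩
    have : 2 ^ t ≤ 2 ^ e := Nat.pow_le_pow_right (by norm_num) ht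
    refine ⟨?_, ?_⟩
    · simp only [BExp.Safe, IExp.Safe, IExp.eval, h3', h0']; omega
    · simp only [BExp.Holds, IExp.eval, h3', h0']
      exact (Nat.lt_clog_iff_pow_lt (by norm_num)).symm
  · rintro t ht σ' ⟨h0', h3'⟩
    have h1 : 2 ^ (t + 1) ≤ 2 ^ e := Nat.pow_le_pow_right (by norm_num) ht
    have h2 : 2 ^ (t + 1) = 2 * 2 ^ t := pow_succ' _ _
    refine Runs.block ?_ le_rfl ⟨?_, ?_⟩
    · simp only [Prog.Ok, IExp.Safe, IExp.eval, h3']; omega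
    · simp only [Prog.den]; rw [Function.update_of_ne (by norm_num), h0']
    · simp only [Prog.den, Function.update_self, IExp.eval, h3', h2]

end prep

end RealRAM

namespace RealRAM

open Korobov (primes mem_primes Good IsConstructed residues)

/-! ### The complete program -/

/-- The construction; the mode is given in variable `4`, which is `0` at the start. -/
def construct : Prog := primesP ;; sizeP ;; forP 5 1 step

/-- The construction with a table of the kernel products. -/
def constructTable : Prog := .iset 4 ♯1 ;; construct

section construct

variable {E : Env} {n d md : ℕ} {τ : ℝ} {σ : State}

theorem construct_spec (hn : 2 ≤ n) (hd : 1 ≤ d) (hα : 1 / 2 < E.α)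
    (hγ : ∀ j, 0 < E.γ j) (hmd : md ≤ 1) (hw : 10000 * (n ^ 4 * d) ≤ E.word)
    (hmem : 7 * fftLen n ≤ E.mem) (hEd : E.d = d) (hτ : 0 < τ) (hτ1 : τ < 1)
    (hT : md = 1 → (primes n).card * (primes n).card * n * n + 7 * fftLen n ≤ E.mem)
    (h0 : σ.ivar 0 = n) (h1 : σ.ivar 1 = d) (h2 : σ.ivar 2 = 0) (h4 : σ.ivar 4 = md)
    (hr0 : σ.rvar 0 = τ) (hrm : ∀ a, σ.rmem a = 0) (ho : σ.out = []) :
    Runs E construct σ (6500 * (d * ((primes n).card * ((primes n).card *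
      (n * (fftLen n * (gT md d + Nat.log 2 (fftLen n)))))))) fun σ' =>
      ∃ ρ, Inv E n d (primes n).card (fftLen n) md τ (nthPrime n) ρ d σ' := by
  have hS := setup hn hd hα hγ hmd hw hmem hEd
  have hb := fftLen_bounds hn
  obtain ⟨hn4, -, hnd, -⟩ := hS.le_pow
  have hNP := hS.NP_pos
  have hG := one_le_gT md d
  set Y := (primes n).card * ((primes n).card *
      (n * (fftLen n * (gT md d + Nat.log 2 (fftLen n))))) with hY
  refine Runs.mono (T := 200 * (n * n) + (200 * n + 6000 * (d * Y))) ?_ (by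
    have e1 : n * n ≤ n * (fftLen n * (gT md d + Nat.log 2 (fftLen n))) :=
      Nat.mul_le_mul_left _ (le_trans (by omega) (Nat.le_mul_of_pos_right _ (by omega)))
    have e2 : n * (fftLen n * (gT md d + Nat.log 2 (fftLen n))) ≤ Y :=
      (Nat.le_mul_of_pos_left _ hNP).trans (Nat.le_mul_of_pos_left _ hNP)
    have e3 : Y ≤ d * Y := Nat.le_mul_of_pos_left _ hd
    have e4 : n ≤ n * n := Nat.le_mul_of_pos_left _ (by omega)
    omega) fun _ h => h
  refine Runs.seq (primesP_spec (by omega) (by omega) hn h0 h2).agree ?_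
  rintro σ₁ ⟨hA1, h21, him⟩
  refine Runs.seq (sizeP_spec (by omega) hn (by rw [hA1.i 0 rfl, h0])).agree ?_
  rintro σ₂ ⟨hA2, h32⟩
  refine steps_spec hS hτ hτ1 ⟨by rw [hA2.i 0 rfl, hA1.i 0 rfl, h0],
    by rw [hA2.i 1 rfl, hA1.i 1 rfl, h1], by rw [hA2.i 2 rfl, h21], h32,
    by rw [hA2.i 4 rfl, hA1.i 4 rfl, h4], by rw [hA2.r 0 rfl, hA1.r 0 rfl, hr0],
    by rw [hA2.im rfl]; exact him⟩ (by rw [hA2.o rfl, hA1.o rfl, ho]) hT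
    (by rw [hA2.rm rfl, hA1.rm rfl]; exact hrm)

end construct

/-! ### The vector with given residues -/

/-- The components in `[0, N)` with the residues `ρ`, except that the first one is `1`. -/
theorem exists_component (n : ℕ) (ρ : ℕ → ℕ → ℕ) (hn : 2 ≤ n) (h0 : ∀ p ∈ primes n, ρ 0 p = 1) :
    ∃ z : ℕ → ℤ, z 0 = 1 ∧ (∀ j, 0 ≤ z j ∧ z j < ∏ p ∈ primes n, (p : ℤ)) ∧
      ∀ j, ∀ p ∈ primes n, z j ≡ ρ j p [ZMOD p] := by
  have hs : ∀ p ∈ primes n, id p ≠ 0 := fun p hp => (mem_primes.1 hp).1.ne_zero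
  have pp : Set.Pairwise (primes n : Set ℕ) (Function.onFun Nat.Coprime id) := fun p hp q hq h =>
    (Nat.coprime_primes (mem_primes.1 hp).1 (mem_primes.1 hq).1).2 h
  have hlt := fun j => Nat.chineseRemainderOfFinset_lt_prod (ρ j) id hs pp
  refine ⟨fun j => if j = 0 then 1 else
    ((Nat.chineseRemainderOfFinset (ρ j) id (primes n) hs pp : ℕ) : ℤ), if_pos rfl, fun j => ?_,
    fun j p hp => ?_⟩
  · rw [← Nat.cast_prod]
    dsimp only
    split_ifs with h
    · refine ⟨zero_le_one, ?_⟩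
      obtain ⟨p, hp⟩ := Finset.card_pos.1 (Korobov.card_primes_pos hn)
      have h1 : p ≤ ∏ q ∈ primes n, q := Nat.le_of_dvd
        (Finset.prod_pos fun q hq => (mem_primes.1 hq).1.pos) (Finset.dvd_prod_of_mem _ hp)
      have h2 := (mem_primes.1 hp).1.one_lt
      exact_mod_cast h2.trans_le h1
    · exact ⟨Int.natCast_nonneg _, by exact_mod_cast hlt j⟩
  · dsimp only
    split_ifs with h
    · rw [h, h0 p hp]; rfl
    · exact Int.natCast_modEq_iff.2
        ((Nat.chineseRemainderOfFinset (ρ j) id (primes n) hs pp).2 p hp)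

theorem residues_eq {n d : ℕ} {z : ℕ → ℤ} {ρ : ℕ → ℕ → ℕ}
    (hz : ∀ j, ∀ p ∈ primes n, z j ≡ ρ j p [ZMOD p]) (hlt : ∀ j, ∀ p ∈ primes n, ρ j p < p) :
    residues n d z = (List.range (d * (primes n).card)).map fun a =>
      ρ (a / (primes n).card) (nthPrime n (a % (primes n).card)) := by
  induction d with
  | zero => simp [residues]
  | succ d ih =>
    rw [residues, List.range_succ (n := d), List.flatMap_append, ← residues, ih, Nat.succ_mul,
      List.range_add (n := d * _), List.map_append, List.flatMap_singleton, List.map_map]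
    congr 1
    -- the list of primes in `residues` is converted to integers as a list
    simp only [List.bind_eq_flatMap, List.pure_def, ← List.map_eq_flatMap, List.map_map]
    have h1 : (primeList n (n + 1)) = (List.range (primes n).card).map (nthPrime n) := by
      refine List.ext_getElem (by simp [length_primeList]) fun i h1 h2 => ?_
      rw [List.getElem_map, List.getElem_range]
      exact (List.getD_eq_getElem _ _ h1).symm
    rw [← primeList, h1, List.map_map]
    refine List.map_congr_left fun i hi => ?_
    have hi := List.mem_range.1 hi
    have hp : nthPrime n i ∈ primes n := by
      rw [← mem_primeList, h1]; exact List.mem_map_of_mem (List.mem_range.2 hi)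
    simp only [Function.comp]
    rw [mul_comm d, Nat.mul_add_div (by omega), Nat.mul_add_mod, Nat.div_eq_of_lt hi,
      Nat.mod_eq_of_lt hi, add_zero, hz d _ hp, ← Int.natCast_mod, Int.toNat_natCast,
      Nat.mod_eq_of_lt (hlt d _ hp)]

/-- The computed values differ from the criteria by the positive factor `γ_s²` and, for `T`, by a
constant, so the residues in the output are those of a constructed vector. -/
theorem Inv.isConstructed {E : Env} {n d md : ℕ} {τ : ℝ} {ρ : ℕ → ℕ → ℕ} {σ : State}
    (hS : Setup E n d (primes n).card (fftLen n) md (nthPrime n))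
    (hI : Inv E n d (primes n).card (fftLen n) md τ (nthPrime n) ρ d σ) :
    ∃ z : ℕ → ℤ, IsConstructed n E.α E.γ τ d z ∧
      (∀ j, 0 ≤ z j ∧ z j < ∏ p ∈ primes n, (p : ℤ)) ∧ residues n d z = σ.out := by
  have hlt : ∀ j, ∀ p ∈ primes n, ρ j p < p := fun j p hp => by
    obtain ⟨i, hi, rfl⟩ := hS.surj p hp
    exact hI.out.lt j i hi
  obtain ⟨z, hz0, hz, hzρ⟩ := exists_component n ρ hS.two_le fun p hp => by
    obtain ⟨i, hi, rfl⟩ := hS.surj p hp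
    exact hI.one hS.one_le i hi
  refine ⟨z, ⟨hz0, fun s hs hsd p hp => ?_⟩, hz, by rw [residues_eq hzρ hlt, hI.out.eq]⟩
  obtain ⟨i, hi, rfl⟩ := hS.surj p hp
  obtain ⟨B, h1, h2, h3, h4, h5⟩ := hI.good s hs hsd i hi
  have hγ := pow_pos (hS.gamma s) 2
  have e := Korobov.theta_eq_thetaVal hS.gamma hS.alpha s (hS.prime hi).pos
    (fun j => ρ j (nthPrime n i)) (z := z) fun j _ => hzρ j _ hp
  obtain ⟨K, hK⟩ := Korobov.critT_eq_critVal hS.gamma hS.alpha hp ρ (s := s) (z := z)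
    (fun q hq j _ => hzρ j q hq) fun q hq _ => hzρ s q hq
  refine ⟨B, h1, h2, fun b hb c hc hcB => ?_, ρ s (nthPrime n i), h4, hzρ s _ hp, fun c hc => ?_⟩
  · rw [e, e]
    exact mul_le_mul_of_nonneg_left (h3 b hb c hc hcB) hγ.le
  · rw [hK, hK]
    linarith [mul_le_mul_of_nonneg_left (h5 c hc) hγ.le]

/-! ### Bounds for the resources -/

theorem log_fftLen_add_le {n g : ℕ} (hn : 2 ≤ n) (hg : 1 ≤ g) :
    ((g + Nat.log 2 (fftLen n) : ℕ) : ℝ) ≤ 14 * g * Real.log n := by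
  have hb := (fftLen_bounds hn).2
  have h2 : (0.6931471803 : ℝ) < Real.log 2 := Real.log_two_gt_d9
  have hn0 : (0 : ℝ) < n := by positivity
  have hl2 : Real.log 2 ≤ Real.log n := Real.log_le_log (by norm_num) (by exact_mod_cast hn)
  have hg1 : (1 : ℝ) ≤ g := by exact_mod_cast hg
  have h1 : (2 : ℝ) ^ Nat.log 2 (fftLen n) ≤ 2 ^ 4 * n := by
    have e : 2 ^ Nat.log 2 (fftLen n) ≤ fftLen n := Nat.pow_log_le_self _ (by unfold fftLen; positivity)
    calc (2 : ℝ) ^ Nat.log 2 (fftLen n) ≤ (fftLen n : ℝ) := by exact_mod_cast e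
      _ ≤ 10 * n := by exact_mod_cast hb
      _ ≤ 2 ^ 4 * n := by nlinarith
  have h3 := Real.log_le_log (by positivity) h1
  rw [Real.log_pow, Real.log_mul (by positivity) hn0.ne', Real.log_pow] at h3
  push_cast at h3 ⊢
  have h4 : (Nat.log 2 (fftLen n) : ℝ) ≤ 10 * Real.log n := by
    have : (0 : ℝ) ≤ Nat.log 2 (fftLen n) := Nat.cast_nonneg _
    nlinarith
  nlinarith [mul_le_mul hg1 hl2 (by linarith) (by linarith)]

/-- The time bound: the number of primes is `O(n / log n)`, and `log L` is `O(log n)`. -/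
theorem time_le {n d g t : ℕ} (hn : 2 ≤ n) (hg : 1 ≤ g)
    (ht : t ≤ 6500 * (d * ((primes n).card * ((primes n).card *
      (n * (fftLen n * (g + Nat.log 2 (fftLen n)))))))) :
    (t : ℝ) ≤ 10000000 * (g * (d * (n : ℝ) ^ 4 / Real.log n)) := by
  have hn0 : (0 : ℝ) < n := by positivity
  have hlog : 0 < Real.log n := Real.log_pos (by exact_mod_cast hn)
  have h1 := Korobov.card_primes_mul_log_le hn
  have h2 : (fftLen n : ℝ) ≤ 10 * n := by exact_mod_cast (fftLen_bounds hn).2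
  have h3 := log_fftLen_add_le hn hg
  set N : ℝ := ((primes n).card : ℝ) with hN
  have h4 : N ≤ 3 * n / Real.log n := (le_div_iff₀ hlog).2 h1
  have hN0 : 0 ≤ N := Nat.cast_nonneg _
  calc (t : ℝ) ≤ 6500 * (d * (N * (N * (n * (fftLen n * ((g + Nat.log 2 (fftLen n) : ℕ) : ℝ)))))) := by
        rw [hN]; exact_mod_cast ht
    _ ≤ 6500 * (d * (3 * n / Real.log n * (3 * n / Real.log n *
        (n * (10 * n * (14 * g * Real.log n)))))) := by gcongr
    _ = 8190000 * (g * (d * (n : ℝ) ^ 4 / Real.log n)) := by field_simp; ring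
    _ ≤ 10000000 * (g * (d * (n : ℝ) ^ 4 / Real.log n)) := by
        have : 0 ≤ g * (d * (n : ℝ) ^ 4 / Real.log n) := by positivity
        linarith

/-- The memory bound: the number of primes is `O(n / log n)`. -/
theorem mem_le {n : ℕ} (hn : 2 ≤ n) :
    (((primes n).card * (primes n).card * n * n + 7 * fftLen n : ℕ) : ℝ) ≤
      100 * ((n : ℝ) ^ 4 / Real.log n ^ 2) := by
  have hn2 : (2 : ℝ) ≤ n := by exact_mod_cast hn
  have hlog : 0 < Real.log n := Real.log_pos (by linarith)
  have h1 := Korobov.card_primes_mul_log_le hn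
  have h2 : (fftLen n : ℝ) ≤ 10 * n := by exact_mod_cast (fftLen_bounds hn).2
  have h3 : Real.log n ≤ n := (Real.log_le_sub_one_of_pos (by linarith)).trans (by linarith)
  set N : ℝ := ((primes n).card : ℝ) with hN
  have hN0 : 0 ≤ N := Nat.cast_nonneg _
  push_cast
  rw [← mul_div_assoc, le_div_iff₀ (by positivity), ← hN]
  have e1 : (N * Real.log n) ^ 2 ≤ (3 * n) ^ 2 := pow_le_pow_left₀ (by positivity) h1 2
  have e2 : Real.log n ^ 2 ≤ (n : ℝ) ^ 2 := pow_le_pow_left₀ hlog.le h3 2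
  have e3 : (fftLen n : ℝ) * Real.log n ^ 2 ≤ 10 * n * (n : ℝ) ^ 2 :=
    mul_le_mul h2 e2 (by positivity) (by positivity)
  have e4 : (n : ℝ) ^ 3 ≤ (n : ℝ) ^ 4 := pow_le_pow_right₀ (by linarith) (by norm_num)
  have e5 : (N * Real.log n) ^ 2 * (n : ℝ) ^ 2 ≤ (3 * n) ^ 2 * (n : ℝ) ^ 2 :=
    mul_le_mul_of_nonneg_right e1 (by positivity)
  nlinarith

/-- As `n d ≥ 2`, the constant is at most a power of `n d`. -/
theorem word_ge {n d : ℕ} (hn : 2 ≤ n) (hd : 1 ≤ d) : 10000 * (n ^ 4 * d) ≤ (n * d) ^ 18 := by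
  have h1 : 2 ≤ n * d := hn.trans (Nat.le_mul_of_pos_right _ hd)
  calc 10000 * (n ^ 4 * d) ≤ 2 ^ 14 * (n ^ 4 * d ^ 4) :=
        Nat.mul_le_mul (by norm_num) (Nat.mul_le_mul_left _ (Nat.le_self_pow (by norm_num) d))
    _ ≤ (n * d) ^ 14 * (n ^ 4 * d ^ 4) := Nat.mul_le_mul_right _ (Nat.pow_le_pow_left h1 14)
    _ = (n * d) ^ 18 := by ring

/-- The program with table: running time, memory and correctness. -/
theorem produces_constructTable {d n : ℕ} {α : ℝ} {γ : ℕ → ℝ} {τ : ℝ} (hd : 1 ≤ d) (hn : 2 ≤ n)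
    (hα : 1 / 2 < α) (hγ : ∀ j, 0 < γ j) (hτ : 0 < τ) (hτ1 : τ < 1) :
    ∃ z : ℕ → ℤ, IsConstructed n α γ τ d z ∧
      (∀ j, 0 ≤ z j ∧ z j < ∏ p ∈ primes n, (p : ℤ)) ∧
      ∃ t, Produces constructTable n d α γ τ (residues n d z) t
        ((primes n).card * (primes n).card * n * n + 7 * fftLen n) ((n * d) ^ 18) ∧
        (t : ℝ) ≤ 20000000 * (d * (n : ℝ) ^ 4 / Real.log n) := by
  set E : Env := ⟨α, γ, d, (primes n).card * (primes n).card * n * n + 7 * fftLen n, (n * d) ^ 18⟩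
  have hw : 10000 * (n ^ 4 * d) ≤ E.word := word_ge hn hd
  have hnd : 1 ≤ n ^ 4 * d := Nat.mul_pos (by positivity) hd
  have hS : Setup E n d (primes n).card (fftLen n) 1 (nthPrime n) :=
    setup hn hd hα hγ le_rfl hw (Nat.le_add_left _ _) rfl
  have hrun : Runs E constructTable (start n d τ) _ _ :=
    Runs.seq (Q := fun σ' => Agree (.iset 4 ♯1) (start n d τ) σ' ∧ σ'.ivar 4 = 1)
    (Runs.block (T := 2) (by simp only [Prog.Ok, IExp.Safe]; omega) le_rfl
      (by simp only [Prog.den, Function.update_self, IExp.eval])).agree fun σ₁ h =>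
      construct_spec (E := E) (n := n) (d := d) (md := 1) (τ := τ) hn hd hα hγ le_rfl hw
      (Nat.le_add_left _ _) rfl hτ hτ1 (fun _ => le_rfl) (h.1.i 0 rfl) (h.1.i 1 rfl) (h.1.i 2 rfl)
      h.2 (h.1.r 0 rfl) (fun a => by rw [h.1.rm rfl]; rfl) (h.1.o rfl)
  obtain ⟨σ', t, h1, h2, ρ, hI⟩ := hrun
  obtain ⟨z, hz, hz', hres⟩ := hI.isConstructed hS
  refine ⟨z, hz, hz', t, ⟨σ', h1, hres.symm⟩, ?_⟩
  have hg : gT 1 d = 1 := if_pos rfl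
  rw [hg] at h2
  have h3 := time_le (t := t - 2) (d := d) hn le_rfl (by omega)
  have h4 : (t : ℝ) ≤ (t - 2 : ℕ) + 2 := by
    have : t ≤ t - 2 + 2 := by omega
    exact_mod_cast this
  have hn2 : (2 : ℝ) ≤ n := by exact_mod_cast hn
  have hlog : 0 < Real.log n := Real.log_pos (by linarith)
  have h5 : (1 : ℝ) ≤ d * (n : ℝ) ^ 4 / Real.log n := by
    rw [le_div_iff₀ hlog, one_mul]
    have e1 : Real.log n ≤ n := (Real.log_le_sub_one_of_pos (by linarith)).trans (by linarith)
    have e2 : (n : ℝ) ≤ (n : ℝ) ^ 4 := le_self_pow₀ (by linarith) (by norm_num)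
    have e3 : (1 : ℝ) ≤ d := by exact_mod_cast hd
    nlinarith [pow_pos (by linarith : (0 : ℝ) < n) 4]
  rw [Nat.cast_one, one_mul] at h3
  linarith

/-- The program without table: running time, memory and correctness. -/
theorem produces_construct {d n : ℕ} {α : ℝ} {γ : ℕ → ℝ} {τ : ℝ} (hd : 1 ≤ d) (hn : 2 ≤ n)
    (hα : 1 / 2 < α) (hγ : ∀ j, 0 < γ j) (hτ : 0 < τ) (hτ1 : τ < 1) :
    ∃ z : ℕ → ℤ, IsConstructed n α γ τ d z ∧
      (∀ j, 0 ≤ z j ∧ z j < ∏ p ∈ primes n, (p : ℤ)) ∧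
      ∃ t, Produces construct n d α γ τ (residues n d z) t (7 * fftLen n) ((n * d) ^ 18) ∧
        (t : ℝ) ≤ 20000000 * (d * (d * (n : ℝ) ^ 4 / Real.log n)) := by
  set E : Env := ⟨α, γ, d, 7 * fftLen n, (n * d) ^ 18⟩
  have hw : 10000 * (n ^ 4 * d) ≤ E.word := word_ge hn hd
  have hS : Setup E n d (primes n).card (fftLen n) 0 (nthPrime n) :=
    setup hn hd hα hγ (Nat.zero_le _) hw le_rfl rfl
  obtain ⟨σ', t, h1, h2, ρ, hI⟩ := construct_spec (E := E) (n := n) (d := d) (md := 0) (τ := τ)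
    (σ := start n d τ) hn hd hα hγ (Nat.zero_le _) hw le_rfl rfl hτ hτ1
    (fun h => absurd h (by norm_num)) rfl rfl rfl rfl rfl (fun _ => rfl) rfl
  obtain ⟨z, hz, hz', hres⟩ := hI.isConstructed hS
  refine ⟨z, hz, hz', t, ⟨σ', h1, hres.symm⟩, ?_⟩
  have hg : gT 0 d = d + 1 := if_neg (by norm_num)
  rw [hg] at h2
  refine (time_le hn (Nat.succ_le_succ (Nat.zero_le d)) h2).trans ?_
  have hlog : 0 < Real.log n := Real.log_pos (by exact_mod_cast hn)
  have h3 : ((d + 1 : ℕ) : ℝ) ≤ 2 * d := by exact_mod_cast (by omega : d + 1 ≤ 2 * d)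
  calc 10000000 * (((d + 1 : ℕ) : ℝ) * (d * (n : ℝ) ^ 4 / Real.log n))
      ≤ 10000000 * (2 * d * (d * (n : ℝ) ^ 4 / Real.log n)) := by gcongr
    _ = 20000000 * (d * (d * (n : ℝ) ^ 4 / Real.log n)) := by ring

end RealRAM

/-! ### The construction, its error and its cost -/

theorem mainTheorem6 :
    -- the error bound for the constructed vectors, in every dimension `d' ≤ d`
    (∃ C : ℝ → ℝ → ℝ,
      (∀ lam : ℝ, 1 / 2 ≤ lam →
        (∀ τ : ℝ, 0 < τ → τ < 1 → 0 < C τ lam) ∧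
        Filter.Tendsto (fun τ => C τ lam) (nhdsWithin 0 (Set.Ioi 0)) Filter.atTop ∧
        Filter.Tendsto (fun τ => C τ lam) (nhdsWithin 1 (Set.Iio 1)) Filter.atTop) ∧
      ∀ (d n : ℕ) (α : ℝ) (γ : ℕ → ℝ) (τ : ℝ),
        1 ≤ d → 2 ≤ n → 1 / 2 < α → (∀ j, 0 < γ j) → 0 < τ → τ < 1 →
        (∃ z : ℕ → ℤ, Korobov.IsConstructed n α γ τ d z) ∧
        ∀ z : ℕ → ℤ, Korobov.IsConstructed n α γ τ d z →
          ∀ d' : ℕ, 1 ≤ d' → d' ≤ d → ∀ lam : ℝ, 1 / 2 ≤ lam → lam < α →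
            Korobov.randomisedError α γ n (fun j : Fin d' => z j) ≤
              ENNReal.ofReal ((C τ lam * Real.log n) ^ (1 / 2 : ℝ) / (n : ℝ) ^ (lam + 1 / 2) *
                Korobov.mu d' α γ lam ^ lam)) ∧
    -- `μ` blows up as `λ → α`, and is bounded in the dimension for summable weights
    (∀ (d : ℕ) (α : ℝ) (γ : ℕ → ℝ), 1 ≤ d → 1 / 2 < α → (∀ j, 0 < γ j) →
      Filter.Tendsto (fun lam => Korobov.mu d α γ lam) (nhdsWithin α (Set.Iio α)) Filter.atTop ∧
      ∀ lam : ℝ, 1 / 2 ≤ lam → lam < α →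
        Summable (fun u : {u : Finset ℕ // u.Nonempty} =>
          (∏ j ∈ u.1, γ j) ^ (1 / lam) *
            (2 * (riemannZeta ((α / lam : ℝ) : ℂ)).re) ^ u.1.card) →
        Korobov.mu d α γ lam ≤ ∑' u : {u : Finset ℕ // u.Nonempty},
          (∏ j ∈ u.1, γ j) ^ (1 / lam) *
            (2 * (riemannZeta ((α / lam : ℝ) : ℂ)).re) ^ u.1.card) ∧
    -- construction in time `O(d n⁴ / ln n)` with memory `O(n⁴ / (ln n)²)`
    (∃ (P : RealRAM.Prog) (K : ℝ) (κ : ℕ),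
      ∀ (d n : ℕ) (α : ℝ) (γ : ℕ → ℝ) (τ : ℝ),
        1 ≤ d → 2 ≤ n → 1 / 2 < α → (∀ j, 0 < γ j) → 0 < τ → τ < 1 →
        ∃ z : ℕ → ℤ, Korobov.IsConstructed n α γ τ d z ∧
          (∀ j < d, 0 ≤ z j ∧ z j < ∏ p ∈ Korobov.primes n, (p : ℤ)) ∧
          ∃ time mem word : ℕ,
            RealRAM.Produces P n d α γ τ (Korobov.residues n d z) time mem word ∧
            (time : ℝ) ≤ K * (d * (n : ℝ) ^ 4 / Real.log n) ∧
            (mem : ℝ) ≤ K * ((n : ℝ) ^ 4 / Real.log n ^ 2) ∧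
            word ≤ (n * d) ^ κ) ∧
    -- construction with memory `O(n)`, the time being larger by a factor `d`
    (∃ (P : RealRAM.Prog) (K : ℝ) (κ : ℕ),
      ∀ (d n : ℕ) (α : ℝ) (γ : ℕ → ℝ) (τ : ℝ),
        1 ≤ d → 2 ≤ n → 1 / 2 < α → (∀ j, 0 < γ j) → 0 < τ → τ < 1 →
        ∃ z : ℕ → ℤ, Korobov.IsConstructed n α γ τ d z ∧
          (∀ j < d, 0 ≤ z j ∧ z j < ∏ p ∈ Korobov.primes n, (p : ℤ)) ∧
          ∃ time mem word : ℕ,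
            RealRAM.Produces P n d α γ τ (Korobov.residues n d z) time mem word ∧
            (time : ℝ) ≤ K * (d * (d * (n : ℝ) ^ 4 / Real.log n)) ∧
            (mem : ℝ) ≤ K * (n : ℝ) ∧
            word ≤ (n * d) ^ κ) := by
  obtain ⟨c, hc, hcn⟩ := Korobov.exists_le_card_primes_mul_log
  refine ⟨⟨Korobov.errorConst c, fun lam hl => ?_, fun d n α γ τ hd hn hα hγ hτ hτ1 => ⟨?_, ?_⟩⟩,
    fun d α γ hd hα hγ => ⟨Korobov.tendsto_mu hγ hα hd, fun lam hl hla hs =>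
      Korobov.mu_le_tsum hγ (by linarith) hla d hs⟩,
    ⟨RealRAM.constructTable, 20000000, 18, fun d n α γ τ hd hn hα hγ hτ hτ1 => ?_⟩,
    ⟨RealRAM.construct, 20000000, 18, fun d n α γ τ hd hn hα hγ hτ hτ1 => ?_⟩⟩
  · exact ⟨fun τ hτ hτ1 => Korobov.errorConst_pos hc hτ hτ1 lam,
      Korobov.tendsto_errorConst_zero hc, Korobov.tendsto_errorConst_one hc (by linarith)⟩
  · obtain ⟨z, hz, -⟩ := RealRAM.produces_construct hd hn hα hγ hτ hτ1
    exact ⟨z, hz⟩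
  · intro z hz d' _ hd' lam hl hla
    exact Korobov.randomisedError_constructed_le hc hγ hn (hcn n hn) hτ hτ1 hl hla hz hd'
  · obtain ⟨z, hz, hz', t, hP, ht⟩ := RealRAM.produces_constructTable hd hn hα hγ hτ hτ1
    refine ⟨z, hz, fun j _ => hz' j, t, _, _, hP, ht, (RealRAM.mem_le hn).trans ?_, le_rfl⟩
    gcongr
    norm_num
  · obtain ⟨z, hz, hz', t, hP, ht⟩ := RealRAM.produces_construct hd hn hα hγ hτ hτ1
    refine ⟨z, hz, fun j _ => hz' j, t, _, _, hP, ht, ?_, le_rfl⟩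
    have h : (RealRAM.fftLen n : ℝ) ≤ 10 * n := by exact_mod_cast (RealRAM.fftLen_bounds hn).2
    have hn0 : (0 : ℝ) ≤ n := Nat.cast_nonneg _
    push_cast
    linarith
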